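/- Let $G$ be a finite tree with vertex set $V$, whose adjacency matrix has largest eigenvalue $\beta<2$ (equivalently, $G$ is a simply laced Dynkin diagram of type $A$, $D$ or $E$), and let $\mu$ be its Perron–Frobenius eigenvector, normalised so that its smallest component is $1$. An elementary path of length $n$ is a succession $(v_0,\dots,v_n)$ of nearest neighbours; $\mathcal P$ is the complex vector space with the elementary paths as orthonormal basis, $\star$ is concatenation of paths ($0$ if the end points do not match), $\xi\mapsto\xi^*$ is the antilinear extension of path reversal, and the Jones projections are $$e_i|\dots v_iv_{i+1}v_{i+2}\dots\rangle=\frac1\beta\,\delta_{v_iv_{i+2}}\sum_{w\sim v_i}\sqrt{\frac{\mu_{v_{i+1}}\mu_w}{\mu_{v_i}\mu_{v_{i+2}}}}\;|\dots v_i\,w\,v_{i+2}\dots\rangle$$ (zero on paths that are too short). A *symmetry family* consists of a finite set of labels $\alpha$, each with an initial vertex $\alpha_i$ and a final vertex $\alpha_f$, and operators $T_{\alpha\beta}$ on $\mathcal P$ that map $\mathcal P_{\alpha_i\beta_i}$ to $\mathcal P_{\alpha_f\beta_f}$ and vanish on the other $\mathcal P_{ab}$ ($\mathcal P_{ab}$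 being spanned by the paths from $a$ to $b$), such that 1. $T_{\alpha\beta}$ preserves length; 2. $T_{\alpha\beta}(\xi\star\rho)=\sum_\gamma T_{\alpha\gamma}(\xi)\star T_{\gamma\beta}(\rho)$; 3. $T_{\alpha\beta}^\dagger=T_{\tilde\alpha\tilde\beta}$ for an involution $\alpha\mapsto\tilde\alpha$ of the labels which exchanges initial and final vertices; 4. $T_{\alpha\beta}(\xi^*)=(T_{\beta\alpha}(\xi))^*$; 5. $[T_{\alpha\beta},e_i]=0$ for all $i$. It is *normalised* if $T_{\alpha\beta}|v\rangle=\delta_{\alpha\beta}\delta_{v\alpha_i}|\alpha_f\rangle$ on paths of length $0$ and if, whenever $\alpha_f=\beta_f$ and $v$ is a common neighbour of $\alpha_i$ and $\beta_i$, $$\sum_{w\sim\alpha_f}\sqrt{\frac{\mu_{\alpha_i}\mu_w}{\mu_{\alpha_f}\mu_v}}\;\langle\alpha_f\,w\,\alpha_f|T_{\alpha\beta}|\alpha_i\,v\,\beta_i\rangle=\delta_{\alpha\beta}.$$ Let $A\subset\mathrm{End}(\mathcal P)$ be the linear span of all operators in normalised symmetry families. An *Ocneanu connection* consists of a finite set of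 labels $\alpha$ with vertices $\alpha_i,\alpha_f$ and complex numbers $Oc_{\alpha\beta}$ (a cell with left side $\alpha$, right side $\beta$, bottom edge $\alpha_i\beta_i$, top edge $\alpha_f\beta_f$), which vanish unless $\alpha_i\sim\beta_i$ and $\alpha_f\sim\beta_f$, with the reflection property $Oc_{\alpha\beta}=\sqrt{\mu_{\beta_f}\mu_{\alpha_i}/(\mu_{\alpha_f}\mu_{\beta_i})}\;\overline{Oc_{\beta\alpha}}$, and such that for all vertices $u,t$ the matrix $(Oc_{\alpha\beta})$, with rows the labels $\alpha$ with $\alpha_f=t$, $\alpha_i\sim u$ and columns the labels $\beta$ with $\beta_i=u$, $\beta_f\sim t$, is unitary (fixed top left vertex $t$ and bottom right vertex $u$). Gluing cells along vertical labels gives operators $Oc_{\alpha\beta}$ on $\mathcal P$ (bottom path $\mapsto$ top path). Intertwiners of connections are matrices between the label sets which respect end points and commute with the cells; a connection is irreducible if its label set is non-empty and its self-intertwiners are the scalars; two connections are equivalent if there is an invertible intertwiner. Let $\mathcal E_n$ be the space of essential paths of length $n$ (combinations of paths of length $n$ killed by all $e_i$) and $\mathrm{End}^{gr}(\mathcal E)=\prod_n\mathrm{End}(\mathcal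 E_n)$. **Theorem.** The space $A$ is finite-dimensional, contains the identity and is closed under composition. Its dual $A^*$ is a weak $*$-Hopf algebra whose coproduct is dual to composition in $A$ and whose product is the projected concatenation product: if $\xi,\eta$ are elementary paths of equal length and $\xi',\eta'$ are elementary paths of equal length, and $[\xi\otimes\eta]\in A^*$ denotes the matrix element $S\mapsto\langle\xi|S|\eta\rangle$, then $[\xi\otimes\eta]\cdot[\xi'\otimes\eta']=[(\xi\star\xi')\otimes(\eta\star\eta')]$. There is a finite system containing exactly one irreducible Ocneanu connection $x$ from each equivalence class. For every such system, put $$T^x_{\alpha\beta}=\Big(\frac{\mu_{\beta_f}\mu_{\alpha_i}}{\mu_{\alpha_f}\mu_{\beta_i}}\Big)^{-1/4}Oc^x_{\alpha\beta}.$$ The families $T^x$ satisfy 1, 2, 4, 5 and are normalised; for each $x$ there is a $y$ such that all $(T^x_{\alpha\beta})^\dagger$ are in the span of the $T^y_{\gamma\delta}$; the $T^x_{\alpha\beta}$ form a basis of $A$; and for the dual basis $E_x^{\alpha\beta}$ of $A^*$ $$E_x^{\alpha\beta}\cdot E_y^{\gamma\delta}=\delta_{xy}\,\delta_{\beta\gamma}\,E_x^{\alpha\delta},\qquad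 (E_x^{\alpha\beta})^*=E_x^{\beta\alpha}.$$ Moreover, the operators $Oc^x_{\alpha\beta}$ restrict to a basis of $\mathrm{End}^{gr}(\mathcal E)$. The dual $\mathrm{End}^{gr}(\mathcal E)^*$, with the dual basis $\mathcal E_x^{\alpha\beta}$ as matrix units, $(\mathcal E_x^{\alpha\beta})^*=\mathcal E_x^{\beta\alpha}$, and the coproduct dual to composition, is a weak $*$-Hopf algebra, namely the Ocneanu double triangle algebra of $G$ reconstructed from the connections $x$. The linear map $E_x^{\alpha\beta}\mapsto\mathcal E_x^{\alpha\beta}$ is an isomorphism of weak $*$-Hopf algebras from $A^*$ onto it. -/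

import Mathlib

open scoped TensorProduct ComplexConjugate

noncomputable section

namespace FaceModel

/-! ### Weak star-Hopf algebras -/

/-- The structure of a weak *-Hopf algebra (Böhm–Nill–Szlachányi) on a complex vector space `H`. -/
structure WeakStarHopf (H : Type*) [AddCommGroup H] [Module ℂ H] extends Coalgebra ℂ H where
  mul : H →ₗ[ℂ] H →ₗ[ℂ] H
  one : H
  antipode : H →ₗ[ℂ] H
  star : H →ₛₗ[starRingEnd ℂ] H
  mul_assoc : ∀ a b c, mul (mul a b) c = mul a (mul b c)
  one_mul : ∀ a, mul one a = a
  mul_one : ∀ a, mul a one = a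
  /-- the coproduct is multiplicative -/
  comul_mul : ∀ a b, comul (mul a b) = TensorProduct.map₂ mul mul (comul a) (comul b)
  /-- `ε(abc) = ε(a b₁) ε(b₂ c)` -/
  counit_mul_mul : ∀ a b c, counit (mul (mul a b) c) =
    LinearMap.mul' ℂ ℂ
      (TensorProduct.map (counit ∘ₗ mul a) (counit ∘ₗ mul.flip c) (comul b))
  /-- `ε(abc) = ε(a b₂) ε(b₁ c)` -/
  counit_mul_mul' : ∀ a b c, counit (mul (mul a b) c) =
    LinearMap.mul' ℂ ℂ
      (TensorProduct.map (counit ∘ₗ mul a) (counit ∘ₗ mul.flip c)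
        (TensorProduct.comm ℂ H H (comul b)))
  /-- `(Δ ⊗ id) Δ(1) = (Δ(1) ⊗ 1) (1 ⊗ Δ(1))` -/
  comul_comul_one : TensorProduct.map comul LinearMap.id (comul one) =
    TensorProduct.map₂ (TensorProduct.map₂ mul mul) mul
      (comul one ⊗ₜ[ℂ] one) ((TensorProduct.assoc ℂ H H H).symm (one ⊗ₜ[ℂ] comul one))
  /-- `(Δ ⊗ id) Δ(1) = (1 ⊗ Δ(1)) (Δ(1) ⊗ 1)` -/
  comul_comul_one' : TensorProduct.map comul LinearMap.id (comul one) =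
    TensorProduct.map₂ (TensorProduct.map₂ mul mul) mul
      ((TensorProduct.assoc ℂ H H H).symm (one ⊗ₜ[ℂ] comul one)) (comul one ⊗ₜ[ℂ] one)
  /-- `a₁ S(a₂) = ε(1₁ a) 1₂` -/
  mul_antipode : ∀ a, TensorProduct.lift mul (TensorProduct.map LinearMap.id antipode (comul a)) =
    TensorProduct.lid ℂ H
      (TensorProduct.map (counit ∘ₗ mul.flip a) LinearMap.id (comul one))
  /-- `S(a₁) a₂ = 1₁ ε(a 1₂)` -/
  antipode_mul : ∀ a, TensorProduct.lift mul (TensorProduct.map antipode LinearMap.id (comul a)) =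
    TensorProduct.rid ℂ H
      (TensorProduct.map LinearMap.id (counit ∘ₗ mul a) (comul one))
  /-- `S(a₁) a₂ S(a₃) = S(a)` -/
  antipode_mul_antipode : ∀ a,
    TensorProduct.lift mul (TensorProduct.map
      (TensorProduct.lift mul ∘ₗ TensorProduct.map antipode LinearMap.id) antipode
        (TensorProduct.map comul LinearMap.id (comul a))) = antipode a
  star_star : ∀ a, star (star a) = a
  star_mul : ∀ a b, star (mul a b) = mul (star b) (star a)
  /-- the coproduct is a *-map -/
  comul_star : ∀ a, comul (star a) = TensorProduct.map star star (comul a)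

/-- A linear equivalence is an isomorphism of weak *-Hopf algebras if it respects the whole
structure. -/
structure WeakStarHopf.IsIso {H K : Type*} [AddCommGroup H] [Module ℂ H] [AddCommGroup K]
    [Module ℂ K] (W : WeakStarHopf H) (D : WeakStarHopf K) (Φ : H ≃ₗ[ℂ] K) : Prop where
  map_mul : ∀ a b, Φ (W.mul a b) = D.mul (Φ a) (Φ b)
  map_one : Φ W.one = D.one
  map_comul : ∀ a, D.comul (Φ a) = TensorProduct.map Φ.toLinearMap Φ.toLinearMap (W.comul a)
  map_counit : ∀ a, D.counit (Φ a) = W.counit a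
  map_antipode : ∀ a, Φ (W.antipode a) = D.antipode (Φ a)
  map_star : ∀ a, Φ (W.star a) = D.star (Φ a)

/-! ### Paths on a graph -/

variable {V : Type*}

/-- A non-empty succession of nearest neighbours. -/
def IsPath (G : SimpleGraph V) (l : List V) : Prop := l ≠ [] ∧ l.IsChain G.Adj

/-- Elementary paths `(v₀, …, vₙ)`. -/
def EPath (G : SimpleGraph V) : Type _ := {l : List V // IsPath G l}

namespace EPath

variable {G : SimpleGraph V}

def first (p : EPath G) : V := p.1.head p.2.1

def last (p : EPath G) : V := p.1.getLast p.2.1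

/-- number of steps -/
def length (p : EPath G) : ℕ := p.1.length - 1

end EPath

/-- The space of finite linear combinations of elementary paths; the elementary paths are an
orthonormal basis. -/
abbrev PathSpace (G : SimpleGraph V) : Type _ := EPath G →₀ ℂ

open Classical in
/-- The basis vector `|v₀ … vₙ⟩`; it is `0` if the succession is not a path. -/
def ket (G : SimpleGraph V) (l : List V) : PathSpace G :=
  if h : IsPath G l then Finsupp.single ⟨l, h⟩ 1 else 0

open Classical in
/-- The coefficient of `|v₀ … vₙ⟩` in a vector. -/
def amp {G : SimpleGraph V} (u : PathSpace G) (l : List V) : ℂ :=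
  if h : IsPath G l then u ⟨l, h⟩ else 0

open Classical in
/-- The concatenation product `⋆`. -/
def concat (G : SimpleGraph V) : PathSpace G →ₗ[ℂ] PathSpace G →ₗ[ℂ] PathSpace G :=
  Finsupp.linearCombination ℂ fun p : EPath G =>
    Finsupp.linearCombination ℂ fun q : EPath G =>
      if p.last = q.first then ket G (p.1 ++ q.1.tail) else 0

/-- The involution `*` for the concatenation product: reversal of paths, followed by complex
conjugation of the coefficients. -/
def pathStar {G : SimpleGraph V} (u : PathSpace G) : PathSpace G :=
  u.sum fun p z => conj z • ket G p.1.reverse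

/-- `S` and `T` are (formal) adjoints for the scalar product in which elementary paths are
orthonormal. -/
def IsAdjoint {G : SimpleGraph V} (S T : Module.End ℂ (PathSpace G)) : Prop :=
  ∀ p q : EPath G, S (Finsupp.single p 1) q = conj (T (Finsupp.single q 1) p)

/-- The Perron–Frobenius eigenvalue `β` and eigenvector `μ` (smallest component `1`). -/
structure IsPerronFrobenius [Fintype V] [DecidableEq V] (G : SimpleGraph V) [DecidableRel G.Adj]
    (β : ℝ) (μ : V → ℝ) : Prop where
  eigen : (G.adjMatrix ℝ).mulVec μ = β • μ
  maximal : ∀ t : ℝ, Module.End.HasEigenvalue (Matrix.toLin' (G.adjMatrix ℝ)) t → t ≤ β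
  one_le : ∀ v, 1 ≤ μ v
  exists_eq_one : ∃ v, μ v = 1

open Classical in
/-- The Jones projection `e_i`:
`e_i |… vᵢ vᵢ₊₁ vᵢ₊₂ …⟩ = (1/β) δ_{vᵢ vᵢ₊₂} ∑_w √(μ_{vᵢ₊₁} μ_w / (μ_{vᵢ} μ_{vᵢ₊₂})) |… vᵢ w vᵢ₊₂ …⟩`,
and `0` on paths that are too short. -/
def jones [Fintype V] (G : SimpleGraph V) (β : ℝ) (μ : V → ℝ) (i : ℕ) :
    Module.End ℂ (PathSpace G) :=
  Finsupp.linearCombination ℂ fun p : EPath G =>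
    if h : i + 2 < p.1.length then
      if p.1[i] = p.1[i + 2] then
        ∑ w : V, ((1 / β * √(μ p.1[i + 1] * μ w / (μ p.1[i] * μ p.1[i + 2])) : ℝ) : ℂ) •
          ket G (p.1.set (i + 1) w)
      else 0
    else 0

/-- Essential paths of length `n`: the combinations of paths of length `n` killed by all `e_i`. -/
def essential [Fintype V] (G : SimpleGraph V) (β : ℝ) (μ : V → ℝ) (n : ℕ) :
    Submodule ℂ (PathSpace G) :=
  Finsupp.supported ℂ ℂ {p : EPath G | p.length = n} ⊓ ⨅ i, LinearMap.ker (jones G β μ i)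

/-- The algebra of length preserving endomorphisms of essential paths, under composition. -/
abbrev GradedEnd [Fintype V] (G : SimpleGraph V) (β : ℝ) (μ : V → ℝ) : Type _ :=
  (n : ℕ) → Module.End ℂ (essential G β μ n)

/-! ### Symmetry operators -/

/-- The conditions on a family of operators `T_{αβ}` that do not involve adjoints. The labels
`α` run over a finite set; each has an initial vertex `α_i = src α` and a final vertex
`α_f = tgt α`, and `T_{αβ}` maps `𝒫_{α_i β_i}` to `𝒫_{α_f β_f}`. -/
structure IsSymmetryFamily [Fintype V] (G : SimpleGraph V) (β : ℝ) (μ : V → ℝ) {ι : Type*}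
    [Fintype ι] (src tgt : ι → V) (T : ι → ι → Module.End ℂ (PathSpace G)) : Prop where
  /-- `T_{αβ}` belongs to `End(𝒫)_{αβ}` -/
  endpoints : ∀ a b (p q : EPath G), T a b (Finsupp.single p 1) q ≠ 0 →
    p.first = src a ∧ p.last = src b ∧ q.first = tgt a ∧ q.last = tgt b
  /-- length is preserved -/
  length : ∀ a b (p q : EPath G), T a b (Finsupp.single p 1) q ≠ 0 → q.length = p.length
  /-- continuity: `T_{αβ}(ξ ⋆ ρ) = ∑_γ T_{αγ}(ξ) ⋆ T_{γβ}(ρ)` -/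
  continuity : ∀ a b (ξ ρ : PathSpace G),
    T a b (concat G ξ ρ) = ∑ c, concat G (T a c ξ) (T c b ρ)
  /-- preserved involution: `T_{αβ}(ξ*) = (T_{βα}(ξ))*` -/
  involution : ∀ a b (ξ : PathSpace G), T a b (pathStar ξ) = pathStar (T b a ξ)
  /-- preserved evolution: `[T_{αβ}, e_i] = 0` -/
  evolution : ∀ a b i, T a b ∘ₗ jones G β μ i = jones G β μ i ∘ₗ T a b

/-- Hermiticity: `T_{αβ}† = T_{α̃β̃}` for an involution `α ↦ α̃` of the labels that exchanges
initial and final vertices. -/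
def IsHermitianFamily {G : SimpleGraph V} {ι : Type*} (src tgt : ι → V)
    (T : ι → ι → Module.End ℂ (PathSpace G)) : Prop :=
  ∃ flip : ι → ι, (∀ a, flip (flip a) = a) ∧ (∀ a, src (flip a) = tgt a) ∧
    ∀ a b, IsAdjoint (T a b) (T (flip a) (flip b))

open Classical in
/-- Normalisation. On paths of length zero every label occurs, `T_{αβ}|v⟩ = δ_{αβ} δ_{v α_i}|α_f⟩`,
and the coefficients obtained by contracting back-and-forth paths of length two with `T_{αβ}`
are `1` for every label:
`∑_w √(μ_{α_i} μ_w / (μ_{α_f} μ_v)) ⟨α_f w α_f| T_{αβ} |α_i v β_i⟩ = δ_{αβ}` if `α_f = β_f`. -/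
structure IsNormalizedFamily [Fintype V] (G : SimpleGraph V) (μ : V → ℝ) {ι : Type*}
    (src tgt : ι → V) (T : ι → ι → Module.End ℂ (PathSpace G)) : Prop where
  vertex : ∀ a b v, T a b (ket G [v]) = if a = b ∧ v = src a then ket G [tgt a] else 0
  contraction : ∀ a b v, tgt a = tgt b → G.Adj (src a) v → G.Adj v (src b) →
    ∑ w : V, ((√(μ (src a) * μ w / (μ (tgt a) * μ v)) : ℝ) : ℂ) *
      amp (T a b (ket G [src a, v, src b])) [tgt a, w, tgt a] = if a = b then 1 else 0

/-- The span `A` of all normalised symmetry operators. -/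
def symmetrySpan [Fintype V] (G : SimpleGraph V) (β : ℝ) (μ : V → ℝ) :
    Submodule ℂ (Module.End ℂ (PathSpace G)) :=
  Submodule.span ℂ {S | ∃ (n : ℕ) (src tgt : Fin n → V)
    (T : Fin n → Fin n → Module.End ℂ (PathSpace G)),
      IsSymmetryFamily G β μ src tgt T ∧ IsHermitianFamily src tgt T ∧
      IsNormalizedFamily G μ src tgt T ∧ ∃ a b, S = T a b}

/-- The linear form `ξ ⊗ η` on an algebra of operators: `S ↦ ∑_p ξ_p (S η)_p`. -/
def matrixForm {G : SimpleGraph V} (A : Subalgebra ℂ (Module.End ℂ (PathSpace G)))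
    (ξ η : PathSpace G) : Module.Dual ℂ A where
  toFun S := ξ.sum fun p z => z * (S : Module.End ℂ (PathSpace G)) η p
  map_add' S T := by simp [mul_add, Finsupp.sum_add]
  map_smul' z S := by simp [Finsupp.mul_sum, mul_left_comm]

/-! ### Ocneanu cells and the double triangle algebra -/

open Classical in
/-- An Ocneanu connection on `G`: finitely many vertical labels `α` with end points
`src α` (bottom) and `tgt α` (top), and for two labels `α`, `β` the value `cell α β` of the cell
with left side `α` and right side `β`, whose horizontal sides are the edges
`src α — src β` and `tgt α — tgt β`. -/
structure OcneanuConnection (G : SimpleGraph V) (μ : V → ℝ) where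
  size : ℕ
  src : Fin size → V
  tgt : Fin size → V
  cell : Matrix (Fin size) (Fin size) ℂ
  support : ∀ a b, cell a b ≠ 0 → G.Adj (src a) (src b) ∧ G.Adj (tgt a) (tgt b)
  reflection : ∀ a b,
    cell a b = (√(μ (tgt b) * μ (src a) / (μ (tgt a) * μ (src b))) : ℝ) * conj (cell b a)
  /-- For fixed top left and bottom right vertices the rows are orthonormal … -/
  unitarity : ∀ a b v, tgt a = tgt b → G.Adj (src a) v → G.Adj (src b) v →
    ∑ c, (if src c = v then cell a c * conj (cell b c) else 0) = if a = b then 1 else 0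
  /-- … and so are the columns. -/
  unitarity' : ∀ a b v, src a = src b → G.Adj (tgt a) v → G.Adj (tgt b) v →
    ∑ c, (if tgt c = v then conj (cell c a) * cell c b else 0) = if a = b then 1 else 0

namespace OcneanuConnection

variable {G : SimpleGraph V} {μ : V → ℝ}

open Classical in
/-- The cells with a horizontal path of arbitrary length at the bottom (first list) and at the
top (second list), obtained by gluing cells of length one along vertical labels. -/
def glue (c : OcneanuConnection G μ) :
    List V → List V → Matrix (Fin c.size) (Fin c.size) ℂ
  | [v], [w] => Matrix.diagonal fun a => if c.src a = v ∧ c.tgt a = w then 1 else 0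
  | v :: p, w :: q =>
    Matrix.diagonal (fun a => if c.src a = v ∧ c.tgt a = w then 1 else 0) * c.cell * glue c p q
  | _, _ => 0

/-- The operator on paths whose matrix elements are the cells: the bottom path is mapped to the
top path. -/
def op [Fintype V] (c : OcneanuConnection G μ) (a b : Fin c.size) :
    Module.End ℂ (PathSpace G) :=
  Finsupp.linearCombination ℂ fun p : EPath G =>
    ∑ w : Fin p.1.length → V, c.glue p.1 (List.ofFn w) a b • ket G (List.ofFn w)

/-- The operators `T_{αβ}`, related to the cells by
`Oc = (μ_{top right} μ_{bottom left} / (μ_{top left} μ_{bottom right}))^{1/4} T`. -/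
def symOp [Fintype V] (c : OcneanuConnection G μ) (a b : Fin c.size) :
    Module.End ℂ (PathSpace G) :=
  (((μ (c.tgt b) * μ (c.src a) / (μ (c.tgt a) * μ (c.src b))) ^ (-(1 / 4) : ℝ) : ℝ) : ℂ) •
    c.op a b

/-- Intertwiners between connections. -/
def Intertwines (c d : OcneanuConnection G μ) (Θ : Matrix (Fin c.size) (Fin d.size) ℂ) : Prop :=
  (∀ a b, Θ a b ≠ 0 → c.src a = d.src b ∧ c.tgt a = d.tgt b) ∧ c.cell * Θ = Θ * d.cell

def IsIrreducible (c : OcneanuConnection G μ) : Prop :=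
  0 < c.size ∧ ∀ Θ, Intertwines c c Θ → ∃ z : ℂ, Θ = z • (1 : Matrix _ _ ℂ)

/-- Gauge equivalence. -/
def Equivalent (c d : OcneanuConnection G μ) : Prop :=
  ∃ (Θ : Matrix (Fin c.size) (Fin d.size) ℂ) (Θ' : Matrix (Fin d.size) (Fin c.size) ℂ),
    Intertwines c d Θ ∧ Intertwines d c Θ' ∧ Θ * Θ' = 1 ∧ Θ' * Θ = 1

end OcneanuConnection

/-- One irreducible connection out of each equivalence class. -/
structure IsCompleteSystem {G : SimpleGraph V} {μ : V → ℝ} {N : ℕ}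
    (conn : Fin N → OcneanuConnection G μ) : Prop where
  irreducible : ∀ x, (conn x).IsIrreducible
  inequivalent : ∀ x y, (conn x).Equivalent (conn y) → x = y
  complete : ∀ c : OcneanuConnection G μ, c.IsIrreducible → ∃ x, c.Equivalent (conn x)

/-- The index set of the `E_x^{αβ}`. -/
abbrev UnitIndex {G : SimpleGraph V} {μ : V → ℝ} {N : ℕ}
    (conn : Fin N → OcneanuConnection G μ) : Type :=
  (x : Fin N) × (Fin (conn x).size × Fin (conn x).size)

/-- The `E_x^{αβ}` are *-matrix units for the product and the star of `W`:
`E_x^{αβ} E_y^{γδ} = δ_{xy} δ_{βγ} E_x^{αδ}` and `(E_x^{αβ})* = E_x^{βα}`. -/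
structure IsMatrixUnits {G : SimpleGraph V} {μ : V → ℝ} {N : ℕ}
    (conn : Fin N → OcneanuConnection G μ) {H : Type*} [AddCommGroup H] [Module ℂ H]
    (W : WeakStarHopf H) (E : UnitIndex conn → H) : Prop where
  mul_same : ∀ x a b c d, W.mul (E ⟨x, a, b⟩) (E ⟨x, c, d⟩) = if b = c then E ⟨x, a, d⟩ else 0
  mul_ne : ∀ x y a b c d, x ≠ y → W.mul (E ⟨x, a, b⟩) (E ⟨y, c, d⟩) = 0
  star : ∀ x a b, W.star (E ⟨x, a, b⟩) = E ⟨x, b, a⟩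

/-- The coproduct of `W` is dual to a product `m`: `⟨Δ φ, a ⊗ b⟩ = ⟨φ, m a b⟩`. -/
def IsDualComul {R : Type*} [AddCommMonoid R] [Module ℂ R] (m : R → R → R)
    (W : WeakStarHopf (Module.Dual ℂ R)) : Prop :=
  ∀ (φ : Module.Dual ℂ R) (a b : R),
    TensorProduct.dualDistrib ℂ R R (W.comul φ) (a ⊗ₜ[ℂ] b) = φ (m a b)

/-- `D` is the double triangle algebra reconstructed from the connections `conn`. It lives on the
dual of the space of graded endomorphisms of essential paths. The cells, restricted to essential
paths, form a basis `B` of graded endomorphisms; the dual basis consists of the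
matrix units for the product; the coproduct is dual to composition, that is
`Δ(ξ ⊗ η) = ∑_ρ (ξ ⊗ ρ) ⊗ (ρ ⊗ η)` with `ρ` running over a basis of essential paths. -/
structure IsDoubleTriangleAlgebra [Fintype V] {G : SimpleGraph V} {β : ℝ} {μ : V → ℝ} {N : ℕ}
    (conn : Fin N → OcneanuConnection G μ)
    (B : Module.Basis (UnitIndex conn) ℂ (GradedEnd G β μ))
    (D : WeakStarHopf (Module.Dual ℂ (GradedEnd G β μ))) : Prop where
  cells : ∀ x a b n (ξ : essential G β μ n),
    (B ⟨x, a, b⟩ n ξ : PathSpace G) = (conn x).op a b ξ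
  units : IsMatrixUnits conn D B.coord
  comul : IsDualComul (fun a b => a * b) D

end FaceModel

end

open FaceModel

noncomputable section
namespace FaceModel
open scoped Classical

variable {V : Type*} {G : SimpleGraph V}

/-! ### Elementary paths as lists: kets and amplitudes -/

section Kets

/-! The Jones projection factors as `cup ∘ cap / β` (`jones_eq`), where `cup μ i` creates and `cap μ
i` annihilates a back-and-forth pair of steps. These operators are adjoint to each other and satisfy
the Temperley–Lieb relations, the loop value `β` being the eigenvalue equation of `μ`. The span `A`
turns out to be `symAlg`, the algebra of all length preserving operators that commute with every
`cup` and `cap`.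

Every vector of length at least two is the sum of an essential vector and of created pairs
(`IsWeight.exists_essential_add`). Hence an operator in `symAlg` is determined by its restriction to
essential paths, and by the Temperley–Lieb relations every graded endomorphism of essential paths
extends (`restrictEquiv`). For `β < 2` there are no long essential paths: the norms of successive
annihilation operators obey the recursion `r ↦ β - 1 / r`, which cannot remain positive
(`IsWeight.exists_essential_eq_bot`). So `symAlg` is finite-dimensional.

The dual of `symAlg` is spanned by the matrix elements `mat`. They are multiplied by gluing paths,
which is well defined because contracting the final parts of the paths of a symmetry operator gives
a symmetry operator again (`contractOp_mem`). Reversal of paths gives the star; reversal, adjunction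
and the weights of the end points give the antipode. Its axioms express that symmetry operators
commute with the contraction of `r.reverse` followed by `r` (`sum_wt_amp`, `sum_antipode_mul`).

Evaluation of `φ* ψ` at the symmetry operator `haar`, which has all entries `1` on vertices and
kills longer essential paths, is a positive definite scalar product on the dual (`dualForm_pos`).
Left multiplication by `φ*` is adjoint to left multiplication by `φ`, so the dual is semisimple,
with its involution. In a symmetric gauge the cells of a connection are Hermitian, and unitarity
says that the glued operators commute with `cup` and `cap`; such a system (`IsCellSystem`) is the
same as a *-representation of the dual. Conversely, a left ideal with an orthonormal basis adapted
to the vertices yields a system of cells. Irreducible connections thus correspond to irreducible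
representations. Minimal left ideals show that their operators span `symAlg`
(`exists_irreducible_apply_ne_zero`), and Schur orthogonality shows that they are independent
(`linearIndependent_symOp`); the dual basis consists of matrix units.

Symmetry families enter through their values on edges: continuity, normalisation and Hermiticity say
that these form a cell system (`IsSymmetryFamily.isCellSystem`), and every cell system occurs inside
a Hermitian normalised family. Finally, `Oc` and `T` differ by conjugation with a diagonal operator
depending on end points only; combined with the restriction to essential paths, this transports the
whole structure to the double triangle algebra (`gaugeEquiv`). -/

@[simp] theorem not_isPath_nil : ¬ IsPath G [] := fun h => h.1 rfl

@[simp] theorem isPath_singleton (v : V) : IsPath G [v] := ⟨by simp, by simp⟩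

@[simp] theorem isPath_cons_cons {a b : V} {l : List V} :
    IsPath G (a :: b :: l) ↔ G.Adj a b ∧ IsPath G (b :: l) := by
  simp [IsPath]

theorem isPath_append_cons {l m : List V} {v : V} :
    IsPath G (l ++ v :: m) ↔ IsPath G (l ++ [v]) ∧ IsPath G (v :: m) := by
  simp only [IsPath]
  constructor
  · rintro ⟨-, h⟩
    have := (List.isChain_split (l₁ := l) (l₂ := m) (c := v)).1 h
    exact ⟨⟨by simp, this.1⟩, ⟨by simp, this.2⟩⟩
  · rintro ⟨⟨-, h⟩, -, h'⟩
    exact ⟨by simp, List.isChain_split.2 ⟨h, h'⟩⟩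

theorem IsPath.tail {a : V} {l : List V} (h : IsPath G (a :: l)) (hl : l ≠ []) : IsPath G l := by
  cases l with
  | nil => exact absurd rfl hl
  | cons b l => exact (isPath_cons_cons.1 h).2

theorem IsPath.reverse {l : List V} (h : IsPath G l) : IsPath G l.reverse :=
  ⟨by simpa using h.1, by
    rw [List.isChain_reverse]; exact h.2.imp fun a b hab => hab.symm⟩

@[simp] theorem isPath_reverse {l : List V} : IsPath G l.reverse ↔ IsPath G l :=
  ⟨fun h => by simpa using h.reverse, IsPath.reverse⟩

/-- The elementary path with a given list of vertices. -/
def EPath.mk (l : List V) (h : IsPath G l) : EPath G := ⟨l, h⟩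

@[simp] theorem EPath.mk_val (l : List V) (h : IsPath G l) : (EPath.mk l h).1 = l := rfl

@[simp] theorem EPath.mk_eq_mk {l m : List V} (h : IsPath G l) (h' : IsPath G m) :
    EPath.mk l h = EPath.mk m h' ↔ l = m := Subtype.ext_iff

theorem ket_of_isPath {l : List V} (h : IsPath G l) :
    ket G l = Finsupp.single (EPath.mk l h) 1 := dif_pos h

theorem amp_of_isPath {l : List V} (h : IsPath G l) (u : PathSpace G) :
    amp u l = u (EPath.mk l h) := dif_pos h

theorem amp_of_not {l : List V} (h : ¬ IsPath G l) (u : PathSpace G) : amp u l = 0 := dif_neg h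

theorem ket_of_not {l : List V} (h : ¬ IsPath G l) : ket G l = 0 := by simp [ket, h]

@[simp] theorem ket_nil : ket G [] = 0 := ket_of_not (by simp)

theorem single_eq_ket (p : EPath G) : Finsupp.single p (1 : ℂ) = ket G p.1 :=
  (ket_of_isPath p.2).symm

theorem apply_eq_amp (u : PathSpace G) (p : EPath G) : u p = amp u p.1 := by
  rw [amp_of_isPath p.2]; rfl

theorem amp_ket (l m : List V) : amp (ket G l) m = if l = m ∧ IsPath G l then 1 else 0 := by
  by_cases hl : IsPath G l
  · by_cases hm : IsPath G m
    · simp [amp_of_isPath hm, ket_of_isPath hl, Finsupp.single_apply, hl]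
    · have : l ≠ m := fun h => hm (h ▸ hl)
      simp [amp_of_not hm, this]
  · by_cases hm : IsPath G m
    · simp [ket_of_not hl, amp_of_isPath hm, hl]
    · simp [amp_of_not hm, hl]

/-- The amplitude as a linear form. -/
def ampL (l : List V) : PathSpace G →ₗ[ℂ] ℂ where
  toFun u := amp u l
  map_add' u v := by
    by_cases h : IsPath G l
    · simp [amp_of_isPath h]
    · simp [amp_of_not h]
  map_smul' z u := by
    by_cases h : IsPath G l
    · simp [amp_of_isPath h]
    · simp [amp_of_not h]

@[simp] theorem amp_zero (l : List V) : amp (0 : PathSpace G) l = 0 := map_zero (ampL l)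
@[simp] theorem amp_add (u v : PathSpace G) (l : List V) : amp (u + v) l = amp u l + amp v l :=
  map_add (ampL l) u v
@[simp] theorem amp_smul (z : ℂ) (u : PathSpace G) (l : List V) :
    amp (z • u) l = z * amp u l := map_smul (ampL l) z u
theorem amp_sum {ι : Type*} (s : Finset ι) (f : ι → PathSpace G) (l : List V) :
    amp (∑ i ∈ s, f i) l = ∑ i ∈ s, amp (f i) l := map_sum (ampL l) f s

theorem ext_amp {u v : PathSpace G} (h : ∀ l, IsPath G l → amp u l = amp v l) : u = v := by
  ext p
  rw [apply_eq_amp, apply_eq_amp, h _ p.2]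

theorem ext_ket {M : Type*} [AddCommMonoid M] [Module ℂ M] {f g : PathSpace G →ₗ[ℂ] M}
    (h : ∀ l, IsPath G l → f (ket G l) = g (ket G l)) : f = g := by
  apply Finsupp.lhom_ext'
  intro p
  ext
  simpa [single_eq_ket] using h p.1 p.2

theorem ket_induction {p : PathSpace G → Prop} (u : PathSpace G) (h0 : p 0)
    (hadd : ∀ u v, p u → p v → p (u + v))
    (hket : ∀ (z : ℂ) l, IsPath G l → p (z • ket G l)) : p u := by
  induction u using Finsupp.induction_linear with
  | zero => exact h0
  | add u v hu hv => exact hadd u v hu hv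
  | single q z =>
    rw [← Finsupp.smul_single_one, single_eq_ket]
    exact hket z _ q.2

/-- The linear map with prescribed values on elementary paths. -/
def onKets {M : Type*} [AddCommMonoid M] [Module ℂ M] (f : List V → M) : PathSpace G →ₗ[ℂ] M :=
  Finsupp.linearCombination ℂ fun p : EPath G => f p.1

theorem onKets_ket {M : Type*} [AddCommMonoid M] [Module ℂ M] (f : List V → M) {l : List V}
    (h : IsPath G l) : onKets (G := G) f (ket G l) = f l := by
  simp [onKets, ket_of_isPath h]

end Kets

/-! ### The scalar product of paths and formal adjoints -/

section ScalarProduct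

/-- The scalar product for which elementary paths are orthonormal. -/
def ip : PathSpace G →ₗ⋆[ℂ] PathSpace G →ₗ[ℂ] ℂ where
  toFun u := Finsupp.linearCombination ℂ fun p => conj (u p)
  map_add' u v := by
    apply Finsupp.lhom_ext'; intro p; ext; simp
  map_smul' z u := by
    apply Finsupp.lhom_ext'; intro p; ext; simp

theorem ip_ket_right (u : PathSpace G) (l : List V) : ip u (ket G l) = conj (amp u l) := by
  by_cases h : IsPath G l
  · simp [ip, ket_of_isPath h, amp_of_isPath h]
  · simp [ket_of_not h, amp_of_not h]

theorem ip_symm (u v : PathSpace G) : conj (ip u v) = ip v u := by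
  induction v using ket_induction with
  | h0 => simp
  | hadd v w hv hw => simp [hv, hw]
  | hket z l hl =>
    rw [map_smul, ip_ket_right, LinearMap.map_smulₛₗ]
    have : ip (ket G l) u = amp u l := by
      induction u using ket_induction with
      | h0 => simp
      | hadd v w hv hw => simp [hv, hw]
      | hket z m hm =>
        rw [map_smul, ip_ket_right, amp_smul, amp_ket, amp_ket]
        by_cases h : l = m
        · subst h; simp [hl]
        · simp [h, Ne.symm h]
    simp [this]

theorem ip_ket_left (u : PathSpace G) (l : List V) : ip (ket G l) u = amp u l := by
  rw [← ip_symm, ip_ket_right, Complex.conj_conj]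

theorem ip_self (u : PathSpace G) : ip u u = ((u.sum fun _ z => Complex.normSq z : ℝ) : ℂ) := by
  simp only [ip, LinearMap.coe_mk, AddHom.coe_mk, Finsupp.linearCombination_apply, smul_eq_mul,
    Finsupp.sum, Complex.ofReal_sum, Complex.mul_conj]

theorem ip_self_pos {u : PathSpace G} (hu : u ≠ 0) : 0 < (ip u u).re := by
  rw [ip_self, Complex.ofReal_re]
  refine Finset.sum_pos (fun p hp => Complex.normSq_pos.2 (Finsupp.mem_support_iff.1 hp)) ?_
  exact Finsupp.support_nonempty_iff.2 hu

theorem ip_self_nonneg (u : PathSpace G) : 0 ≤ (ip u u).re := by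
  by_cases hu : u = 0
  · simp [hu]
  · exact (ip_self_pos hu).le

theorem eq_zero_of_ip_self {u : PathSpace G} (h : ip u u = 0) : u = 0 := by
  by_contra hu
  have := ip_self_pos hu
  simp [h] at this

/-- Formally adjoint operators. -/
def Adjoint (S T : Module.End ℂ (PathSpace G)) : Prop := ∀ u v, ip (S u) v = ip u (T v)

theorem Adjoint.symm {S T : Module.End ℂ (PathSpace G)} (h : Adjoint S T) : Adjoint T S := by
  intro u v
  rw [← ip_symm, ← h, ip_symm]

theorem adjoint_of_ket {S T : Module.End ℂ (PathSpace G)}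
    (h : ∀ l m, IsPath G l → IsPath G m → amp (T (ket G m)) l = conj (amp (S (ket G l)) m)) :
    Adjoint S T := by
  intro u v
  induction u using ket_induction with
  | h0 => simp
  | hadd u w hu hw => simp [hu, hw]
  | hket z l hl =>
    induction v using ket_induction with
    | h0 => simp
    | hadd u w hu hw => simp only [map_add, hu, hw]
    | hket y m hm =>
      simp only [map_smul, LinearMap.map_smulₛₗ, LinearMap.smul_apply]
      rw [ip_ket_left, ip_ket_right, h l m hl hm]

theorem Adjoint.comp {S T S' T' : Module.End ℂ (PathSpace G)} (h : Adjoint S T)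
    (h' : Adjoint S' T') : Adjoint (S ∘ₗ S') (T' ∘ₗ T) := by
  intro u v
  simp [h _ _, h' _ _]

theorem Adjoint.sum {ι : Type*} (s : Finset ι) {S T : ι → Module.End ℂ (PathSpace G)}
    (h : ∀ i, Adjoint (S i) (T i)) : Adjoint (∑ i ∈ s, S i) (∑ i ∈ s, T i) := by
  intro u v
  simp [LinearMap.sum_apply, h _ _]

end ScalarProduct

/-! ### Adding and removing a first step -/

section Operators

/-- Add a step in front. -/
def prep (v : V) : Module.End ℂ (PathSpace G) := onKets fun l => ket G (v :: l)

/-- Remove the first step, which has to start at `v`. -/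
def strp (v : V) : Module.End ℂ (PathSpace G) :=
  onKets fun l => if l.head? = some v then ket G l.tail else 0

/-- The projection onto the paths that start at `v`. -/
def fst (v : V) : Module.End ℂ (PathSpace G) :=
  onKets fun l => if l.head? = some v then ket G l else 0

/-- The projection onto the paths that end at `v`. -/
def lst (v : V) : Module.End ℂ (PathSpace G) :=
  onKets fun l => if l.getLast? = some v then ket G l else 0

theorem prep_ket (v : V) {l : List V} (hl : l ≠ []) : prep v (ket G l) = ket G (v :: l) := by
  by_cases h : IsPath G l
  · rw [prep, onKets_ket _ h]
  · rw [ket_of_not h, map_zero, ket_of_not]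
    exact fun h' => h (h'.tail hl)

@[simp] theorem prep_ket_cons (v x : V) (l : List V) :
    prep v (ket G (x :: l)) = ket G (v :: x :: l) := prep_ket v (by simp)

@[simp] theorem fst_ket (v x : V) (l : List V) :
    fst v (ket G (x :: l)) = if x = v then ket G (x :: l) else 0 := by
  by_cases h : IsPath G (x :: l)
  · rw [fst, onKets_ket _ h]; simp
  · simp [ket_of_not h]

theorem lst_ket (v : V) (l : List V) :
    lst v (ket G l) = if l.getLast? = some v then ket G l else 0 := by
  by_cases h : IsPath G l
  · rw [lst, onKets_ket _ h]
  · simp [ket_of_not h]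

@[simp] theorem strp_ket_cons_cons {x y : V} {l : List V} (v : V)
    (h : IsPath G (x :: y :: l)) :
    strp v (ket G (x :: y :: l)) = if x = v then ket G (y :: l) else 0 := by
  rw [strp, onKets_ket _ h]; simp

@[simp] theorem strp_ket_singleton (v x : V) : strp v (ket G [x]) = 0 := by
  rw [strp, onKets_ket _ (by simp)]; simp

theorem adjoint_prep (v : V) : Adjoint (prep (G := G) v) (strp v) := by
  apply adjoint_of_ket
  rintro l m hl hm
  rw [prep_ket v hl.1, amp_ket]
  match m, hm with
  | [], hm => simp at hm
  | [x], hm => simp [hl.1]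
  | x :: y :: t, hm =>
    rw [strp_ket_cons_cons _ hm]
    by_cases hx : x = v
    · subst hx
      simp only [if_true, amp_ket]
      by_cases h : y :: t = l
      · subst h; simp_all
      · simp [h, Ne.symm h]
    · simp [hx, Ne.symm hx]

end Operators

end FaceModel

end

noncomputable section
namespace FaceModel
open scoped Classical

variable {V : Type*} {G : SimpleGraph V}

/-! ### Operators acting after the first vertex -/

section Shift

theorem path_cases {p : List V → Prop} (h1 : ∀ x, p [x])
    (h2 : ∀ x y t, IsPath G (x :: y :: t) → p (x :: y :: t)) (l : List V) (hl : IsPath G l) :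
    p l := by
  match l, hl with
  | [], hl => simp at hl
  | [x], _ => exact h1 x
  | x :: y :: t, hl => exact h2 x y t hl

theorem fst_prep (v x : V) (u : PathSpace G) :
    fst v (prep x u) = if x = v then prep x u else 0 := by
  induction u using ket_induction with
  | h0 => simp
  | hadd u w hu hw => rw [map_add, map_add, hu, hw]; split_ifs <;> simp
  | hket z l hl =>
    rw [map_smul, map_smul, prep_ket x hl.1, fst_ket]
    split_ifs <;> simp

theorem strp_fst (v x : V) (u : PathSpace G) :
    strp v (fst x u) = if v = x then strp v u else 0 := by
  induction u using ket_induction with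
  | h0 => simp
  | hadd u w hu hw => rw [map_add, map_add, map_add, hu, hw]; split_ifs <;> simp
  | hket z l hl =>
    simp only [map_smul]
    refine path_cases (p := fun l => z • strp v (fst x (ket G l)) =
      if v = x then z • strp v (ket G l) else 0) ?_ ?_ l hl
    · intro a; simp only [fst_ket]; split_ifs <;> simp
    · intro a b t h
      simp only [fst_ket, strp_ket_cons_cons _ h]
      by_cases hax : a = x
      · subst hax; by_cases hv : v = a
        · subst hv; simp [strp_ket_cons_cons _ h]
        · simp [strp_ket_cons_cons _ h, hv, Ne.symm hv]
      · by_cases hav : a = v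
        · subst hav; simp [hax]
        · simp [hax, hav]

theorem prep_eq_zero {x v : V} {u : PathSpace G} (hu : fst v u = u) (h : ¬ G.Adj x v) :
    prep x u = 0 := by
  rw [← hu]
  clear hu
  induction u using ket_induction with
  | h0 => simp
  | hadd u w hu hw => rw [map_add, map_add, hu, hw, add_zero]
  | hket z l hl =>
    match l, hl with
    | [], hl => simp at hl
    | y :: t, hl =>
      rw [map_smul, map_smul, fst_ket]
      split_ifs with hy
      · subst hy
        rw [prep_ket_cons, ket_of_not, smul_zero]
        simp [h]
      · simp

/-- An operator preserves the first vertex. -/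
def PreservesFirst (S : Module.End ℂ (PathSpace G)) : Prop :=
  ∀ v u, fst v (S u) = S (fst v u)

theorem Adjoint.eq_of_eq {S T S' T' : Module.End ℂ (PathSpace G)} (h : Adjoint S T)
    (h' : Adjoint S' T') (hS : S = S') : T = T' := by
  subst hS
  ext1 p
  ext1
  apply ext_amp
  intro l _
  simp only [LinearMap.comp_apply]
  rw [← ip_ket_left, ← h, h', ip_ket_left]

theorem Adjoint.comm_of_comm {S T A B : Module.End ℂ (PathSpace G)} (h : Adjoint S T)
    (h' : Adjoint A B) (hc : A ∘ₗ S = S ∘ₗ A) : B ∘ₗ T = T ∘ₗ B :=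
  (h'.comp h).eq_of_eq (h.comp h') hc |>.symm

theorem adjoint_fst (v : V) : Adjoint (fst (G := G) v) (fst v) := by
  apply adjoint_of_ket
  intro l m hl hm
  match l, m, hl, hm with
  | [], _, hl, _ => simp at hl
  | _ :: _, [], _, hm => simp at hm
  | x :: t, y :: s, hl, hm =>
    simp only [fst_ket]
    by_cases h : x :: t = y :: s
    · obtain ⟨rfl, rfl⟩ := List.cons_eq_cons.1 h
      split_ifs <;> simp [amp_ket, hl]
    · split_ifs <;> simp [amp_ket, h, Ne.symm h]

variable [Fintype V]

/-- Apply an operator to what follows the first vertex. -/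
def shift (S : Module.End ℂ (PathSpace G)) : Module.End ℂ (PathSpace G) :=
  ∑ v, prep v ∘ₗ S ∘ₗ strp v

@[simp] theorem shift_singleton (S : Module.End ℂ (PathSpace G)) (x : V) :
    shift S (ket G [x]) = 0 := by
  simp [shift, LinearMap.sum_apply]

theorem shift_cons_cons (S : Module.End ℂ (PathSpace G)) {x y : V} {t : List V}
    (h : IsPath G (x :: y :: t)) : shift S (ket G (x :: y :: t)) = prep x (S (ket G (y :: t))) := by
  simp only [shift, LinearMap.sum_apply, LinearMap.comp_apply, strp_ket_cons_cons _ h]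
  rw [Finset.sum_eq_single x]
  · simp
  · intro b _ hb; simp [Ne.symm hb]
  · simp

theorem preservesFirst_shift (S : Module.End ℂ (PathSpace G)) : PreservesFirst (shift S) := by
  intro v u
  simp only [shift, LinearMap.sum_apply, LinearMap.comp_apply, map_sum, fst_prep, strp_fst]
  refine Finset.sum_congr rfl fun x _ => ?_
  split_ifs <;> simp

/-- The hypothesis on `S` matters where `prep x` kills a path: `S` must not move the first vertex of
that path to a neighbour of `x`. -/
theorem shift_prep {S : Module.End ℂ (PathSpace G)} (hS : PreservesFirst S) (x : V)
    (u : PathSpace G) : shift S (prep x u) = prep x (S u) := by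
  induction u using ket_induction with
  | h0 => simp
  | hadd u w hu hw => simp only [map_add, hu, hw]
  | hket z l hl =>
    match l, hl with
    | [], hl => simp at hl
    | y :: t, hl =>
      simp only [map_smul, prep_ket_cons]
      by_cases h : G.Adj x y
      · rw [shift_cons_cons _ (isPath_cons_cons.2 ⟨h, hl⟩)]
      · rw [ket_of_not (l := x :: y :: t) (by simp [h]), map_zero,
          prep_eq_zero (v := y) (by rw [hS]; simp) h]

theorem Adjoint.shift {S T : Module.End ℂ (PathSpace G)} (h : Adjoint S T) :
    Adjoint (FaceModel.shift S) (FaceModel.shift T) :=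
  Adjoint.sum Finset.univ fun v => by
    have := (adjoint_prep v).comp (h.comp (adjoint_prep v).symm)
    rwa [LinearMap.comp_assoc] at this

/-- This is the adjoint of `shift_prep` for `T`, since `strp x` is adjoint to `prep x`. -/
theorem strp_shift {S T : Module.End ℂ (PathSpace G)} (h : Adjoint S T)
    (hT : PreservesFirst T) (x : V)
    (u : PathSpace G) : strp x (shift S u) = S (strp x u) := by
  have h1 : (prep x).comp T = (shift T).comp (prep x) := by
    ext1 p; ext1; simp [shift_prep hT]
  have := ((adjoint_prep x).comp h.symm).eq_of_eq (h.shift.symm.comp (adjoint_prep x)) h1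
  exact (congrArg (fun f => f u) this).symm

end Shift

/-! ### Creation and annihilation of back-and-forth steps -/

section CupCap

variable (μ : V → ℝ)

/-- The weight `√(μ_a / μ_b)`. -/
def rt (a b : V) : ℂ := (√(μ a / μ b) : ℝ)

@[simp] theorem conj_rt (a b : V) : conj (rt μ a b) = rt μ a b := Complex.conj_ofReal _

variable {μ} in
theorem rt_mul_rt (hμ : ∀ v, 0 < μ v) (a b c : V) : rt μ a b * rt μ b c = rt μ a c := by
  unfold rt
  rw [← Complex.ofReal_mul, ← Real.sqrt_mul (div_pos (hμ a) (hμ b)).le,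
    div_mul_div_cancel₀ (hμ b).ne']

variable {μ} in
theorem rt_self (hμ : ∀ v, 0 < μ v) (a : V) : rt μ a a = 1 := by
  simp [rt, div_self (hμ a).ne']

variable {μ} in
theorem rt_sq (hμ : ∀ v, 0 < μ v) (a b : V) : rt μ a b * rt μ a b = (μ a / μ b : ℝ) := by
  unfold rt
  rw [← Complex.ofReal_mul, Real.mul_self_sqrt (div_pos (hμ a) (hμ b)).le]

variable [Fintype V]

/-- Creation of a back-and-forth pair of steps at position `i`. -/
def cup : ℕ → Module.End ℂ (PathSpace G)
  | 0 => onKets fun l => match l with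
    | [] => 0
    | v :: t => ∑ w, rt μ w v • ket G (v :: w :: v :: t)
  | i + 1 => shift (cup i)

/-- Annihilation of a back-and-forth pair of steps at position `i`. -/
def cap : ℕ → Module.End ℂ (PathSpace G)
  | 0 => onKets fun l => match l with
    | a :: b :: c :: t => if a = c then rt μ b a • ket G (a :: t) else 0
    | _ => 0
  | i + 1 => shift (cap i)

theorem cup_zero_ket (v : V) (t : List V) : cup μ 0 (ket G (v :: t)) =
    ∑ w, rt μ w v • ket G (v :: w :: v :: t) := by
  by_cases h : IsPath G (v :: t)
  · rw [cup, onKets_ket _ h]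
  · rw [ket_of_not h, map_zero, Finset.sum_eq_zero]
    intro w _
    rw [ket_of_not, smul_zero]
    simp [h]

theorem cap_zero_ket {a b c : V} {t : List V} (h : IsPath G (a :: b :: c :: t)) :
    cap μ 0 (ket G (a :: b :: c :: t)) =
      if a = c then rt μ b a • ket G (a :: t) else 0 := by
  rw [cap, onKets_ket _ h]

@[simp] theorem cap_zero_ket_one (a : V) : cap μ 0 (ket G [a]) = 0 := by
  rw [cap, onKets_ket _ (by simp)]

@[simp] theorem cap_zero_ket_two (a b : V) : cap μ 0 (ket G [a, b]) = 0 := by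
  by_cases h : IsPath G [a, b]
  · rw [cap, onKets_ket _ h]
  · simp [ket_of_not h]

theorem preservesFirst_cup (i : ℕ) : PreservesFirst (cup (G := G) μ i) := by
  cases i with
  | succ i => exact preservesFirst_shift _
  | zero =>
    intro v u
    induction u using ket_induction with
    | h0 => simp
    | hadd u w hu hw => simp only [map_add, hu, hw]
    | hket z l hl =>
      match l, hl with
      | [], hl => simp at hl
      | y :: t, hl =>
        simp only [map_smul, fst_ket, cup_zero_ket, map_sum]
        split_ifs <;> simp [cup_zero_ket]

theorem preservesFirst_cap (i : ℕ) : PreservesFirst (cap (G := G) μ i) := by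
  cases i with
  | succ i => exact preservesFirst_shift _
  | zero =>
    intro v u
    induction u using ket_induction with
    | h0 => simp
    | hadd u w hu hw => simp only [map_add, hu, hw]
    | hket z l hl =>
      match l, hl with
      | [], hl => simp at hl
      | [a], hl => simp only [map_smul, fst_ket]; split_ifs <;> simp
      | [a, b], hl => simp only [map_smul, fst_ket]; split_ifs <;> simp
      | a :: b :: c :: t, hl =>
        simp only [map_smul, fst_ket, cap_zero_ket μ hl]
        by_cases hac : a = c
        · subst hac
          by_cases hav : a = v
          · subst hav; simp [cap_zero_ket μ hl]
          · simp [hav]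
        · split_ifs <;> simp [cap_zero_ket μ hl, hac]

/-- Both operators weigh a pair of steps `v w v` with the same real number `rt μ w v`, and `shift`
preserves adjointness. -/
theorem adjoint_cup_cap (i : ℕ) : Adjoint (cup (G := G) μ i) (cap μ i) := by
  induction i with
  | succ i ih => exact ih.shift
  | zero =>
    apply adjoint_of_ket
    intro l m hl hm
    match l, m, hl, hm with
    | [], _, hl, _ => simp at hl
    | v :: t, [], _, hm => simp at hm
    | v :: t, [a], _, hm => simp [cup_zero_ket, amp_sum, amp_ket, -Complex.coe_smul]
    | v :: t, [a, b], _, hm => simp [cup_zero_ket, amp_sum, amp_ket, -Complex.coe_smul]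
    | v :: t, a :: b :: c :: s, hl, hm =>
      simp only [cup_zero_ket, amp_sum, amp_smul, cap_zero_ket μ hm, map_sum, map_mul,
        conj_rt]
      rw [Finset.sum_eq_single b]
      · by_cases hac : a = c
        · subst hac
          simp only [if_true, amp_smul, amp_ket]
          by_cases h : a :: s = v :: t
          · obtain ⟨rfl, rfl⟩ := List.cons_eq_cons.1 h
            simp [hl, hm]
          · have : ¬ (v :: b :: v :: t = a :: b :: a :: s) := by
              intro h'; simp at h'; exact h (by simp [h'])
            simp [h, this]
        · have : ¬ (v :: b :: v :: t = a :: b :: c :: s) := by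
            intro h'; simp at h'; exact hac (by rw [← h'.1, h'.2.1])
          simp [hac, amp_ket, this]
      · intro w _ hw
        have : ¬ (v :: w :: v :: t = a :: b :: c :: s) := by
          intro h'; simp at h'; exact hw h'.2.1
        simp [amp_ket, this]
      · simp

end CupCap

end FaceModel

end

noncomputable section
namespace FaceModel
set_option linter.unusedSectionVars false
open scoped Classical

variable {V : Type*} {G : SimpleGraph V} (μ : V → ℝ) [Fintype V]

/-! ### Action on explicit paths and commutation at a distance -/

section Relations

theorem cup_succ_prep (i : ℕ) (x : V) (u : PathSpace G) :
    cup μ (i + 1) (prep x u) = prep x (cup μ i u) := shift_prep (preservesFirst_cup μ i) x u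

theorem cap_succ_prep (i : ℕ) (x : V) (u : PathSpace G) :
    cap μ (i + 1) (prep x u) = prep x (cap μ i u) := shift_prep (preservesFirst_cap μ i) x u

theorem strp_cup_succ (i : ℕ) (x : V) (u : PathSpace G) :
    strp x (cup μ (i + 1) u) = cup μ i (strp x u) :=
  strp_shift (adjoint_cup_cap μ i) (preservesFirst_cap μ i) x u

theorem strp_cap_succ (i : ℕ) (x : V) (u : PathSpace G) :
    strp x (cap μ (i + 1) u) = cap μ i (strp x u) :=
  strp_shift (adjoint_cup_cap μ i).symm (preservesFirst_cup μ i) x u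

theorem cup_zero_eq {v : V} {u : PathSpace G} (hu : fst v u = u) :
    cup μ 0 u = ∑ w, rt μ w v • prep v (prep w u) := by
  rw [← hu]
  clear hu
  induction u using ket_induction with
  | h0 => simp
  | hadd u w hu hw => simp only [map_add, hu, hw, smul_add, Finset.sum_add_distrib]
  | hket z l hl =>
    match l, hl with
    | [], hl => simp at hl
    | y :: t, hl =>
      simp only [map_smul, fst_ket]
      split_ifs with h
      · subst h
        simp [cup_zero_ket, Finset.smul_sum, smul_comm z]
      · simp

theorem cap_zero_prep_prep (a b : V) (u : PathSpace G) :
    cap μ 0 (prep a (prep b u)) = if G.Adj a b then rt μ b a • fst a u else 0 := by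
  induction u using ket_induction with
  | h0 => simp
  | hadd u w hu hw => simp only [map_add, hu, hw]; split_ifs <;> simp
  | hket z l hl =>
    match l, hl with
    | [], hl => simp at hl
    | y :: t, hl =>
      simp only [map_smul, prep_ket_cons, fst_ket]
      by_cases hab : G.Adj a b
      · by_cases hay : y = a
        · subst hay
          rw [cap_zero_ket μ (by simp [hab, hab.symm, hl])]
          simp [hab, smul_comm z]
        · by_cases h : IsPath G (a :: b :: y :: t)
          · rw [cap_zero_ket μ h]
            simp [hay, Ne.symm hay]
          · simp [ket_of_not h, hay]
      · rw [ket_of_not (by simp [hab])]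
        simp [hab]

theorem fst_ket_self (a : V) (t : List V) : fst a (ket G (a :: t)) = ket G (a :: t) := by simp

theorem cup_succ_singleton (i : ℕ) (x : V) : cup μ (i + 1) (ket G [x]) = 0 := shift_singleton _ x
theorem cap_succ_singleton (i : ℕ) (x : V) : cap μ (i + 1) (ket G [x]) = 0 := shift_singleton _ x

theorem cup_eq_zero {l : List V} : ∀ {i : ℕ}, l.length ≤ i → cup μ i (ket G l) = 0 := by
  induction l with
  | nil => simp
  | cons x t ih =>
    intro i hi
    obtain ⟨i, rfl⟩ : ∃ j, i = j + 1 := ⟨i - 1, by simp at hi; omega⟩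
    cases t with
    | nil => exact cup_succ_singleton μ i x
    | cons y t =>
      rw [← prep_ket_cons, cup_succ_prep, ih (by simpa using hi), map_zero]

theorem cap_eq_zero {l : List V} : ∀ {i : ℕ}, l.length ≤ i + 2 → cap μ i (ket G l) = 0 := by
  induction l with
  | nil => simp
  | cons x t ih =>
    intro i hi
    cases t with
    | nil => cases i with
      | zero => exact cap_zero_ket_one μ x
      | succ i => exact cap_succ_singleton μ i x
    | cons y t =>
      cases i with
      | zero =>
        obtain rfl : t = [] := by simpa using hi
        exact cap_zero_ket_two μ x y
      | succ i =>
        rw [← prep_ket_cons, cap_succ_prep, ih (by simp at hi ⊢; omega), map_zero]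

theorem cup_append {i : ℕ} {l : List V} (hi : i = l.length) (v : V) (m : List V) :
    cup μ i (ket G (l ++ v :: m)) =
      ∑ w, rt μ w v • ket G (l ++ v :: w :: v :: m) := by
  subst hi
  induction l with
  | nil => exact cup_zero_ket μ v m
  | cons x t ih =>
    rw [List.cons_append, ← prep_ket x (by simp), List.length_cons, cup_succ_prep, ih, map_sum]
    refine Finset.sum_congr rfl fun w _ => ?_
    rw [map_smul, prep_ket x (by simp), List.cons_append]

theorem cap_append {i : ℕ} {l : List V} (hi : i = l.length) {a b c : V} {m : List V}
    (h : IsPath G (l ++ a :: b :: c :: m)) :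
    cap μ i (ket G (l ++ a :: b :: c :: m)) =
      if a = c then rt μ b a • ket G (l ++ a :: m) else 0 := by
  subst hi
  induction l with
  | nil => exact cap_zero_ket μ h
  | cons x t ih =>
    rw [List.cons_append, ← prep_ket x (by simp), List.length_cons, cap_succ_prep,
      ih (h.tail (by simp))]
    split_ifs
    · rw [map_smul, prep_ket x (by simp), List.cons_append]
    · simp

/-- The two operators act on disjoint stretches of the path, and `cap` lowers the later position by
two. Removing first steps reduces to position `0`, where `cap` only inspects the first three
vertices. -/
theorem cap_cup_far (i k : ℕ) (u : PathSpace G) :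
    cap μ i (cup μ (i + 2 + k) u) = cup μ (i + k) (cap μ i u) := by
  suffices h : cap (G := G) μ i ∘ₗ cup μ (i + 2 + k) = cup μ (i + k) ∘ₗ cap μ i from
    congrArg (fun f => f u) h
  clear u
  induction i with
  | zero =>
    apply ext_ket
    intro l hl
    simp only [LinearMap.comp_apply, zero_add, show 2 + k = k + 1 + 1 by ring]
    match l, hl with
    | [], hl => simp at hl
    | [a], _ => simp [cup_succ_singleton]
    | [a, b], _ =>
      rw [cap_zero_ket_two, ← prep_ket_cons, cup_succ_prep, cup_succ_singleton]; simp
    | a :: b :: c :: t, h =>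
      have hab := (isPath_cons_cons.1 h).1
      rw [← prep_ket_cons, ← prep_ket_cons, cup_succ_prep, cup_succ_prep, cap_zero_prep_prep,
        cap_zero_prep_prep, if_pos hab, if_pos hab, preservesFirst_cup, map_smul]
  | succ i ih =>
    apply ext_ket
    intro l hl
    simp only [LinearMap.comp_apply, show i + 1 + 2 + k = i + 2 + k + 1 by ring,
      show i + 1 + k = i + k + 1 by ring]
    match l, hl with
    | [], hl => simp at hl
    | [a], _ => simp [cup_succ_singleton, cap_succ_singleton]
    | a :: b :: t, h =>
      rw [← prep_ket_cons, cup_succ_prep, cap_succ_prep, cap_succ_prep, cup_succ_prep]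
      congr 1
      exact congrArg (fun f => f (ket G (b :: t))) ih

theorem cap_cup_far' (i k : ℕ) (u : PathSpace G) :
    cap μ (i + 2 + k) (cup μ i u) = cup μ i (cap μ (i + k) u) := by
  have h1 := (adjoint_cup_cap (G := G) μ (i + 2 + k)).symm.comp (adjoint_cup_cap μ i)
  have h2 := (adjoint_cup_cap (G := G) μ i).comp (adjoint_cup_cap (G := G) μ (i + k)).symm
  refine congrArg (fun f => f u) (Adjoint.eq_of_eq h1.symm h2.symm ?_)
  ext1 p; ext1; exact cap_cup_far μ i k _

theorem cap_cap_far (i k : ℕ) (u : PathSpace G) :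
    cap μ i (cap μ (i + 2 + k) u) = cap μ (i + k) (cap μ i u) := by
  suffices h : cap (G := G) μ i ∘ₗ cap μ (i + 2 + k) = cap μ (i + k) ∘ₗ cap μ i from
    congrArg (fun f => f u) h
  clear u
  induction i with
  | zero =>
    apply ext_ket
    intro l hl
    simp only [LinearMap.comp_apply, zero_add, show 2 + k = k + 1 + 1 by ring]
    match l, hl with
    | [], hl => simp at hl
    | [a], _ => simp [cap_succ_singleton]
    | [a, b], _ =>
      rw [cap_zero_ket_two, ← prep_ket_cons, cap_succ_prep, cap_succ_singleton]; simp
    | a :: b :: c :: t, h =>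
      have hab := (isPath_cons_cons.1 h).1
      rw [← prep_ket_cons, ← prep_ket_cons, cap_succ_prep, cap_succ_prep, cap_zero_prep_prep,
        cap_zero_prep_prep, if_pos hab, if_pos hab, preservesFirst_cap, map_smul]
  | succ i ih =>
    apply ext_ket
    intro l hl
    simp only [LinearMap.comp_apply, show i + 1 + 2 + k = i + 2 + k + 1 by ring,
      show i + 1 + k = i + k + 1 by ring]
    match l, hl with
    | [], hl => simp at hl
    | [a], _ => simp [cap_succ_singleton]
    | a :: b :: t, h =>
      rw [← prep_ket_cons, cap_succ_prep, cap_succ_prep, cap_succ_prep, cap_succ_prep]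
      congr 1
      exact congrArg (fun f => f (ket G (b :: t))) ih

end Relations

/-! ### The grading by length -/

section Degree

/-- The span of the paths of length `n`. -/
def deg (G : SimpleGraph V) (n : ℕ) : Submodule ℂ (PathSpace G) :=
  Finsupp.supported ℂ ℂ {p : EPath G | p.length = n}

omit [Fintype V] in
theorem deg_eq_span (n : ℕ) : deg G n =
    Submodule.span ℂ {u | ∃ l, IsPath G l ∧ l.length = n + 1 ∧ ket G l = u} := by
  rw [deg, Finsupp.supported_eq_span_single]
  congr 1
  ext u
  constructor
  · rintro ⟨p, hp, rfl⟩
    refine ⟨p.1, p.2, ?_, (single_eq_ket p).symm⟩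
    have := List.length_pos_of_ne_nil p.2.1
    have : p.1.length - 1 = n := hp
    omega
  · rintro ⟨l, hl, h, rfl⟩
    refine ⟨EPath.mk l hl, ?_, (ket_of_isPath hl).symm⟩
    simp [EPath.length, h]

omit [Fintype V] in
theorem ket_mem_deg {l : List V} {n : ℕ} (h : l.length = n + 1) : ket G l ∈ deg G n := by
  by_cases hl : IsPath G l
  · rw [deg_eq_span]
    exact Submodule.subset_span ⟨l, hl, h, rfl⟩
  · rw [ket_of_not hl]; exact zero_mem _

omit [Fintype V] in
theorem deg_induction {n : ℕ} {p : PathSpace G → Prop} {u : PathSpace G} (hu : u ∈ deg G n)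
    (h0 : p 0) (hadd : ∀ u v, p u → p v → p (u + v)) (hsmul : ∀ (z : ℂ) u, p u → p (z • u))
    (hket : ∀ l, IsPath G l → l.length = n + 1 → p (ket G l)) : p u := by
  rw [deg_eq_span] at hu
  induction hu using Submodule.span_induction with
  | mem x h => obtain ⟨l, hl, h, rfl⟩ := h; exact hket l hl h
  | zero => exact h0
  | add x y _ _ hx hy => exact hadd x y hx hy
  | smul z x _ hx => exact hsmul z x hx

omit [Fintype V] in
theorem mem_deg_iff {n : ℕ} {u : PathSpace G} :
    u ∈ deg G n ↔ ∀ l, IsPath G l → l.length ≠ n + 1 → amp u l = 0 := by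
  rw [deg, Finsupp.mem_supported']
  constructor
  · intro h l hl hn
    rw [amp_of_isPath hl]
    refine h _ ?_
    have := List.length_pos_of_ne_nil hl.1
    simp [EPath.length]; omega
  · intro h p hp
    rw [apply_eq_amp]
    refine h _ p.2 fun h => hp ?_
    simp [EPath.length, h]

instance (n : ℕ) : Module.Finite ℂ (deg G n) := by
  rw [deg_eq_span]
  refine FiniteDimensional.span_of_finite ℂ (((List.finite_length_eq V (n + 1)).image (ket G)).subset ?_)
  rintro _ ⟨l, -, h, rfl⟩
  exact ⟨l, h, rfl⟩

theorem linearMap_mem_deg {n k : ℕ} {S : Module.End ℂ (PathSpace G)}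
    (h : ∀ l, IsPath G l → l.length = n + 1 → S (ket G l) ∈ deg G k)
    {u : PathSpace G} (hu : u ∈ deg G n) : S u ∈ deg G k := by
  refine deg_induction (p := fun u => S u ∈ deg G k) hu (by simp) ?_ ?_ h
  · intro u v hu hv; rw [map_add]; exact add_mem hu hv
  · intro z u hu; rw [map_smul]; exact Submodule.smul_mem _ _ hu

theorem prep_mem_deg {n : ℕ} (v : V) {u : PathSpace G} (hu : u ∈ deg G n) :
    prep v u ∈ deg G (n + 1) :=
  linearMap_mem_deg (fun l hl h => by
    rw [prep_ket v hl.1]; exact ket_mem_deg (by simp [h])) hu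

theorem fst_mem_deg {n : ℕ} (v : V) {u : PathSpace G} (hu : u ∈ deg G n) :
    fst v u ∈ deg G n :=
  linearMap_mem_deg (fun l hl h => by
    rw [fst, onKets_ket _ hl]
    split_ifs
    · exact ket_mem_deg h
    · exact zero_mem _) hu

theorem strp_mem_deg {n : ℕ} (v : V) {u : PathSpace G} (hu : u ∈ deg G (n + 1)) :
    strp v u ∈ deg G n :=
  linearMap_mem_deg (fun l hl h => by
    rw [strp, onKets_ket _ hl]
    split_ifs
    · exact ket_mem_deg (by simp [h])
    · exact zero_mem _) hu

theorem cup_mem_deg {n : ℕ} (i : ℕ) {u : PathSpace G} (hu : u ∈ deg G n) :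
    cup μ i u ∈ deg G (n + 2) := by
  refine linearMap_mem_deg (fun l hl h => ?_) hu
  by_cases hi : l.length ≤ i
  · rw [cup_eq_zero μ hi]; exact zero_mem _
  · obtain ⟨l1, v, m, rfl, rfl⟩ : ∃ l1 v m, l = l1 ++ v :: m ∧ i = l1.length :=
      ⟨l.take i, l[i], l.drop (i + 1), by simp, by simp; omega⟩
    rw [cup_append μ rfl]
    exact Submodule.sum_mem _ fun w _ => Submodule.smul_mem _ _
      (ket_mem_deg (by simp at h ⊢; omega))

omit [Fintype V] in
theorem exists_split_three {l : List V} {i : ℕ} (hi : i + 2 < l.length) :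
    ∃ l1 a b c m, l = l1 ++ a :: b :: c :: m ∧ i = l1.length :=
  ⟨l.take i, l[i], l[i + 1], l[i + 2], l.drop (i + 3), by simp, by simp; omega⟩

theorem cap_mem_deg {n : ℕ} (i : ℕ) {u : PathSpace G} (hu : u ∈ deg G (n + 2)) :
    cap μ i u ∈ deg G n := by
  refine linearMap_mem_deg (fun l hl h => ?_) hu
  by_cases hi : l.length ≤ i + 2
  · rw [cap_eq_zero μ hi]; exact zero_mem _
  · obtain ⟨l1, a, b, c, m, rfl, rfl⟩ := exists_split_three (by omega : i + 2 < l.length)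
    rw [cap_append μ rfl hl]
    split_ifs
    · exact Submodule.smul_mem _ _ (ket_mem_deg (by simp at h ⊢; omega))
    · exact zero_mem _

theorem cap_eq_zero_of_deg {n i : ℕ} (h : n ≤ i + 1) {u : PathSpace G} (hu : u ∈ deg G n) :
    cap μ i u = 0 := by
  refine deg_induction (p := fun u => cap μ i u = 0) hu (by simp) ?_ ?_ ?_
  · intro u v hu hv; simp [hu, hv]
  · intro z u hu; simp [hu]
  · intro l hl hn
    exact cap_eq_zero μ (by omega)

theorem cup_eq_zero_of_deg {n i : ℕ} (h : n < i) {u : PathSpace G} (hu : u ∈ deg G n) :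
    cup μ i u = 0 := by
  refine deg_induction (p := fun u => cup μ i u = 0) hu (by simp) ?_ ?_ ?_
  · intro u v hu hv; simp [hu, hv]
  · intro z u hu; simp [hu]
  · intro l hl hn
    exact cup_eq_zero μ (by omega)

end Degree

/-! ### Temperley–Lieb relations for neighbouring positions -/

section NearRelations

variable {μ}

/-- The weights of creation and annihilation of `v w v` multiply to `μ w / μ v`; summed over the
neighbours `w` of `v` this is the eigenvalue equation divided by `μ v`. Beyond the end of the path
`cup` is zero, whence the bound on `i`. -/
theorem cap_cup_self (hμ : ∀ v, 0 < μ v) {β : ℝ}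
    (hβ : ∀ v, ∑ w, (if G.Adj v w then μ w else 0) = β * μ v) {n : ℕ} {u : PathSpace G}
    (hu : u ∈ deg G n) {i : ℕ} (hi : i ≤ n) : cap μ i (cup μ i u) = (β : ℂ) • u := by
  refine deg_induction (p := fun u => cap μ i (cup μ i u) = (β : ℂ) • u) hu (by simp) ?_ ?_ ?_
  · intro u v hu hv; simp only [map_add, hu, hv, smul_add]
  · intro z u hu; simp only [map_smul, hu, smul_comm z]
  · intro l hl hn
    clear hu
    induction i generalizing l n with
    | zero =>
      match l, hl with
      | [], hl => simp at hl
      | v :: t, hl =>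
        rw [cup_zero_eq μ (fst_ket_self v t), map_sum]
        simp only [map_smul, cap_zero_prep_prep]
        have : ∀ w, rt μ w v • (if G.Adj v w then rt μ w v • fst v (ket G (v :: t)) else 0) =
            ((if G.Adj v w then μ w else 0 : ℝ) / μ v : ℂ) • ket G (v :: t) := by
          intro w
          split_ifs
          · rw [smul_smul, rt_sq hμ]; simp [-Complex.coe_smul]
          · simp
        rw [Finset.sum_congr rfl fun w _ => this w, ← Finset.sum_smul, ← Finset.sum_div,
          ← Complex.ofReal_sum, hβ, Complex.ofReal_mul,
          mul_div_cancel_right₀ _ (Complex.ofReal_ne_zero.2 (hμ v).ne')]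
    | succ i ih =>
      match l, hl with
      | [], hl => simp at hl
      | [a], hl => simp at hn; omega
      | a :: b :: t, hl =>
        rw [← prep_ket_cons, cup_succ_prep, cap_succ_prep,
          ih (n := n - 1) (by omega) (b :: t) (hl.tail (by simp)) (by simp at hn ⊢; omega),
          map_smul]

/-- The zigzag relation: among the inserted vertices `w` only the next vertex `x` of the path
survives the annihilation, and its two weights `rt μ x v` and `rt μ v x` cancel. -/
theorem cap_succ_cup (hμ : ∀ v, 0 < μ v) {n : ℕ} {u : PathSpace G}
    (hu : u ∈ deg G n) {i : ℕ} (hi : i + 1 ≤ n) : cap μ (i + 1) (cup μ i u) = u := by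
  refine deg_induction (p := fun u => cap μ (i + 1) (cup μ i u) = u) hu (by simp) ?_ ?_ ?_
  · intro u v hu hv; simp only [map_add, hu, hv]
  · intro z u hu; simp only [map_smul, hu]
  · intro l hl hn
    clear hu
    induction i generalizing l n with
    | zero =>
      match l, hl with
      | [], hl => simp at hl
      | [a], hl => simp at hn; omega
      | v :: x :: t, hl =>
        have hvx := (isPath_cons_cons.1 hl).1
        rw [cup_zero_eq μ (fst_ket_self v _), map_sum]
        simp only [map_smul, zero_add]
        rw [Finset.sum_eq_single x]
        · rw [cap_succ_prep, ← prep_ket_cons, cap_zero_prep_prep, if_pos hvx.symm]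
          rw [map_smul, fst_ket_self, smul_smul, rt_mul_rt hμ, rt_self hμ, one_smul]
        · intro w _ hw
          rw [cap_succ_prep, ← prep_ket_cons, cap_zero_prep_prep]
          split_ifs <;> simp [Ne.symm hw]
        · simp
    | succ i ih =>
      match l, hl with
      | [], hl => simp at hl
      | [a], hl => simp at hn; omega
      | a :: b :: t, hl =>
        rw [← prep_ket_cons, cup_succ_prep, cap_succ_prep,
          ih (n := n - 1) (by omega) (b :: t) (hl.tail (by simp)) (by simp at hn ⊢; omega)]

/-- The adjoint of the zigzag relation `cap_succ_cup`, tested on all paths. -/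
theorem cap_cup_succ (hμ : ∀ v, 0 < μ v) {n : ℕ} {u : PathSpace G}
    (hu : u ∈ deg G n) {i : ℕ} (hi : i + 1 ≤ n) : cap μ i (cup μ (i + 1) u) = u := by
  apply ext_amp
  intro l hl
  rw [← ip_ket_left, ← adjoint_cup_cap, ← (adjoint_cup_cap μ (i + 1)).symm]
  by_cases hn : l.length = n + 1
  · rw [cap_succ_cup hμ (ket_mem_deg hn) hi, ip_ket_left]
  · rw [← ip_ket_left]
    -- Vectors of different lengths are orthogonal, which settles the test paths whose length is not
    -- that of `u`.
    have hz : ∀ (k : ℕ) (w : PathSpace G), w ∈ deg G k → k ≠ n → ip w u = 0 := by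
      intro k w hw hk
      refine deg_induction (p := fun w => ip w u = 0) hw (by simp) ?_ ?_ ?_
      · intro u v hu hv; simp [hu, hv]
      · intro z u hu; simp [hu]
      · intro m hm hmk
        rw [ip_ket_left]
        exact mem_deg_iff.1 hu m hm (by omega)
    have hpos := List.length_pos_of_ne_nil hl.1
    rw [hz (l.length - 1) _ (cap_mem_deg μ _ (cup_mem_deg μ _ (ket_mem_deg (by omega))))
      (by omega), hz (l.length - 1) _ (ket_mem_deg (by omega)) (by omega)]

end NearRelations

/-! ### The Jones projections as products of creation and annihilation -/

section Jones

theorem jones_eq (hμ : ∀ v, 0 < μ v) (β : ℝ) (i : ℕ) :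
    jones G β μ i = ((1 / β : ℝ) : ℂ) • (cup μ i ∘ₗ cap μ i) := by
  apply ext_ket
  intro l hl
  have key : jones G β μ i (ket G l) = if h : i + 2 < l.length then
      if l[i] = l[i + 2] then
        ∑ w : V, ((1 / β * √(μ l[i + 1] * μ w / (μ l[i] * μ l[i + 2])) : ℝ) : ℂ) •
          ket G (l.set (i + 1) w)
      else 0
    else 0 := by
    rw [ket_of_isPath hl, jones, Finsupp.linearCombination_single, one_smul]
    rfl
  rw [key, LinearMap.smul_apply, LinearMap.comp_apply]
  split_ifs with h1 h2
  · obtain ⟨l1, a, b, c, m, rfl, rfl⟩ := exists_split_three h1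
    have hac : a = c := by simpa [List.getElem_append_right] using h2
    subst hac
    rw [cap_append μ rfl hl, if_pos rfl, map_smul, cup_append μ rfl, Finset.smul_sum,
      Finset.smul_sum]
    refine Finset.sum_congr rfl fun w _ => ?_
    rw [smul_smul, smul_smul]
    congr 1
    · simp only [List.getElem_append_right (le_refl _), Nat.sub_self, List.getElem_cons_zero]
      have e1 : (l1 ++ a :: b :: a :: m)[l1.length + 1] = b := by
        rw [List.getElem_append_right (by omega)]; simp
      have e2 : (l1 ++ a :: b :: a :: m)[l1.length + 2] = a := by
        rw [List.getElem_append_right (by omega)]; simp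
      rw [e1, e2]
      rw [rt, rt, ← Complex.ofReal_mul, ← Complex.ofReal_mul,
        mul_assoc, ← Real.sqrt_mul (div_pos (hμ _) (hμ _)).le, div_mul_div_comm]
    · congr 1
      rw [List.set_append_right _ _ (by omega)]
      simp
  · obtain ⟨l1, a, b, c, m, rfl, rfl⟩ := exists_split_three h1
    have hac : ¬ a = c := by simpa [List.getElem_append_right] using h2
    rw [cap_append μ rfl hl, if_neg hac]; simp
  · rw [cap_eq_zero μ (by omega)]; simp

end Jones

end FaceModel

end

noncomputable section
namespace FaceModel
set_option linter.unusedSectionVars false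
open scoped Classical

/-! ### Orthonormal bases and projections for positive forms -/

section Forms

variable {E : Type*} [AddCommGroup E] [Module ℂ E]

/-- Stated for an arbitrary positive form because it serves the scalar product `ip` of paths, its
weighted version `weightedIp` and the form `dualForm` on the dual. Only the finite-dimensional `U`
is made into an inner product space. -/
theorem exists_orthonormal (B : E →ₗ⋆[ℂ] E →ₗ[ℂ] ℂ) (hs : ∀ x y, conj (B x y) = B y x)
    (hp : ∀ x, x ≠ 0 → 0 < (B x x).re) (U : Submodule ℂ E) [Module.Finite ℂ U] :
    ∃ (d : ℕ) (u : Fin d → E), (∀ i, u i ∈ U) ∧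
      (∀ i j, B (u i) (u j) = if i = j then 1 else 0) ∧
      ∀ x ∈ U, x = ∑ i, B (u i) x • u i := by
  let core : InnerProductSpace.Core ℂ U :=
    { inner := fun x y => B x y
      conj_inner_symm := fun x y => hs y x
      re_inner_nonneg := fun x => by
        by_cases hx : (x : E) = 0
        · simp [hx]
        · exact (hp x hx).le
      add_left := fun x y z => by simp
      smul_left := fun x y r => by simp
      definite := fun x hx => by
        by_contra h
        have := hp x (by simpa using h)
        rw [hx] at this
        simp at this }
  let _ : NormedAddCommGroup U := core.toNormedAddCommGroup
  let _ : InnerProductSpace ℂ U := InnerProductSpace.ofCore core.toCore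
  have hin : ∀ x y : U, inner ℂ x y = B x y := fun x y => rfl
  let b := stdOrthonormalBasis ℂ U
  refine ⟨_, fun i => b i, fun i => (b i).2, fun i j => ?_, fun x hx => ?_⟩
  · rw [← hin]; exact orthonormal_iff_ite.1 b.orthonormal i j
  · have := b.sum_repr' ⟨x, hx⟩
    have h2 := congrArg U.subtype this
    simp only [map_sum, map_smul, hin] at h2
    exact h2.symm

theorem exists_decomposition (B : E →ₗ⋆[ℂ] E →ₗ[ℂ] ℂ) (hs : ∀ x y, conj (B x y) = B y x)
    (hp : ∀ x, x ≠ 0 → 0 < (B x x).re) (U : Submodule ℂ E) [Module.Finite ℂ U] (x : E) :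
    ∃ y ∈ U, ∀ z ∈ U, B z (x - y) = 0 := by
  obtain ⟨d, u, hu, ho, hx⟩ := exists_orthonormal B hs hp U
  refine ⟨∑ i, B (u i) x • u i, Submodule.sum_mem _ fun i _ => Submodule.smul_mem _ _ (hu i), ?_⟩
  intro z hz
  rw [hx z hz]
  have h : ∀ i, B (u i) (x - ∑ i, B (u i) x • u i) = 0 := by
    intro i; simp [ho]
  simp only [map_sum, LinearMap.map_smulₛₗ, LinearMap.sum_apply, LinearMap.smul_apply, h,
    smul_zero, Finset.sum_const_zero]

end Forms

variable {V : Type*} {G : SimpleGraph V} [Fintype V]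

/-- `μ` is a positive eigenvector of the adjacency matrix with eigenvalue `β`. -/
structure IsWeight (G : SimpleGraph V) (β : ℝ) (μ : V → ℝ) : Prop where
  pos : ∀ v, 0 < μ v
  eig : ∀ v, ∑ w, (if G.Adj v w then μ w else 0) = β * μ v

variable {β : ℝ} {μ : V → ℝ}

/-! ### Essential paths as the complement of created pairs -/

section Essential

theorem IsWeight.not_adj (hW : IsWeight G β μ) (hβ : β = 0) (v w : V) : ¬ G.Adj v w := by
  intro h
  have h0 := hW.eig v
  rw [hβ, zero_mul, Finset.sum_eq_zero_iff_of_nonneg] at h0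
  · have := h0 w (Finset.mem_univ _)
    rw [if_pos h] at this
    exact (hW.pos w).ne' this
  · intro x _; split_ifs
    · exact (hW.pos x).le
    · exact le_rfl

/-- By adjointness `cup (cap u) = 0` forces `‖cap u‖² = 0`. The case `β = 0` is separate: there the
coefficient `1 / β` is `0` and `jones` vanishes identically, but the graph then has no edges, so
`cap` vanishes as well. -/
theorem IsWeight.jones_eq_zero (hW : IsWeight G β μ) {i : ℕ} {u : PathSpace G} :
    jones G β μ i u = 0 ↔ cap μ i u = 0 := by
  rw [jones_eq μ hW.pos]
  constructor
  · intro h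
    by_cases hβ : β = 0
    · suffices h : cap (G := G) μ i = 0 by rw [h]; rfl
      apply ext_ket
      intro l hl
      refine path_cases (p := fun l => cap μ i (ket G l) = 0) ?_ ?_ l hl
      · intro x; exact cap_eq_zero μ (by simp)
      · intro x y t h
        exact absurd (isPath_cons_cons.1 h).1 (hW.not_adj hβ x y)
    · rw [LinearMap.smul_apply, smul_eq_zero] at h
      have h := h.resolve_left (by simpa using hβ)
      apply eq_zero_of_ip_self
      rw [← adjoint_cup_cap]
      rw [LinearMap.comp_apply] at h
      rw [h]; simp
  · intro h; simp [h]

theorem IsWeight.mem_essential (hW : IsWeight G β μ) {n : ℕ} {u : PathSpace G} :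
    u ∈ essential G β μ n ↔ u ∈ deg G n ∧ ∀ i, cap μ i u = 0 := by
  simp only [essential, Submodule.mem_inf, Submodule.mem_iInf, LinearMap.mem_ker,
    hW.jones_eq_zero]
  rfl

theorem essential_le_deg (n : ℕ) : essential G β μ n ≤ deg G n := inf_le_left

instance (n : ℕ) : Module.Finite ℂ (essential G β μ n) :=
  Submodule.finiteDimensional_of_le (essential_le_deg n)

variable (G μ) in
/-- The span of the images of the creation operators. -/
def cupSpan (n : ℕ) : Submodule ℂ (PathSpace G) := ⨆ i, (deg G n).map (cup μ i)

theorem cupSpan_le (n : ℕ) : cupSpan G μ n ≤ deg G (n + 2) := by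
  refine iSup_le fun i => ?_
  rintro _ ⟨u, hu, rfl⟩
  exact cup_mem_deg μ i hu

instance (n : ℕ) : Module.Finite ℂ (cupSpan G μ n) :=
  Submodule.finiteDimensional_of_le (cupSpan_le n)

theorem ip_cupSpan {n : ℕ} {e x : PathSpace G} (he : ∀ i, cap μ i e = 0)
    (hx : x ∈ cupSpan G μ n) : ip e x = 0 := by
  refine Submodule.iSup_induction _ (motive := fun x => ip e x = 0) hx ?_ (by simp) ?_
  · rintro i _ ⟨u, -, rfl⟩
    rw [← (adjoint_cup_cap μ i).symm, he]; simp
  · intro x y hx hy; rw [map_add, hx, hy, add_zero]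

/-- The orthogonal complement of the images of the `cup μ i` is the common kernel of their adjoints
`cap μ i`, which consists of the essential vectors. -/
theorem IsWeight.exists_essential_add (hW : IsWeight G β μ) {n : ℕ} {u : PathSpace G}
    (hu : u ∈ deg G (n + 2)) :
    ∃ e ∈ essential G β μ (n + 2), ∃ x ∈ cupSpan G μ n, u = e + x := by
  obtain ⟨x, hx, h⟩ := exists_decomposition ip ip_symm (fun _ => ip_self_pos) (cupSpan G μ n) u
  refine ⟨u - x, hW.mem_essential.2 ⟨sub_mem hu (cupSpan_le n hx), fun i => ?_⟩, x, hx, by simp⟩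
  apply eq_zero_of_ip_self
  rw [← adjoint_cup_cap]
  exact h _ (Submodule.mem_iSup_of_mem i
    ⟨_, cap_mem_deg μ i (sub_mem hu (cupSpan_le n hx)), rfl⟩)

theorem IsWeight.essential_eq_deg (hW : IsWeight G β μ) {n : ℕ} (hn : n < 2) :
    essential G β μ n = deg G n :=
  le_antisymm (essential_le_deg n) fun _ hu =>
    hW.mem_essential.2 ⟨hu, fun _ => cap_eq_zero_of_deg μ (by omega) hu⟩

end Essential

/-! ### The algebra commuting with creation and annihilation -/

section SymAlg

variable (G μ) in
/-- The length preserving operators that commute with creation and annihilation. -/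
def symAlg : Subalgebra ℂ (Module.End ℂ (PathSpace G)) where
  carrier := {T | (∀ n, ∀ u ∈ deg G n, T u ∈ deg G n) ∧
    (∀ i u, T (cup μ i u) = cup μ i (T u)) ∧ ∀ i u, T (cap μ i u) = cap μ i (T u)}
  mul_mem' := by
    rintro S T ⟨h1, h2, h3⟩ ⟨h1', h2', h3'⟩
    refine ⟨fun n u hu => h1 n _ (h1' n u hu), fun i u => ?_, fun i u => ?_⟩
    · rw [Module.End.mul_apply, Module.End.mul_apply, h2', h2]
    · rw [Module.End.mul_apply, Module.End.mul_apply, h3', h3]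
  add_mem' := by
    rintro S T ⟨h1, h2, h3⟩ ⟨h1', h2', h3'⟩
    refine ⟨fun n u hu => add_mem (h1 n u hu) (h1' n u hu), fun i u => ?_, fun i u => ?_⟩
    · rw [LinearMap.add_apply, LinearMap.add_apply, h2', h2, map_add]
    · rw [LinearMap.add_apply, LinearMap.add_apply, h3', h3, map_add]
  algebraMap_mem' z := by
    refine ⟨fun n u hu => ?_, fun i u => ?_, fun i u => ?_⟩
    · exact Submodule.smul_mem _ z hu
    · simp [Module.algebraMap_end_apply]
    · simp [Module.algebraMap_end_apply]

variable {T S : Module.End ℂ (PathSpace G)}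

theorem symAlg_mem_deg (hT : T ∈ symAlg G μ) {n : ℕ} {u : PathSpace G} (hu : u ∈ deg G n) :
    T u ∈ deg G n := hT.1 n u hu

theorem symAlg_cup (hT : T ∈ symAlg G μ) (i : ℕ) (u : PathSpace G) :
    T (cup μ i u) = cup μ i (T u) := hT.2.1 i u

theorem symAlg_cap (hT : T ∈ symAlg G μ) (i : ℕ) (u : PathSpace G) :
    T (cap μ i u) = cap μ i (T u) := hT.2.2 i u

theorem symAlg_essential (hW : IsWeight G β μ) (hT : T ∈ symAlg G μ) {n : ℕ} {u : PathSpace G}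
    (hu : u ∈ essential G β μ n) : T u ∈ essential G β μ n := by
  rw [hW.mem_essential] at hu ⊢
  refine ⟨symAlg_mem_deg hT hu.1, fun i => ?_⟩
  rw [← symAlg_cap hT, hu.2, map_zero]

theorem ext_deg {M : Type*} [AddCommMonoid M] [Module ℂ M] {f g : PathSpace G →ₗ[ℂ] M}
    (h : ∀ n, ∀ u ∈ deg G n, f u = g u) : f = g :=
  ext_ket fun l hl => h (l.length - 1) _ (ket_mem_deg (by
    have := List.length_pos_of_ne_nil hl.1; omega))

theorem cupSpan_induction {n : ℕ} {p : PathSpace G → Prop} {x : PathSpace G}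
    (hx : x ∈ cupSpan G μ n) (h0 : p 0) (hadd : ∀ u v, p u → p v → p (u + v))
    (hcup : ∀ i, ∀ u ∈ deg G n, p (cup μ i u)) : p x := by
  refine Submodule.iSup_induction _ (motive := p) hx ?_ h0 hadd
  rintro i _ ⟨u, hu, rfl⟩
  exact hcup i u hu

/-- Induction on the length: on the essential part the operators agree by hypothesis, and on a
created pair `cup μ i u` their values come from those on the shorter `u`. -/
theorem symAlg_ext (hW : IsWeight G β μ) (hT : T ∈ symAlg G μ) (hS : S ∈ symAlg G μ)
    (h : ∀ n, ∀ u ∈ essential G β μ n, T u = S u) : T = S := by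
  apply ext_deg
  intro n
  induction n using Nat.strong_induction_on with
  | _ n ih =>
    match n with
    | 0 => rw [← hW.essential_eq_deg (by omega)]; exact h 0
    | 1 => rw [← hW.essential_eq_deg (by omega)]; exact h 1
    | n + 2 =>
      intro u hu
      obtain ⟨e, he, x, hx, rfl⟩ := hW.exists_essential_add hu
      rw [map_add, map_add, h _ e he]
      congr 1
      refine cupSpan_induction (p := fun x => T x = S x) hx (by simp) ?_ ?_
      · intro u v hu hv; simp [hu, hv]
      · intro i u hu
        rw [symAlg_cup hT, symAlg_cup hS, ih n (by omega) u hu]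

/-- Restriction to essential paths. -/
def restrictEssential (hW : IsWeight G β μ) : symAlg G μ →ₐ[ℂ] GradedEnd G β μ where
  toFun T n := (T : Module.End ℂ (PathSpace G)).restrict
    fun _ hu => symAlg_essential hW T.2 (n := n) hu
  map_one' := rfl
  map_mul' _ _ := rfl
  map_zero' := rfl
  map_add' _ _ := rfl
  commutes' _ := rfl

theorem restrictEssential_apply (hW : IsWeight G β μ) (T : symAlg G μ) (n : ℕ)
    (ξ : essential G β μ n) : (restrictEssential hW T n ξ : PathSpace G) = T.1 ξ := rfl

theorem restrictEssential_injective (hW : IsWeight G β μ) :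
    Function.Injective (restrictEssential (G := G) hW) := by
  intro S T h
  refine Subtype.ext (symAlg_ext hW S.2 T.2 fun n u hu => ?_)
  rw [← restrictEssential_apply hW S n ⟨u, hu⟩, h]
  rfl

end SymAlg

/-! ### Extending graded endomorphisms of essential paths -/

section Extension

variable (F : GradedEnd G β μ)

/-- The graph of the extension of a graded endomorphism of essential paths. -/
def extRel : ℕ → Submodule ℂ (PathSpace G × PathSpace G)
  | 0 => LinearMap.range ((essential G β μ 0).subtype.prod ((essential G β μ 0).subtype ∘ₗ F 0))
  | 1 => LinearMap.range ((essential G β μ 1).subtype.prod ((essential G β μ 1).subtype ∘ₗ F 1))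
  | n + 2 => LinearMap.range
      ((essential G β μ (n + 2)).subtype.prod ((essential G β μ (n + 2)).subtype ∘ₗ F (n + 2))) ⊔
      ⨆ i, (extRel n).map ((cup μ i).prodMap (cup μ i))

theorem essential_mem_extRel (n : ℕ) (ξ : essential G β μ n) :
    ((ξ : PathSpace G), (F n ξ : PathSpace G)) ∈ extRel F n := by
  match n with
  | 0 => exact ⟨ξ, rfl⟩
  | 1 => exact ⟨ξ, rfl⟩
  | n + 2 => exact Submodule.mem_sup_left ⟨ξ, rfl⟩

theorem cup_mem_extRel {n : ℕ} (i : ℕ) {x y : PathSpace G} (h : (x, y) ∈ extRel F n) :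
    (cup μ i x, cup μ i y) ∈ extRel F (n + 2) :=
  Submodule.mem_sup_right (Submodule.mem_iSup_of_mem i ⟨_, h, rfl⟩)

theorem extRel_cases {n : ℕ} {z : PathSpace G × PathSpace G} (h : z ∈ extRel F (n + 2)) :
    ∃ ξ : essential G β μ (n + 2), ∃ w ∈ (⨆ i, (extRel F n).map ((cup μ i).prodMap (cup μ i))),
      z = ((ξ : PathSpace G), (F (n + 2) ξ : PathSpace G)) + w := by
  obtain ⟨_, ⟨ξ, rfl⟩, w, hw, rfl⟩ := Submodule.mem_sup.1 h
  exact ⟨ξ, w, hw, rfl⟩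

theorem extRel_mem_deg (n : ℕ) {z : PathSpace G × PathSpace G} (h : z ∈ extRel F n) :
    z.1 ∈ deg G n ∧ z.2 ∈ deg G n := by
  induction n using Nat.strong_induction_on generalizing z with
  | _ n ih =>
    have base : ∀ ξ : essential G β μ n, ((ξ : PathSpace G) ∈ deg G n ∧
        (F n ξ : PathSpace G) ∈ deg G n) :=
      fun ξ => ⟨essential_le_deg _ ξ.2, essential_le_deg _ (F n ξ).2⟩
    match n with
    | 0 => obtain ⟨ξ, rfl⟩ := h; exact base ξ
    | 1 => obtain ⟨ξ, rfl⟩ := h; exact base ξ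
    | n + 2 =>
      obtain ⟨ξ, w, hw, rfl⟩ := extRel_cases F h
      suffices hw : w.1 ∈ deg G (n + 2) ∧ w.2 ∈ deg G (n + 2) from
        ⟨add_mem (base ξ).1 hw.1, add_mem (base ξ).2 hw.2⟩
      refine Submodule.iSup_induction _
        (motive := fun w => w.1 ∈ deg G (n + 2) ∧ w.2 ∈ deg G (n + 2)) hw ?_
        ⟨zero_mem _, zero_mem _⟩ fun a b ha hb => ⟨add_mem ha.1 hb.1, add_mem ha.2 hb.2⟩
      rintro i _ ⟨v, hv, rfl⟩
      exact ⟨cup_mem_deg μ i (ih n (by omega) hv).1, cup_mem_deg μ i (ih n (by omega) hv).2⟩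

/-- The Temperley–Lieb relations turn `cap μ j` after `cup μ i` into a creation after an
annihilation, the identity, the factor `β`, or zero for positions outside the path, and they do so
simultaneously in both components. A creation after an annihilation is covered by the induction on
the length. -/
theorem cap_mem_extRel (hW : IsWeight G β μ) (n j : ℕ) {z : PathSpace G × PathSpace G}
    (h : z ∈ extRel F (n + 2)) : (cap μ j z.1, cap μ j z.2) ∈ extRel F n := by
  induction n using Nat.strong_induction_on generalizing j z with
  | _ n ih =>
    obtain ⟨ξ, w, hw, rfl⟩ := extRel_cases F h
    suffices hw : (cap μ j w.1, cap μ j w.2) ∈ extRel F n by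
      have h1 := (hW.mem_essential.1 ξ.2).2 j
      have h2 := (hW.mem_essential.1 (F (n + 2) ξ).2).2 j
      simpa [h1, h2] using hw
    refine Submodule.iSup_induction _
      (motive := fun w => (cap μ j w.1, cap μ j w.2) ∈ extRel F n) hw ?_
      (by simp only [Prod.fst_zero, Prod.snd_zero, map_zero]; exact zero_mem _) ?_
    · rintro i _ ⟨⟨x, y⟩, hv, rfl⟩
      obtain ⟨hx, hy⟩ := extRel_mem_deg F n hv
      change (cap μ j (cup μ i x), cap μ j (cup μ i y)) ∈ extRel F n
      have h0 : (cap μ j (cup μ i x) = 0 ∧ cap μ j (cup μ i y) = 0) →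
          (cap μ j (cup μ i x), cap μ j (cup μ i y)) ∈ extRel F n := by
        rintro ⟨h1, h2⟩; rw [h1, h2]; exact zero_mem _
      have hfar : ∀ i' j', (cup μ i' (cap μ j' x), cup μ i' (cap μ j' y)) ∈ extRel F n := by
        intro i' j'
        by_cases hn : n < 2
        · rw [cap_eq_zero_of_deg μ (by omega) hx, cap_eq_zero_of_deg μ (by omega) hy, map_zero]
          exact zero_mem _
        · obtain ⟨m, rfl⟩ : ∃ m, n = m + 2 := ⟨n - 2, by omega⟩
          exact cup_mem_extRel F _ (ih m (by omega) j' hv)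
      rcases lt_trichotomy i j with hij | rfl | hij
      · rcases Nat.lt_or_ge (i + 1) j with hij' | hij'
        · obtain ⟨k, rfl⟩ := Nat.exists_eq_add_of_le (by omega : i + 2 ≤ j)
          rw [cap_cup_far', cap_cup_far']
          exact hfar _ _
        · obtain rfl : j = i + 1 := by omega
          by_cases hi : i + 1 ≤ n
          · rw [cap_succ_cup hW.pos hx hi, cap_succ_cup hW.pos hy hi]; exact hv
          · exact h0 ⟨cap_eq_zero_of_deg μ (by omega) (cup_mem_deg μ i hx),
              cap_eq_zero_of_deg μ (by omega) (cup_mem_deg μ i hy)⟩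
      · by_cases hi : i ≤ n
        · rw [cap_cup_self hW.pos hW.eig hx hi, cap_cup_self hW.pos hW.eig hy hi]
          exact Submodule.smul_mem _ (β : ℂ) hv
        · exact h0 (by
            rw [cup_eq_zero_of_deg μ (by omega) hx, cup_eq_zero_of_deg μ (by omega) hy]; simp)
      · rcases Nat.lt_or_ge (j + 1) i with hij' | hij'
        · obtain ⟨k, rfl⟩ := Nat.exists_eq_add_of_le (by omega : j + 2 ≤ i)
          rw [cap_cup_far, cap_cup_far]
          exact hfar _ _
        · obtain rfl : i = j + 1 := by omega
          by_cases hi : j + 1 ≤ n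
          · rw [cap_cup_succ hW.pos hx hi, cap_cup_succ hW.pos hy hi]; exact hv
          · exact h0 (by
              rw [cup_eq_zero_of_deg μ (by omega) hx, cup_eq_zero_of_deg μ (by omega) hy]; simp)
    · intro a b ha hb
      have := add_mem ha hb
      simpa using this

/-- It suffices that `(0, y)` in the relation forces `y = 0`. By induction all annihilations of `y`
vanish. The essential part `ξ` of the first component is orthogonal to the created part, so `ξ = 0`;
hence `y` is a sum of created pairs and at the same time orthogonal to all of them. -/
theorem extRel_unique (hW : IsWeight G β μ) (n : ℕ) {x y y' : PathSpace G}
    (h : (x, y) ∈ extRel F n) (h' : (x, y') ∈ extRel F n) : y = y' := by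
  rw [← sub_eq_zero]
  replace h : (0, y - y') ∈ extRel F n := by simpa using sub_mem h h'
  clear h'
  generalize y - y' = y at h
  clear x
  have base : ∀ n (ξ : essential G β μ n), (ξ : PathSpace G) = 0 → (F n ξ : PathSpace G) = 0 := by
    intro n ξ hξ
    rw [show ξ = 0 from Subtype.ext hξ, map_zero]; rfl
  induction n using Nat.strong_induction_on generalizing y with
  | _ n ih =>
    match n with
    | 0 =>
      obtain ⟨ξ, hξ⟩ := h
      exact (congrArg Prod.snd hξ).symm.trans (base 0 ξ (congrArg Prod.fst hξ))
    | 1 =>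
      obtain ⟨ξ, hξ⟩ := h
      exact (congrArg Prod.snd hξ).symm.trans (base 1 ξ (congrArg Prod.fst hξ))
    | n + 2 =>
      have hcap : ∀ j, cap μ j y = 0 := by
        intro j
        have := cap_mem_extRel F hW n j h
        rw [map_zero] at this
        exact ih n (by omega) _ this
      obtain ⟨ξ, w, hw, hz⟩ := extRel_cases F h
      have hw' : w.1 ∈ cupSpan G μ n ∧ w.2 ∈ cupSpan G μ n := by
        refine Submodule.iSup_induction _
          (motive := fun w => w.1 ∈ cupSpan G μ n ∧ w.2 ∈ cupSpan G μ n) hw ?_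
          ⟨zero_mem _, zero_mem _⟩ fun a b ha hb => ⟨add_mem ha.1 hb.1, add_mem ha.2 hb.2⟩
        rintro i _ ⟨v, hv, rfl⟩
        exact ⟨Submodule.mem_iSup_of_mem i ⟨_, (extRel_mem_deg F n hv).1, rfl⟩,
          Submodule.mem_iSup_of_mem i ⟨_, (extRel_mem_deg F n hv).2, rfl⟩⟩
      have h1 : 0 = (ξ : PathSpace G) + w.1 := congrArg Prod.fst hz
      have h2 : y = (F (n + 2) ξ : PathSpace G) + w.2 := congrArg Prod.snd hz
      have hξ : (ξ : PathSpace G) = 0 := by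
        apply eq_zero_of_ip_self
        have h3 := ip_cupSpan (hW.mem_essential.1 ξ.2).2 hw'.1
        have h4 : ip (ξ : PathSpace G) ((ξ : PathSpace G) + w.1) = 0 := by rw [← h1, map_zero]
        rwa [map_add, h3, add_zero] at h4
      rw [base _ ξ hξ, zero_add] at h2
      apply eq_zero_of_ip_self
      exact ip_cupSpan hcap (h2 ▸ hw'.2)

theorem exists_extRel (hW : IsWeight G β μ) (n : ℕ) {x : PathSpace G} (hx : x ∈ deg G n) :
    ∃ y, (x, y) ∈ extRel F n := by
  induction n using Nat.strong_induction_on generalizing x with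
  | _ n ih =>
    match n with
    | 0 =>
      rw [← hW.essential_eq_deg (by omega)] at hx
      exact ⟨_, essential_mem_extRel F 0 ⟨x, hx⟩⟩
    | 1 =>
      rw [← hW.essential_eq_deg (by omega)] at hx
      exact ⟨_, essential_mem_extRel F 1 ⟨x, hx⟩⟩
    | n + 2 =>
      obtain ⟨e, he, x, hx', rfl⟩ := hW.exists_essential_add hx
      have : ∃ y, (x, y) ∈ extRel F (n + 2) := by
        refine cupSpan_induction (p := fun x => ∃ y, (x, y) ∈ extRel F (n + 2)) hx'
          ⟨0, zero_mem _⟩ ?_ ?_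
        · rintro u v ⟨y, hy⟩ ⟨z, hz⟩; exact ⟨y + z, add_mem hy hz⟩
        · intro i u hu
          obtain ⟨y, hy⟩ := ih n (by omega) hu
          exact ⟨_, cup_mem_extRel F i hy⟩
      obtain ⟨y, hy⟩ := this
      exact ⟨_, add_mem (essential_mem_extRel F (n + 2) ⟨e, he⟩) hy⟩

/-- The relation `extRel F` is the graph of a linear map. Values chosen on kets extend linearly
inside it, and uniqueness turns its stability under `cup` and `cap` into commutation relations. -/
theorem restrictEssential_surjective (hW : IsWeight G β μ) :
    Function.Surjective (restrictEssential (G := G) hW) := by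
  intro F
  let T : Module.End ℂ (PathSpace G) := onKets fun l =>
    if h : IsPath G l then (exists_extRel F hW (l.length - 1) (x := ket G l)
      (ket_mem_deg (by have := List.length_pos_of_ne_nil h.1; omega))).choose else 0
  have hT : ∀ n, ∀ u ∈ deg G n, (u, T u) ∈ extRel F n := by
    intro n u hu
    refine deg_induction (p := fun u => (u, T u) ∈ extRel F n) hu
      (by rw [map_zero]; exact zero_mem _) ?_ ?_ ?_
    · intro u v hu hv; simpa using add_mem hu hv
    · intro z u hu; simpa using Submodule.smul_mem _ z hu
    · intro l hl hn
      obtain rfl : n = l.length - 1 := by omega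
      have hu : ket G l ∈ deg G (l.length - 1) := ket_mem_deg hn
      have : T (ket G l) = _ := onKets_ket _ hl
      rw [this, dif_pos hl]
      exact Exists.choose_spec (exists_extRel F hW (l.length - 1) hu)
  have hmem : T ∈ symAlg G μ := by
    refine ⟨fun n u hu => (extRel_mem_deg F n (hT n u hu)).2, fun i u => ?_, fun i u => ?_⟩
    · refine congrArg (fun f => f u) (ext_deg (f := T ∘ₗ cup μ i) (g := cup μ i ∘ₗ T)
        fun n u hu => ?_)
      exact extRel_unique F hW _ (hT _ _ (cup_mem_deg μ i hu)) (cup_mem_extRel F i (hT n u hu))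
    · refine congrArg (fun f => f u) (ext_deg (f := T ∘ₗ cap μ i) (g := cap μ i ∘ₗ T)
        fun n u hu => ?_)
      simp only [LinearMap.comp_apply]
      by_cases hn : n < 2
      · rw [cap_eq_zero_of_deg μ (by omega) hu,
          cap_eq_zero_of_deg μ (by omega) (extRel_mem_deg F n (hT n u hu)).2, map_zero]
      · obtain ⟨m, rfl⟩ : ∃ m, n = m + 2 := ⟨n - 2, by omega⟩
        exact extRel_unique F hW _ (hT _ _ (cap_mem_deg μ i hu))
          (cap_mem_extRel F hW m i (hT _ u hu))
  refine ⟨⟨T, hmem⟩, ?_⟩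
  funext n
  ext1 ξ
  apply Subtype.ext
  exact extRel_unique F hW n (hT n ξ (essential_le_deg n ξ.2)) (essential_mem_extRel F n ξ)

/-- The symmetry operators are the graded endomorphisms of essential paths. -/
def restrictEquiv (hW : IsWeight G β μ) : symAlg G μ ≃ₐ[ℂ] GradedEnd G β μ :=
  AlgEquiv.ofBijective (restrictEssential hW)
    ⟨restrictEssential_injective hW, restrictEssential_surjective hW⟩

end Extension

end FaceModel

end

noncomputable section
namespace FaceModel
set_option linter.unusedSectionVars false
open scoped Classical

variable {V : Type*} {G : SimpleGraph V} [Fintype V] {β : ℝ} {μ : V → ℝ}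

/-! ### Absence of long essential paths for `β < 2` -/

section Finiteness

theorem isNoetherian_pi_end {k : ℕ} {M : Type*} [AddCommGroup M] [Module ℂ M]
    (E : Fin k → Submodule ℂ M) [∀ n, Module.Finite ℂ (E n)] :
    IsNoetherian ℂ ((n : Fin k) → E n →ₗ[ℂ] E n) :=
  isNoetherian_of_isNoetherianRing_of_finite ℂ ((n : Fin k) → E n →ₗ[ℂ] E n)

variable (G μ) in
/-- The paths of length `N` that are essential on their first `n` steps. -/
def initialEssential (n N : ℕ) : Submodule ℂ (PathSpace G) :=
  deg G N ⊓ ⨅ i, ⨅ _ : i + 2 ≤ n, LinearMap.ker (cap μ i)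

theorem mem_initialEssential {n N : ℕ} {u : PathSpace G} :
    u ∈ initialEssential G μ n N ↔ u ∈ deg G N ∧ ∀ i, i + 2 ≤ n → cap μ i u = 0 := by
  simp [initialEssential]

instance (n N : ℕ) : Module.Finite ℂ (initialEssential G μ n N) :=
  Submodule.finiteDimensional_of_le (inf_le_left : _ ≤ deg G N)

variable (G μ) in
/-- The annihilation operator at the end of the first `n + 1` steps has norm at most `√r`. -/
def CapBound (n : ℕ) (r : ℝ) : Prop :=
  ∀ N, ∀ ζ ∈ initialEssential G μ (n + 1) (N + 2),
    (ip (cap μ n ζ) (cap μ n ζ)).re ≤ r * (ip ζ ζ).re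

theorem ip_sub_real_smul (a ζ : PathSpace G) (s : ℝ) :
    (ip (a - (s : ℂ) • ζ) (a - (s : ℂ) • ζ)).re =
      (ip a a).re - 2 * s * (ip a ζ).re + s ^ 2 * (ip ζ ζ).re := by
  have h : (ip ζ a).re = (ip a ζ).re := by rw [← ip_symm a ζ]; simp
  simp only [map_sub, LinearMap.map_smulₛₗ, LinearMap.sub_apply, LinearMap.smul_apply,
    Complex.conj_ofReal, smul_eq_mul, Complex.sub_re, Complex.re_ofReal_mul, map_smul, h]
  ring

theorem IsWeight.capBound_zero (hW : IsWeight G β μ) (hβ : β ≤ 2) : CapBound G μ 0 2 := by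
  intro N ζ hζ
  have hd := (mem_initialEssential.1 hζ).1
  set θ := cap μ 0 ζ with hθ
  have h1 : ip (cup μ 0 θ) ζ = ip θ θ := by rw [adjoint_cup_cap]
  have h2 : ip (cup μ 0 θ) (cup μ 0 θ) = β * ip θ θ := by
    rw [adjoint_cup_cap, cap_cup_self hW.pos hW.eig (cap_mem_deg μ 0 hd) (Nat.zero_le _),
      map_smul, smul_eq_mul]
  -- The expansion is `β ‖θ‖² - 4 ‖θ‖² + 4 ‖ζ‖² ≥ 0`; since `4 - β ≥ 2` this gives `‖θ‖² ≤ 2 ‖ζ‖²`.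
  have h3 := ip_self_nonneg (cup μ 0 θ - ((2 : ℝ) : ℂ) • ζ)
  rw [ip_sub_real_smul, h1, h2, Complex.re_ofReal_mul] at h3
  nlinarith [ip_self_nonneg θ, ip_self_nonneg ζ]

/-- Let `θ = cap μ (n + 1) ζ` and split `cup μ (n + 1) θ` into its projection `a` to the vectors
essential on the first `n + 2` steps and the rest `b`. By the zigzag relation `cap μ n b = θ`, so
the known bound gives `‖b‖² ≥ ‖θ‖² / r`. The loop value gives `‖a‖² + ‖b‖² = β ‖θ‖²`, hence `‖a‖² ≤
(β - 1 / r) ‖θ‖²`, while the inner product of `a` and `ζ` is `‖θ‖²`. If `β - 1 / r` is not positive,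
then `a = 0` and so `θ = 0`. -/
theorem IsWeight.capBound_succ (hW : IsWeight G β μ) {n : ℕ} {r : ℝ} (hr : 0 < r)
    (h : CapBound G μ n r) :
    (0 < β - 1 / r ∧ CapBound G μ (n + 1) (β - 1 / r)) ∨
      ∀ N, ∀ ζ ∈ initialEssential G μ (n + 2) (N + 2), cap μ (n + 1) ζ = 0 := by
  have key : ∀ N, ∀ ζ ∈ initialEssential G μ (n + 2) (N + 2), ∃ a : PathSpace G,
      ip a ζ = ip (cap μ (n + 1) ζ) (cap μ (n + 1) ζ) ∧
      (ip a a).re ≤ (β - 1 / r) * (ip (cap μ (n + 1) ζ) (cap μ (n + 1) ζ)).re := by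
    intro N ζ hζ
    obtain ⟨hd, hc⟩ := mem_initialEssential.1 hζ
    by_cases hN : n + 1 ≤ N
    · set θ := cap μ (n + 1) ζ with hθ
      have hθd : θ ∈ deg G N := cap_mem_deg μ _ hd
      have hθc : ∀ i, i + 2 ≤ n + 1 → cap μ i θ = 0 := by
        intro i hi
        obtain ⟨k, hk⟩ := Nat.exists_eq_add_of_le (by omega : i + 2 ≤ n + 1)
        rw [hθ, hk, cap_cap_far, hc i (by omega), map_zero]
      obtain ⟨a, ha, hb⟩ := exists_decomposition ip ip_symm (fun _ => ip_self_pos)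
        (initialEssential G μ (n + 2) (N + 2)) (cup μ (n + 1) θ)
      obtain ⟨had, hac⟩ := mem_initialEssential.1 ha
      refine ⟨a, ?_, ?_⟩
      · have h1 : ip ζ (cup μ (n + 1) θ) = ip θ θ := by rw [← (adjoint_cup_cap μ _).symm]
        have h2 := hb ζ hζ
        rw [map_sub, sub_eq_zero, h1] at h2
        rw [← ip_symm, ← h2, ip_symm]
      · set b := cup μ (n + 1) θ - a with hbdef
        have hbmem : b ∈ initialEssential G μ (n + 1) (N + 2) := by
          refine mem_initialEssential.2 ⟨sub_mem (cup_mem_deg μ _ hθd) had, fun i hi => ?_⟩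
          obtain ⟨k, hk⟩ := Nat.exists_eq_add_of_le (by omega : i + 2 ≤ n + 1)
          rw [map_sub, hac i (by omega), hk, cap_cup_far, hθc i hi, map_zero, sub_zero]
        have hcb : cap μ n b = θ := by
          rw [map_sub, hac n (by omega), sub_zero, cap_cup_succ hW.pos hθd hN]
        have h1 := h N b hbmem
        rw [hcb] at h1
        have h2 : ip (cup μ (n + 1) θ) (cup μ (n + 1) θ) = β * ip θ θ := by
          rw [adjoint_cup_cap, cap_cup_self hW.pos hW.eig hθd hN, map_smul, smul_eq_mul]
        have hab : ip a b = 0 := hb a ha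
        have hba : ip b a = 0 := by rw [← ip_symm, hab, map_zero]
        have h3 : cup μ (n + 1) θ = a + b := by rw [hbdef]; abel
        rw [h3] at h2
        simp only [map_add, LinearMap.add_apply, hab, hba, zero_add, add_zero] at h2
        have h4 := congrArg Complex.re h2
        rw [Complex.add_re, Complex.re_ofReal_mul] at h4
        have h5 : 1 / r * (ip θ θ).re ≤ (ip b b).re := by
          rw [one_div, inv_mul_le_iff₀ hr]; exact h1
        linarith
    · refine ⟨0, ?_, ?_⟩ <;> rw [cap_eq_zero_of_deg μ (by omega) hd] <;> simp
  by_cases hr' : 0 < β - 1 / r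
  · refine Or.inl ⟨hr', fun N ζ hζ => ?_⟩
    obtain ⟨a, h1, h2⟩ := key N ζ hζ
    -- With `s = β - 1 / r` and `θ = cap μ (n + 1) ζ`, the expansion and the bound `‖a‖² ≤ s ‖θ‖²`
    -- give `s ‖θ‖² ≤ s² ‖ζ‖²`.
    have h3 := ip_self_nonneg (a - ((β - 1 / r : ℝ) : ℂ) • ζ)
    rw [ip_sub_real_smul, h1] at h3
    refine le_of_mul_le_mul_left (a := β - 1 / r) ?_ hr'
    nlinarith
  · refine Or.inr fun N ζ hζ => ?_
    obtain ⟨a, h1, h2⟩ := key N ζ hζ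
    have h3 := ip_self_nonneg a
    have h4 := ip_self_nonneg (cap μ (n + 1) ζ)
    have ha : a = 0 := by
      by_contra h
      have := ip_self_pos h
      nlinarith
    rw [ha] at h1
    exact eq_zero_of_ip_self (by rw [← h1]; simp)

/-- Since `r + 1 / r ≥ 2`, each step `r ↦ β - 1 / r` lowers the bound by at least `2 - β`, so
positivity must fail at some stage. There `cap μ (n + 1)` kills all initially essential vectors, in
particular `cup μ (n + 2) η` for `η` essential of length `n + 2`, and the zigzag relation returns `η
= 0`. -/
theorem IsWeight.exists_essential_eq_bot (hW : IsWeight G β μ) (hβ : β < 2) :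
    ∃ n, essential G β μ n = ⊥ := by
  by_contra hne
  have h : ∀ n : ℕ, ∃ r : ℝ, 0 < r ∧ r ≤ 2 - n * (2 - β) ∧ CapBound G μ n r := by
    intro n
    induction n with
    | zero => exact ⟨2, by norm_num, by simp, hW.capBound_zero hβ.le⟩
    | succ n ih =>
      obtain ⟨r, hr, hr', hb⟩ := ih
      rcases hW.capBound_succ hr hb with ⟨h1, h2⟩ | h0
      · refine ⟨_, h1, ?_, h2⟩
        have : 2 ≤ r + 1 / r := by
          rw [← sub_nonneg, show r + 1 / r - 2 = (r - 1) ^ 2 / r by field_simp; ring]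
          positivity
        push_cast; linarith
      · refine absurd ⟨n + 2, (Submodule.eq_bot_iff _).2 fun η hη => ?_⟩ hne
        obtain ⟨hd, hc⟩ := hW.mem_essential.1 hη
        have h1 : cap μ (n + 1) (cup μ (n + 2) η) = η := cap_cup_succ hW.pos hd le_rfl
        rw [← h1]
        refine h0 (n + 2) _ (mem_initialEssential.2 ⟨cup_mem_deg μ _ hd, fun i hi => ?_⟩)
        obtain ⟨k, hk⟩ := Nat.exists_eq_add_of_le hi
        rw [hk, cap_cup_far, hc, map_zero]
  obtain ⟨n, hn⟩ := exists_nat_gt (2 / (2 - β))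
  obtain ⟨r, hr, hr', -⟩ := h n
  rw [div_lt_iff₀ (by linarith)] at hn
  linarith

theorem sum_prep_strp {n : ℕ} {u : PathSpace G} (hu : u ∈ deg G (n + 1)) :
    ∑ v, prep v (strp v u) = u := by
  have h : ∀ u : PathSpace G, ∑ v, prep v (strp v u) = shift LinearMap.id u := fun u => by
    simp [shift, LinearMap.sum_apply]
  rw [h]
  refine deg_induction (p := fun u => shift LinearMap.id u = u) hu (by simp) ?_ ?_ ?_
  · intro u v hu hv; rw [map_add, hu, hv]
  · intro z u hu; rw [map_smul, hu]
  · intro l hl hn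
    match l, hl, hn with
    | [x], _, hn => simp at hn
    | x :: y :: t, hl, _ => rw [shift_cons_cons _ hl]; simp

/-- Removing the first step of an essential vector leaves an essential vector, and a vector of
positive length is recovered from these remainders. -/
theorem IsWeight.essential_succ_eq_bot (hW : IsWeight G β μ) {n : ℕ}
    (h : essential G β μ n = ⊥) : essential G β μ (n + 1) = ⊥ := by
  refine (Submodule.eq_bot_iff _).2 fun η hη => ?_
  obtain ⟨hd, hc⟩ := hW.mem_essential.1 hη
  rw [← sum_prep_strp hd]
  refine Finset.sum_eq_zero fun v _ => ?_
  rw [(Submodule.eq_bot_iff _).1 h (strp v η), map_zero]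
  exact hW.mem_essential.2 ⟨strp_mem_deg v hd, fun i => by rw [← strp_cap_succ, hc, map_zero]⟩

theorem IsWeight.finite_symAlg (hW : IsWeight G β μ) (hβ : β < 2) :
    Module.Finite ℂ (symAlg G μ) := by
  obtain ⟨n₀, h0⟩ := hW.exists_essential_eq_bot hβ
  have hbot : ∀ k, essential G β μ (n₀ + k) = ⊥ := by
    intro k
    induction k with
    | zero => exact h0
    | succ k ih => exact hW.essential_succ_eq_bot ih
  -- From length `n₀` on there are no essential paths, so truncating the product at `n₀` loses
  -- nothing.
  let f : GradedEnd G β μ →ₗ[ℂ] ((n : Fin n₀) → essential G β μ n →ₗ[ℂ] essential G β μ n) :=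
    { toFun := fun F n => F n
      map_add' := fun _ _ => rfl
      map_smul' := fun _ _ => rfl }
  have hf : Function.Injective f := by
    intro F F' h
    funext n
    by_cases hn : n < n₀
    · exact congrFun h ⟨n, hn⟩
    · obtain ⟨k, rfl⟩ := Nat.exists_eq_add_of_le (not_lt.1 hn)
      ext1 ξ
      apply Subtype.ext
      have hz : ∀ x : essential G β μ (n₀ + k), (x : PathSpace G) = 0 := fun x =>
        (Submodule.eq_bot_iff _).1 (hbot k) _ x.2
      rw [hz, hz]
  have hinj : Function.Injective (f ∘ₗ (restrictEssential hW).toLinearMap) :=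
    hf.comp (restrictEssential_injective hW)
  have : IsNoetherian ℂ ((n : Fin n₀) → essential G β μ n →ₗ[ℂ] essential G β μ n) :=
    isNoetherian_pi_end fun n => essential G β μ n
  exact Module.Finite.of_injective _ hinj

end Finiteness

end FaceModel

end

noncomputable section
namespace FaceModel
set_option linter.unusedSectionVars false
open scoped Classical

variable {V : Type*} {G : SimpleGraph V} [Fintype V] {β : ℝ} {μ : V → ℝ}

/-! ### Reversal of paths -/

section Reversal

/-- The reversal of paths as an antilinear map. -/
def rev : PathSpace G →ₗ⋆[ℂ] PathSpace G where
  toFun := pathStar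
  map_add' u v := by
    unfold pathStar
    rw [Finsupp.sum_add_index'] <;> simp [add_smul]
  map_smul' z u := by
    unfold pathStar
    rw [Finsupp.sum_smul_index (by simp), Finsupp.smul_sum]
    simp [mul_smul]

theorem rev_apply (u : PathSpace G) : rev u = pathStar u := rfl

theorem rev_ket (l : List V) : rev (ket G l) = ket G l.reverse := by
  by_cases h : IsPath G l
  · rw [rev_apply, ket_of_isPath h, pathStar, Finsupp.sum_single_index (by simp)]
    simp
  · rw [ket_of_not h, map_zero, ket_of_not (by simpa using h)]

theorem rev_rev (u : PathSpace G) : rev (rev u) = u := by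
  induction u using ket_induction with
  | h0 => simp
  | hadd u w hu hw => rw [map_add, map_add, hu, hw]
  | hket z l hl => simp [LinearMap.map_smulₛₗ, rev_ket]

theorem amp_rev (u : PathSpace G) (l : List V) : amp (rev u) l = conj (amp u l.reverse) := by
  induction u using ket_induction with
  | h0 => simp
  | hadd u w hu hw => rw [map_add, amp_add, amp_add, hu, hw, map_add]
  | hket z m hm =>
    rw [LinearMap.map_smulₛₗ, rev_ket, amp_smul, amp_smul, amp_ket, amp_ket, map_mul]
    simp only [isPath_reverse, List.reverse_eq_iff]
    split_ifs <;> simp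

theorem rev_mem_deg {n : ℕ} {u : PathSpace G} (hu : u ∈ deg G n) : rev u ∈ deg G n := by
  refine deg_induction (p := fun u => rev u ∈ deg G n) hu (by simp) ?_ ?_ ?_
  · intro u v hu hv; rw [map_add]; exact add_mem hu hv
  · intro z u hu; rw [LinearMap.map_smulₛₗ]; exact Submodule.smul_mem _ _ hu
  · intro l _ hn; rw [rev_ket]; exact ket_mem_deg (by simpa using hn)

theorem rev_cup {n i j : ℕ} (h : i + j = n) {u : PathSpace G} (hu : u ∈ deg G n) :
    rev (cup μ i u) = cup μ j (rev u) := by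
  refine deg_induction (p := fun u => rev (cup μ i u) = cup μ j (rev u)) hu (by simp) ?_ ?_ ?_
  · intro u v hu hv; simp only [map_add, hu, hv]
  · intro z u hu; simp only [map_smul, LinearMap.map_smulₛₗ, hu]
  · intro l hl hn
    obtain ⟨l1, v, m, rfl, rfl⟩ : ∃ l1 v m, l = l1 ++ v :: m ∧ i = l1.length :=
      ⟨l.take i, l[i], l.drop (i + 1), by simp, by simp; omega⟩
    rw [cup_append μ rfl, rev_ket, map_sum]
    have : (l1 ++ v :: m).reverse = m.reverse ++ v :: l1.reverse := by simp
    rw [this, cup_append μ (by simp at hn ⊢; omega)]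
    refine Finset.sum_congr rfl fun w _ => ?_
    rw [LinearMap.map_smulₛₗ, conj_rt, rev_ket]
    simp

theorem rev_cap {n i j : ℕ} (h : i + j = n) {u : PathSpace G} (hu : u ∈ deg G (n + 2)) :
    rev (cap μ i u) = cap μ j (rev u) := by
  refine deg_induction (p := fun u => rev (cap μ i u) = cap μ j (rev u)) hu (by simp) ?_ ?_ ?_
  · intro u v hu hv; simp only [map_add, hu, hv]
  · intro z u hu; simp only [map_smul, LinearMap.map_smulₛₗ, hu]
  · intro l hl hn
    obtain ⟨l1, a, b, c, m, rfl, rfl⟩ := exists_split_three (by omega : i + 2 < l.length)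
    have hr := hl.reverse
    have : (l1 ++ a :: b :: c :: m).reverse = m.reverse ++ c :: b :: a :: l1.reverse := by simp
    rw [cap_append μ rfl hl, rev_ket, this]
    rw [this] at hr
    rw [cap_append μ (by simp at hn ⊢; omega) hr]
    by_cases hac : a = c
    · subst hac
      rw [if_pos rfl, if_pos rfl, LinearMap.map_smulₛₗ, conj_rt, rev_ket]
      simp
    · rw [if_neg hac, if_neg (Ne.symm hac), map_zero]

/-- Conjugation of an operator by the reversal of paths. -/
def sharp (T : Module.End ℂ (PathSpace G)) : Module.End ℂ (PathSpace G) :=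
  rev.comp (T.comp rev)

theorem sharp_apply (T : Module.End ℂ (PathSpace G)) (u : PathSpace G) :
    sharp T u = rev (T (rev u)) := rfl

theorem sharp_mem {T : Module.End ℂ (PathSpace G)} (hT : T ∈ symAlg G μ) :
    sharp T ∈ symAlg G μ := by
  have hd : ∀ n, ∀ u ∈ deg G n, sharp T u ∈ deg G n := fun n u hu =>
    rev_mem_deg (symAlg_mem_deg hT (rev_mem_deg hu))
  refine ⟨hd, fun i u => ?_, fun i u => ?_⟩
  · refine congrArg (fun f => f u) (ext_deg (f := sharp T ∘ₗ cup μ i) (g := cup μ i ∘ₗ sharp T)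
      fun n u hu => ?_)
    simp only [LinearMap.comp_apply]
    by_cases hi : i ≤ n
    · obtain ⟨j, hj⟩ := Nat.exists_eq_add_of_le hi
      rw [sharp_apply, rev_cup hj.symm hu, symAlg_cup hT,
        rev_cup (j := i) (by omega) (symAlg_mem_deg hT (rev_mem_deg hu))]
      rfl
    · rw [cup_eq_zero_of_deg μ (by omega) hu, cup_eq_zero_of_deg μ (by omega) (hd n u hu), map_zero]
  · refine congrArg (fun f => f u) (ext_deg (f := sharp T ∘ₗ cap μ i) (g := cap μ i ∘ₗ sharp T)
      fun n u hu => ?_)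
    simp only [LinearMap.comp_apply]
    by_cases hi : i + 2 ≤ n
    · obtain ⟨n, rfl⟩ : ∃ m, n = m + 2 := ⟨n - 2, by omega⟩
      obtain ⟨j, hj⟩ := Nat.exists_eq_add_of_le (by omega : i ≤ n)
      rw [sharp_apply, rev_cap hj.symm hu, symAlg_cap hT,
        rev_cap (j := i) (by omega) (symAlg_mem_deg hT (rev_mem_deg hu))]
      rfl
    · rw [cap_eq_zero_of_deg μ (by omega) hu, cap_eq_zero_of_deg μ (by omega) (hd n u hu), map_zero]

theorem amp_sharp (T : Module.End ℂ (PathSpace G)) (p q : List V) :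
    amp (sharp T (ket G q)) p = conj (amp (T (ket G q.reverse)) p.reverse) := by
  rw [sharp_apply, rev_ket, amp_rev]

end Reversal

/-! ### Operators given by matrix elements; adjoints -/

section Words

/-- The lists of a given length. -/
def words (V : Type*) [Fintype V] (n : ℕ) : Finset (List V) :=
  (List.finite_length_eq V n).toFinset

@[simp] theorem mem_words {n : ℕ} {l : List V} : l ∈ words V n ↔ l.length = n := by
  simp [words]

theorem amp_sum_words (n : ℕ) (f : List V → ℂ) (l : List V) :
    amp (∑ m ∈ words V n, f m • ket G m) l = if l.length = n ∧ IsPath G l then f l else 0 := by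
  rw [amp_sum]
  simp only [amp_smul, amp_ket]
  by_cases hl : l.length = n
  · rw [Finset.sum_eq_single l]
    · simp [hl]
    · intro m _ hm; simp [hm]
    · simp [hl]
  · rw [Finset.sum_eq_zero]
    · simp [hl]
    · intro m hm
      have : m ≠ l := by rintro rfl; exact hl (mem_words.1 hm)
      simp [this]

theorem eq_sum_words {n : ℕ} {u : PathSpace G} (hu : u ∈ deg G n) :
    u = ∑ m ∈ words V (n + 1), amp u m • ket G m := by
  apply ext_amp
  intro l hl
  rw [amp_sum_words]
  by_cases h : l.length = n + 1
  · simp [h, hl]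
  · rw [mem_deg_iff.1 hu l hl h]; simp [h]

theorem ip_eq_sum {n : ℕ} {u v : PathSpace G} (hv : v ∈ deg G n) :
    ip u v = ∑ m ∈ words V (n + 1), conj (amp u m) * amp v m := by
  conv_lhs => rw [eq_sum_words hv]
  rw [map_sum]
  refine Finset.sum_congr rfl fun m _ => ?_
  rw [map_smul, ip_ket_right, smul_eq_mul, mul_comm]

/-- The length preserving operator with given matrix elements: `k p q` is the coefficient of `p`
in the image of `q`. -/
def ofKernel (k : List V → List V → ℂ) : Module.End ℂ (PathSpace G) :=
  onKets fun q => ∑ p ∈ words V q.length, k p q • ket G p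

theorem amp_ofKernel (k : List V → List V → ℂ) (p q : List V) :
    amp (ofKernel (G := G) k (ket G q)) p =
      if p.length = q.length ∧ IsPath G p ∧ IsPath G q then k p q else 0 := by
  by_cases h : IsPath G q
  · rw [ofKernel, onKets_ket _ h, amp_sum_words (f := fun p => k p q)]
    simp [h]
  · rw [ket_of_not h, map_zero, amp_zero]; simp [h]

theorem ofKernel_mem_deg (k : List V → List V → ℂ) {n : ℕ} {u : PathSpace G}
    (hu : u ∈ deg G n) : ofKernel k u ∈ deg G n :=
  linearMap_mem_deg (fun l hl h => by
    rw [ofKernel, onKets_ket _ hl]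
    refine Submodule.sum_mem _ fun p hp => Submodule.smul_mem _ _ (ket_mem_deg ?_)
    rw [mem_words.1 hp, h]) hu

theorem ext_amp_ket {S T : Module.End ℂ (PathSpace G)}
    (h : ∀ p q, IsPath G p → IsPath G q → amp (S (ket G q)) p = amp (T (ket G q)) p) : S = T :=
  ext_ket fun q hq => ext_amp fun p hp => h p q hp hq

theorem symAlg_amp_eq_zero {T : Module.End ℂ (PathSpace G)} (hT : T ∈ symAlg G μ) {p q : List V}
    (h : p.length ≠ q.length) : amp (T (ket G q)) p = 0 := by
  by_cases hp : IsPath G p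
  · by_cases hq : IsPath G q
    · have := List.length_pos_of_ne_nil hq.1
      refine mem_deg_iff.1 (symAlg_mem_deg hT (ket_mem_deg (n := q.length - 1) ?_)) p hp ?_ <;> omega
    · rw [ket_of_not hq, map_zero, amp_zero]
  · exact amp_of_not hp _

/-- The adjoint of a length preserving operator. -/
def adj (T : Module.End ℂ (PathSpace G)) : Module.End ℂ (PathSpace G) :=
  ofKernel fun p q => conj (amp (T (ket G p)) q)

theorem amp_adj {T : Module.End ℂ (PathSpace G)} (hT : T ∈ symAlg G μ) (p q : List V) :
    amp (adj T (ket G q)) p = conj (amp (T (ket G p)) q) := by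
  rw [adj, amp_ofKernel]
  split_ifs with h
  · rfl
  · by_cases hp : IsPath G p
    · by_cases hq : IsPath G q
      · rw [symAlg_amp_eq_zero hT, map_zero]
        simp [hp, hq] at h; exact fun h' => h h'.symm
      · rw [amp_of_not hq, map_zero]
    · rw [ket_of_not hp, map_zero, amp_zero, map_zero]

theorem adjoint_adj {T : Module.End ℂ (PathSpace G)} (hT : T ∈ symAlg G μ) : Adjoint T (adj T) :=
  adjoint_of_ket fun l m _ _ => amp_adj hT l m

/-- Adjunction exchanges `cup` and `cap`, so each of the two commutation relations of `T` yields the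
other one for `adj T`. -/
theorem adj_mem {T : Module.End ℂ (PathSpace G)} (hT : T ∈ symAlg G μ) :
    adj T ∈ symAlg G μ := by
  have h := adjoint_adj hT
  refine ⟨fun n u hu => ofKernel_mem_deg _ hu, fun i u => ?_, fun i u => ?_⟩
  · have := h.comm_of_comm (adjoint_cup_cap μ i).symm (by ext1 p; ext1; exact (symAlg_cap hT i _).symm)
    exact (congrArg (fun f => f u) this).symm
  · have := h.comm_of_comm (adjoint_cup_cap μ i) (by ext1 p; ext1; exact (symAlg_cup hT i _).symm)
    exact (congrArg (fun f => f u) this).symm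

end Words

/-! ### Operators depending on the end points of a path -/

section Ends

theorem fst_mem (v : V) : fst (G := G) v ∈ symAlg G μ :=
  ⟨fun _ _ hu => fst_mem_deg v hu, fun i u => preservesFirst_cup μ i v u,
    fun i u => preservesFirst_cap μ i v u⟩

theorem fst_ket' (v : V) (l : List V) :
    fst v (ket G l) = if l.head? = some v then ket G l else 0 := by
  cases l with
  | nil => simp
  | cons x t => simp

theorem sharp_fst (v : V) : sharp (fst (G := G) v) = lst v := by
  apply ext_ket
  intro l _
  rw [sharp_apply, rev_ket, fst_ket', lst_ket, List.head?_reverse]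
  split_ifs <;> simp [rev_ket]

theorem lst_mem (v : V) : lst (G := G) v ∈ symAlg G μ := by
  rw [← sharp_fst]; exact sharp_mem (fst_mem v)

/-- The diagonal operator whose eigenvalues depend on the end points. -/
def endDiag (f : V → V → ℂ) : Module.End ℂ (PathSpace G) :=
  ∑ u, ∑ v, f u v • (fst u ∘ₗ lst v)

theorem endDiag_mem (f : V → V → ℂ) : endDiag (G := G) f ∈ symAlg G μ :=
  Subalgebra.sum_mem _ fun u _ => Subalgebra.sum_mem _ fun v _ =>
    Subalgebra.smul_mem _ (Subalgebra.mul_mem _ (fst_mem u) (lst_mem v)) _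

theorem endDiag_ket (f : V → V → ℂ) {l : List V} {a b : V} (ha : l.head? = some a)
    (hb : l.getLast? = some b) : endDiag f (ket G l) = f a b • ket G l := by
  simp only [endDiag, LinearMap.sum_apply, LinearMap.smul_apply, LinearMap.comp_apply, lst_ket, hb]
  rw [Finset.sum_eq_single a, Finset.sum_eq_single b]
  · simp [fst_ket', ha]
  · intro v _ hv; simp [Ne.symm hv]
  · simp
  · intro u _ hu
    refine Finset.sum_eq_zero fun v _ => ?_
    split_ifs
    · simp [fst_ket', ha, Ne.symm hu]
    · simp
  · simp

theorem endDiag_mul (f g : V → V → ℂ) (h : ∀ a b, f a b * g a b = 1) :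
    endDiag (G := G) f * endDiag g = 1 := by
  apply ext_ket
  intro l hl
  obtain ⟨a, ha⟩ : ∃ a, l.head? = some a := by
    cases l with
    | nil => simp at hl
    | cons x t => exact ⟨x, rfl⟩
  obtain ⟨b, hb⟩ : ∃ b, l.getLast? = some b := ⟨_, List.getLast?_eq_some_getLast hl.1⟩
  rw [Module.End.mul_apply, endDiag_ket g ha hb, map_smul, endDiag_ket f ha hb, smul_smul,
    mul_comm, h]
  simp

theorem amp_endDiag (f : V → V → ℂ) (u : PathSpace G) {l : List V} {a b : V}
    (ha : l.head? = some a) (hb : l.getLast? = some b) : amp (endDiag f u) l = f a b * amp u l := by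
  induction u using ket_induction with
  | h0 => simp
  | hadd u w hu hw => rw [map_add, amp_add, hu, hw, amp_add, mul_add]
  | hket z m hm =>
    obtain ⟨a', ha'⟩ : ∃ a, m.head? = some a := by
      cases m with
      | nil => simp at hm
      | cons x t => exact ⟨x, rfl⟩
    obtain ⟨b', hb'⟩ : ∃ b, m.getLast? = some b := ⟨_, List.getLast?_eq_some_getLast hm.1⟩
    rw [map_smul, endDiag_ket f ha' hb', amp_smul, amp_smul, amp_smul, amp_ket]
    by_cases h : m = l
    · subst h
      obtain rfl : a = a' := by simpa [ha] using ha'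
      obtain rfl : b = b' := by simpa [hb] using hb'
      ring
    · simp [h]

end Ends

end FaceModel

end

noncomputable section
namespace FaceModel
set_option linter.unusedSectionVars false
open scoped Classical

variable {V : Type*} {G : SimpleGraph V} [Fintype V] {β : ℝ} {μ : V → ℝ}

/-! ### Gluing lists at a common end point -/

section Glue

/-- Concatenation of lists with a common end point, and `[]` if the end points do not match. -/
def glueList (p q : List V) : List V := if p.getLast? = q.head? then p ++ q.tail else []

theorem glueList_append_cons (p q : List V) (v w : V) :
    glueList (p ++ [v]) (w :: q) = if v = w then p ++ v :: q else [] := by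
  simp [glueList]

@[simp] theorem glueList_nil_left (q : List V) : glueList [] q = [] := by
  cases q <;> simp [glueList]

@[simp] theorem glueList_nil_right (p : List V) : glueList p [] = [] := by
  cases p <;> simp [glueList]

theorem glueList_singleton_left (v : V) (q : List V) :
    glueList [v] q = if q.head? = some v then q else [] := by
  cases q with
  | nil => simp
  | cons w q =>
    rw [show [v] = [] ++ [v] by rfl, glueList_append_cons]
    by_cases h : v = w
    · subst h; simp
    · simp [h, Ne.symm h]

theorem glueList_cons (v x : V) (p q : List V) :
    glueList (v :: x :: p) q = if glueList (x :: p) q = [] then [] else v :: glueList (x :: p) q := by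
  simp only [glueList, List.getLast?_cons_cons]
  split_ifs <;> simp_all

theorem reverse_glueList (p q : List V) :
    (glueList p q).reverse = glueList q.reverse p.reverse := by
  rcases p.eq_nil_or_concat with rfl | ⟨p, v, rfl⟩
  · simp
  · cases q with
    | nil => simp
    | cons w q =>
      simp only [List.concat_eq_append, List.reverse_append, List.reverse_cons, List.reverse_nil,
        List.nil_append, List.singleton_append]
      rw [glueList_append_cons, glueList_append_cons]
      by_cases h : v = w
      · subst h; simp
      · simp [h, Ne.symm h]

theorem glueList_assoc (p q r : List V) :
    glueList (glueList p q) r = glueList p (glueList q r) := by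
  rcases p.eq_nil_or_concat with rfl | ⟨p, v, rfl⟩
  · simp
  · rw [List.concat_eq_append]
    cases r with
    | nil => simp
    | cons z r =>
      cases q with
      | nil => simp
      | cons w q =>
        rw [glueList_append_cons]
        rcases q.eq_nil_or_concat with rfl | ⟨q, y, rfl⟩
        · rw [glueList_singleton_left]
          by_cases h : v = w
          · subst h
            rw [if_pos rfl, glueList_append_cons]
            by_cases h : v = z
            · subst h; simp [glueList_append_cons]
            · simp [h, Ne.symm h]
          · by_cases h' : z = w
            · subst h'; simp [h, glueList_append_cons]
            · simp [h, h']
        · rw [List.concat_eq_append]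
          have hw : glueList (w :: (q ++ [y])) (z :: r) =
              if y = z then w :: (q ++ y :: r) else [] := by
            rw [← List.cons_append, glueList_append_cons]; rfl
          rw [hw]
          by_cases h : v = w
          · subst h
            have : p ++ v :: (q ++ [y]) = (p ++ v :: q) ++ [y] := by simp
            rw [if_pos rfl, this, glueList_append_cons]
            split_ifs
            · simp [glueList_append_cons]
            · simp
          · simp only [h, if_false, glueList_nil_left]
            split_ifs
            · simp [glueList_append_cons, h]
            · simp

theorem length_glueList {p q p' q' : List V} (h : p.length = q.length)
    (h' : p'.length = q'.length) (hp : glueList p p' ≠ []) (hq : glueList q q' ≠ []) :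
    (glueList p p').length = (glueList q q').length := by
  simp only [glueList] at *
  split_ifs at * <;> simp_all

theorem isPath_glueList {p q : List V} (h : IsPath G (glueList p q)) : IsPath G p ∧ IsPath G q := by
  rcases p.eq_nil_or_concat with rfl | ⟨p, v, rfl⟩
  · simp at h
  · cases q with
    | nil => simp at h
    | cons w q =>
      rw [List.concat_eq_append] at h ⊢
      rw [glueList_append_cons] at h
      split_ifs at h with hvw
      · subst hvw; exact isPath_append_cons.1 h
      · simp at h

theorem glueList_isPath {p q : List V} (hp : IsPath G p) (hq : IsPath G q)
    (h : glueList p q ≠ []) : IsPath G (glueList p q) := by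
  rcases p.eq_nil_or_concat with rfl | ⟨p, v, rfl⟩
  · simp at hp
  · cases q with
    | nil => simp at hq
    | cons w q =>
      rw [List.concat_eq_append] at hp h ⊢
      rw [glueList_append_cons] at h ⊢
      split_ifs at h ⊢ with hvw
      · subst hvw; exact isPath_append_cons.2 ⟨hp, hq⟩
      · exact absurd rfl h

theorem concat_ket (p q : List V) : concat G (ket G p) (ket G q) = ket G (glueList p q) := by
  by_cases hp : IsPath G p
  · by_cases hq : IsPath G q
    · rw [ket_of_isPath hp, ket_of_isPath hq, concat]
      simp only [Finsupp.linearCombination_single, one_smul]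
      have h1 : p.getLast? = some (EPath.last (EPath.mk p hp)) :=
        List.getLast?_eq_some_getLast hp.1
      have h2 : q.head? = some (EPath.first (EPath.mk q hq)) :=
        List.head?_eq_some_head hq.1
      rw [glueList, h1, h2]
      simp only [Option.some.injEq]
      split_ifs
      · rfl
      · simp
    · rw [ket_of_not hq, map_zero, ket_of_not]
      exact fun h => hq (isPath_glueList h).2
  · rw [ket_of_not hp, map_zero, LinearMap.zero_apply, ket_of_not]
    exact fun h => hp (isPath_glueList h).1

end Glue

/-! ### Matrix elements span the dual -/

section Dual

variable (G μ) in
/-- The dual of the algebra of symmetry operators. -/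
abbrev DualAlg : Type _ := Module.Dual ℂ (symAlg G μ)

variable (G μ) in
/-- The matrix element of an operator between two lists. -/
def mat (p q : List V) : DualAlg G μ := matrixForm (symAlg G μ) (ket G p) (ket G q)

theorem matrixForm_ket (A : Subalgebra ℂ (Module.End ℂ (PathSpace G))) (p : List V)
    (u : PathSpace G) (a : A) : matrixForm A (ket G p) u a = amp (a.1 u) p := by
  change (ket G p).sum (fun p z => z * (a : Module.End ℂ (PathSpace G)) u p) = _
  by_cases hp : IsPath G p
  · rw [ket_of_isPath hp, Finsupp.sum_single_index (by simp), one_mul, amp_of_isPath hp]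
  · rw [ket_of_not hp, amp_of_not hp]; simp

theorem mat_apply (p q : List V) (a : symAlg G μ) : mat G μ p q a = amp (a.1 (ket G q)) p :=
  matrixForm_ket _ p _ a

theorem mat_of_not_left {p : List V} (hp : ¬ IsPath G p) (q : List V) : mat G μ p q = 0 := by
  ext a; rw [mat_apply, amp_of_not hp]; simp

theorem mat_of_not_right {q : List V} (hq : ¬ IsPath G q) (p : List V) : mat G μ p q = 0 := by
  ext a; rw [mat_apply, ket_of_not hq]; simp

@[simp] theorem mat_nil_left (q : List V) : mat G μ [] q = 0 := mat_of_not_left (by simp) q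
@[simp] theorem mat_nil_right (p : List V) : mat G μ p [] = 0 := mat_of_not_right (by simp) p

theorem mat_of_length_ne {p q : List V} (h : p.length ≠ q.length) : mat G μ p q = 0 := by
  ext a; rw [mat_apply, symAlg_amp_eq_zero a.2 h]; simp

variable [Module.Finite ℂ (symAlg G μ)]

/-- An operator whose matrix elements all vanish is zero, so the matrix elements have trivial common
kernel; in finite dimension they therefore span. -/
theorem span_mat : Submodule.span ℂ {φ | ∃ p q, IsPath G p ∧ IsPath G q ∧
    p.length = q.length ∧ mat G μ p q = φ} = ⊤ := by
  set U := Submodule.span ℂ {φ | ∃ p q, IsPath G p ∧ IsPath G q ∧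
    p.length = q.length ∧ mat G μ p q = φ}
  have h : U.dualCoannihilator = ⊥ := by
    refine (Submodule.eq_bot_iff _).2 fun a ha => ?_
    rw [Submodule.mem_dualCoannihilator] at ha
    refine Subtype.ext (ext_amp_ket fun p q hp hq => ?_)
    by_cases hpq : p.length = q.length
    · rw [← mat_apply, ha _ (Submodule.subset_span ⟨p, q, hp, hq, hpq, rfl⟩)]
      simp
    · rw [symAlg_amp_eq_zero a.2 hpq]; simp
  let : AddCommGroup (symAlg G μ) := Module.addCommMonoidToAddCommGroup ℂ
  have h2 : U.dualCoannihilator.dualAnnihilator = U :=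
    Subspace.dualCoannihilator_dualAnnihilator_eq (K := ℂ) (V := symAlg G μ)
  rw [← h2, h, Submodule.dualAnnihilator_bot]

theorem dual_induction {p : DualAlg G μ → Prop} (φ : DualAlg G μ) (h0 : p 0)
    (hadd : ∀ φ ψ, p φ → p ψ → p (φ + ψ)) (hsmul : ∀ (z : ℂ) φ, p φ → p (z • φ))
    (hmat : ∀ l m, IsPath G l → IsPath G m → l.length = m.length → p (mat G μ l m)) : p φ := by
  have hφ : φ ∈ Submodule.span ℂ {φ | ∃ p q, IsPath G p ∧ IsPath G q ∧
    p.length = q.length ∧ mat G μ p q = φ} := by rw [span_mat]; trivial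
  induction hφ using Submodule.span_induction with
  | mem x h => obtain ⟨l, m, hl, hm, h, rfl⟩ := h; exact hmat l m hl hm h
  | zero => exact h0
  | add x y _ _ hx hy => exact hadd x y hx hy
  | smul z x _ hx => exact hsmul z x hx

end Dual

/-! ### The projected concatenation product -/

section Product

/-- `prep` raises the position of every `cup` and `cap` by one, and `strp` lowers it again. -/
theorem symAlg_prep_strp {T : Module.End ℂ (PathSpace G)} (hT : T ∈ symAlg G μ) (v w : V) :
    strp v ∘ₗ T ∘ₗ prep w ∈ symAlg G μ := by
  refine ⟨fun n u hu => strp_mem_deg v (symAlg_mem_deg hT (prep_mem_deg w hu)), fun i u => ?_,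
    fun i u => ?_⟩
  · simp only [LinearMap.comp_apply]
    rw [← cup_succ_prep, symAlg_cup hT, strp_cup_succ]
  · simp only [LinearMap.comp_apply]
    rw [← cap_succ_prep, symAlg_cap hT, strp_cap_succ]

/-- Fix the first step of the argument and of the value of a symmetry operator. -/
def stripStep (v w : V) : symAlg G μ →ₗ[ℂ] symAlg G μ where
  toFun a := ⟨strp v ∘ₗ a.1 ∘ₗ prep w, symAlg_prep_strp a.2 v w⟩
  map_add' a b := by ext; simp
  map_smul' z a := by ext; simp

/-- Fix the first vertex of the argument and of the value of a symmetry operator. -/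
def corner (v w : V) : symAlg G μ →ₗ[ℂ] symAlg G μ where
  toFun a := ⟨fst v, fst_mem v⟩ * a * ⟨fst w, fst_mem w⟩
  map_add' a b := by rw [mul_add, add_mul]
  map_smul' z a := by simp

/-- Fix the initial parts of the argument and of the value of a symmetry operator. -/
def initialPart : List V → List V → symAlg G μ →ₗ[ℂ] symAlg G μ
  | [v], [w] => corner v w
  | v :: x :: p, w :: y :: q => initialPart (x :: p) (y :: q) ∘ₗ stripStep v w
  | _, _ => 0

theorem amp_prep_strp (v : V) (u : PathSpace G) {l : List V} (hl : l ≠ []) :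
    amp (strp v u) l = amp u (v :: l) := by
  rw [← ip_ket_left, ← adjoint_prep, prep_ket v hl, ip_ket_left]

theorem amp_fst (v : V) (u : PathSpace G) (l : List V) :
    amp (fst v u) l = amp u (glueList [v] l) := by
  rw [← ip_ket_left, ← adjoint_fst, fst_ket', glueList_singleton_left]
  split_ifs
  · rw [ip_ket_left]
  · rw [map_zero, amp_of_not (by simp)]; rfl

theorem amp_initialPart {p q : List V} (h : p.length = q.length) (a : symAlg G μ)
    (p' q' : List V) : amp ((initialPart p q a).1 (ket G q')) p' =
      amp (a.1 (ket G (glueList q q'))) (glueList p p') := by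
  induction p generalizing q a with
  | nil =>
    obtain rfl : q = [] := by simpa using h.symm
    simp [initialPart]
  | cons v p ih =>
    match p, q, h with
    | [], [w], _ =>
      change amp (fst v (a.1 (fst w (ket G q')))) p' = _
      rw [amp_fst, fst_ket', glueList_singleton_left w]
      split_ifs <;> simp
    | x :: p, w :: y :: q, h =>
      change amp ((initialPart (x :: p) (y :: q) (stripStep v w a)).1 (ket G q')) p' = _
      rw [ih (by simpa using h), glueList_cons, glueList_cons]
      change amp (strp v (a.1 (prep w (ket G (glueList (y :: q) q'))))) _ = _
      by_cases h1 : glueList (x :: p) p' = []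
      · rw [h1, amp_of_not (by simp), if_pos rfl, amp_of_not (by simp)]
      · rw [if_neg h1, amp_prep_strp v _ h1]
        by_cases h2 : glueList (y :: q) q' = []
        · simp [h2]
        · rw [if_neg h2, prep_ket w h2]

/-- The operator obtained from a symmetry operator by evaluating a linear form on the
remaining part of the paths. -/
def contractOp (ψ : DualAlg G μ) (a : symAlg G μ) : Module.End ℂ (PathSpace G) :=
  ofKernel fun p q => ψ (initialPart p q a)

variable [Module.Finite ℂ (symAlg G μ)]

/-- This is what makes the product of linear forms well defined. Matrix elements span the dual, so
it suffices to contract with one of them; that amounts to fixing the final parts of the paths, the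
mirror image under reversal of fixing initial parts, which preserves `symAlg` by `initialPart`. -/
theorem contractOp_mem (ψ : DualAlg G μ) (a : symAlg G μ) : contractOp ψ a ∈ symAlg G μ := by
  have hz : ∀ (z : ℂ) (k : List V → List V → ℂ),
      ofKernel (G := G) (fun p q => z * k p q) = z • ofKernel k := by
    intro z k
    refine ext_amp_ket fun p q _ _ => ?_
    rw [LinearMap.smul_apply, amp_smul, amp_ofKernel, amp_ofKernel]
    split_ifs <;> simp
  induction ψ using dual_induction with
  | h0 =>
    have : contractOp (0 : DualAlg G μ) a = 0 :=
      (hz 0 fun _ _ => 0 : _) |> fun h => by simpa [contractOp] using h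
    rw [this]; exact zero_mem _
  | hadd φ ψ hφ hψ =>
    have : contractOp (φ + ψ) a = contractOp φ a + contractOp ψ a := by
      refine ext_amp_ket fun p q _ _ => ?_
      rw [LinearMap.add_apply, amp_add, contractOp, contractOp, contractOp, amp_ofKernel,
        amp_ofKernel, amp_ofKernel]
      split_ifs <;> simp
    rw [this]; exact add_mem hφ hψ
  | hsmul z φ hφ =>
    have : contractOp (z • φ) a = z • contractOp φ a := hz z _
    rw [this]; exact Subalgebra.smul_mem _ hφ z
  | hmat l m hl hm hlm =>
    have : contractOp (mat G μ l m) a = sharp (initialPart l.reverse m.reverse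
        ⟨sharp a.1, sharp_mem a.2⟩ : symAlg G μ).1 := by
      refine ext_amp_ket fun p q hp hq => ?_
      rw [amp_sharp, amp_initialPart (by simpa using hlm), amp_sharp, ← reverse_glueList,
        ← reverse_glueList, List.reverse_reverse, List.reverse_reverse, Complex.conj_conj,
        contractOp, amp_ofKernel]
      -- If the lengths differ, the kernel of `contractOp` is cut off to zero; the glued paths then
      -- also differ in length, or cannot be glued, so the matrix element of `a` vanishes as well.
      by_cases h : p.length = q.length
      · rw [if_pos ⟨h, hp, hq⟩, mat_apply, amp_initialPart h]
      · rw [if_neg (by simp [h])]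
        by_cases h1 : glueList p l = []
        · rw [h1, amp_of_not (by simp)]
        · by_cases h2 : glueList q m = []
          · rw [h2]; simp
          · rw [symAlg_amp_eq_zero a.2]
            intro h'
            apply h
            simp only [glueList] at h1 h2 h'
            split_ifs at h1 h2 h' <;> simp_all
    rw [this]
    exact sharp_mem (Subtype.property _)

/-- The linear form obtained by splitting paths. -/
def dualMul : DualAlg G μ →ₗ[ℂ] DualAlg G μ →ₗ[ℂ] DualAlg G μ :=
  have hadd : ∀ k k' : List V → List V → ℂ, ofKernel (G := G) (fun p q => k p q + k' p q) =
      ofKernel k + ofKernel k' := by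
    intro k k'
    refine ext_amp_ket fun p q _ _ => ?_
    rw [LinearMap.add_apply, amp_add, amp_ofKernel, amp_ofKernel, amp_ofKernel]
    split_ifs <;> simp
  have hsmul : ∀ (z : ℂ) (k : List V → List V → ℂ),
      ofKernel (G := G) (fun p q => z * k p q) = z • ofKernel k := by
    intro z k
    refine ext_amp_ket fun p q _ _ => ?_
    rw [LinearMap.smul_apply, amp_smul, amp_ofKernel, amp_ofKernel]
    split_ifs <;> simp
  LinearMap.mk₂ ℂ
    (fun φ ψ =>
      { toFun := fun a => φ ⟨contractOp ψ a, contractOp_mem ψ a⟩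
        map_add' := fun a b => by
          rw [← map_add]; congr 1; apply Subtype.ext
          simp only [contractOp, map_add, hadd]; rfl
        map_smul' := fun z a => by
          rw [RingHom.id_apply, ← map_smul]; congr 1; apply Subtype.ext
          simp only [contractOp, map_smul, smul_eq_mul, hsmul]; rfl })
    (fun φ φ' ψ => rfl) (fun z φ ψ => rfl)
    (fun φ ψ ψ' => by
      ext a
      simp only [LinearMap.coe_mk, AddHom.coe_mk, LinearMap.add_apply]
      rw [← map_add]; congr 1; apply Subtype.ext
      simp only [contractOp, LinearMap.add_apply, hadd]; rfl)
    (fun z φ ψ => by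
      ext a
      simp only [LinearMap.coe_mk, AddHom.coe_mk, LinearMap.smul_apply]
      rw [← map_smul]; congr 1; apply Subtype.ext
      simp only [contractOp, LinearMap.smul_apply, smul_eq_mul, hsmul]; rfl)

theorem dualMul_apply (φ ψ : DualAlg G μ) (a : symAlg G μ) :
    dualMul φ ψ a = φ ⟨contractOp ψ a, contractOp_mem ψ a⟩ := rfl

theorem dualMul_mat {p q : List V} (h : p.length = q.length) (p' q' : List V) :
    dualMul (mat G μ p q) (mat G μ p' q') = mat G μ (glueList p p') (glueList q q') := by
  by_cases hp : IsPath G p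
  · by_cases hq : IsPath G q
    · ext a
      rw [dualMul_apply, mat_apply, mat_apply]
      change amp (ofKernel (fun p q => mat G μ p' q' (initialPart p q a)) (ket G q)) p = _
      rw [amp_ofKernel, if_pos ⟨h, hp, hq⟩, mat_apply, amp_initialPart h]
    · rw [mat_of_not_right hq, mat_of_not_right (fun h => hq (isPath_glueList h).1), map_zero,
        LinearMap.zero_apply]
  · rw [mat_of_not_left hp, mat_of_not_left (fun h => hp (isPath_glueList h).1), map_zero,
      LinearMap.zero_apply]

end Product

end FaceModel

end

noncomputable section
namespace FaceModel
set_option linter.unusedSectionVars false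
open scoped Classical

variable {V : Type*} {G : SimpleGraph V} [Fintype V] {β : ℝ} {μ : V → ℝ}

/-! ### Sums over paths cut into two pieces -/

section WordSums

theorem sum_words_succ {M : Type*} [AddCommMonoid M] (n : ℕ) (f : List V → M) :
    ∑ l ∈ words V (n + 1), f l = ∑ v, ∑ l ∈ words V n, f (v :: l) := by
  have h : words V (n + 1) = (Finset.univ ×ˢ words V n).image fun x : V × List V => x.1 :: x.2 := by
    ext l
    cases l <;> simp
  rw [h, Finset.sum_image, Finset.sum_product]
  rintro ⟨v, l⟩ _ ⟨w, m⟩ _ h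
  simpa using h

theorem sum_words_zero {M : Type*} [AddCommMonoid M] (f : List V → M) :
    ∑ l ∈ words V 0, f l = f [] := by
  have : words V 0 = {[]} := by ext l; simp
  rw [this, Finset.sum_singleton]

theorem sum_words_one {M : Type*} [AddCommMonoid M] (f : List V → M) :
    ∑ l ∈ words V 1, f l = ∑ v, f [v] := by
  rw [sum_words_succ]; simp [sum_words_zero]

theorem sum_words_reverse {M : Type*} [AddCommMonoid M] (n : ℕ) (f : List V → M) :
    ∑ l ∈ words V n, f l.reverse = ∑ l ∈ words V n, f l :=
  Finset.sum_bij' (fun l _ => l.reverse) (fun l _ => l.reverse) (by simp) (by simp) (by simp)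
    (by simp) (by simp)

/-- A list of `n + m + 1` vertices is cut in exactly one way into pieces with `n + 1` and `m + 1`
vertices sharing the vertex of the cut; pairs that do not match are glued to `[]`, where `f`
vanishes. -/
theorem sum_words_glueList {M : Type*} [AddCommMonoid M] (n m : ℕ) (f : List V → M)
    (hf : f [] = 0) :
    ∑ r ∈ words V (n + 1), ∑ s ∈ words V (m + 1), f (glueList r s) =
      ∑ l ∈ words V (n + m + 1), f l := by
  induction n generalizing f with
  | zero =>
    rw [sum_words_one, Finset.sum_comm, zero_add]
    refine Finset.sum_congr rfl fun l hl => ?_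
    cases l with
    | nil => simp at hl
    | cons v l =>
      rw [Finset.sum_eq_single v]
      · simp [glueList_singleton_left]
      · intro w _ hw
        simp [glueList_singleton_left, Ne.symm hw, hf]
      · simp
  | succ n ih =>
    rw [sum_words_succ (n + 1), show n + 1 + m + 1 = (n + m + 1) + 1 by ring, sum_words_succ]
    refine Finset.sum_congr rfl fun v _ => ?_
    trans ∑ l ∈ words V (n + m + 1), if l = [] then 0 else f (v :: l)
    · rw [← ih (fun l => if l = [] then 0 else f (v :: l)) (by simp)]
      refine Finset.sum_congr rfl fun l hl => Finset.sum_congr rfl fun s _ => ?_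
      cases l with
      | nil => simp at hl
      | cons x l =>
        rw [glueList_cons]
        split_ifs <;> simp [hf]
    · refine Finset.sum_congr rfl fun l hl => ?_
      rw [if_neg]
      rintro rfl
      simp at hl

theorem glueList_inj {p q p' q' : List V} (h : p.length = q.length) (hne : glueList p p' ≠ [])
    (he : glueList p p' = glueList q q') : p = q ∧ p' = q' := by
  have hne' : glueList q q' ≠ [] := he ▸ hne
  simp only [glueList] at *
  split_ifs at * with h1 h2
  · obtain ⟨rfl, ht⟩ := List.append_inj he h
    refine ⟨rfl, ?_⟩
    rw [h1] at h2
    cases p' <;> cases q' <;> simp_all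
  all_goals simp_all

end WordSums

/-! ### The coproduct dual to composition -/

section Coalgebra

theorem free_symAlg : Module.Free ℂ (symAlg G μ) := by
  let : AddCommGroup (symAlg G μ) := Module.addCommMonoidToAddCommGroup ℂ
  exact Module.Free.of_divisionRing ℂ (symAlg G μ)

variable [Module.Finite ℂ (symAlg G μ)]

variable (G μ) in
theorem dualDistrib_bijective :
    Function.Bijective (TensorProduct.dualDistrib ℂ (symAlg G μ) (symAlg G μ)) := by
  have := free_symAlg (G := G) (μ := μ)
  exact (TensorProduct.dualDistribEquiv ℂ (symAlg G μ) (symAlg G μ)).bijective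

/-- The coproduct dual to composition. -/
def dualComul : DualAlg G μ →ₗ[ℂ] DualAlg G μ ⊗[ℂ] DualAlg G μ :=
  (LinearEquiv.ofBijective _ (dualDistrib_bijective G μ)).symm.toLinearMap ∘ₗ
    (LinearMap.mul' ℂ (symAlg G μ)).dualMap

theorem dualComul_apply (φ : DualAlg G μ) (a b : symAlg G μ) :
    TensorProduct.dualDistrib ℂ _ _ (dualComul φ) (a ⊗ₜ[ℂ] b) = φ (a * b) := by
  have h : TensorProduct.dualDistrib ℂ _ _ (dualComul φ) =
      (LinearMap.mul' ℂ (symAlg G μ)).dualMap φ :=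
    (LinearEquiv.ofBijective _ (dualDistrib_bijective G μ)).apply_symm_apply _
  rw [h]; simp

theorem dualTensor_ext {x y : DualAlg G μ ⊗[ℂ] DualAlg G μ}
    (h : ∀ a b, TensorProduct.dualDistrib ℂ _ _ x (a ⊗ₜ[ℂ] b) =
      TensorProduct.dualDistrib ℂ _ _ y (a ⊗ₜ[ℂ] b)) : x = y :=
  (dualDistrib_bijective G μ).1 (TensorProduct.ext' h)

theorem dualComul_mat {n : ℕ} {p q : List V} (hp : p.length = n) (hq : q.length = n) :
    dualComul (mat G μ p q) = ∑ r ∈ words V n, mat G μ p r ⊗ₜ[ℂ] mat G μ r q := by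
  apply dualTensor_ext
  intro a b
  rw [dualComul_apply, mat_apply]
  simp only [map_sum, LinearMap.sum_apply, TensorProduct.dualDistrib_apply, mat_apply]
  change amp (a.1 (b.1 (ket G q))) p = _
  cases n with
  | zero =>
    obtain rfl : p = [] := by simpa using hp
    rw [amp_of_not (by simp), Finset.sum_eq_zero]
    intro l _; rw [amp_of_not (by simp)]; simp
  | succ n =>
    rw [eq_sum_words (symAlg_mem_deg b.2 (ket_mem_deg (G := G) hq))]
    rw [map_sum, amp_sum]
    refine Finset.sum_congr rfl fun r hr => ?_
    rw [map_smul, amp_smul, mul_comm, ← eq_sum_words (symAlg_mem_deg b.2 (ket_mem_deg (G := G) hq))]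

variable (G μ) in
/-- The counit: evaluation at the identity operator. -/
def dualCounit : DualAlg G μ →ₗ[ℂ] ℂ := LinearMap.applyₗ 1

theorem dualCounit_mat (p q : List V) :
    dualCounit G μ (mat G μ p q) = if p = q ∧ IsPath G p then 1 else 0 := by
  change mat G μ p q 1 = _
  rw [mat_apply]
  change amp (ket G q) p = _
  rw [amp_ket]
  by_cases h : p = q
  · subst h; simp
  · simp [h, Ne.symm h]

theorem sum_dualCounit_mat {M : Type*} [AddCommGroup M] [Module ℂ M] {n : ℕ} {p : List V}
    (hp : p.length = n) (hp' : IsPath G p) (f : List V → M) :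
    ∑ r ∈ words V n, dualCounit G μ (mat G μ p r) • f r = f p := by
  rw [Finset.sum_eq_single p]
  · simp [dualCounit_mat, hp']
  · intro r _ hr; simp [dualCounit_mat, Ne.symm hr]
  · simp [hp]

theorem sum_dualCounit_mat' {M : Type*} [AddCommGroup M] [Module ℂ M] {n : ℕ} {p : List V}
    (hp : p.length = n) (hp' : IsPath G p) (f : List V → M) :
    ∑ r ∈ words V n, dualCounit G μ (mat G μ r p) • f r = f p := by
  rw [Finset.sum_eq_single p]
  · simp [dualCounit_mat, hp']
  · intro r _ hr; simp [dualCounit_mat, hr]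
  · simp [hp]

theorem dual_hom_ext {M : Type*} [AddCommMonoid M] [Module ℂ M] {f g : DualAlg G μ →ₗ[ℂ] M}
    (h : ∀ p q, IsPath G p → IsPath G q → p.length = q.length →
      f (mat G μ p q) = g (mat G μ p q)) : f = g := by
  ext1 φ
  induction φ using dual_induction with
  | h0 => simp
  | hadd φ ψ h h' => rw [map_add, map_add, h, h']
  | hsmul z φ h => rw [map_smul, map_smul, h]
  | hmat p q hp hq hpq => exact h p q hp hq hpq

variable (G μ) in
/-- The coalgebra dual to the algebra of symmetry operators. -/
@[reducible] def dualCoalgebra : Coalgebra ℂ (DualAlg G μ) where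
  comul := dualComul
  counit := dualCounit G μ
  coassoc := by
    apply dual_hom_ext
    intro p q hp hq h
    simp only [LinearMap.comp_apply, LinearEquiv.coe_coe, dualComul_mat h rfl, map_sum,
      LinearMap.rTensor_tmul, LinearMap.lTensor_tmul]
    have h1 : ∀ r ∈ words V q.length, dualComul (mat G μ p r) =
        ∑ s ∈ words V q.length, mat G μ p s ⊗ₜ[ℂ] mat G μ s r := fun r hr =>
      dualComul_mat h (mem_words.1 hr)
    have h2 : ∀ r ∈ words V q.length, dualComul (mat G μ r q) =
        ∑ s ∈ words V q.length, mat G μ r s ⊗ₜ[ℂ] mat G μ s q := fun r hr =>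
      dualComul_mat (mem_words.1 hr) rfl
    have e1 : ∑ r ∈ words V q.length, TensorProduct.assoc ℂ _ _ _
        (dualComul (mat G μ p r) ⊗ₜ[ℂ] mat G μ r q) = ∑ r ∈ words V q.length,
        TensorProduct.assoc ℂ _ _ _ ((∑ s ∈ words V q.length, mat G μ p s ⊗ₜ[ℂ] mat G μ s r) ⊗ₜ[ℂ]
          mat G μ r q) := Finset.sum_congr rfl fun r hr => by rw [h1 r hr]
    have e2 : ∑ r ∈ words V q.length, mat G μ p r ⊗ₜ[ℂ] dualComul (mat G μ r q) =
        ∑ r ∈ words V q.length, mat G μ p r ⊗ₜ[ℂ] ∑ s ∈ words V q.length,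
          mat G μ r s ⊗ₜ[ℂ] mat G μ s q := Finset.sum_congr rfl fun r hr => by rw [h2 r hr]
    rw [e1, e2]
    simp only [TensorProduct.sum_tmul, TensorProduct.tmul_sum, map_sum, TensorProduct.assoc_tmul]
    exact Finset.sum_comm
  rTensor_counit_comp_comul := by
    apply dual_hom_ext
    intro p q hp hq h
    simp only [LinearMap.comp_apply, dualComul_mat h rfl, map_sum, LinearMap.rTensor_tmul,
      TensorProduct.mk_apply]
    rw [← sum_dualCounit_mat (μ := μ) h hp (fun r => (1 : ℂ) ⊗ₜ[ℂ] mat G μ r q)]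
    simp [TensorProduct.smul_tmul']
  lTensor_counit_comp_comul := by
    apply dual_hom_ext
    intro p q hp hq h
    simp only [LinearMap.comp_apply, dualComul_mat h rfl, map_sum, LinearMap.lTensor_tmul,
      LinearMap.flip_apply, TensorProduct.mk_apply]
    rw [← sum_dualCounit_mat' (μ := μ) rfl hq (fun r => mat G μ p r ⊗ₜ[ℂ] (1 : ℂ))]
    simp [← TensorProduct.tmul_smul]

end Coalgebra

/-! ### Unit, star and multiplicativity of coproduct and counit -/

section Unit

variable (G μ) in
/-- The unit for the projected concatenation product. -/
def dualOne : DualAlg G μ := ∑ v, ∑ w, mat G μ [v] [w]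

/-- The star for the projected concatenation product. -/
def dualStar : DualAlg G μ →ₗ⋆[ℂ] DualAlg G μ where
  toFun φ :=
    { toFun := fun a => conj (φ ⟨sharp a.1, sharp_mem a.2⟩)
      map_add' := fun a b => by
        rw [← map_add, ← map_add]; congr 2; ext1; simp [sharp, LinearMap.ext_iff]
      map_smul' := fun z a => by
        rw [RingHom.id_apply, smul_eq_mul, ← Complex.conj_conj z, ← map_mul, ← smul_eq_mul,
          ← map_smul]
        congr 2; ext1; simp [sharp, LinearMap.ext_iff] }
  map_add' φ ψ := by ext; simp
  map_smul' z φ := by ext; simp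

theorem dualStar_apply (φ : DualAlg G μ) (a : symAlg G μ) :
    dualStar φ a = conj (φ ⟨sharp a.1, sharp_mem a.2⟩) := rfl

theorem dualStar_mat (p q : List V) : dualStar (mat G μ p q) = mat G μ p.reverse q.reverse := by
  ext a
  rw [dualStar_apply, mat_apply, amp_sharp, Complex.conj_conj, mat_apply]

variable [Module.Finite ℂ (symAlg G μ)]

theorem dualMul_singleton (v w : V) (p q : List V) : dualMul (mat G μ [v] [w]) (mat G μ p q) =
    mat G μ (glueList [v] p) (glueList [w] q) :=
  dualMul_mat (by simp) p q

theorem mul_dualOne (φ : DualAlg G μ) : dualMul φ (dualOne G μ) = φ := by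
  suffices h : dualMul.flip (dualOne G μ) = LinearMap.id from congrArg (fun f => f φ) h
  apply dual_hom_ext
  intro p q hp hq h
  rw [LinearMap.flip_apply]
  simp only [dualOne, map_sum, dualMul_mat (G := G) (μ := μ) h, LinearMap.id_apply]
  rcases p.eq_nil_or_concat with rfl | ⟨p, v, rfl⟩
  · simp at hp
  rcases q.eq_nil_or_concat with rfl | ⟨q, w, rfl⟩
  · simp at hq
  simp only [List.concat_eq_append, glueList_append_cons]
  rw [Finset.sum_eq_single v, Finset.sum_eq_single w]
  · simp
  · intro x _ hx; simp [Ne.symm hx]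
  · simp
  · intro x _ hx; simp [Ne.symm hx]
  · simp

theorem dualOne_mul (φ : DualAlg G μ) : dualMul (dualOne G μ) φ = φ := by
  suffices h : dualMul (dualOne G μ) = LinearMap.id from congrArg (fun f => f φ) h
  apply dual_hom_ext
  intro p q hp hq h
  simp only [dualOne, map_sum, LinearMap.sum_apply, dualMul_singleton,
    LinearMap.id_apply]
  cases p with
  | nil => simp at hp
  | cons v p =>
  cases q with
  | nil => simp at hq
  | cons w q =>
  simp only [glueList_singleton_left, List.head?_cons, Option.some.injEq]
  rw [Finset.sum_eq_single v, Finset.sum_eq_single w]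
  · simp
  · intro x _ hx; simp [Ne.symm hx]
  · simp
  · intro x _ hx; simp [Ne.symm hx]
  · simp

theorem dualMul_assoc (a b c : DualAlg G μ) :
    dualMul (dualMul a b) c = dualMul a (dualMul b c) := by
  induction a using dual_induction with
  | h0 => simp
  | hadd φ ψ h h' => simp only [map_add, LinearMap.add_apply, h, h']
  | hsmul z φ h => simp only [map_smul, LinearMap.smul_apply, h]
  | hmat p q hp hq h =>
  induction b using dual_induction with
  | h0 => simp
  | hadd φ ψ h h' => simp only [map_add, LinearMap.add_apply, h, h']
  | hsmul z φ h => simp only [map_smul, LinearMap.smul_apply, h]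
  | hmat p' q' hp' hq' h' =>
  induction c using dual_induction with
  | h0 => simp
  | hadd φ ψ h h' => simp only [map_add, h, h']
  | hsmul z φ h => simp only [map_smul, h]
  | hmat p'' q'' hp'' hq'' h'' =>
  rw [dualMul_mat h, dualMul_mat h', dualMul_mat h]
  by_cases h1 : glueList p p' = []
  · rw [h1, ← glueList_assoc, h1]; simp
  by_cases h2 : glueList q q' = []
  · rw [h2, ← glueList_assoc q, h2]; simp
  rw [dualMul_mat (length_glueList h h' h1 h2), glueList_assoc, glueList_assoc]

theorem dualStar_dualStar (φ : DualAlg G μ) : dualStar (dualStar φ) = φ := by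
  induction φ using dual_induction with
  | h0 => simp
  | hadd φ ψ h h' => simp only [map_add, h, h']
  | hsmul z φ h => simp [LinearMap.map_smulₛₗ, h]
  | hmat p q hp hq h => simp [dualStar_mat]

theorem dualStar_mul (a b : DualAlg G μ) :
    dualStar (dualMul a b) = dualMul (dualStar b) (dualStar a) := by
  induction a using dual_induction with
  | h0 => simp
  | hadd φ ψ h h' => simp only [map_add, LinearMap.add_apply, h, h']
  | hsmul z φ h => simp only [map_smul, LinearMap.smul_apply, LinearMap.map_smulₛₗ, h]
  | hmat p q hp hq h =>
  induction b using dual_induction with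
  | h0 => simp
  | hadd φ ψ h h' => simp only [map_add, LinearMap.add_apply, h, h']
  | hsmul z φ h => simp only [map_smul, LinearMap.smul_apply, LinearMap.map_smulₛₗ, h]
  | hmat p' q' hp' hq' h' =>
  rw [dualMul_mat h, dualStar_mat, dualStar_mat, dualStar_mat, dualMul_mat (by simpa using h'),
    reverse_glueList, reverse_glueList]

theorem dualComul_star (φ : DualAlg G μ) :
    dualComul (dualStar φ) = TensorProduct.map dualStar dualStar (dualComul φ) := by
  induction φ using dual_induction with
  | h0 => simp
  | hadd φ ψ h h' => simp only [map_add, h, h']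
  | hsmul z φ h => simp only [map_smul, LinearMap.map_smulₛₗ, h]
  | hmat p q hp hq h =>
  rw [dualStar_mat, dualComul_mat (n := q.length) (by simpa using h) (by simp), dualComul_mat h rfl,
    map_sum]
  simp only [TensorProduct.map_tmul, dualStar_mat]
  exact (sum_words_reverse _ fun r => mat G μ p.reverse r ⊗ₜ[ℂ] mat G μ r q.reverse).symm

/-- On matrix elements the coproduct sums over intermediate paths. Independent intermediate paths
for the two factors are glued to the intermediate paths of the product by `sum_words_glueList`. -/
theorem dualComul_mul (a b : DualAlg G μ) : dualComul (dualMul a b) =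
    TensorProduct.map₂ dualMul dualMul (dualComul a) (dualComul b) := by
  induction a using dual_induction with
  | h0 => simp
  | hadd φ ψ h h' => simp only [map_add, LinearMap.add_apply, h, h']
  | hsmul z φ h => simp only [map_smul, LinearMap.smul_apply, h]
  | hmat p q hp hq h =>
  induction b using dual_induction with
  | h0 => simp
  | hadd φ ψ h h' => simp only [map_add, h, h']
  | hsmul z φ h => simp only [map_smul, h]
  | hmat p' q' hp' hq' h' =>
  obtain ⟨n, hn⟩ : ∃ n, q.length = n + 1 := Nat.exists_eq_succ_of_ne_zero (by simpa using hq.1)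
  obtain ⟨m, hm⟩ : ∃ m, q'.length = m + 1 := Nat.exists_eq_succ_of_ne_zero (by simpa using hq'.1)
  rw [dualMul_mat h, dualComul_mat (h.trans hn) hn, dualComul_mat (h'.trans hm) hm]
  simp only [map_sum, LinearMap.sum_apply, TensorProduct.map₂_apply_tmul, TensorProduct.map_tmul]
  rw [Finset.sum_comm]
  have key : ∀ r ∈ words V (n + 1), ∀ s ∈ words V (m + 1),
      dualMul (mat G μ p r) (mat G μ p' s) ⊗ₜ[ℂ] dualMul (mat G μ r q) (mat G μ s q') =
        mat G μ (glueList p p') (glueList r s) ⊗ₜ[ℂ] mat G μ (glueList r s) (glueList q q') := by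
    intro r hr s hs
    rw [mem_words] at hr hs
    rw [dualMul_mat (h.trans (hn.trans hr.symm)), dualMul_mat (hr.trans hn.symm)]
  rw [Finset.sum_congr rfl fun r hr => Finset.sum_congr rfl fun s hs => key r hr s hs,
    sum_words_glueList n m (fun l => mat G μ (glueList p p') l ⊗ₜ[ℂ] mat G μ l (glueList q q'))
      (by simp)]
  by_cases h1 : glueList p p' = []
  · simp [h1]
  by_cases h2 : glueList q q' = []
  · simp [h2]
  have hl : (glueList q q').length = n + m + 1 := by
    simp only [glueList] at h2 ⊢
    split_ifs at h2 ⊢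
    · simp [hn, hm]; omega
    · exact absurd rfl h2
  exact dualComul_mat ((length_glueList h h' h1 h2).trans hl) hl

theorem dualCounit_mul_mat {p q p' q' : List V} (h : p.length = q.length) :
    dualCounit G μ (dualMul (mat G μ p q) (mat G μ p' q')) =
      if p = q ∧ p' = q' ∧ IsPath G (glueList p p') then 1 else 0 := by
  rw [dualMul_mat h, dualCounit_mat]
  congr 1
  rw [eq_iff_iff]
  constructor
  · rintro ⟨h1, h2⟩
    obtain ⟨rfl, rfl⟩ := glueList_inj h h2.1 h1
    exact ⟨rfl, rfl, h2⟩
  · rintro ⟨rfl, rfl, h2⟩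
    exact ⟨rfl, h2⟩

theorem isPath_glueList_glueList {p q r : List V} :
    IsPath G (glueList (glueList p q) r) ↔ IsPath G (glueList p q) ∧ IsPath G (glueList q r) := by
  refine ⟨fun h => ⟨(isPath_glueList h).1, ?_⟩, ?_⟩
  · rw [glueList_assoc] at h; exact (isPath_glueList h).2
  · rintro ⟨h1, h2⟩
    refine glueList_isPath h1 (isPath_glueList h2).2 ?_
    rcases p.eq_nil_or_concat with rfl | ⟨p, v, rfl⟩
    · simp at h1
    rw [List.concat_eq_append] at h1 ⊢
    cases q with
    | nil => simp at h1
    | cons w q =>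
    rw [glueList_append_cons] at h1 ⊢
    split_ifs at h1 ⊢ with hvw
    · cases r with
      | nil => simp at h2
      | cons z r =>
      obtain hq | ⟨q', y, hq⟩ := (w :: q).eq_nil_or_concat
      · simp at hq
      · subst hvw
        rw [List.concat_eq_append] at hq
        rw [hq, glueList_append_cons] at h2
        split_ifs at h2 with hyz
        · rw [hq, ← List.append_assoc, glueList_append_cons, if_pos hyz]; simp
        · simp at h2
    · simp at h1

/-- On matrix elements both sides are `0` or `1`, and they are `1` exactly when each pair of paths
coincides and the three paths can be glued. The intermediate path in the coproduct of the middle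
factor is forced. -/
theorem dualCounit_mul_mul (a b c : DualAlg G μ) : dualCounit G μ (dualMul (dualMul a b) c) =
    LinearMap.mul' ℂ ℂ (TensorProduct.map (dualCounit G μ ∘ₗ dualMul a)
      (dualCounit G μ ∘ₗ dualMul.flip c) (dualComul b)) := by
  induction a using dual_induction with
  | h0 => simp
  | hadd φ ψ h h' => simp only [map_add, LinearMap.add_apply, h, h', LinearMap.comp_add,
      TensorProduct.map_add_left]
  | hsmul z φ h => simp only [map_smul, LinearMap.smul_apply, h, LinearMap.comp_smul,
      TensorProduct.map_smul_left]
  | hmat p q hp hq h =>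
  induction c using dual_induction with
  | h0 => simp
  | hadd φ ψ h h' => simp only [map_add, LinearMap.add_apply, h, h', LinearMap.comp_add,
      TensorProduct.map_add_right]
  | hsmul z φ h => simp only [map_smul, LinearMap.smul_apply, h, LinearMap.comp_smul,
      TensorProduct.map_smul_right]
  | hmat p'' q'' hp'' hq'' h'' =>
  induction b using dual_induction with
  | h0 => simp
  | hadd φ ψ h h' => simp only [map_add, LinearMap.add_apply, h, h']
  | hsmul z φ h => simp only [map_smul, LinearMap.smul_apply, h]
  | hmat p' q' hp' hq' h' =>
  rw [dualComul_mat h' rfl]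
  simp only [map_sum, TensorProduct.map_tmul, LinearMap.mul'_apply, LinearMap.comp_apply,
    LinearMap.flip_apply]
  have hr : ∀ r ∈ words V q'.length, dualCounit G μ (dualMul (mat G μ p q) (mat G μ p' r)) *
      dualCounit G μ (dualMul (mat G μ r q') (mat G μ p'' q'')) = if p = q ∧ p' = r ∧
        r = q' ∧ p'' = q'' ∧ IsPath G (glueList (glueList p p') p'') then 1 else 0 := by
    intro r hr
    rw [dualCounit_mul_mat h, dualCounit_mul_mat (mem_words.1 hr), ite_zero_mul_ite_zero]
    · congr 1
      · rw [isPath_glueList_glueList, eq_iff_iff]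
        constructor
        · rintro ⟨⟨rfl, rfl, h1⟩, rfl, rfl, h2⟩; exact ⟨rfl, rfl, rfl, rfl, h1, h2⟩
        · rintro ⟨rfl, rfl, rfl, rfl, h1, h2⟩; exact ⟨⟨rfl, rfl, h1⟩, rfl, rfl, h2⟩
      · simp
  rw [Finset.sum_congr rfl hr, Finset.sum_eq_single p']
  · rw [dualMul_mat h]
    by_cases h1 : glueList p p' = []
    · simp [h1]
    by_cases h2 : glueList q q' = []
    · simp only [h2, mat_nil_right, map_zero, LinearMap.zero_apply]
      rw [if_neg]
      rintro ⟨rfl, -, rfl, -⟩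
      exact h1 h2
    rw [dualCounit_mul_mat (length_glueList h h' h1 h2)]
    congr 1
    rw [eq_iff_iff]
    constructor
    · rintro ⟨h3, rfl, h4⟩
      obtain ⟨rfl, rfl⟩ := glueList_inj h h1 h3
      exact ⟨rfl, rfl, rfl, rfl, h4⟩
    · rintro ⟨rfl, -, rfl, rfl, h4⟩
      exact ⟨rfl, rfl, h4⟩
  · intro r _ hr; simp [Ne.symm hr]
  · simp [h']

/-- Exchanging the legs of the coproduct has no effect: in either order only the intermediate path
`r = p'` can contribute, with the same value. -/
theorem dualCounit_mul_mul' (a b c : DualAlg G μ) : dualCounit G μ (dualMul (dualMul a b) c) =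
    LinearMap.mul' ℂ ℂ (TensorProduct.map (dualCounit G μ ∘ₗ dualMul a)
      (dualCounit G μ ∘ₗ dualMul.flip c) (TensorProduct.comm ℂ _ _ (dualComul b))) := by
  induction a using dual_induction with
  | h0 => simp
  | hadd φ ψ h h' => simp only [map_add, LinearMap.add_apply, h, h', LinearMap.comp_add,
      TensorProduct.map_add_left]
  | hsmul z φ h => simp only [map_smul, LinearMap.smul_apply, h, LinearMap.comp_smul,
      TensorProduct.map_smul_left]
  | hmat p q hp hq h =>
  induction c using dual_induction with
  | h0 => simp
  | hadd φ ψ h h' => simp only [map_add, LinearMap.add_apply, h, h', LinearMap.comp_add,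
      TensorProduct.map_add_right]
  | hsmul z φ h => simp only [map_smul, LinearMap.smul_apply, h, LinearMap.comp_smul,
      TensorProduct.map_smul_right]
  | hmat p'' q'' hp'' hq'' h'' =>
  induction b using dual_induction with
  | h0 => simp
  | hadd φ ψ h h' => simp only [map_add, LinearMap.add_apply, h, h']
  | hsmul z φ h => simp only [map_smul, LinearMap.smul_apply, h]
  | hmat p' q' hp' hq' h' =>
  rw [dualCounit_mul_mul, dualComul_mat h' rfl]
  simp only [map_sum, TensorProduct.map_tmul, LinearMap.mul'_apply, LinearMap.comp_apply,
    LinearMap.flip_apply, TensorProduct.comm_tmul]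
  have hr : ∀ r ∈ words V q'.length,
      dualCounit G μ (dualMul (mat G μ p q) (mat G μ r q')) *
        dualCounit G μ (dualMul (mat G μ p' r) (mat G μ p'' q'')) =
      if r = p' then dualCounit G μ (dualMul (mat G μ p q) (mat G μ p' q')) *
        dualCounit G μ (dualMul (mat G μ p' q') (mat G μ p'' q'')) else 0 := by
    intro r hr
    rw [mem_words] at hr
    simp only [dualCounit_mul_mat h, dualCounit_mul_mat (h'.trans hr.symm), dualCounit_mul_mat h']
    by_cases h1 : r = p'
    · subst h1
      by_cases h2 : r = q'
      · subst h2; simp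
      · simp [h2]
    · simp [h1, Ne.symm h1]
  have hr' : ∀ r ∈ words V q'.length,
      dualCounit G μ (dualMul (mat G μ p q) (mat G μ p' r)) *
        dualCounit G μ (dualMul (mat G μ r q') (mat G μ p'' q'')) =
      if r = p' then dualCounit G μ (dualMul (mat G μ p q) (mat G μ p' q')) *
        dualCounit G μ (dualMul (mat G μ p' q') (mat G μ p'' q'')) else 0 := by
    intro r hr
    rw [mem_words] at hr
    simp only [dualCounit_mul_mat h, dualCounit_mul_mat hr, dualCounit_mul_mat h']
    by_cases h1 : r = p'
    · subst h1
      by_cases h2 : r = q'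
      · subst h2; simp
      · simp [h2]
    · simp [h1, Ne.symm h1]
  rw [Finset.sum_congr rfl hr, Finset.sum_congr rfl hr']

end Unit

end FaceModel

end

noncomputable section
namespace FaceModel
set_option linter.unusedSectionVars false
open scoped Classical

variable {V : Type*} {G : SimpleGraph V} [Fintype V] {β : ℝ} {μ : V → ℝ}

/-! ### Weights of the end points of a path -/

section Weights

variable (μ) in
/-- The ratio of the weights at the end points. -/
def wt : List V → ℂ
  | [] => 1
  | v :: l => rt μ v ((v :: l).getLast (by simp))

theorem wt_eq {l : List V} {a b : V} (ha : l.head? = some a) (hb : l.getLast? = some b) :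
    wt μ l = rt μ a b := by
  cases l with
  | nil => simp at ha
  | cons v l =>
    obtain rfl : v = a := by simpa using ha
    rw [List.getLast?_eq_some_getLast (by simp)] at hb
    rw [wt]; congr 1; simpa using hb

theorem exists_ends {l : List V} (hl : l ≠ []) :
    ∃ a b, l.head? = some a ∧ l.getLast? = some b :=
  ⟨_, _, List.head?_eq_some_head hl, List.getLast?_eq_some_getLast hl⟩

@[simp] theorem conj_wt (l : List V) : conj (wt μ l) = wt μ l := by
  cases l <;> simp [wt]

theorem wt_reverse_mul (hμ : ∀ v, 0 < μ v) (l : List V) : wt μ l.reverse * wt μ l = 1 := by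
  by_cases hl : l = []
  · subst hl; simp [wt]
  · obtain ⟨a, b, ha, hb⟩ := exists_ends hl
    rw [wt_eq ha hb, wt_eq (a := b) (b := a) (by simpa using hb) (by simpa using ha),
      rt_mul_rt hμ, rt_self hμ]

theorem wt_singleton (hμ : ∀ v, 0 < μ v) (v : V) : wt μ [v] = 1 := by
  simp [wt, rt_self hμ]

theorem wt_cons_cons (hμ : ∀ v, 0 < μ v) (v x : V) (l : List V) :
    wt μ (v :: x :: l) = rt μ v x * wt μ (x :: l) := by
  rw [wt, wt, rt_mul_rt hμ, List.getLast_cons_cons]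

end Weights

/-! ### Contraction of a path of even length in the middle -/

section Contraction

variable (μ) in
/-- Nested annihilation operators at the middle of a path of length `2 n`. -/
def capN : ℕ → Module.End ℂ (PathSpace G)
  | 0 => 1
  | n + 1 => capN n ∘ₗ cap μ n

variable (μ) in
/-- Nested creation operators. -/
def cupN : ℕ → Module.End ℂ (PathSpace G)
  | 0 => 1
  | n + 1 => cup μ n ∘ₗ cupN n

theorem adjoint_cupN_capN (n : ℕ) : Adjoint (cupN (G := G) μ n) (capN μ n) := by
  induction n with
  | zero => intro u v; rfl
  | succ n ih => exact (adjoint_cup_cap μ n).comp ih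

theorem symAlg_capN {T : Module.End ℂ (PathSpace G)} (hT : T ∈ symAlg G μ) (n : ℕ)
    (u : PathSpace G) : T (capN μ n u) = capN μ n (T u) := by
  induction n generalizing u with
  | zero => rfl
  | succ n ih => change T (capN μ n (cap μ n u)) = _; rw [ih, symAlg_cap hT]; rfl

theorem capN_mem_deg (n : ℕ) {u : PathSpace G} (hu : u ∈ deg G (2 * n)) :
    capN μ n u ∈ deg G 0 := by
  induction n generalizing u with
  | zero => exact hu
  | succ n ih => exact ih (cap_mem_deg μ n hu)

/-- Once the first vertices of `p` and `q` match, the innermost annihilation compares their second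
vertices and produces the weight of the first step. Continuing outwards, the weights telescope to
`wt μ p`. -/
theorem capN_glueList (hμ : ∀ v, 0 < μ v) {n : ℕ} {p q : List V} (hp : IsPath G p)
    (hq : IsPath G q) (hpn : p.length = n + 1) (hqn : q.length = n + 1) {b : V}
    (hb : p.getLast? = some b) :
    capN μ n (ket G (glueList p.reverse q)) = if p = q then wt μ p • ket G [b] else 0 := by
  induction n generalizing p q with
  | zero =>
    obtain ⟨v, rfl⟩ := List.length_eq_one_iff.1 hpn
    obtain ⟨w, rfl⟩ := List.length_eq_one_iff.1 hqn
    obtain rfl : v = b := by simpa using hb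
    simp only [List.reverse_singleton, glueList_singleton_left, List.head?_cons,
      Option.some.injEq, wt_singleton hμ, one_smul, List.cons.injEq, and_true]
    by_cases h : w = v
    · subst h; simp [capN]
    · simp [h, Ne.symm h, capN]
  | succ n ih =>
    match p, q, hpn, hqn with
    | v :: x :: p, w :: y :: q, hpn, hqn =>
    rw [List.reverse_cons, glueList_append_cons]
    by_cases hvw : v = w
    · subst hvw
      rw [if_pos rfl, List.reverse_cons]
      by_cases hxy : x = y
      · subst hxy
        have hb' : (x :: p).getLast? = some b := by simpa using hb
        have ih' := ih (p := x :: p) (q := x :: q) (hp.tail (by simp)) (hq.tail (by simp))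
          (by simpa using hpn) (by simpa using hqn) hb'
        rw [List.reverse_cons, glueList_append_cons, if_pos rfl] at ih'
        have hpath : IsPath G (p.reverse ++ x :: v :: x :: q) := by
          have h1 : IsPath G ((x :: p).reverse ++ v :: []) := by
            have := hp.reverse
            rwa [List.reverse_cons] at this
          rw [List.reverse_cons, List.append_assoc] at h1
          rw [isPath_append_cons]
          exact ⟨(isPath_append_cons.1 h1).1, isPath_cons_cons.2
            ⟨(isPath_cons_cons.1 hp).1.symm, hq⟩⟩
        change capN μ n (cap μ n (ket G ((p.reverse ++ [x]) ++ v :: x :: q))) = _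
        rw [List.append_assoc, List.singleton_append,
          cap_append μ (by simp at hpn ⊢; omega) hpath, if_pos rfl, map_smul, ih']
        simp only [List.cons.injEq, true_and]
        split_ifs
        · rw [smul_smul, wt_cons_cons hμ]
        · simp
      · rw [if_neg (by simp [hxy])]
        change capN μ n (cap μ n (ket G ((p.reverse ++ [x]) ++ v :: y :: q))) = _
        by_cases hpath : IsPath G (p.reverse ++ x :: v :: y :: q)
        · rw [List.append_assoc, List.singleton_append,
            cap_append μ (by simp at hpn ⊢; omega) hpath, if_neg hxy, map_zero]
        · rw [List.append_assoc, List.singleton_append, ket_of_not hpath, map_zero, map_zero]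
    · simp [hvw]

theorem exists_glueList {n : ℕ} {l : List V} (hl : l.length = 2 * n + 1) :
    ∃ p q : List V, l = glueList p.reverse q ∧ p.length = n + 1 ∧ q.length = n + 1 := by
  -- The middle vertex, at position `n`, belongs to both halves.
  refine ⟨(l.take (n + 1)).reverse, l.drop n, ?_, by simp; omega, by simp; omega⟩
  rw [List.reverse_reverse, glueList, if_pos, List.tail_drop, List.take_append_drop]
  rw [List.head?_drop, List.getLast?_take]
  simp
  rw [List.getElem?_eq_getElem (by omega)]; simp

/-- The weighted sum over paths `r.reverse` followed by `r` is thus a full contraction, which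
commutes with symmetry operators; this drives the antipode axioms. For a single path, written as
`p.reverse` glued to `q`, both sides are `wt μ p` if `p = q` and zero otherwise. -/
theorem sum_wt_amp (hμ : ∀ v, 0 < μ v) {n : ℕ} {u : PathSpace G} (hu : u ∈ deg G (2 * n)) :
    ∑ r ∈ words V (n + 1), wt μ r * amp u (glueList r.reverse r) =
      ∑ b, amp (capN μ n u) [b] := by
  refine deg_induction (p := fun u => ∑ r ∈ words V (n + 1), wt μ r *
    amp u (glueList r.reverse r) = ∑ b, amp (capN μ n u) [b]) hu (by simp) ?_ ?_ ?_
  · intro u v hu hv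
    simp only [map_add, amp_add, mul_add, Finset.sum_add_distrib, hu, hv]
  · intro z u hu
    simp only [map_smul, amp_smul, ← Finset.mul_sum, ← hu, mul_left_comm _ z]
  · intro l hl hn
    obtain ⟨p, q, rfl, hp, hq⟩ := exists_glueList hn
    obtain ⟨hpp, hqp⟩ := isPath_glueList hl
    rw [isPath_reverse] at hpp
    obtain ⟨a, b, ha, hb⟩ := exists_ends hpp.1
    rw [capN_glueList hμ hpp hqp hp hq hb, Finset.sum_eq_single p]
    · rw [amp_ket]
      by_cases hpq : p = q
      · subst hpq
        simp only [hl, and_self, if_true, mul_one, amp_smul, amp_ket]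
        rw [Finset.sum_eq_single b] <;> simp +contextual [eq_comm]
      · rw [if_neg, if_neg hpq]
        · simp
        · rintro ⟨h1, -⟩
          exact hpq (glueList_inj (by simp) hl.1 h1).2.symm
    · intro r hr hrp
      rw [amp_ket, if_neg, mul_zero]
      rintro ⟨h1, -⟩
      rw [mem_words] at hr
      exact hrp (List.reverse_injective (glueList_inj (by simp [hp, hr]) hl.1 h1).1).symm
    · intro h; exact absurd (mem_words.2 hp) h

theorem length_glueList_reverse {n : ℕ} {p q : List V} (hp : p.length = n + 1)
    (hq : q.length = n + 1) (h : glueList p.reverse q ≠ []) :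
    (glueList p.reverse q).length = 2 * n + 1 := by
  rw [glueList] at h ⊢
  split_ifs at h ⊢
  · simp [hp, hq]; omega
  · exact absurd rfl h

theorem ket_glueList_mem_deg {n : ℕ} {p q : List V} (hp : p.length = n + 1)
    (hq : q.length = n + 1) : ket G (glueList p.reverse q) ∈ deg G (2 * n) := by
  by_cases h : glueList p.reverse q = []
  · rw [h, ket_nil]; exact zero_mem _
  · exact ket_mem_deg (length_glueList_reverse hp hq h)

end Contraction

/-! ### The antipode -/

section Antipode

/-- The operation on symmetry operators which is dual to the antipode. -/
def antipodeOp (μ : V → ℝ) (T : Module.End ℂ (PathSpace G)) : Module.End ℂ (PathSpace G) :=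
  ofKernel fun p q => wt μ q * wt μ p.reverse * amp (T (ket G p.reverse)) q.reverse

theorem amp_antipodeOp {T : Module.End ℂ (PathSpace G)} (hT : T ∈ symAlg G μ) (p q : List V) :
    amp (antipodeOp μ T (ket G q)) p =
      wt μ q * wt μ p.reverse * amp (T (ket G p.reverse)) q.reverse := by
  rw [antipodeOp, amp_ofKernel]
  split_ifs with h
  · rfl
  · by_cases hp : IsPath G p
    · by_cases hq : IsPath G q
      · rw [symAlg_amp_eq_zero hT, mul_zero]
        simp only [hp, hq, and_true] at h
        simpa using Ne.symm h
      · rw [amp_of_not (by simpa using hq), mul_zero]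
    · rw [ket_of_not (by simpa using hp), map_zero, amp_zero, mul_zero]

/-- Up to the diagonal operators of end weights, the antipode is the adjoint of the operator
conjugated by reversal, and each of these operations preserves `symAlg`. -/
theorem antipodeOp_mem {T : Module.End ℂ (PathSpace G)} (hT : T ∈ symAlg G μ) :
    antipodeOp μ T ∈ symAlg G μ := by
  have h : antipodeOp μ T = endDiag (fun a b => rt μ b a) * adj (sharp T) *
      endDiag (fun a b => rt μ a b) := by
    refine ext_amp_ket fun p q hp hq => ?_
    obtain ⟨a, b, ha, hb⟩ := exists_ends hp.1
    obtain ⟨c, d, hc, hd⟩ := exists_ends hq.1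
    rw [amp_antipodeOp hT, Module.End.mul_apply, Module.End.mul_apply, endDiag_ket _ hc hd,
      map_smul, map_smul, amp_smul, amp_endDiag _ _ ha hb, amp_adj (sharp_mem hT), amp_sharp,
      Complex.conj_conj, wt_eq hc hd,
      wt_eq (l := p.reverse) (a := b) (b := a) (by simpa using hb) (by simpa using ha)]
    ring
  rw [h]
  exact mul_mem (mul_mem (endDiag_mem _) (adj_mem (sharp_mem hT))) (endDiag_mem _)

/-- The antipode. -/
def dualAntipode : DualAlg G μ →ₗ[ℂ] DualAlg G μ :=
  LinearMap.dualMap (M₁ := symAlg G μ) (M₂ := symAlg G μ)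
    { toFun := fun a => ⟨antipodeOp μ a.1, antipodeOp_mem a.2⟩
      map_add' := fun a b => by
        refine Subtype.ext (ext_amp_ket fun p q _ _ => ?_)
        change amp (antipodeOp μ (a + b : symAlg G μ).1 _) p =
          amp (antipodeOp μ a.1 _ + antipodeOp μ b.1 _) p
        rw [amp_add, amp_antipodeOp a.2, amp_antipodeOp b.2, amp_antipodeOp (a + b).2]
        simp [mul_add]
      map_smul' := fun z a => by
        refine Subtype.ext (ext_amp_ket fun p q _ _ => ?_)
        change amp (antipodeOp μ (z • a : symAlg G μ).1 _) p = amp (z • antipodeOp μ a.1 _) p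
        rw [amp_smul, amp_antipodeOp a.2, amp_antipodeOp (z • a).2]
        simp; ring }

theorem dualAntipode_mat (p q : List V) : dualAntipode (mat G μ p q) =
    (wt μ q * wt μ p.reverse) • mat G μ q.reverse p.reverse := by
  ext a
  change mat G μ p q ⟨antipodeOp μ a.1, antipodeOp_mem a.2⟩ = _
  rw [mat_apply, amp_antipodeOp a.2, LinearMap.smul_apply, mat_apply, smul_eq_mul]

variable [Module.Finite ℂ (symAlg G μ)]

/-- Evaluated at `a`, the sum over `r` contracts the image under `a` of `p.reverse` glued to `q`.
The contraction can be moved to the argument of `a`, where it gives `wt μ p` times a single vertex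
if `p = q`; this weight cancels against the one from the antipode. -/
theorem sum_antipode_mul (hμ : ∀ v, 0 < μ v) {n : ℕ} {p q : List V} (hp : IsPath G p)
    (hq : IsPath G q) (hpn : p.length = n + 1) (hqn : q.length = n + 1) {b : V}
    (hb : p.getLast? = some b) :
    ∑ r ∈ words V (n + 1), dualMul (dualAntipode (mat G μ p r)) (mat G μ r q) =
      if p = q then ∑ v, mat G μ [v] [b] else 0 := by
  ext a
  have h1 : ∀ r ∈ words V (n + 1), dualMul (dualAntipode (mat G μ p r)) (mat G μ r q) a =
      wt μ p.reverse * (wt μ r * amp (a.1 (ket G (glueList p.reverse q)))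
        (glueList r.reverse r)) := by
    intro r hr
    rw [mem_words] at hr
    rw [dualAntipode_mat, map_smul, LinearMap.smul_apply, LinearMap.smul_apply,
      dualMul_mat (by simp [hr, hpn]), mat_apply, smul_eq_mul]
    ring
  rw [LinearMap.sum_apply, Finset.sum_congr rfl h1, ← Finset.mul_sum,
    sum_wt_amp hμ (symAlg_mem_deg a.2 (ket_glueList_mem_deg hpn hqn)), ← symAlg_capN a.2,
    capN_glueList hμ hp hq hpn hqn hb]
  split_ifs with h
  · simp only [map_smul, amp_smul, ← Finset.mul_sum, ← mul_assoc, wt_reverse_mul hμ, one_mul,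
      LinearMap.sum_apply, mat_apply]
  · simp

/-- The argument of `sum_antipode_mul`, applied to the adjoint of `a` and to the reversed paths. -/
theorem sum_mul_antipode (hμ : ∀ v, 0 < μ v) {n : ℕ} {p q : List V} (hp : IsPath G p)
    (hq : IsPath G q) (hpn : p.length = n + 1) (hqn : q.length = n + 1) {b : V}
    (hb : p.head? = some b) :
    ∑ r ∈ words V (n + 1), dualMul (mat G μ p r) (dualAntipode (mat G μ r q)) =
      if p = q then ∑ v, mat G μ [b] [v] else 0 := by
  ext a
  have h1 : ∀ r ∈ words V (n + 1), dualMul (mat G μ p r) (dualAntipode (mat G μ r q)) a =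
      conj (wt μ q * (wt μ r.reverse * amp (adj a.1 (ket G (glueList p.reverse.reverse q.reverse)))
        (glueList r.reverse.reverse r.reverse))) := by
    intro r hr
    rw [mem_words] at hr
    rw [dualAntipode_mat, map_smul, LinearMap.smul_apply,
      dualMul_mat (by simp [hr, hpn]), mat_apply, smul_eq_mul, amp_adj a.2]
    simp [mul_assoc]
  rw [LinearMap.sum_apply, Finset.sum_congr rfl h1, ← map_sum, ← Finset.mul_sum,
    sum_words_reverse (n + 1) (fun r => wt μ r *
      amp (adj a.1 (ket G (glueList p.reverse.reverse q.reverse))) (glueList r.reverse r)),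
    sum_wt_amp hμ (symAlg_mem_deg (adj_mem a.2) (ket_glueList_mem_deg (by simpa) (by simpa))),
    ← symAlg_capN (adj_mem a.2),
    capN_glueList hμ hp.reverse hq.reverse (by simpa) (by simpa) (b := b) (by simpa using hb)]
  simp only [List.reverse_inj]
  split_ifs with h
  · subst h
    simp only [map_smul, amp_smul, ← Finset.mul_sum, ← mul_assoc]
    rw [mul_comm (wt μ p), wt_reverse_mul hμ, one_mul, map_sum]
    simp only [LinearMap.sum_apply, mat_apply, amp_adj a.2, Complex.conj_conj]
  · simp

theorem dualComul_one : dualComul (dualOne G μ) =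
    ∑ v, ∑ w, ∑ x, mat G μ [v] [x] ⊗ₜ[ℂ] mat G μ [x] [w] := by
  simp only [dualOne, map_sum]
  refine Finset.sum_congr rfl fun v _ => Finset.sum_congr rfl fun w _ => ?_
  rw [dualComul_mat (n := 1) rfl rfl, sum_words_one]

theorem mul_antipode_eq (hμ : ∀ v, 0 < μ v) (a : DualAlg G μ) :
    TensorProduct.lift dualMul (TensorProduct.map LinearMap.id dualAntipode (dualComul a)) =
    TensorProduct.lid ℂ (DualAlg G μ) (TensorProduct.map (dualCounit G μ ∘ₗ dualMul.flip a)
      LinearMap.id (dualComul (dualOne G μ))) := by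
  induction a using dual_induction with
  | h0 => simp
  | hadd φ ψ h h' => simp only [map_add, h, h', LinearMap.comp_add, TensorProduct.map_add_left,
      LinearMap.add_apply]
  | hsmul z φ h => simp only [map_smul, h, LinearMap.comp_smul, TensorProduct.map_smul_left,
      LinearMap.smul_apply]
  | hmat p q hp hq h =>
  obtain ⟨n, hn⟩ : ∃ n, q.length = n + 1 := Nat.exists_eq_succ_of_ne_zero (by simpa using hq.1)
  obtain ⟨a, b, ha, hb⟩ := exists_ends hp.1
  rw [dualComul_mat (h.trans hn) hn, dualComul_one]
  simp only [map_sum, TensorProduct.map_tmul, TensorProduct.lift.tmul, LinearMap.id_apply,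
    LinearMap.comp_apply, LinearMap.flip_apply, TensorProduct.lid_tmul]
  rw [sum_mul_antipode hμ hp hq (h.trans hn) hn ha]
  have h1 : ∀ v w x : V, dualCounit G μ (dualMul (mat G μ [v] [x]) (mat G μ p q)) •
      mat G μ [x] [w] = if v = x ∧ x = a then (if p = q then mat G μ [a] [w] else 0) else 0 := by
    intro v w x
    rw [dualCounit_mul_mat (by simp), glueList_singleton_left, ha]
    by_cases hx : x = a
    · subst hx
      by_cases hv : v = x
      · subst hv
        by_cases hpq : p = q
        · subst hpq; simp [hp]
        · simp [hpq]
      · simp [hv]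
    · rw [if_neg, if_neg (by simp [hx]), zero_smul]
      rintro ⟨h1, h2, h3⟩
      obtain rfl : v = x := by simpa using h1
      simp [Ne.symm hx] at h3
  simp only [h1]
  rw [Finset.sum_comm]
  have h2 : ∀ w, ∑ v, ∑ x, (if v = x ∧ x = a then (if p = q then mat G μ [a] [w] else 0) else 0)
      = if p = q then mat G μ [a] [w] else 0 := by
    intro w
    rw [Finset.sum_eq_single a, Finset.sum_eq_single a]
    · simp
    · intro x _ hx; simp [hx]
    · simp
    · intro v _ hv
      refine Finset.sum_eq_zero fun x _ => if_neg ?_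
      rintro ⟨rfl, rfl⟩; exact hv rfl
    · simp
  simp only [h2]
  split_ifs <;> simp

theorem antipode_mul_eq (hμ : ∀ v, 0 < μ v) (a : DualAlg G μ) :
    TensorProduct.lift dualMul (TensorProduct.map dualAntipode LinearMap.id (dualComul a)) =
    TensorProduct.rid ℂ (DualAlg G μ) (TensorProduct.map LinearMap.id
      (dualCounit G μ ∘ₗ dualMul a) (dualComul (dualOne G μ))) := by
  induction a using dual_induction with
  | h0 => simp
  | hadd φ ψ h h' => simp only [map_add, h, h', LinearMap.comp_add, TensorProduct.map_add_right,
      LinearMap.add_apply]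
  | hsmul z φ h => simp only [map_smul, h, LinearMap.comp_smul, TensorProduct.map_smul_right,
      LinearMap.smul_apply]
  | hmat p q hp hq h =>
  obtain ⟨n, hn⟩ : ∃ n, q.length = n + 1 := Nat.exists_eq_succ_of_ne_zero (by simpa using hq.1)
  obtain ⟨a, b, ha, hb⟩ := exists_ends hp.1
  rw [dualComul_mat (h.trans hn) hn, dualComul_one]
  simp only [map_sum, TensorProduct.map_tmul, TensorProduct.lift.tmul, LinearMap.id_apply,
    LinearMap.comp_apply, TensorProduct.rid_tmul]
  rw [sum_antipode_mul hμ hp hq (h.trans hn) hn hb]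
  have hgl : ∀ x, glueList p [x] = if x = b then p else [] := by
    intro x
    rw [glueList, hb]
    simp [eq_comm]
  have h1 : ∀ v w x : V, dualCounit G μ (dualMul (mat G μ p q) (mat G μ [x] [w])) •
      mat G μ [v] [x] = if x = w ∧ x = b then (if p = q then mat G μ [v] [b] else 0) else 0 := by
    intro v w x
    rw [dualCounit_mul_mat h, hgl]
    by_cases hx : x = b
    · subst hx
      by_cases hv : x = w
      · subst hv
        by_cases hpq : p = q
        · subst hpq; simp [hp]
        · simp [hpq]
      · simp [hv]
    · simp [hx]
  simp only [h1]
  have h2 : ∀ v, ∑ w, ∑ x, (if x = w ∧ x = b then (if p = q then mat G μ [v] [b] else 0) else 0)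
      = if p = q then mat G μ [v] [b] else 0 := by
    intro v
    rw [Finset.sum_eq_single b, Finset.sum_eq_single b]
    · simp
    · intro x _ hx; simp [hx]
    · simp
    · intro v _ hv
      refine Finset.sum_eq_zero fun x _ => if_neg ?_
      rintro ⟨rfl, rfl⟩; exact hv rfl
    · simp
  simp only [h2]
  split_ifs <;> simp

/-- By `sum_antipode_mul` the first two factors collapse to a sum of vertex elements ending at the
last vertex of `p`. This acts as the identity on the antipode of `mat G μ p q`, in which `p` appears
reversed. -/
theorem antipode_mul_antipode_eq (hμ : ∀ v, 0 < μ v) (a : DualAlg G μ) :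
    TensorProduct.lift dualMul (TensorProduct.map
      (TensorProduct.lift dualMul ∘ₗ TensorProduct.map dualAntipode LinearMap.id) dualAntipode
        (TensorProduct.map dualComul LinearMap.id (dualComul a))) = dualAntipode a := by
  induction a using dual_induction with
  | h0 => simp
  | hadd φ ψ h h' => simp only [map_add, h, h']
  | hsmul z φ h => simp only [map_smul, h]
  | hmat p q hp hq h =>
  obtain ⟨n, hn⟩ : ∃ n, q.length = n + 1 := Nat.exists_eq_succ_of_ne_zero (by simpa using hq.1)
  obtain ⟨a, b, ha, hb⟩ := exists_ends hp.1
  rw [dualComul_mat (h.trans hn) hn]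
  simp only [map_sum, TensorProduct.map_tmul, TensorProduct.lift.tmul, LinearMap.id_apply,
    LinearMap.comp_apply]
  have h1 : ∀ s ∈ words V (n + 1), dualMul (TensorProduct.lift dualMul
      (TensorProduct.map dualAntipode LinearMap.id (dualComul (mat G μ p s))))
        (dualAntipode (mat G μ s q)) =
      if p = s then dualMul (∑ v, mat G μ [v] [b]) (dualAntipode (mat G μ p q)) else 0 := by
    intro s hs
    rw [mem_words] at hs
    have h2 : TensorProduct.lift dualMul (TensorProduct.map dualAntipode LinearMap.id
        (dualComul (mat G μ p s))) =
        ∑ r ∈ words V (n + 1), dualMul (dualAntipode (mat G μ p r)) (mat G μ r s) := by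
      rw [dualComul_mat (h.trans hn) hs]
      simp only [map_sum, TensorProduct.map_tmul, TensorProduct.lift.tmul, LinearMap.id_apply]
    rw [h2]
    by_cases hsp : IsPath G s
    · rw [sum_antipode_mul hμ hp hsp (h.trans hn) hs hb]
      split_ifs with h
      · subst h; simp
      · simp
    · rw [mat_of_not_left hsp, map_zero, map_zero, if_neg]
      rintro rfl; exact hsp hp
  rw [Finset.sum_congr rfl h1, Finset.sum_ite_eq, if_pos (mem_words.2 (h.trans hn)),
    dualAntipode_mat, map_sum, LinearMap.sum_apply]
  simp only [map_smul, dualMul_singleton]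
  obtain ⟨c, d, hc, hd⟩ := exists_ends hq.1
  rw [Finset.sum_eq_single d]
  · simp [glueList_singleton_left, hd, hb]
  · intro v _ hv
    simp [glueList_singleton_left, hd, Ne.symm hv]
  · simp

end Antipode

/-! ### The coproduct of the unit and the weak *-Hopf structure -/

section WeakHopf

variable [Module.Finite ℂ (symAlg G μ)]

theorem dualMul_singleton_singleton (v w x y : V) :
    dualMul (mat G μ [v] [w]) (mat G μ [x] [y]) = if v = x ∧ w = y then mat G μ [v] [w] else 0 := by
  rw [dualMul_singleton, glueList_singleton_left, glueList_singleton_left]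
  by_cases h : x = v
  · by_cases h' : y = w
    · simp [h, h']
    · simp [h', Ne.symm h']
  · simp [h, Ne.symm h]

variable (G μ) in
/-- The sum of the matrix elements between vertices in a column. -/
def columnSum (x : V) : DualAlg G μ := ∑ v, mat G μ [v] [x]

variable (G μ) in
/-- The sum of the matrix elements between vertices in a row. -/
def rowSum (x : V) : DualAlg G μ := ∑ v, mat G μ [x] [v]

theorem rowSum_mul_columnSum (x y : V) :
    dualMul (rowSum G μ x) (columnSum G μ y) = mat G μ [x] [y] := by
  simp only [rowSum, columnSum, map_sum, LinearMap.sum_apply, dualMul_singleton_singleton]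
  rw [Finset.sum_eq_single x, Finset.sum_eq_single y]
  · simp
  · intro v _ hv; simp [hv]
  · simp
  · intro v _ hv
    exact Finset.sum_eq_zero fun w _ => if_neg fun h => hv h.1.symm
  · simp

/-- Row and column sums, the legs of the coproduct of `1`, commute with each other; compare
`rowSum_mul_columnSum`. That is why both orders in the axiom for `(Δ ⊗ id) Δ(1)` hold. -/
theorem columnSum_mul_rowSum (x y : V) :
    dualMul (columnSum G μ y) (rowSum G μ x) = mat G μ [x] [y] := by
  simp only [rowSum, columnSum, map_sum, LinearMap.sum_apply, dualMul_singleton_singleton]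
  rw [Finset.sum_eq_single y, Finset.sum_eq_single x]
  · simp
  · intro v _ hv; simp [hv]
  · simp
  · intro v _ hv
    exact Finset.sum_eq_zero fun w _ => if_neg fun h => hv h.2.symm
  · simp

theorem dualComul_one_eq_sum :
    dualComul (dualOne G μ) = ∑ x, columnSum G μ x ⊗ₜ[ℂ] rowSum G μ x := by
  simp only [dualComul_one, columnSum, rowSum, TensorProduct.sum_tmul, TensorProduct.tmul_sum]
  rw [Finset.sum_congr rfl fun v _ => Finset.sum_comm, Finset.sum_comm]
  exact Finset.sum_congr rfl fun y _ => Finset.sum_comm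

theorem dualComul_columnSum (x : V) :
    dualComul (columnSum G μ x) = ∑ y, columnSum G μ y ⊗ₜ[ℂ] mat G μ [y] [x] := by
  simp only [columnSum, map_sum, dualComul_mat (n := 1) (p := [_]) (q := [_]) rfl rfl,
    sum_words_one, TensorProduct.sum_tmul]
  exact Finset.sum_comm

theorem comul_comul_one_eq :
    TensorProduct.map dualComul LinearMap.id (dualComul (dualOne G μ)) =
      TensorProduct.map₂ (TensorProduct.map₂ dualMul dualMul) dualMul
        (dualComul (dualOne G μ) ⊗ₜ[ℂ] dualOne G μ)
        ((TensorProduct.assoc ℂ (DualAlg G μ) (DualAlg G μ) (DualAlg G μ)).symm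
          (dualOne G μ ⊗ₜ[ℂ] dualComul (dualOne G μ))) := by
  simp only [dualComul_one_eq_sum, TensorProduct.sum_tmul, TensorProduct.tmul_sum, map_sum,
    TensorProduct.assoc_symm_tmul, LinearMap.sum_apply, TensorProduct.map₂_apply_tmul,
    TensorProduct.map_tmul, mul_dualOne, dualOne_mul, rowSum_mul_columnSum, dualComul_columnSum,
    LinearMap.id_apply]
  try exact Finset.sum_comm

theorem comul_comul_one_eq' :
    TensorProduct.map dualComul LinearMap.id (dualComul (dualOne G μ)) =
      TensorProduct.map₂ (TensorProduct.map₂ dualMul dualMul) dualMul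
        ((TensorProduct.assoc ℂ (DualAlg G μ) (DualAlg G μ) (DualAlg G μ)).symm
          (dualOne G μ ⊗ₜ[ℂ] dualComul (dualOne G μ)))
        (dualComul (dualOne G μ) ⊗ₜ[ℂ] dualOne G μ) := by
  simp only [dualComul_one_eq_sum, TensorProduct.sum_tmul, TensorProduct.tmul_sum, map_sum,
    TensorProduct.assoc_symm_tmul, LinearMap.sum_apply, TensorProduct.map₂_apply_tmul,
    TensorProduct.map_tmul, mul_dualOne, dualOne_mul, columnSum_mul_rowSum, dualComul_columnSum,
    LinearMap.id_apply]
  try exact Finset.sum_comm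

/-- The dual of the algebra of symmetry operators is a weak *-Hopf algebra for the projected
concatenation product. -/
def dualWeakHopf (hμ : ∀ v, 0 < μ v) : WeakStarHopf (DualAlg G μ) where
  toCoalgebra := dualCoalgebra G μ
  mul := dualMul
  one := dualOne G μ
  antipode := dualAntipode
  star := dualStar
  mul_assoc := dualMul_assoc
  one_mul := dualOne_mul
  mul_one := mul_dualOne
  comul_mul := dualComul_mul
  counit_mul_mul := dualCounit_mul_mul
  counit_mul_mul' := dualCounit_mul_mul'
  comul_comul_one := comul_comul_one_eq
  comul_comul_one' := comul_comul_one_eq'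
  mul_antipode := mul_antipode_eq hμ
  antipode_mul := antipode_mul_eq hμ
  antipode_mul_antipode := antipode_mul_antipode_eq hμ
  star_star := dualStar_dualStar
  star_mul := dualStar_mul
  comul_star := dualComul_star

end WeakHopf

end FaceModel

end

noncomputable section
namespace FaceModel
set_option linter.unusedSectionVars false
open scoped Classical

variable {V : Type*} {G : SimpleGraph V} [Fintype V] {β : ℝ} {μ : V → ℝ}

/-! ### Concatenation and annihilation -/

section Concat

theorem concat_ket_singleton (x : V) (u : PathSpace G) : concat G (ket G [x]) u = fst x u := by
  induction u using ket_induction with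
  | h0 => simp
  | hadd u w hu hw => rw [map_add, map_add, hu, hw]
  | hket z l hl =>
    rw [map_smul, map_smul, concat_ket, glueList_singleton_left, fst_ket']
    split_ifs <;> simp

theorem concat_ket_cons (x : V) {p : List V} (hp : p ≠ []) (u : PathSpace G) :
    concat G (ket G (x :: p)) u = prep x (concat G (ket G p) u) := by
  induction u using ket_induction with
  | h0 => simp
  | hadd u w hu hw => rw [map_add, map_add, map_add, hu, hw]
  | hket z l hl =>
    rw [map_smul, map_smul, map_smul, concat_ket, concat_ket]
    cases p with
    | nil => exact absurd rfl hp
    | cons y p =>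
      rw [glueList_cons]
      split_ifs with h
      · simp [h]
      · rw [prep_ket x h]

theorem rev_concat (u v : PathSpace G) : rev (concat G u v) = concat G (rev v) (rev u) := by
  induction u using ket_induction with
  | h0 => simp
  | hadd u w hu hw => simp only [map_add, LinearMap.add_apply, hu, hw]
  | hket z l hl =>
    simp only [map_smul, LinearMap.smul_apply, LinearMap.map_smulₛₗ]
    congr 1
    induction v using ket_induction with
    | h0 => simp
    | hadd u w hu hw => simp only [map_add, LinearMap.add_apply, hu, hw]
    | hket z m hm =>
      simp only [map_smul, LinearMap.smul_apply, LinearMap.map_smulₛₗ, concat_ket, rev_ket,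
        reverse_glueList]

theorem concat_mem_deg {n m : ℕ} {u v : PathSpace G} (hu : u ∈ deg G n) (hv : v ∈ deg G m) :
    concat G u v ∈ deg G (n + m) := by
  refine deg_induction (p := fun u => concat G u v ∈ deg G (n + m)) hu (by simp) ?_ ?_ ?_
  · intro u w hu hw; rw [map_add]; exact add_mem hu hw
  · intro z u hu; rw [map_smul]; exact Submodule.smul_mem _ _ hu
  intro p hp hpn
  refine deg_induction (p := fun v => concat G _ v ∈ deg G (n + m)) hv (by simp) ?_ ?_ ?_
  · intro u w hu hw; rw [map_add]; exact add_mem hu hw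
  · intro z u hu; rw [map_smul]; exact Submodule.smul_mem _ _ hu
  intro q hq hqn
  rw [concat_ket]
  by_cases h : glueList p q = []
  · rw [h, ket_nil]; exact zero_mem _
  · refine ket_mem_deg ?_
    rw [glueList] at h ⊢
    split_ifs at h ⊢
    · simp [hpn, hqn]; omega
    · exact absurd rfl h

theorem cap_concat_right {n : ℕ} (j : ℕ) {u : PathSpace G} (hu : u ∈ deg G n) (v : PathSpace G) :
    cap μ (n + j) (concat G u v) = concat G u (cap μ j v) := by
  refine deg_induction (p := fun u => cap μ (n + j) (concat G u v) = concat G u (cap μ j v)) hu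
    (by simp) ?_ ?_ ?_
  · intro u w hu hw; simp only [map_add, LinearMap.add_apply, hu, hw]
  · intro z u hu; simp only [map_smul, LinearMap.smul_apply, hu]
  intro p hp hn
  clear hu u
  induction p generalizing n with
  | nil => simp at hn
  | cons x p ih =>
    cases p with
    | nil =>
      obtain rfl : n = 0 := by simpa using hn
      rw [concat_ket_singleton, concat_ket_singleton, zero_add, preservesFirst_cap]
    | cons y p =>
      cases n with
      | zero => simp at hn
      | succ n =>
        rw [concat_ket_cons x (by simp), concat_ket_cons x (by simp),
          show n + 1 + j = (n + j) + 1 by ring, cap_succ_prep,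
          ih (hp.tail (by simp)) (by simpa using hn)]

/-- The mirror image of `cap_concat_right` under reversal of paths. -/
theorem cap_concat_left {n m i : ℕ} (hi : i + 2 ≤ n) {u v : PathSpace G} (hu : u ∈ deg G n)
    (hv : v ∈ deg G m) : cap μ i (concat G u v) = concat G (cap μ i u) v := by
  obtain ⟨k, rfl⟩ := Nat.exists_eq_add_of_le hi
  have hu' : u ∈ deg G (i + k + 2) := by rwa [show i + k + 2 = i + 2 + k by ring]
  have h1 : concat G u v ∈ deg G (m + i + k + 2) := by
    have := concat_mem_deg hu hv
    rwa [show m + i + k + 2 = i + 2 + k + m by ring]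
  have h2 : rev (cap μ i (concat G u v)) = rev (concat G (cap μ i u) v) := by
    rw [rev_cap (j := m + k) (n := m + i + k) (by ring) h1, rev_concat, rev_concat,
      cap_concat_right k (rev_mem_deg hv), rev_cap (n := i + k) rfl hu']
  rw [← rev_rev (cap μ i (concat G u v)), h2, rev_rev]

theorem amp_concat_reverse (ξ η : PathSpace G) {r : List V} (hr : IsPath G r) {n : ℕ}
    (hξ : ξ ∈ deg G n) (hn : r.length = n + 1) :
    amp (concat G (rev ξ) η) (glueList r.reverse r) = conj (amp ξ r) * amp η r := by
  have hrr : IsPath G (glueList r.reverse r) := by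
    refine glueList_isPath hr.reverse hr ?_
    cases r with
    | nil => simp at hr
    | cons v r => rw [List.reverse_cons, glueList_append_cons]; simp
  refine deg_induction (p := fun ξ => amp (concat G (rev ξ) η) (glueList r.reverse r) =
    conj (amp ξ r) * amp η r) hξ (by simp) ?_ ?_ ?_
  · intro u w hu hw; simp only [map_add, LinearMap.add_apply, amp_add, hu, hw, add_mul]
  · intro z u hu
    simp only [map_smul, LinearMap.smul_apply, LinearMap.map_smulₛₗ, amp_smul, map_mul, hu, mul_assoc]
  intro p hp hpn
  rw [rev_ket]
  induction η using ket_induction with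
  | h0 => simp
  | hadd u w hu hw => simp only [map_add, amp_add, hu, hw, mul_add]
  | hket z q hq =>
    rw [map_smul, amp_smul, amp_smul, concat_ket, amp_ket, amp_ket, amp_ket, mul_left_comm]
    congr 1
    by_cases h : p = r
    · subst h
      by_cases h' : q = p
      · subst h'; simp [hrr, hq]
      · have h3 : ¬ (q = p ∧ IsPath G q) := fun h1 => h' h1.1
        rw [if_neg h3, mul_zero, if_neg]
        rintro ⟨h1, h2⟩
        exact h' (glueList_inj rfl h2.1 h1).2
    · rw [if_neg, if_neg (fun h1 => h h1.1)]
      · simp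
      · rintro ⟨h1, h2⟩
        exact h (List.reverse_injective (glueList_inj (by simp [hn, hpn]) h2.1 h1).1)

end Concat

/-! ### Matrix elements between arbitrary vectors -/

section CoefficientForm

variable (G μ) in
/-- The matrix elements `a ↦ ⟨ξ, a η⟩`. -/
def coeff : PathSpace G →ₗ⋆[ℂ] PathSpace G →ₗ[ℂ] DualAlg G μ where
  toFun ξ :=
    { toFun := fun η =>
        { toFun := fun a => ip ξ (a.1 η)
          map_add' := by simp
          map_smul' := by simp }
      map_add' := fun η η' => by ext; simp
      map_smul' := fun z η => by ext; simp }
  map_add' ξ ξ' := by ext; simp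
  map_smul' z ξ := by ext; simp

theorem coeff_apply (ξ η : PathSpace G) (a : symAlg G μ) : coeff G μ ξ η a = ip ξ (a.1 η) := rfl

theorem coeff_ket (p q : List V) : coeff G μ (ket G p) (ket G q) = mat G μ p q := by
  ext a; rw [coeff_apply, ip_ket_left, mat_apply]

theorem star_coeff (ξ η : PathSpace G) :
    dualStar (coeff G μ ξ η) = coeff G μ (rev ξ) (rev η) := by
  induction ξ using ket_induction with
  | h0 => simp
  | hadd u w hu hw => simp only [map_add, LinearMap.add_apply, hu, hw]
  | hket z p hp =>
    simp only [LinearMap.smul_apply, LinearMap.map_smulₛₗ]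
    congr 1
    induction η using ket_induction with
    | h0 => simp
    | hadd u w hu hw => simp only [map_add, hu, hw]
    | hket z q hq =>
      simp only [map_smul, LinearMap.map_smulₛₗ, coeff_ket, rev_ket, dualStar_mat]

variable [Module.Finite ℂ (symAlg G μ)]

theorem coeff_mul {n : ℕ} {ξ η : PathSpace G} (hξ : ξ ∈ deg G n) (hη : η ∈ deg G n)
    (ξ' η' : PathSpace G) : dualMul (coeff G μ ξ η) (coeff G μ ξ' η') =
      coeff G μ (concat G ξ ξ') (concat G η η') := by
  refine deg_induction (p := fun ξ => dualMul (coeff G μ ξ η) (coeff G μ ξ' η') =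
    coeff G μ (concat G ξ ξ') (concat G η η')) hξ (by simp) ?_ ?_ ?_
  · intro u w hu hw; simp only [map_add, LinearMap.add_apply, hu, hw]
  · intro z u hu; simp only [map_smul, LinearMap.smul_apply, LinearMap.map_smulₛₗ, hu]
  intro p hp hpn
  refine deg_induction (p := fun η => dualMul (coeff G μ (ket G p) η) (coeff G μ ξ' η') =
    coeff G μ (concat G (ket G p) ξ') (concat G η η')) hη (by simp) ?_ ?_ ?_
  · intro u w hu hw; simp only [map_add, LinearMap.add_apply, hu, hw]
  · intro z u hu; simp only [map_smul, LinearMap.smul_apply, hu]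
  intro q hq hqn
  induction ξ' using ket_induction with
  | h0 => simp
  | hadd u w hu hw => simp only [map_add, LinearMap.add_apply, hu, hw]
  | hket z p' hp' =>
    simp only [map_smul, LinearMap.smul_apply, LinearMap.map_smulₛₗ]
    congr 1
    induction η' using ket_induction with
    | h0 => simp
    | hadd u w hu hw => simp only [map_add, hu, hw]
    | hket z q' hq' =>
      simp only [map_smul, concat_ket, coeff_ket, dualMul_mat (G := G) (μ := μ) (hpn.trans hqn.symm)]

/-- If all these forms vanish at `a`, the choice `ξ = a u`, `η = u` with `u` essential gives `‖a u‖²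
= 0`. So `a` vanishes on essential paths and therefore everywhere. -/
theorem span_coeff (hW : IsWeight G β μ) : Submodule.span ℂ {φ | ∃ n,
    ∃ ξ ∈ essential G β μ n, ∃ η ∈ essential G β μ n, coeff G μ ξ η = φ} = ⊤ := by
  set U := Submodule.span ℂ {φ | ∃ n,
    ∃ ξ ∈ essential G β μ n, ∃ η ∈ essential G β μ n, coeff G μ ξ η = φ}
  have h : U.dualCoannihilator = ⊥ := by
    refine (Submodule.eq_bot_iff _).2 fun a ha => Subtype.ext ?_
    rw [Submodule.mem_dualCoannihilator] at ha
    refine symAlg_ext hW a.2 (zero_mem _) fun n u hu => ?_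
    have hau := symAlg_essential hW a.2 hu
    exact eq_zero_of_ip_self (ha _ (Submodule.subset_span ⟨n, _, hau, u, hu, rfl⟩))
  let : AddCommGroup (symAlg G μ) := Module.addCommMonoidToAddCommGroup ℂ
  have h2 : U.dualCoannihilator.dualAnnihilator = U :=
    Subspace.dualCoannihilator_dualAnnihilator_eq (K := ℂ) (V := symAlg G μ)
  rw [← h2, h, Submodule.dualAnnihilator_bot]

end CoefficientForm

/-! ### The Haar element -/

section Haar

variable (G) in
/-- The sum of all paths of length zero. -/
def vertexSum : PathSpace G := ∑ v, ket G [v]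

/-- The sum of the coefficients of paths of length zero. -/
def vertexCoeff : PathSpace G →ₗ[ℂ] ℂ := ∑ v, ampL [v]

theorem vertexCoeff_apply (u : PathSpace G) : vertexCoeff u = ∑ v, amp u [v] := by
  simp only [vertexCoeff, LinearMap.sum_apply]; rfl

theorem vertexSum_mem : vertexSum G ∈ deg G 0 :=
  Submodule.sum_mem _ fun _ _ => ket_mem_deg rfl

theorem ip_vertexSum (u : PathSpace G) : ip u (vertexSum G) = conj (vertexCoeff u) := by
  simp [vertexSum, vertexCoeff_apply, ip_ket_right]

/-- The symmetry operator with all matrix elements `1` on paths of length zero, and `0` on longer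
essential paths. -/
def haar (hW : IsWeight G β μ) : symAlg G μ := (restrictEquiv hW).symm fun n =>
  match n with
  | 0 => (vertexCoeff.smulRight (⟨vertexSum G, by
      rw [hW.essential_eq_deg (by omega)]; exact vertexSum_mem⟩ : essential G β μ 0)) ∘ₗ
        (essential G β μ 0).subtype
  | _ + 1 => 0

theorem restrict_apply (hW : IsWeight G β μ) (F : GradedEnd G β μ) {n : ℕ} (u : essential G β μ n) :
    ((restrictEquiv hW).symm F).1 u = F n u := by
  have := congrArg (fun F => ((F n u : essential G β μ n) : PathSpace G))
    ((restrictEquiv hW).apply_symm_apply F)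
  exact this

theorem haar_deg_zero (hW : IsWeight G β μ) {u : PathSpace G} (hu : u ∈ deg G 0) :
    (haar hW).1 u = vertexCoeff u • vertexSum G := by
  rw [← hW.essential_eq_deg (by omega)] at hu
  exact restrict_apply hW _ (⟨u, hu⟩ : essential G β μ 0)

theorem haar_essential (hW : IsWeight G β μ) {n : ℕ} (hn : n ≠ 0) {u : PathSpace G}
    (hu : u ∈ essential G β μ n) : (haar hW).1 u = 0 := by
  cases n with
  | zero => exact absurd rfl hn
  | succ n => exact restrict_apply hW _ (⟨u, hu⟩ : essential G β μ (n + 1))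

/-- The adjoint of `haar` preserves essential vectors and `haar` kills those of positive length.
Hence the adjoint of `haar` annihilates the essential vector `haar u`, and `‖haar u‖² = 0`. -/
theorem eq_zero_of_haar_mem (hW : IsWeight G β μ) {n : ℕ} (hn : n ≠ 0) {u : PathSpace G}
    (hu : (haar hW).1 u ∈ essential G β μ n) : (haar hW).1 u = 0 := by
  have hA := adjoint_adj (haar hW).2
  have h1 := symAlg_essential hW (adj_mem (haar hW).2) hu
  have h2 : adj (haar hW).1 ((haar hW).1 u) = 0 := by
    apply eq_zero_of_ip_self
    rw [← hA, haar_essential hW hn h1, map_zero, LinearMap.zero_apply]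
  apply eq_zero_of_ip_self
  rw [hA, h2, map_zero]

variable (G μ) in
/-- Paths of length `n + m` annihilated away from the middle. -/
def splitEssential (n m : ℕ) : Submodule ℂ (PathSpace G) :=
  deg G (n + m) ⊓ ⨅ i, ⨅ _ : i + 1 ≠ n, LinearMap.ker (cap μ i)

theorem mem_splitEssential {n m : ℕ} {u : PathSpace G} : u ∈ splitEssential G μ n m ↔
    u ∈ deg G (n + m) ∧ ∀ i, i + 1 ≠ n → cap μ i u = 0 := by
  simp [splitEssential]

instance (n m : ℕ) : Module.Finite ℂ (splitEssential G μ n m) :=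
  Submodule.finiteDimensional_of_le (inf_le_left : _ ≤ deg G (n + m))

theorem symAlg_splitEssential {T : Module.End ℂ (PathSpace G)} (hT : T ∈ symAlg G μ) {n m : ℕ}
    {u : PathSpace G} (hu : u ∈ splitEssential G μ n m) : T u ∈ splitEssential G μ n m := by
  rw [mem_splitEssential] at hu ⊢
  refine ⟨symAlg_mem_deg hT hu.1, fun i hi => ?_⟩
  rw [← symAlg_cap hT, hu.2 i hi, map_zero]

theorem concat_mem_splitEssential (hW : IsWeight G β μ) {n m : ℕ} {ξ η : PathSpace G}
    (hξ : ξ ∈ essential G β μ n) (hη : η ∈ essential G β μ m) :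
    concat G (rev ξ) η ∈ splitEssential G μ n m := by
  rw [hW.mem_essential] at hξ hη
  have hr := rev_mem_deg hξ.1
  refine mem_splitEssential.2 ⟨concat_mem_deg hr hη.1, fun i hi => ?_⟩
  by_cases h : n ≤ i
  · obtain ⟨j, rfl⟩ := Nat.exists_eq_add_of_le h
    rw [cap_concat_right j hr, hη.2, map_zero]
  · have h2 : i + 2 ≤ n := by omega
    rw [cap_concat_left h2 hr hη.1]
    obtain ⟨k, rfl⟩ := Nat.exists_eq_add_of_le h2
    have hr' : rev ξ ∈ deg G (i + k + 2) := by rwa [show i + k + 2 = i + 2 + k by ring]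
    have h3 : rev (cap μ i (rev ξ)) = 0 := by
      rw [rev_cap (j := k) rfl hr', rev_rev, hξ.2]
    rw [← rev_rev (cap μ i (rev ξ)), h3]; simp

/-- Induction on `n`: the only possibly nonzero annihilation of `u`, the one in the middle, lands in
the same kind of space with both lengths lowered by one, where `haar` vanishes by induction. So all
annihilations of `haar u` vanish, it is essential of positive length, and `eq_zero_of_haar_mem`
applies. At `n = 0` the vector is essential itself. -/
theorem haar_splitEssential (hW : IsWeight G β μ) {n m : ℕ} {u : PathSpace G}
    (hu : u ∈ splitEssential G μ n m) (h : n = m → capN μ n u = 0) : (haar hW).1 u = 0 := by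
  induction n generalizing m u with
  | zero =>
    rw [mem_splitEssential, zero_add] at hu
    have he : u ∈ essential G β μ m := hW.mem_essential.2 ⟨hu.1, fun i => hu.2 i (by omega)⟩
    by_cases hm : m = 0
    · have : u = 0 := h hm.symm
      rw [this, map_zero]
    · exact haar_essential hW hm he
  | succ n ih =>
    obtain ⟨hd, hc⟩ := mem_splitEssential.1 hu
    have hcap : (haar hW).1 (cap μ n u) = 0 := by
      cases m with
      | zero => rw [cap_eq_zero_of_deg μ (by omega) hd, map_zero]
      | succ m =>
        refine ih (m := m) (mem_splitEssential.2 ⟨?_, fun i hi => ?_⟩) fun hnm => ?_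
        · refine cap_mem_deg μ n (n := n + m) ?_
          rwa [show n + m + 2 = n + 1 + (m + 1) by ring]
        · by_cases hin : i < n
          · obtain ⟨k, rfl⟩ := Nat.exists_eq_add_of_le (show i + 2 ≤ n by omega)
            rw [cap_cap_far, hc i (by omega), map_zero]
          · obtain ⟨k, rfl⟩ := Nat.exists_eq_add_of_le (show n ≤ i by omega)
            rw [← cap_cap_far, hc (n + 2 + k) (by omega), map_zero]
        · subst hnm; exact h rfl
    refine eq_zero_of_haar_mem hW (n := n + 1 + m) (by omega)
      (hW.mem_essential.2 ⟨symAlg_mem_deg (haar hW).2 hd, fun i => ?_⟩)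
    rw [← symAlg_cap (haar hW).2]
    by_cases hi : i + 1 = n + 1
    · obtain rfl : i = n := by omega
      exact hcap
    · rw [hc i hi, map_zero]

theorem eq_of_ip_eq {U : Submodule ℂ (PathSpace G)} {x y : PathSpace G} (hx : x ∈ U) (hy : y ∈ U)
    (h : ∀ z ∈ U, ip z x = ip z y) : x = y := by
  rw [← sub_eq_zero]
  apply eq_zero_of_ip_self
  rw [map_sub (ip (x - y)), h _ (sub_mem hx hy), sub_self]

theorem ext_deg_zero {u v : PathSpace G} (hu : u ∈ deg G 0) (hv : v ∈ deg G 0)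
    (h : ∀ x, amp u [x] = amp v [x]) : u = v := by
  apply ext_amp
  intro l hl
  by_cases hl' : l.length = 1
  · obtain ⟨x, rfl⟩ := List.length_eq_one_iff.1 hl'
    exact h x
  · rw [mem_deg_iff.1 hu l hl hl', mem_deg_iff.1 hv l hl hl']

/-- On these vectors `haar` only sees the full contraction `capN μ n`, so its form has rank at most
one. The constant is the inverse of the scalar by which the contraction acts after its own adjoint;
the vector `ζ₀` ensures that this scalar is not zero. -/
theorem exists_haar_form (hW : IsWeight G β μ) {n : ℕ} {ζ₀ : PathSpace G}
    (hζ₀ : ζ₀ ∈ splitEssential G μ n n) (h0 : capN μ n ζ₀ ≠ 0) :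
    ∃ κ : ℝ, 0 < κ ∧ ∀ ζ ∈ splitEssential G μ n n, ∀ ζ' ∈ splitEssential G μ n n,
      ip ζ ((haar hW).1 ζ') =
        κ * (conj (vertexCoeff (capN μ n ζ)) * vertexCoeff (capN μ n ζ')) := by
  set Q := splitEssential G μ n n with hQ
  -- `X u`, the projection of `cupN μ n u` to `Q`, is the adjoint of the contraction on `Q`. Vectors
  -- of `Q` are determined by their scalar products with `Q`, so `X` commutes with symmetry
  -- operators.
  have hX : ∀ u, ∃ y ∈ Q, ∀ z ∈ Q, ip z y = ip (capN μ n z) u := fun u => by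
    obtain ⟨y, hy, h⟩ := exists_decomposition ip ip_symm (fun _ => ip_self_pos) Q (cupN μ n u)
    refine ⟨y, hy, fun z hz => ?_⟩
    have := h z hz
    rw [map_sub, sub_eq_zero] at this
    rw [← this, (adjoint_cupN_capN n).symm]
  choose X hXQ hXip using hX
  have hdeg : ∀ z ∈ Q, capN μ n z ∈ deg G 0 := fun z hz =>
    capN_mem_deg n (by rw [two_mul]; exact (mem_splitEssential.1 hz).1)
  have hXT : ∀ {T}, T ∈ symAlg G μ → ∀ u, T (X u) = X (T u) := fun {T} hT u =>
    eq_of_ip_eq (symAlg_splitEssential hT (hXQ u)) (hXQ _) fun z hz => by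
      rw [hXip _ z hz, ← (adjoint_adj hT).symm, hXip _ _ (symAlg_splitEssential (adj_mem hT) hz),
        ← symAlg_capN (adj_mem hT), (adjoint_adj hT).symm]
  have hX0 : X 0 = 0 := eq_of_ip_eq (hXQ 0) (zero_mem _) fun z hz => by
    rw [hXip _ z hz, map_zero, map_zero]
  have hXX : ∀ u w, ip (capN μ n (X u)) w = ip (X u) (X w) := fun u w => (hXip w _ (hXQ u)).symm
  have horth : ∀ v w, v ≠ w → ip (X (ket G [v])) (X (ket G [w])) = 0 := fun v w hvw => by
    have h1 : fst v (X (ket G [v])) = X (ket G [v]) := by rw [hXT (fst_mem v)]; simp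
    rw [← h1, adjoint_fst, hXT (fst_mem v), fst_ket]
    simp [Ne.symm hvw, hX0]
  have hcapX : ∀ v, capN μ n (X (ket G [v])) =
      ((ip (X (ket G [v])) (X (ket G [v]))).re : ℂ) • ket G [v] := fun v => by
    refine ext_deg_zero (hdeg _ (hXQ _)) (Submodule.smul_mem _ _ (ket_mem_deg rfl)) fun w => ?_
    have h1 : amp (capN μ n (X (ket G [v]))) [w] = ip (X (ket G [w])) (X (ket G [v])) := by
      rw [← ip_symm, ← hXX, ip_ket_right, Complex.conj_conj]
    rw [h1, amp_smul, amp_ket]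
    by_cases hvw : v = w
    · subst hvw
      rw [if_pos ⟨rfl, by simp⟩, mul_one, ip_self, Complex.ofReal_re]
    · rw [horth w v (Ne.symm hvw), if_neg (by simp [hvw]), mul_zero]
  have hvs : ∀ v, (haar hW).1 (ket G [v]) = vertexSum G := fun v => by
    rw [haar_deg_zero hW (ket_mem_deg rfl), vertexCoeff_apply, Finset.sum_eq_single v]
    · simp [amp_ket]
    · intro w _ hw; simp [amp_ket, Ne.symm hw]
    · simp
  have hvc : ∀ v, vertexCoeff (ket G [v]) = 1 := fun v => by
    rw [vertexCoeff_apply, Finset.sum_eq_single v]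
    · simp [amp_ket]
    · intro w _ hw; simp [amp_ket, Ne.symm hw]
    · simp
  -- The same matrix element of `haar` between `X [v]` and `X [w]` is computed by moving `haar` past
  -- `X` and past the contraction; one computation gives `‖X [v]‖²`, the other `‖X [w]‖²`.
  have hconst : ∀ v w, (ip (X (ket G [v])) (X (ket G [v]))).re =
      (ip (X (ket G [w])) (X (ket G [w]))).re := fun v w => by
    have h1 : ip (X (ket G [v])) ((haar hW).1 (X (ket G [w]))) =
        ((ip (X (ket G [v])) (X (ket G [v]))).re : ℂ) := by
      rw [hXT (haar hW).2, ← hXX, hcapX, hvs, ip_vertexSum, map_smul, hvc]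
      simp
    have h2 : ip (X (ket G [v])) ((haar hW).1 (X (ket G [w]))) =
        ((ip (X (ket G [w])) (X (ket G [w]))).re : ℂ) := by
      rw [← ip_symm, hXip _ _ (symAlg_splitEssential (haar hW).2 (hXQ _)), ip_symm,
        ← symAlg_capN (haar hW).2, hcapX, map_smul, hvs, map_smul, ip_vertexSum, hvc]
      simp
    exact_mod_cast h1.symm.trans h2
  obtain ⟨v₀, hv₀⟩ : ∃ v, amp (capN μ n ζ₀) [v] ≠ 0 := by
    by_contra hne
    push Not at hne
    exact h0 (ext_deg_zero (hdeg _ hζ₀) (zero_mem _) fun x => by rw [hne, amp_zero])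
  set κ := (ip (X (ket G [v₀])) (X (ket G [v₀]))).re with hκ
  have hκpos : 0 < κ := by
    apply ip_self_pos
    intro hz
    have := hXip (ket G [v₀]) ζ₀ hζ₀
    rw [hz, map_zero, ip_ket_right] at this
    exact hv₀ (by simpa using this.symm)
  have hκ0 : (κ : ℂ) ≠ 0 := by exact_mod_cast hκpos.ne'
  have hcapX' : ∀ u ∈ deg G 0, capN μ n (X u) = (κ : ℂ) • u := fun u hu => by
    refine ext_deg_zero (hdeg _ (hXQ _)) (Submodule.smul_mem _ _ hu) fun w => ?_
    have h1 : amp (capN μ n (X u)) [w] = ip (X (ket G [w])) (X u) := by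
      rw [← ip_symm, ← hXX, ip_ket_right, Complex.conj_conj]
    rw [h1, ← hXX, hcapX, hconst w v₀, LinearMap.map_smulₛₗ, LinearMap.smul_apply, ip_ket_left,
      amp_smul, Complex.conj_ofReal, smul_eq_mul]
  refine ⟨κ⁻¹, inv_pos.2 hκpos, fun ζ hζ ζ' hζ' => ?_⟩
  -- The subtracted vector has the same contraction as `ζ'`, so `haar` kills the difference.
  have h1 : (haar hW).1 (ζ' - (κ : ℂ)⁻¹ • X (capN μ n ζ')) = 0 := by
    refine haar_splitEssential hW (sub_mem hζ' (Submodule.smul_mem _ _ (hXQ _))) fun _ => ?_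
    rw [map_sub, map_smul, hcapX' _ (hdeg _ hζ'), smul_smul, inv_mul_cancel₀ hκ0, one_smul, sub_self]
  rw [map_sub, sub_eq_zero, map_smul, hXT (haar hW).2] at h1
  rw [h1, map_smul, hXip _ _ hζ, haar_deg_zero hW (hdeg _ hζ'), map_smul, ip_vertexSum]
  simp only [smul_eq_mul]
  push_cast
  ring

end Haar

end FaceModel

end

noncomputable section
namespace FaceModel
set_option linter.unusedSectionVars false
open scoped Classical

variable {V : Type*} {G : SimpleGraph V} [Fintype V] {β : ℝ} {μ : V → ℝ}

/-! ### Positivity from an orthogonal spanning family -/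

section Sesquilinear

variable {E : Type*} [AddCommGroup E] [Module ℂ E]

/-- Used for `dualForm`, whose Hermitian symmetry is not visible from its definition but can be read
off from a spanning orthogonal family with real norms. -/
theorem form_symm_of_orthogonal {ι : Type*} [DecidableEq ι] (B : E →ₗ⋆[ℂ] E →ₗ[ℂ] ℂ) (f : ι → E) (c : ι → ℝ)
    (hB : ∀ i j, B (f i) (f j) = if i = j then (c i : ℂ) else 0)
    (hf : ∀ x, x ∈ Submodule.span ℂ (Set.range f)) (x y : E) : conj (B x y) = B y x := by
  have hx := hf x
  induction hx using Submodule.span_induction with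
  | zero => simp
  | add x x' _ _ hx hx' => simp [hx, hx']
  | smul z x _ hx => simp [hx]
  | mem x hx =>
    obtain ⟨i, rfl⟩ := hx
    have hy := hf y
    induction hy using Submodule.span_induction with
    | zero => simp
    | add x x' _ _ hx hx' => simp [hx, hx']
    | smul z x _ hx => simp [hx]
    | mem x hx =>
      obtain ⟨j, rfl⟩ := hx
      rw [hB, hB]
      by_cases h : i = j
      · subst h; simp
      · simp [h, Ne.symm h]

theorem form_pos_of_orthogonal {ι : Type*} [DecidableEq ι] (B : E →ₗ⋆[ℂ] E →ₗ[ℂ] ℂ) (f : ι → E) (c : ι → ℝ)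
    (hc : ∀ i, 0 < c i) (hB : ∀ i j, B (f i) (f j) = if i = j then (c i : ℂ) else 0)
    (hf : ∀ x, x ∈ Submodule.span ℂ (Set.range f)) (x : E) (hx : x ≠ 0) : 0 < (B x x).re := by
  obtain ⟨l, rfl⟩ := Finsupp.mem_span_range_iff_exists_finsupp.1 (hf x)
  have h1 : B (l.sum fun i z => z • f i) (l.sum fun i z => z • f i) =
      ((∑ i ∈ l.support, Complex.normSq (l i) * c i : ℝ) : ℂ) := by
    simp only [Finsupp.sum, map_sum, LinearMap.sum_apply, LinearMap.map_smulₛₗ, map_smul,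
      LinearMap.smul_apply, hB, smul_eq_mul]
    push_cast
    refine Finset.sum_congr rfl fun i hi => ?_
    rw [Finset.sum_eq_single i]
    · rw [if_pos rfl, ← Complex.mul_conj]; ring
    · intro j _ hj; simp [hj]
    · intro h; exact absurd hi h
  rw [h1, Complex.ofReal_re]
  refine Finset.sum_pos (fun i hi => mul_pos (Complex.normSq_pos.2 (Finsupp.mem_support_iff.1 hi))
    (hc i)) (Finsupp.support_nonempty_iff.2 ?_)
  rintro rfl
  simp at hx

end Sesquilinear

/-! ### The scalar product weighted with the end points -/

section WeightedProduct

theorem adjoint_endDiag (f : V → V → ℝ) :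
    Adjoint (endDiag (G := G) fun a b => (f a b : ℂ)) (endDiag fun a b => (f a b : ℂ)) := by
  apply adjoint_of_ket
  intro l m hl hm
  obtain ⟨a, b, ha, hb⟩ := exists_ends hl.1
  obtain ⟨c, d, hc, hd⟩ := exists_ends hm.1
  rw [amp_endDiag _ _ ha hb, amp_endDiag _ _ hc hd, amp_ket, amp_ket]
  by_cases h : l = m
  · subst h
    obtain rfl : a = c := by simpa [ha] using hc
    obtain rfl : b = d := by simpa [hb] using hd
    simp [hl]
  · simp [h, Ne.symm h]

variable (G μ) in
/-- The scalar product of paths weighted with the end points. -/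
def weightedIp : PathSpace G →ₗ⋆[ℂ] PathSpace G →ₗ[ℂ] ℂ where
  toFun u := ip u ∘ₗ endDiag (rt μ)
  map_add' u v := by ext; simp
  map_smul' z u := by ext; simp

theorem weightedIp_eq (u v : PathSpace G) : weightedIp G μ u v =
    ip (endDiag (fun a b => ((√√(μ a / μ b) : ℝ) : ℂ)) u)
      (endDiag (fun a b => ((√√(μ a / μ b) : ℝ) : ℂ)) v) := by
  rw [adjoint_endDiag fun a b => √√(μ a / μ b)]
  change ip u (endDiag (rt μ) v) = _
  congr 1
  apply ext_amp
  intro l hl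
  obtain ⟨a, b, ha, hb⟩ := exists_ends hl.1
  rw [amp_endDiag _ _ ha hb, amp_endDiag _ _ ha hb, amp_endDiag _ _ ha hb, ← mul_assoc,
    ← Complex.ofReal_mul, Real.mul_self_sqrt (Real.sqrt_nonneg _)]
  rfl

theorem weightedIp_symm (u v : PathSpace G) :
    conj (weightedIp G μ u v) = weightedIp G μ v u := by
  rw [weightedIp_eq, weightedIp_eq, ip_symm]

theorem weightedIp_pos (hμ : ∀ v, 0 < μ v) (u : PathSpace G) (hu : u ≠ 0) :
    0 < (weightedIp G μ u u).re := by
  rw [weightedIp_eq]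
  refine ip_self_pos fun h => hu ?_
  have h1 := endDiag_mul (G := G) (fun a b => ((√√(μ a / μ b) : ℝ) : ℂ)⁻¹)
    (fun a b => ((√√(μ a / μ b) : ℝ) : ℂ)) fun a b => inv_mul_cancel₀ (by
      rw [Complex.ofReal_ne_zero]
      exact (Real.sqrt_pos.2 (Real.sqrt_pos.2 (div_pos (hμ a) (hμ b)))).ne')
  have h2 := congrArg (fun f => f u) h1
  simp only [Module.End.mul_apply, h, map_zero, Module.End.one_apply] at h2
  exact h2.symm

/-- By `sum_wt_amp` the full contraction of `rev ξ` concatenated with `η` pairs equal paths in `ξ`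
and `η`, with the weight of their end points. -/
theorem vertexCoeff_capN (hμ : ∀ v, 0 < μ v) {n : ℕ} {ξ η : PathSpace G} (hξ : ξ ∈ deg G n)
    (hη : η ∈ deg G n) :
    vertexCoeff (capN μ n (concat G (rev ξ) η)) = weightedIp G μ ξ η := by
  have hd : concat G (rev ξ) η ∈ deg G (2 * n) := by
    rw [two_mul]; exact concat_mem_deg (rev_mem_deg hξ) hη
  rw [vertexCoeff_apply, ← sum_wt_amp hμ hd]
  change _ = ip ξ (endDiag (rt μ) η)
  rw [ip_eq_sum (symAlg_mem_deg (endDiag_mem (μ := μ) _) hη)]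
  refine Finset.sum_congr rfl fun r hr => ?_
  rw [mem_words] at hr
  by_cases h : IsPath G r
  · obtain ⟨a, b, ha, hb⟩ := exists_ends h.1
    rw [amp_concat_reverse ξ η h hξ hr, wt_eq ha hb, amp_endDiag _ _ ha hb]
    ring
  · rw [amp_of_not (fun h' => h (isPath_glueList h').2), amp_of_not h]; simp

end WeightedProduct

/-! ### The positive scalar product on the dual -/

section DualForm

variable [Module.Finite ℂ (symAlg G μ)]

/-- The scalar product on the dual given by the Haar functional. -/
def dualForm (hW : IsWeight G β μ) : DualAlg G μ →ₗ⋆[ℂ] DualAlg G μ →ₗ[ℂ] ℂ where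
  toFun φ := LinearMap.applyₗ (haar hW) ∘ₗ dualMul (dualStar φ)
  map_add' φ ψ := by ext; simp
  map_smul' z φ := by ext; simp

theorem dualForm_apply (hW : IsWeight G β μ) (φ ψ : DualAlg G μ) :
    dualForm hW φ ψ = dualMul (dualStar φ) ψ (haar hW) := rfl

/-- Left multiplication by the star is the adjoint of left multiplication; consequently orthogonal
complements of left ideals are left ideals. -/
theorem dualForm_mul (hW : IsWeight G β μ) (φ ψ χ : DualAlg G μ) :
    dualForm hW (dualMul φ ψ) χ = dualForm hW ψ (dualMul (dualStar φ) χ) := by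
  rw [dualForm_apply, dualForm_apply, dualStar_mul, dualMul_assoc]

theorem dualForm_coeff (hW : IsWeight G β μ) {n : ℕ} {ξ η : PathSpace G} (hξ : ξ ∈ deg G n)
    (hη : η ∈ deg G n) (ξ' η' : PathSpace G) : dualForm hW (coeff G μ ξ η) (coeff G μ ξ' η') =
      ip (concat G (rev ξ) ξ') ((haar hW).1 (concat G (rev η) η')) := by
  rw [dualForm_apply, star_coeff, coeff_mul (rev_mem_deg hξ) (rev_mem_deg hη), coeff_apply]

theorem dualForm_coeff_ne (hW : IsWeight G β μ) {n m : ℕ} (hnm : n ≠ m) {ξ η ξ' η' : PathSpace G}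
    (hξ : ξ ∈ essential G β μ n) (hη : η ∈ essential G β μ n) (hη' : η' ∈ essential G β μ m) :
    dualForm hW (coeff G μ ξ η) (coeff G μ ξ' η') = 0 := by
  rw [dualForm_coeff hW (essential_le_deg n hξ) (essential_le_deg n hη),
    haar_splitEssential hW (concat_mem_splitEssential hW hη hη') fun h => absurd h hnm, map_zero]

/-- The form is a matrix element of `haar` between two concatenations, and `exists_haar_form`
factors it into two contractions, which are weighted scalar products. The constant depends on the
length alone; without nonzero essential vectors it is arbitrary. -/
theorem exists_dualForm_coeff (hW : IsWeight G β μ) (n : ℕ) : ∃ κ : ℝ, 0 < κ ∧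
    ∀ ξ ∈ essential G β μ n, ∀ η ∈ essential G β μ n, ∀ ξ' ∈ essential G β μ n,
    ∀ η' ∈ essential G β μ n, dualForm hW (coeff G μ ξ η) (coeff G μ ξ' η') =
      κ * (conj (weightedIp G μ ξ ξ') * weightedIp G μ η η') := by
  by_cases hE : ∃ e ∈ essential G β μ n, e ≠ 0
  · obtain ⟨e, he, he0⟩ := hE
    have hed := essential_le_deg n he
    obtain ⟨κ, hκ, h⟩ := exists_haar_form hW (concat_mem_splitEssential hW he he) fun h0 => by
      have h1 := vertexCoeff_capN hW.pos hed hed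
      rw [h0, map_zero] at h1
      have h2 := weightedIp_pos hW.pos e he0
      rw [← h1] at h2
      simp at h2
    refine ⟨κ, hκ, fun ξ hξ η hη ξ' hξ' η' hη' => ?_⟩
    rw [dualForm_coeff hW (essential_le_deg n hξ) (essential_le_deg n hη),
      h _ (concat_mem_splitEssential hW hξ hξ') _ (concat_mem_splitEssential hW hη hη'),
      vertexCoeff_capN hW.pos (essential_le_deg n hξ) (essential_le_deg n hξ'),
      vertexCoeff_capN hW.pos (essential_le_deg n hη) (essential_le_deg n hη')]
  · push Not at hE
    refine ⟨1, one_pos, fun ξ hξ η hη ξ' hξ' η' hη' => ?_⟩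
    rw [hE ξ hξ]; simp

/-- Bases of essential paths orthonormal for `weightedIp` give orthogonal matrix elements of squared
norm `κ n`; different lengths are orthogonal by `dualForm_coeff_ne`. -/
theorem exists_orthogonal_family (hW : IsWeight G β μ) :
    ∃ (d : ℕ → ℕ) (f : ((n : ℕ) × (Fin (d n) × Fin (d n))) → DualAlg G μ)
      (c : ((n : ℕ) × (Fin (d n) × Fin (d n))) → ℝ), (∀ i, 0 < c i) ∧
      (∀ i j, dualForm hW (f i) (f j) = if i = j then (c i : ℂ) else 0) ∧
      ∀ φ, φ ∈ Submodule.span ℂ (Set.range f) := by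
  choose d e heE heo hes using fun n => exists_orthonormal (weightedIp G μ)
    (weightedIp_symm) (weightedIp_pos hW.pos) (essential G β μ n)
  choose κ hκ hform using exists_dualForm_coeff (G := G) hW
  refine ⟨d, fun i => coeff G μ (e i.1 i.2.1) (e i.1 i.2.2), fun i => κ i.1, fun i => hκ _, ?_, ?_⟩
  · rintro ⟨n, i, j⟩ ⟨m, k, l⟩
    by_cases hnm : n = m
    · subst hnm
      rw [hform n _ (heE _ _) _ (heE _ _) _ (heE _ _) _ (heE _ _), heo, heo]
      by_cases h1 : i = k <;> by_cases h2 : j = l <;> simp [h1, h2]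
    · rw [dualForm_coeff_ne hW hnm (heE _ _) (heE _ _) (heE _ _), if_neg]
      intro h
      exact hnm (congrArg Sigma.fst h)
  · intro φ
    have hφ : φ ∈ Submodule.span ℂ {φ | ∃ n, ∃ ξ ∈ essential G β μ n, ∃ η ∈ essential G β μ n,
      coeff G μ ξ η = φ} := by rw [span_coeff hW]; trivial
    refine Submodule.span_le.2 ?_ hφ
    rintro _ ⟨n, ξ, hξ, η, hη, rfl⟩
    rw [hes n ξ hξ, hes n η hη]
    simp only [map_sum, LinearMap.sum_apply, LinearMap.map_smulₛₗ, map_smul, LinearMap.smul_apply]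
    refine Submodule.sum_mem _ fun i _ => Submodule.smul_mem _ _ (Submodule.sum_mem _ fun j _ =>
      Submodule.smul_mem _ _ (Submodule.subset_span ?_))
    exact ⟨⟨n, j, i⟩, rfl⟩

theorem dualForm_symm (hW : IsWeight G β μ) (φ ψ : DualAlg G μ) :
    conj (dualForm hW φ ψ) = dualForm hW ψ φ := by
  obtain ⟨d, f, c, -, h, hs⟩ := exists_orthogonal_family (G := G) hW
  exact form_symm_of_orthogonal _ f c h hs φ ψ

theorem dualForm_pos (hW : IsWeight G β μ) (φ : DualAlg G μ) (hφ : φ ≠ 0) :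
    0 < (dualForm hW φ φ).re := by
  obtain ⟨d, f, c, hc, h, hs⟩ := exists_orthogonal_family (G := G) hW
  exact form_pos_of_orthogonal _ f c hc h hs φ hφ

end DualForm

end FaceModel

end

noncomputable section
namespace FaceModel
set_option linter.unusedSectionVars false
open scoped Classical Matrix

variable {V : Type*} {G : SimpleGraph V} [Fintype V] {β : ℝ} {μ : V → ℝ}

/-! ### Cells in the symmetric gauge and their representations of the dual -/

section CellSystem

/-- Cells in the symmetric gauge: `t a b` is Hermitian, and unitarity takes the form of the
commutation with creation and annihilation of back-and-forth steps. -/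
structure IsCellSystem (G : SimpleGraph V) (μ : V → ℝ) {ι : Type*} [Fintype ι] (src tgt : ι → V)
    (t : Matrix ι ι ℂ) : Prop where
  support : ∀ a b, t a b ≠ 0 → G.Adj (src a) (src b) ∧ G.Adj (tgt a) (tgt b)
  hermitian : ∀ a b, conj (t a b) = t b a
  row : ∀ a b v, tgt a = tgt b → G.Adj (src a) v → G.Adj (src b) v →
    ∑ c, (if src c = v then rt μ (tgt c) (tgt a) * (t a c * t c b) else 0) =
      if a = b then rt μ v (src a) else 0
  col : ∀ a b v, src a = src b → G.Adj (tgt a) v → G.Adj (tgt b) v →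
    ∑ c, (if tgt c = v then rt μ (src c) (src a) * (t a c * t c b) else 0) =
      if a = b then rt μ v (tgt a) else 0

variable {ι : Type*} [Fintype ι] {src tgt : ι → V} {t : Matrix ι ι ℂ}

/-- The system with bottom and top exchanged. -/
theorem IsCellSystem.swap (h : IsCellSystem G μ src tgt t) :
    IsCellSystem G μ tgt src (t.map conj) where
  support a b hab := by
    have := h.support a b fun h0 => hab (by simp [h0])
    exact ⟨this.2, this.1⟩
  hermitian a b := by simp [h.hermitian]
  row a b v h1 h2 h3 := by
    have := congrArg conj (h.col a b v h1 h2 h3)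
    simp only [map_sum, apply_ite conj, map_mul, conj_rt, map_zero] at this
    simpa using this
  col a b v h1 h2 h3 := by
    have := congrArg conj (h.row a b v h1 h2 h3)
    simp only [map_sum, apply_ite conj, map_mul, conj_rt, map_zero] at this
    simpa using this

variable (src tgt) in
/-- The projection onto the labels from `w` to `v`. -/
def endProj (v w : V) : Matrix ι ι ℂ :=
  Matrix.diagonal fun a => if tgt a = v ∧ src a = w then 1 else 0

variable (src tgt t) in
/-- The cells glued along vertical labels, with the first list on top and the second one at the
bottom. -/
def cells : List V → List V → Matrix ι ι ℂ
  | [v], [w] => endProj src tgt v w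
  | v :: x :: p, w :: y :: q => endProj src tgt v w * t * cells (x :: p) (y :: q)
  | _, _ => 0

@[simp] theorem cells_nil_left (q : List V) : cells src tgt t [] q = 0 := by simp [cells]
@[simp] theorem cells_nil_right (p : List V) : cells src tgt t p [] = 0 := by
  match p with
  | [] => simp [cells]
  | [_] => simp [cells]
  | _ :: _ :: _ => simp [cells]

theorem cells_singleton (v w : V) : cells src tgt t [v] [w] = endProj src tgt v w := by simp [cells]

theorem cells_cons {p q : List V} (hp : p ≠ []) (hq : q ≠ []) (v w : V) :
    cells src tgt t (v :: p) (w :: q) = endProj src tgt v w * t * cells src tgt t p q := by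
  cases p with
  | nil => exact absurd rfl hp
  | cons x p =>
    cases q with
    | nil => exact absurd rfl hq
    | cons y q => rw [cells]

theorem endProj_mul_endProj (v w x y : V) : endProj src tgt v w * endProj src tgt x y =
    if v = x ∧ w = y then endProj src tgt v w else 0 := by
  rw [endProj, endProj, Matrix.diagonal_mul_diagonal]
  by_cases h : v = x ∧ w = y
  · obtain ⟨rfl, rfl⟩ := h
    rw [if_pos ⟨rfl, rfl⟩]
    congr 1; ext a; split_ifs <;> simp
  · rw [if_neg h, Matrix.diagonal_eq_zero]
    ext a
    by_cases h1 : tgt a = v ∧ src a = w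
    · obtain ⟨rfl, rfl⟩ := h1
      simp [h]
    · simp [h1]

theorem endProj_mul_cells (v w : V) (p q : List V) : endProj src tgt v w * cells src tgt t p q =
    if p.head? = some v ∧ q.head? = some w then cells src tgt t p q else 0 := by
  match p, q with
  | [], q => simp
  | p, [] => simp
  | [x], [y] =>
    rw [cells_singleton, endProj_mul_endProj]
    by_cases h : v = x ∧ w = y
    · obtain ⟨rfl, rfl⟩ := h; simp
    · rw [if_neg h, if_neg]
      simpa [eq_comm] using h
  | [x], _ :: _ :: _ => simp [cells]
  | _ :: _ :: _, [y] => simp [cells]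
  | x :: x' :: p, y :: y' :: q =>
    rw [cells_cons (by simp) (by simp), ← mul_assoc, ← mul_assoc, endProj_mul_endProj]
    by_cases h : v = x ∧ w = y
    · obtain ⟨rfl, rfl⟩ := h; simp
    · rw [if_neg h, if_neg]
      · simp
      · simpa [eq_comm] using h

theorem cells_glueList {p q : List V} (h : p.length = q.length) (p' q' : List V) :
    cells src tgt t (glueList p p') (glueList q q') =
      cells src tgt t p q * cells src tgt t p' q' := by
  induction p generalizing q with
  | nil => simp
  | cons v p ih =>
    match p, q, h with
    | [], [w], _ =>
      rw [cells_singleton, endProj_mul_cells, glueList_singleton_left, glueList_singleton_left]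
      by_cases h1 : p'.head? = some v
      · by_cases h2 : q'.head? = some w
        · simp [h1, h2]
        · simp [h2]
      · simp [h1]
    | x :: p, w :: y :: q, h =>
      have ih' := ih (q := y :: q) (by simpa using h)
      rw [glueList_cons, glueList_cons, cells_cons (by simp) (by simp), mul_assoc, ← ih']
      by_cases h1 : glueList (x :: p) p' = []
      · simp [h1]
      · by_cases h2 : glueList (y :: q) q' = []
        · simp [h2]
        · rw [if_neg h1, if_neg h2, cells_cons h1 h2]

theorem endProj_apply (v w : V) (a b : ι) :
    endProj src tgt v w a b = if a = b ∧ tgt a = v ∧ src a = w then 1 else 0 := by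
  rw [endProj, Matrix.diagonal_apply]
  by_cases h : a = b <;> simp [h]

theorem endProj_mul_apply (v w : V) (M : Matrix ι ι ℂ) (a b : ι) :
    (endProj src tgt v w * M) a b = if tgt a = v ∧ src a = w then M a b else 0 := by
  rw [endProj, Matrix.diagonal_mul]; split_ifs <;> simp

theorem mul_endProj_apply (v w : V) (M : Matrix ι ι ℂ) (a b : ι) :
    (M * endProj src tgt v w) a b = if tgt b = v ∧ src b = w then M a b else 0 := by
  rw [endProj, Matrix.mul_diagonal]; split_ifs <;> simp

theorem IsCellSystem.cells_support (h : IsCellSystem G μ src tgt t) {p q : List V} {a b : ι}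
    (hab : cells src tgt t p q a b ≠ 0) : p.length = q.length ∧ IsPath G p ∧ IsPath G q ∧
      p.head? = some (tgt a) ∧ q.head? = some (src a) ∧ p.getLast? = some (tgt b) ∧
      q.getLast? = some (src b) := by
  induction p generalizing q a with
  | nil => simp at hab
  | cons v p ih =>
    match p, q with
    | [], [w] =>
      rw [cells_singleton, endProj_apply] at hab
      split_ifs at hab with h1
      · obtain ⟨rfl, rfl, rfl⟩ := h1; simp
      · exact absurd rfl hab
    | _, [] => simp at hab
    | [], _ :: _ :: _ => simp [cells] at hab
    | _ :: _, [_] => simp [cells] at hab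
    | x :: p, w :: y :: q =>
      rw [cells_cons (by simp) (by simp), mul_assoc, endProj_mul_apply] at hab
      split_ifs at hab with h1
      · obtain ⟨rfl, rfl⟩ := h1
        rw [Matrix.mul_apply] at hab
        obtain ⟨c, -, hc⟩ := Finset.exists_ne_zero_of_sum_ne_zero hab
        obtain ⟨i1, i2, i3, i4, i5, i6, i7⟩ := ih (right_ne_zero_of_mul hc)
        obtain ⟨j1, j2⟩ := h.support _ _ (left_ne_zero_of_mul hc)
        obtain rfl : x = tgt c := by simpa using i4
        obtain rfl : y = src c := by simpa using i5
        refine ⟨by simpa using i1, isPath_cons_cons.2 ⟨j2, i2⟩, isPath_cons_cons.2 ⟨j1, i3⟩, rfl,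
          rfl, ?_, ?_⟩
        · rw [List.getLast?_cons_cons]; exact i6
        · rw [List.getLast?_cons_cons]; exact i7
      · exact absurd rfl hab

theorem cells_of_length_ne {p q : List V} (hl : p.length ≠ q.length) :
    cells src tgt t p q = 0 := by
  induction p generalizing q with
  | nil => simp
  | cons v p ih =>
    rcases p with _ | ⟨x, p⟩ <;> rcases q with _ | ⟨w, _ | ⟨y, q⟩⟩
    · simp
    · simp at hl
    · simp [cells]
    · simp
    · simp [cells]
    · rw [cells_cons (by simp) (by simp), ih (by simpa using hl), Matrix.mul_zero]

theorem cells_map_conj (p q : List V) :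
    cells tgt src (t.map conj) q p = (cells src tgt t p q).map conj := by
  have hP : ∀ v w, endProj tgt src w v = (endProj src tgt v w).map conj := fun v w => by
    ext a b
    rw [Matrix.map_apply, endProj_apply, endProj_apply]
    simp only [and_comm (a := tgt a = v), apply_ite conj, map_one, map_zero]
  induction p generalizing q with
  | nil => simp
  | cons v p ih =>
    match p, q with
    | [], [w] => rw [cells_singleton, cells_singleton, hP]
    | _, [] => simp
    | [], _ :: _ :: _ => simp [cells]
    | _ :: _, [_] => simp [cells]
    | x :: p, w :: y :: q =>
      rw [cells_cons (p := y :: q) (by simp) (by simp), ih, hP,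
        cells_cons (p := x :: p) (by simp) (by simp), Matrix.map_mul, Matrix.map_mul]

theorem conjTranspose_endProj (v w : V) : (endProj src tgt v w)ᴴ = endProj src tgt v w := by
  rw [endProj, Matrix.diagonal_conjTranspose]
  congr 1; ext a; simp [apply_ite]

theorem IsCellSystem.conjTranspose (h : IsCellSystem G μ src tgt t) : tᴴ = t := by
  ext a b; rw [Matrix.conjTranspose_apply]; exact h.hermitian b a

theorem cells_cons_cons (v x w y : V) (p q : List V) : cells src tgt t (v :: x :: p) (w :: y :: q) =
    cells src tgt t [v, x] [w, y] * cells src tgt t (x :: p) (y :: q) := by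
  rw [cells_cons (by simp) (by simp), cells_cons (p := [x]) (by simp) (by simp), cells_singleton,
    mul_assoc _ (endProj src tgt x y), endProj_mul_cells]
  simp

theorem IsCellSystem.conjTranspose_cells (h : IsCellSystem G μ src tgt t) (p q : List V) :
    (cells src tgt t p q)ᴴ = cells src tgt t p.reverse q.reverse := by
  induction p generalizing q with
  | nil => simp
  | cons v p ih =>
    match p, q with
    | [], [w] => simp [cells_singleton, conjTranspose_endProj]
    | _, [] => simp
    | [], w :: y :: q =>
      rw [cells_of_length_ne (by simp), cells_of_length_ne (by simp)]; simp
    | x :: p, [w] =>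
      rw [cells_of_length_ne (by simp), cells_of_length_ne (by simp)]; simp
    | x :: p, w :: y :: q =>
      by_cases hl : p.length = q.length
      · have h1 : ∀ (a b : V) (l : List V), (a :: b :: l).reverse =
            glueList (b :: l).reverse [b, a] := fun a b l => by
          rw [List.reverse_cons, List.reverse_cons, glueList_append_cons, if_pos rfl]; simp
        rw [cells_cons_cons, Matrix.conjTranspose_mul, ih, h1, h1, cells_glueList (by simp [hl]),
          cells_cons (p := [x]) (q := [y]) (by simp) (by simp),
          cells_cons (p := [v]) (q := [w]) (by simp) (by simp), cells_singleton,
          cells_singleton, Matrix.conjTranspose_mul, Matrix.conjTranspose_mul,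
          conjTranspose_endProj, conjTranspose_endProj, h.conjTranspose, mul_assoc (endProj _ _ _ _)]
      · rw [cells_of_length_ne (by simp [hl]), cells_of_length_ne (by simp [hl])]; simp

variable (G src tgt t) in
/-- The operator on paths given by glued cells. -/
def cellOp (a b : ι) : Module.End ℂ (PathSpace G) := ofKernel fun p q => cells src tgt t p q a b

theorem cellOp_mem_deg (a b : ι) {n : ℕ} {u : PathSpace G} (hu : u ∈ deg G n) :
    cellOp G src tgt t a b u ∈ deg G n := ofKernel_mem_deg _ hu

theorem IsCellSystem.amp_cellOp (h : IsCellSystem G μ src tgt t) (a b : ι) (p q : List V) :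
    amp (cellOp G src tgt t a b (ket G q)) p = cells src tgt t p q a b := by
  rw [cellOp, amp_ofKernel]
  split_ifs with h1
  · rfl
  · by_contra hne
    have := h.cells_support (Ne.symm hne)
    exact h1 ⟨this.1, this.2.1, this.2.2.1⟩

theorem IsCellSystem.adjoint_cellOp (h : IsCellSystem G μ src tgt t) (a b : ι) :
    Adjoint (cellOp G src tgt t a b) (cellOp G tgt src (t.map conj) a b) :=
  adjoint_of_ket fun l m _ _ => by
    rw [h.amp_cellOp, h.swap.amp_cellOp, cells_map_conj, Matrix.map_apply]

/-- This is the condition `col`, with the sum over the middle labels sorted according to their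
bottom vertex `w`. -/
theorem IsCellSystem.sum_rt_cells (h : IsCellSystem G μ src tgt t) {a b c : V} (hab : G.Adj a b)
    (hbc : G.Adj b c) (v : V) : ∑ w, rt μ w v • cells src tgt t [a, b, c] [v, w, v] =
      if a = c then rt μ b a • cells src tgt t [a] [v] else 0 := by
  ext x y
  have h1 : ∀ w, cells src tgt t [a, b, c] [v, w, v] x y =
      if tgt x = a ∧ src x = v ∧ tgt y = c ∧ src y = v then
        ∑ z, if tgt z = b ∧ src z = w then t x z * t z y else 0 else 0 := fun w => by
    rw [cells_cons (by simp) (by simp), cells_cons (by simp) (by simp), cells_singleton, mul_assoc,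
      endProj_mul_apply, ← mul_assoc, ← mul_assoc, mul_endProj_apply]
    have : (t * endProj src tgt b w * t) x y =
        ∑ z, if tgt z = b ∧ src z = w then t x z * t z y else 0 := by
      rw [Matrix.mul_apply]
      refine Finset.sum_congr rfl fun z _ => ?_
      rw [mul_endProj_apply]; split_ifs <;> simp
    rw [this]
    by_cases h2 : tgt x = a <;> by_cases h3 : src x = v <;> by_cases h4 : tgt y = c <;>
      by_cases h5 : src y = v <;> simp [h2, h3, h4, h5]
  rw [Matrix.sum_apply]
  simp only [Matrix.smul_apply, h1, smul_eq_mul]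
  by_cases h2 : tgt x = a ∧ src x = v ∧ tgt y = c ∧ src y = v
  · obtain ⟨rfl, rfl, rfl, h3⟩ := h2
    simp only [h3, and_self, if_true]
    have h4 := h.col x y b h3.symm hab hbc.symm
    have h5 : ∑ w, rt μ w (src x) * ∑ z, (if tgt z = b ∧ src z = w then t x z * t z y else 0) =
        ∑ c, (if tgt c = b then rt μ (src c) (src x) * (t x c * t c y) else 0) := by
      simp only [Finset.mul_sum]
      rw [Finset.sum_comm]
      refine Finset.sum_congr rfl fun z _ => ?_
      rw [Finset.sum_eq_single (src z)]
      · by_cases hz : tgt z = b <;> simp [hz]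
      · intro w _ hw; simp [Ne.symm hw]
      · simp
    rw [h5, h4]
    by_cases hxy : x = y
    · subst hxy
      simp [cells_singleton, endProj_apply]
    · rw [if_neg hxy]
      split_ifs
      · simp [cells_singleton, endProj_apply, hxy]
      · simp
  · simp only [h2, if_false, mul_zero, Finset.sum_const_zero]
    split_ifs with hac
    · subst hac
      rw [Matrix.smul_apply, cells_singleton, endProj_apply, if_neg, smul_zero]
      rintro ⟨rfl, rfl, rfl⟩
      simp at h2
    · simp

/-- Creation changes only three consecutive vertices. The glued cells factor into the cells before,
over and after these vertices, and `sum_rt_cells` evaluates the middle factor. -/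
theorem IsCellSystem.cellOp_cup (h : IsCellSystem G μ src tgt t) (a b : ι) (i : ℕ)
    (u : PathSpace G) : cellOp G src tgt t a b (cup μ i u) = cup μ i (cellOp G src tgt t a b u) := by
  suffices hs : cellOp G src tgt t a b ∘ₗ cup μ i = cup μ i ∘ₗ cellOp G src tgt t a b from
    congrArg (fun f => f u) hs
  clear u
  apply ext_ket
  intro q hq
  simp only [LinearMap.comp_apply]
  obtain ⟨n, hn⟩ : ∃ n, q.length = n + 1 := Nat.exists_eq_succ_of_ne_zero (by simpa using hq.1)
  have hdeg : ket G q ∈ deg G n := ket_mem_deg hn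
  have hTdeg : cellOp G src tgt t a b (ket G q) ∈ deg G n := ofKernel_mem_deg _ hdeg
  by_cases hi : q.length ≤ i
  · rw [cup_eq_zero μ hi, map_zero, cup_eq_zero_of_deg μ (by omega) hTdeg]
  push Not at hi
  apply ext_amp
  intro p hp
  by_cases hpl : p.length = n + 2 + 1
  · obtain ⟨l', x, y, z, m', rfl, hl'⟩ := exists_split_three (l := p) (i := i) (by omega)
    obtain ⟨l, v, m, rfl, hl⟩ : ∃ l v m, q = l ++ v :: m ∧ i = l.length :=
      ⟨q.take i, q[i], q.drop (i + 1), by simp, by simp; omega⟩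
    rw [cup_append μ hl, map_sum, amp_sum]
    simp only [map_smul, amp_smul, h.amp_cellOp]
    have hxyz : IsPath G (x :: y :: z :: m') := (isPath_append_cons.1 hp).2
    have hxy := (isPath_cons_cons.1 hxyz).1
    have hyz := (isPath_cons_cons.1 (isPath_cons_cons.1 hxyz).2).1
    have h1 : amp (cup μ i (cellOp G src tgt t a b (ket G (l ++ v :: m))))
        (l' ++ x :: y :: z :: m') = if x = z then rt μ y x *
          cells src tgt t (l' ++ x :: m') (l ++ v :: m) a b else 0 := by
      rw [← ip_ket_left, ← (adjoint_cup_cap μ i).symm, cap_append μ hl' hp]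
      split_ifs
      · rw [LinearMap.map_smulₛₗ, LinearMap.smul_apply, ip_ket_left, h.amp_cellOp, conj_rt]; rfl
      · simp
    have hml : m'.length = m.length := by simp at hpl hn; omega
    have h2 : ∀ w, cells src tgt t (l' ++ x :: y :: z :: m') (l ++ v :: w :: v :: m) =
        cells src tgt t (l' ++ [x]) (l ++ [v]) * cells src tgt t [x, y, z] [v, w, v] *
          cells src tgt t (z :: m') (v :: m) := fun w => by
      rw [mul_assoc, ← cells_glueList (by simp), ← cells_glueList (by simp [← hl, ← hl'])]
      congr 1
      · rw [show [x, y, z] = [x, y] ++ [z] by rfl, glueList_append_cons, if_pos rfl]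
        simp [glueList_append_cons]
      · rw [show [v, w, v] = [v, w] ++ [v] by rfl, glueList_append_cons, if_pos rfl]
        simp [glueList_append_cons]
    have h3 : ∑ w, rt μ w v • cells src tgt t (l' ++ x :: y :: z :: m') (l ++ v :: w :: v :: m) =
        if x = z then rt μ y x • cells src tgt t (l' ++ x :: m') (l ++ v :: m) else 0 := by
      have h5 : ∀ (z : ℂ) (A B C : Matrix ι ι ℂ), z • (A * B * C) = A * (z • B) * C := by
        intro z A B C; rw [mul_smul_comm, smul_mul_assoc]
      simp only [h2, h5]
      rw [← Finset.sum_mul, ← Finset.mul_sum, h.sum_rt_cells hxy hyz]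
      by_cases hxz : x = z
      · subst hxz
        rw [if_pos rfl, if_pos rfl, mul_smul_comm, smul_mul_assoc, mul_assoc,
          ← cells_glueList (p := [x]) (q := [v]) rfl, ← cells_glueList (by simp [← hl, ← hl'])]
        simp [glueList_singleton_left, glueList_append_cons]
      · simp [hxz]
    have h4 := congrFun (congrFun h3 a) b
    rw [Matrix.sum_apply] at h4
    simp only [Matrix.smul_apply, smul_eq_mul] at h4
    rw [h1, h4]
    split_ifs <;> simp
  · rw [mem_deg_iff.1 (cup_mem_deg μ i hTdeg) p hp hpl,
      mem_deg_iff.1 (cellOp_mem_deg a b (cup_mem_deg μ i hdeg)) p hp hpl]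

/-- Commutation with `cap` is the adjoint of commutation with `cup` for the system with top and
bottom exchanged, whose operators are the adjoints. -/
theorem IsCellSystem.cellOp_mem (h : IsCellSystem G μ src tgt t) (a b : ι) :
    cellOp G src tgt t a b ∈ symAlg G μ := by
  refine ⟨fun n u hu => ofKernel_mem_deg _ hu, fun i u => h.cellOp_cup a b i u, fun i u => ?_⟩
  have h1 := (h.adjoint_cellOp a b).symm.comm_of_comm (adjoint_cup_cap μ i) (by
    ext1 p; ext1; exact (h.swap.cellOp_cup a b i _).symm)
  exact (congrArg (fun f => f u) h1).symm

/-- The representation of the dual given by a cell system. -/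
def IsCellSystem.rep (h : IsCellSystem G μ src tgt t) : DualAlg G μ →ₗ[ℂ] Matrix ι ι ℂ where
  toFun φ := Matrix.of fun a b => φ ⟨_, h.cellOp_mem a b⟩
  map_add' φ ψ := by ext; simp
  map_smul' z φ := by ext; simp

theorem IsCellSystem.rep_apply (h : IsCellSystem G μ src tgt t) (φ : DualAlg G μ) (a b : ι) :
    h.rep φ a b = φ ⟨_, h.cellOp_mem a b⟩ := rfl

theorem IsCellSystem.rep_mat (h : IsCellSystem G μ src tgt t) (p q : List V) :
    h.rep (mat G μ p q) = cells src tgt t p q := by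
  ext a b; rw [h.rep_apply, mat_apply, h.amp_cellOp]

variable [Module.Finite ℂ (symAlg G μ)]

theorem IsCellSystem.rep_mul (h : IsCellSystem G μ src tgt t) (φ ψ : DualAlg G μ) :
    h.rep (dualMul φ ψ) = h.rep φ * h.rep ψ := by
  induction φ using dual_induction with
  | h0 => simp
  | hadd φ φ' h1 h2 => simp only [map_add, LinearMap.add_apply, h1, h2, add_mul]
  | hsmul z φ h1 => simp only [map_smul, LinearMap.smul_apply, h1, smul_mul_assoc]
  | hmat p q hp hq hpq =>
  induction ψ using dual_induction with
  | h0 => simp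
  | hadd φ φ' h1 h2 => simp only [map_add, h1, h2, mul_add]
  | hsmul z φ h1 => simp only [map_smul, h1, mul_smul_comm]
  | hmat p' q' hp' hq' hpq' => rw [dualMul_mat hpq, h.rep_mat, h.rep_mat, h.rep_mat, cells_glueList hpq]

theorem IsCellSystem.rep_star (h : IsCellSystem G μ src tgt t) (φ : DualAlg G μ) :
    h.rep (dualStar φ) = (h.rep φ)ᴴ := by
  induction φ using dual_induction with
  | h0 => simp
  | hadd φ φ' h1 h2 => simp only [map_add, h1, h2, Matrix.conjTranspose_add]
  | hsmul z φ h1 =>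
    rw [LinearMap.map_smulₛₗ, map_smul, map_smul, h1, Matrix.conjTranspose_smul]; rfl
  | hmat p q hp hq hpq => rw [dualStar_mat, h.rep_mat, h.rep_mat, h.conjTranspose_cells]

theorem IsCellSystem.rep_one (h : IsCellSystem G μ src tgt t) : h.rep (dualOne G μ) = 1 := by
  ext a b
  simp only [dualOne, map_sum, h.rep_mat, cells_singleton, Matrix.sum_apply, endProj_apply]
  rw [Finset.sum_eq_single (tgt a), Finset.sum_eq_single (src a)]
  · simp [Matrix.one_apply]
  · intro v _ hv; simp [Ne.symm hv]
  · simp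
  · intro v _ hv; simp [Ne.symm hv]
  · simp

end CellSystem

end FaceModel

end

noncomputable section
namespace FaceModel
set_option linter.unusedSectionVars false
set_option linter.unusedSimpArgs false
open scoped Classical Matrix

variable {V : Type*} {G : SimpleGraph V} [Fintype V] {β : ℝ} {μ : V → ℝ}

/-! ### Cell systems are normalised symmetry families -/

section Families

variable {ι : Type*} [Fintype ι] {src tgt : ι → V} {t : Matrix ι ι ℂ}

theorem EPath.first_eq {p : EPath G} {v : V} (h : p.1.head? = some v) : p.first = v := by
  rw [List.head?_eq_some_head p.2.1] at h
  exact Option.some.inj h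

theorem EPath.last_eq {p : EPath G} {v : V} (h : p.1.getLast? = some v) : p.last = v := by
  rw [List.getLast?_eq_some_getLast p.2.1] at h
  exact Option.some.inj h

theorem jones_comm_of_mem (hμ : ∀ v, 0 < μ v) {T : Module.End ℂ (PathSpace G)}
    (hT : T ∈ symAlg G μ) (i : ℕ) : T ∘ₗ jones G β μ i = jones G β μ i ∘ₗ T := by
  rw [jones_eq μ hμ]
  ext1 p
  ext1
  simp only [LinearMap.comp_apply, LinearMap.smul_apply, map_smul, symAlg_cup hT, symAlg_cap hT]

theorem IsCellSystem.cellOp_concat (h : IsCellSystem G μ src tgt t) (a b : ι) (ξ ρ : PathSpace G) :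
    cellOp G src tgt t a b (concat G ξ ρ) =
      ∑ c, concat G (cellOp G src tgt t a c ξ) (cellOp G src tgt t c b ρ) := by
  induction ξ using ket_induction with
  | h0 => simp
  | hadd u w hu hw => simp only [map_add, LinearMap.add_apply, hu, hw, Finset.sum_add_distrib]
  | hket z p hp =>
  induction ρ using ket_induction with
  | h0 => simp
  | hadd u w hu hw => simp only [map_add, hu, hw, Finset.sum_add_distrib]
  | hket z' q hq =>
  simp only [map_smul, LinearMap.smul_apply, ← Finset.smul_sum]
  congr 2
  obtain ⟨n, hn⟩ : ∃ n, p.length = n + 1 := Nat.exists_eq_succ_of_ne_zero (by simpa using hp.1)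
  obtain ⟨m, hm⟩ : ∃ n, q.length = n + 1 := Nat.exists_eq_succ_of_ne_zero (by simpa using hq.1)
  have h1 : ∀ {n : ℕ} {p : List V}, p.length = n + 1 → ∀ a c, cellOp G src tgt t a c (ket G p) =
      ∑ r ∈ words V (n + 1), cells src tgt t r p a c • ket G r := fun {n p} hn a c => by
    rw [eq_sum_words (cellOp_mem_deg a c (ket_mem_deg hn))]
    simp only [h.amp_cellOp]
  have h2 : ∀ c, concat G (cellOp G src tgt t a c (ket G p)) (cellOp G src tgt t c b (ket G q)) =
      ∑ r ∈ words V (n + 1), ∑ s ∈ words V (m + 1),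
        (cells src tgt t r p a c * cells src tgt t s q c b) • ket G (glueList r s) := fun c => by
    rw [h1 hn, h1 hm]
    simp only [map_sum, LinearMap.sum_apply, map_smul, LinearMap.smul_apply, concat_ket]
    rw [Finset.sum_comm]
    refine Finset.sum_congr rfl fun r _ => ?_
    rw [Finset.smul_sum]
    exact Finset.sum_congr rfl fun s _ => by rw [smul_smul, mul_comm]
  simp only [h2]
  rw [Finset.sum_comm]
  have h3 : ∀ r ∈ words V (n + 1), ∑ c, ∑ s ∈ words V (m + 1),
        (cells src tgt t r p a c * cells src tgt t s q c b) • ket G (glueList r s) =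
      ∑ s ∈ words V (m + 1),
        cells src tgt t (glueList r s) (glueList p q) a b • ket G (glueList r s) := fun r hr => by
    rw [Finset.sum_comm]
    refine Finset.sum_congr rfl fun s hs => ?_
    rw [mem_words] at hr
    rw [← Finset.sum_smul, cells_glueList (hr.trans hn.symm), Matrix.mul_apply]
  rw [Finset.sum_congr rfl h3, sum_words_glueList n m
    (fun l => cells src tgt t l (glueList p q) a b • ket G l) (by simp), concat_ket]
  by_cases hpq : glueList p q = []
  · simp [hpq]
  · refine h1 ?_ a b
    rw [glueList] at hpq ⊢
    split_ifs at hpq ⊢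
    · simp [hn, hm]; omega
    · exact absurd rfl hpq

theorem IsCellSystem.isSymmetryFamily (hμ : ∀ v, 0 < μ v) (h : IsCellSystem G μ src tgt t) :
    IsSymmetryFamily G β μ src tgt (cellOp G src tgt t) where
  endpoints a b p q hpq := by
    rw [single_eq_ket, apply_eq_amp, h.amp_cellOp] at hpq
    obtain ⟨-, -, -, h1, h2, h3, h4⟩ := h.cells_support hpq
    exact ⟨EPath.first_eq h2, EPath.last_eq h4, EPath.first_eq h1, EPath.last_eq h3⟩
  length a b p q hpq := by
    rw [single_eq_ket, apply_eq_amp, h.amp_cellOp] at hpq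
    rw [EPath.length, EPath.length, (h.cells_support hpq).1]
  continuity := h.cellOp_concat
  involution a b ξ := by
    rw [← rev_apply, ← rev_apply]
    induction ξ using ket_induction with
    | h0 => simp
    | hadd u w hu hw => simp only [map_add, hu, hw]
    | hket z q hq =>
      simp only [LinearMap.map_smulₛₗ, map_smul]
      congr 1
      apply ext_amp
      intro p hp
      have h1 := congrFun (congrFun (h.conjTranspose_cells p.reverse q) a) b
      rw [Matrix.conjTranspose_apply, List.reverse_reverse] at h1
      rw [rev_ket, amp_rev, h.amp_cellOp, h.amp_cellOp]
      exact h1.symm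
  evolution a b i := jones_comm_of_mem hμ (h.cellOp_mem a b) i

theorem sqrt_mul_div (hμ : ∀ v, 0 < μ v) (a b c d : V) :
    ((√(μ a * μ b / (μ c * μ d)) : ℝ) : ℂ) = rt μ b c * rt μ a d := by
  rw [rt, rt, ← Complex.ofReal_mul, ← Real.sqrt_mul (div_pos (hμ b) (hμ c)).le,
    div_mul_div_comm, mul_comm (μ b)]

theorem IsCellSystem.isNormalizedFamily (hμ : ∀ v, 0 < μ v) (h : IsCellSystem G μ src tgt t) :
    IsNormalizedFamily G μ src tgt (cellOp G src tgt t) where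
  vertex a b v := by
    apply ext_amp
    intro p hp
    rw [h.amp_cellOp]
    by_cases hl : p.length = 1
    · obtain ⟨w, rfl⟩ := List.length_eq_one_iff.1 hl
      rw [cells_singleton, endProj_apply]
      by_cases h1 : a = b ∧ v = src a
      · obtain ⟨rfl, rfl⟩ := h1
        simp [amp_ket]
      · rw [if_neg (fun h2 => h1 ⟨h2.1, h2.2.2.symm⟩), if_neg h1, amp_zero]
    · rw [cells_of_length_ne (by simpa using hl)]
      split_ifs
      · rw [amp_ket, if_neg]
        · rfl
        · rintro ⟨rfl, -⟩; simp at hl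
      · simp
  contraction a b v hab h1 h2 := by
    have h3 := congrFun (congrFun (h.swap.sum_rt_cells h1 h2 (tgt a)) a) b
    rw [Matrix.sum_apply] at h3
    simp only [Matrix.smul_apply, smul_eq_mul, cells_map_conj, Matrix.map_apply] at h3
    have h4 : ∑ w, rt μ w (tgt a) * cells src tgt t [tgt a, w, tgt a] [src a, v, src b] a b =
        if a = b then rt μ v (src a) else 0 := by
      have h5 := congrArg conj h3
      simp only [map_sum, map_mul, conj_rt, Complex.conj_conj] at h5
      rw [h5]
      by_cases hs : src a = src b
      · rw [if_pos hs, cells_singleton]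
        change conj (rt μ v (src a) * conj (endProj src tgt (tgt a) (src a) a b)) = _
        rw [endProj_apply, map_mul, Complex.conj_conj, conj_rt]
        by_cases hab : a = b <;> simp [hab]
      · rw [if_neg hs, if_neg (fun h => hs (congrArg src h))]; simp
    have h6 : ∀ w, ((√(μ (src a) * μ w / (μ (tgt a) * μ v)) : ℝ) : ℂ) *
        amp (cellOp G src tgt t a b (ket G [src a, v, src b])) [tgt a, w, tgt a] =
        rt μ (src a) v * (rt μ w (tgt a) *
          cells src tgt t [tgt a, w, tgt a] [src a, v, src b] a b) := fun w => by
      rw [h.amp_cellOp, sqrt_mul_div hμ]; ring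
    simp only [h6]
    rw [← Finset.mul_sum, h4]
    split_ifs
    · rw [rt_mul_rt hμ, rt_self hμ]
    · rw [mul_zero]

/-- By continuity the values on a path are determined by those on its edges. -/
theorem IsSymmetryFamily.ext {T T' : ι → ι → Module.End ℂ (PathSpace G)}
    (h : IsSymmetryFamily G β μ src tgt T) (h' : IsSymmetryFamily G β μ src tgt T')
    (h0 : ∀ a b v, T a b (ket G [v]) = T' a b (ket G [v]))
    (h1 : ∀ a b v w, T a b (ket G [v, w]) = T' a b (ket G [v, w])) : T = T' := by
  suffices hs : ∀ l : List V, ∀ a b, T a b (ket G l) = T' a b (ket G l) by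
    ext1 a; ext1 b; exact ext_ket fun l _ => hs l a b
  intro l
  induction l with
  | nil => simp
  | cons v l ih =>
    intro a b
    cases l with
    | nil => exact h0 a b v
    | cons x l =>
      have hk : ket G (v :: x :: l) = concat G (ket G [v, x]) (ket G (x :: l)) := by
        rw [concat_ket, show [v, x] = [v] ++ [x] by rfl, glueList_append_cons, if_pos rfl]; rfl
      rw [hk, h.continuity, h'.continuity]
      simp only [h1, ih]

/-! ### Normalised Hermitian symmetry families come from cell systems -/

section OfFamily

variable {T : ι → ι → Module.End ℂ (PathSpace G)}

variable (src tgt T) in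
/-- The matrix elements of a family between edges. -/
def edgeCells : Matrix ι ι ℂ := Matrix.of fun a b => amp (T a b (ket G [src a, src b])) [tgt a, tgt b]

theorem IsSymmetryFamily.apply_edge (h : IsSymmetryFamily G β μ src tgt T) (a b : ι) (x y : V) :
    T a b (ket G [x, y]) =
      if x = src a ∧ y = src b then edgeCells src tgt T a b • ket G [tgt a, tgt b] else 0 := by
  apply ext_amp
  intro p hp
  by_cases hxy : IsPath G [x, y]
  swap
  · rw [ket_of_not hxy, map_zero, amp_zero]
    split_ifs with h1
    · obtain ⟨rfl, rfl⟩ := h1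
      rw [edgeCells, Matrix.of_apply, ket_of_not hxy]; simp
    · simp
  by_cases hne : amp (T a b (ket G [x, y])) p = 0
  · rw [hne]
    split_ifs with h1
    · obtain ⟨rfl, rfl⟩ := h1
      rw [amp_smul, amp_ket]
      by_cases h2 : [tgt a, tgt b] = p
      · subst h2; rw [edgeCells, Matrix.of_apply, hne, zero_mul]
      · simp [h2]
    · simp
  · have hne' := hne
    rw [ket_of_isPath hxy, amp_of_isPath hp] at hne'
    obtain ⟨h1, h2, h3, h4⟩ := h.endpoints a b _ _ hne'
    have h5 := h.length a b _ _ hne'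
    obtain rfl : x = src a := h1
    obtain rfl : y = src b := h2
    have h6 : p = [tgt a, tgt b] := by
      change p.length - 1 = 1 at h5
      change p.head _ = _ at h3
      change p.getLast _ = _ at h4
      match p, h5 with
      | [c, d], _ =>
        obtain rfl : c = tgt a := h3
        obtain rfl : d = tgt b := h4
        rfl
    subst h6
    rw [if_pos ⟨rfl, rfl⟩, amp_smul, amp_ket, if_pos ⟨rfl, hp⟩, mul_one]; rfl

theorem edgeCells_support (a b : ι)
    (hab : edgeCells src tgt T a b ≠ 0) : G.Adj (src a) (src b) ∧ G.Adj (tgt a) (tgt b) := by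
  rw [edgeCells, Matrix.of_apply] at hab
  constructor
  · by_contra hne
    rw [ket_of_not (by simpa using hne), map_zero, amp_zero] at hab
    exact hab rfl
  · by_contra hne
    exact hab (amp_of_not (by simpa using hne) _)

theorem IsSymmetryFamily.conj_edgeCells (h : IsSymmetryFamily G β μ src tgt T) (a b : ι) :
    conj (edgeCells src tgt T a b) = edgeCells src tgt T b a := by
  have h1 := h.involution b a (ket G [src a, src b])
  rw [← rev_apply, ← rev_apply, rev_ket] at h1
  rw [edgeCells, Matrix.of_apply, Matrix.of_apply]
  have h2 := congrArg (fun u => amp u [tgt b, tgt a]) h1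
  simp only [amp_rev] at h2
  simpa using h2.symm

/-- Continuity writes the matrix element at `src a, v, src b` as a sum of products of edge cells
over the labels in the middle. The normalisation condition then becomes the condition `row`, up to
the factor `rt μ (src a) v`. -/
theorem IsSymmetryFamily.row_of_normalized (hμ : ∀ v, 0 < μ v)
    (h : IsSymmetryFamily G β μ src tgt T)
    (hN : IsNormalizedFamily G μ src tgt T) (a b : ι) (v : V) (hab : tgt a = tgt b)
    (h1 : G.Adj (src a) v) (h2 : G.Adj (src b) v) :
    ∑ c, (if src c = v then rt μ (tgt c) (tgt a) *
      (edgeCells src tgt T a c * edgeCells src tgt T c b) else 0) =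
      if a = b then rt μ v (src a) else 0 := by
  have hk : ket G [src a, v, src b] = concat G (ket G [src a, v]) (ket G [v, src b]) := by
    rw [concat_ket, show [src a, v] = [src a] ++ [v] by rfl, glueList_append_cons, if_pos rfl]; rfl
  have h3 : ∀ w, amp (T a b (ket G [src a, v, src b])) [tgt a, w, tgt a] =
      ∑ c, if src c = v ∧ tgt c = w then
        edgeCells src tgt T a c * edgeCells src tgt T c b else 0 := fun w => by
    rw [hk, h.continuity, amp_sum]
    refine Finset.sum_congr rfl fun c _ => ?_
    rw [h.apply_edge, h.apply_edge]
    by_cases hc : src c = v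
    · subst hc
      simp only [and_self, true_and, if_true, map_smul, LinearMap.smul_apply, amp_smul]
      rw [concat_ket, show [tgt a, tgt c] = [tgt a] ++ [tgt c] by rfl, glueList_append_cons,
        if_pos rfl, ← hab]
      by_cases hw : tgt c = w
      · subst hw
        rw [if_pos rfl]
        by_cases hz : edgeCells src tgt T a c = 0
        · simp [hz]
        by_cases hz' : edgeCells src tgt T c b = 0
        · simp [hz']
        have h4 := (edgeCells_support a c hz).2
        have h5 := (edgeCells_support c b hz').2
        rw [← hab] at h5
        rw [amp_ket, if_pos ⟨rfl, by simp [h4, h5]⟩]; ring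
      · rw [if_neg hw, amp_ket, if_neg]
        · simp
        · rintro ⟨h4, -⟩
          simp only [List.singleton_append, List.cons.injEq, and_true, true_and] at h4
          exact hw h4
    · simp [hc, Ne.symm hc]
  have h4 := hN.contraction a b v hab h1 h2.symm
  simp only [h3, sqrt_mul_div hμ, Finset.mul_sum] at h4
  rw [Finset.sum_comm] at h4
  have h5 : ∀ c, ∑ w, rt μ w (tgt a) * rt μ (src a) v * (if src c = v ∧ tgt c = w then
        edgeCells src tgt T a c * edgeCells src tgt T c b else 0) = rt μ (src a) v *
      (if src c = v then rt μ (tgt c) (tgt a) *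
      (edgeCells src tgt T a c * edgeCells src tgt T c b) else 0) := fun c => by
    rw [Finset.sum_eq_single (tgt c)]
    · by_cases hc : src c = v
      · simp only [hc, and_self, if_true]; ring
      · simp [hc]
    · intro w _ hw; simp [Ne.symm hw]
    · simp
  simp only [h5] at h4
  rw [← Finset.mul_sum] at h4
  have h6 := congrArg (fun z => rt μ v (src a) * z) h4
  simp only [← mul_assoc, rt_mul_rt hμ, rt_self hμ, one_mul] at h6
  simp only [← mul_assoc]
  rw [h6]
  split_ifs <;> simp

/-- The involution of the labels exchanges bottom and top and, by Hermiticity, conjugates the edge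
cells. So the condition `col` is the conjugate of the condition `row` for the flipped labels. -/
theorem IsSymmetryFamily.isCellSystem (hμ : ∀ v, 0 < μ v) (h : IsSymmetryFamily G β μ src tgt T)
    (hH : IsHermitianFamily src tgt T) (hN : IsNormalizedFamily G μ src tgt T) :
    IsCellSystem G μ src tgt (edgeCells src tgt T) where
  support := edgeCells_support
  hermitian := h.conj_edgeCells
  row := h.row_of_normalized hμ hN
  col a b v hab h1 h2 := by
    obtain ⟨f, hf, hsf, hadj⟩ := hH
    have htf : ∀ a, tgt (f a) = src a := fun a => by rw [← hsf, hf]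
    have hc : ∀ a b, edgeCells src tgt T (f a) (f b) = conj (edgeCells src tgt T a b) := by
      intro a b
      rw [edgeCells, Matrix.of_apply, Matrix.of_apply, hsf, hsf, htf, htf]
      by_cases hp : IsPath G [src a, src b]
      · by_cases hq : IsPath G [tgt a, tgt b]
        · have := hadj a b (EPath.mk _ hp) (EPath.mk _ hq)
          rw [ket_of_isPath hp, ket_of_isPath hq, amp_of_isPath hp, amp_of_isPath hq, this,
            Complex.conj_conj]
        · rw [ket_of_not hq, amp_of_not hq]; simp
      · rw [ket_of_not hp, amp_of_not hp]; simp
    have h3 := h.row_of_normalized hμ hN (f a) (f b) v (by rw [htf, htf, hab])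
      (by rwa [hsf]) (by rwa [hsf])
    rw [← Equiv.sum_comp (Function.Involutive.toPerm f hf)] at h3
    have hp : ∀ c, Function.Involutive.toPerm f hf c = f c := fun _ => rfl
    simp only [hp, hsf, htf, hc, (Function.Involutive.injective hf).eq_iff]
      at h3
    have h4 := congrArg conj h3
    simpa only [map_sum, apply_ite conj, map_mul, conj_rt, Complex.conj_conj, map_zero] using h4

theorem IsSymmetryFamily.eq_cellOp (hμ : ∀ v, 0 < μ v) (h : IsSymmetryFamily G β μ src tgt T)
    (hH : IsHermitianFamily src tgt T) (hN : IsNormalizedFamily G μ src tgt T) :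
    T = cellOp G src tgt (edgeCells src tgt T) := by
  have hc := h.isCellSystem hμ hH hN
  refine h.ext (hc.isSymmetryFamily hμ) (fun a b v => ?_) (fun a b v w => ?_)
  · rw [hN.vertex, (hc.isNormalizedFamily hμ).vertex]
  · rw [h.apply_edge, (hc.isSymmetryFamily (β := β) hμ).apply_edge]
    congr 2
    change edgeCells src tgt T a b = amp (cellOp G src tgt (edgeCells src tgt T) a b _) _
    rw [hc.amp_cellOp, cells_cons (by simp) (by simp), cells_singleton, mul_assoc, endProj_mul_apply,
      if_pos ⟨rfl, rfl⟩, mul_endProj_apply, if_pos ⟨rfl, rfl⟩]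

end OfFamily

/-! ### Relabelling and direct sums of cell systems -/

section Operations

variable {κ : Type*} [Fintype κ]

theorem IsCellSystem.reindex (h : IsCellSystem G μ src tgt t) (e : κ ≃ ι) :
    IsCellSystem G μ (src ∘ e) (tgt ∘ e) (t.submatrix e e) where
  support a b hab := h.support _ _ hab
  hermitian a b := h.hermitian _ _
  row a b v h1 h2 h3 := by
    have := h.row (e a) (e b) v h1 h2 h3
    rw [← Equiv.sum_comp e] at this
    simp only [e.injective.eq_iff] at this
    convert this using 2 <;> rfl
  col a b v h1 h2 h3 := by
    have := h.col (e a) (e b) v h1 h2 h3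
    rw [← Equiv.sum_comp e] at this
    simp only [e.injective.eq_iff] at this
    convert this using 2 <;> rfl

theorem cells_reindex (e : κ ≃ ι) (p q : List V) :
    cells (src ∘ e) (tgt ∘ e) (t.submatrix e e) p q = (cells src tgt t p q).submatrix e e := by
  have hP : ∀ v w, endProj (src ∘ e) (tgt ∘ e) v w = (endProj src tgt v w).submatrix e e :=
    fun v w => by
      ext a b
      simp [endProj_apply]
  induction p generalizing q with
  | nil => simp
  | cons v p ih =>
    match p, q with
    | [], [w] => rw [cells_singleton, cells_singleton, hP]
    | _, [] => simp
    | [], _ :: _ :: _ => simp [cells]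
    | _ :: _, [_] => simp [cells]
    | x :: p, w :: y :: q =>
      rw [cells_cons (p := x :: p) (by simp) (by simp), ih, hP,
        cells_cons (p := x :: p) (by simp) (by simp), Matrix.submatrix_mul_equiv,
        Matrix.submatrix_mul_equiv]

variable {src' tgt' : κ → V} {t' : Matrix κ κ ℂ}

theorem IsCellSystem.directSum (h : IsCellSystem G μ src tgt t)
    (h' : IsCellSystem G μ src' tgt' t') :
    IsCellSystem G μ (Sum.elim src src') (Sum.elim tgt tgt') (Matrix.fromBlocks t 0 0 t') where
  support a b hab := by
    rcases a with a | a <;> rcases b with b | b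
    · exact h.support a b hab
    · exact absurd rfl hab
    · exact absurd rfl hab
    · exact h'.support a b hab
  hermitian a b := by
    rcases a with a | a <;> rcases b with b | b
    · exact h.hermitian a b
    · simp
    · simp
    · exact h'.hermitian a b
  row a b v h1 h2 h3 := by
    rcases a with a | a <;> rcases b with b | b
    · convert h.row a b v h1 h2 h3 using 1
      · simp only [Fintype.sum_sum_type, Sum.elim_inl, Sum.elim_inr, Matrix.zero_apply,
          Matrix.fromBlocks_apply₁₁, Matrix.fromBlocks_apply₁₂, Matrix.fromBlocks_apply₂₁,
          Matrix.fromBlocks_apply₂₂, mul_zero, ite_self, Finset.sum_const_zero, add_zero, zero_add]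
        congr!
      · simp
    · simp
    · simp
    · convert h'.row a b v h1 h2 h3 using 1
      · simp only [Fintype.sum_sum_type, Sum.elim_inl, Sum.elim_inr, Matrix.zero_apply,
          Matrix.fromBlocks_apply₁₁, Matrix.fromBlocks_apply₁₂, Matrix.fromBlocks_apply₂₁,
          Matrix.fromBlocks_apply₂₂, mul_zero, ite_self, Finset.sum_const_zero, add_zero, zero_add]
        congr!
      · simp
  col a b v h1 h2 h3 := by
    rcases a with a | a <;> rcases b with b | b
    · convert h.col a b v h1 h2 h3 using 1
      · simp only [Fintype.sum_sum_type, Sum.elim_inl, Sum.elim_inr, Matrix.zero_apply,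
          Matrix.fromBlocks_apply₁₁, Matrix.fromBlocks_apply₁₂, Matrix.fromBlocks_apply₂₁,
          Matrix.fromBlocks_apply₂₂, mul_zero, ite_self, Finset.sum_const_zero, add_zero, zero_add]
        congr!
      · simp
    · simp
    · simp
    · convert h'.col a b v h1 h2 h3 using 1
      · simp only [Fintype.sum_sum_type, Sum.elim_inl, Sum.elim_inr, Matrix.zero_apply,
          Matrix.fromBlocks_apply₁₁, Matrix.fromBlocks_apply₁₂, Matrix.fromBlocks_apply₂₁,
          Matrix.fromBlocks_apply₂₂, mul_zero, ite_self, Finset.sum_const_zero, add_zero, zero_add]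
        congr!
      · simp

theorem cells_directSum (p q : List V) :
    cells (Sum.elim src src') (Sum.elim tgt tgt') (Matrix.fromBlocks t 0 0 t') p q =
      Matrix.fromBlocks (cells src tgt t p q) 0 0 (cells src' tgt' t' p q) := by
  have hP : ∀ v w, endProj (Sum.elim src src') (Sum.elim tgt tgt') v w =
      Matrix.fromBlocks (endProj src tgt v w) 0 0 (endProj src' tgt' v w) := fun v w => by
    ext (a | a) (b | b) <;> simp [endProj_apply]
  induction p generalizing q with
  | nil => simp
  | cons v p ih =>
    match p, q with
    | [], [w] => rw [cells_singleton, cells_singleton, cells_singleton, hP]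
    | _, [] => simp
    | [], _ :: _ :: _ => simp [cells]
    | _ :: _, [_] => simp [cells]
    | x :: p, w :: y :: q =>
      rw [cells_cons (p := x :: p) (by simp) (by simp), ih, hP,
        cells_cons (p := x :: p) (by simp) (by simp), cells_cons (p := x :: p) (by simp) (by simp)]
      simp [Matrix.fromBlocks_multiply]

theorem IsCellSystem.cellOp_mem_symmetrySpan (hμ : ∀ v, 0 < μ v) (h : IsCellSystem G μ src tgt t)
    (a b : ι) : cellOp G src tgt t a b ∈ symmetrySpan G β μ := by
  set s := Matrix.fromBlocks t 0 0 (t.map conj) with hs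
  have hd : IsCellSystem G μ (Sum.elim src tgt) (Sum.elim tgt src) s := h.directSum h.swap
  have hflip : ∀ p q (a b : ι ⊕ ι), cells (Sum.elim src tgt) (Sum.elim tgt src) s p q a.swap b.swap =
      conj (cells (Sum.elim src tgt) (Sum.elim tgt src) s q p a b) := fun p q a b => by
    rw [← Matrix.map_apply (f := conj) (M := cells (Sum.elim src tgt) (Sum.elim tgt src) s q p),
      ← cells_map_conj]
    have h1 := cells_reindex (src := Sum.elim src tgt) (tgt := Sum.elim tgt src) (t := s)
      (Equiv.sumComm ι ι) p q
    have h2 : Sum.elim src tgt ∘ Equiv.sumComm ι ι = Sum.elim tgt src := by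
      ext (a | a) <;> rfl
    have h3 : Sum.elim tgt src ∘ Equiv.sumComm ι ι = Sum.elim src tgt := by
      ext (a | a) <;> rfl
    have h4 : s.submatrix (Equiv.sumComm ι ι) (Equiv.sumComm ι ι) = s.map conj := by
      ext (a | a) (b | b) <;> simp [hs]
    rw [h2, h3, h4] at h1
    rw [h1]; rfl
  set e := (Fintype.equivFin (ι ⊕ ι)).symm with he
  have hr := hd.reindex e
  refine Submodule.subset_span ⟨Fintype.card (ι ⊕ ι), _, _, _, hr.isSymmetryFamily hμ,
    ⟨fun i => e.symm (e i).swap, fun i => by simp, fun i => ?_, fun i j p q => ?_⟩,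
    hr.isNormalizedFamily hμ, e.symm (Sum.inl a), e.symm (Sum.inl b), ?_⟩
  · simp only [Function.comp_apply, Equiv.apply_symm_apply]
    rcases e i with x | x <;> rfl
  · rw [single_eq_ket, single_eq_ket, apply_eq_amp, apply_eq_amp, hr.amp_cellOp, hr.amp_cellOp,
      cells_reindex, cells_reindex, Matrix.submatrix_apply, Matrix.submatrix_apply,
      Equiv.apply_symm_apply, Equiv.apply_symm_apply, hflip, Complex.conj_conj]
  · refine ext_amp_ket fun p q _ _ => ?_
    rw [h.amp_cellOp, hr.amp_cellOp, cells_reindex, Matrix.submatrix_apply, Equiv.apply_symm_apply,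
      Equiv.apply_symm_apply, cells_directSum, Matrix.fromBlocks_apply₁₁]

end Operations

theorem symmetrySpan_le (hμ : ∀ v, 0 < μ v) :
    symmetrySpan G β μ ≤ Subalgebra.toSubmodule (symAlg G μ) := by
  refine Submodule.span_le.2 ?_
  rintro _ ⟨n, src, tgt, T, h, hH, hN, a, b, rfl⟩
  rw [h.eq_cellOp hμ hH hN]
  exact (h.isCellSystem hμ hH hN).cellOp_mem a b

end Families

end FaceModel

end

noncomputable section
namespace FaceModel
set_option linter.unusedSectionVars false
set_option linter.unusedSimpArgs false
open scoped Classical Matrix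

variable {V : Type*} {G : SimpleGraph V} [Fintype V] {β : ℝ} {μ : V → ℝ}

/-! ### Intertwiners of cell systems -/

section Intertwiners

variable {ι : Type*} [Fintype ι] {src tgt : ι → V} {t : Matrix ι ι ℂ}
variable {κ : Type*} [Fintype κ] {src' tgt' : κ → V} {t' : Matrix κ κ ℂ}

variable (src tgt t src' tgt' t') in
/-- Intertwiners between systems of cells. -/
def IsCellIntertwiner (Θ : Matrix ι κ ℂ) : Prop :=
  (∀ a b, Θ a b ≠ 0 → src a = src' b ∧ tgt a = tgt' b) ∧ t * Θ = Θ * t'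

variable {Θ : Matrix ι κ ℂ}

theorem IsCellIntertwiner.endProj_mul (h : IsCellIntertwiner src tgt t src' tgt' t' Θ) (v w : V) :
    endProj src tgt v w * Θ = Θ * endProj src' tgt' v w := by
  ext a b
  rw [endProj, endProj, Matrix.diagonal_mul, Matrix.mul_diagonal]
  by_cases h0 : Θ a b = 0
  · simp [h0]
  · obtain ⟨h1, h2⟩ := h.1 a b h0
    rw [h1, h2, mul_comm]

theorem IsCellIntertwiner.cells_mul (h : IsCellIntertwiner src tgt t src' tgt' t' Θ)
    (p q : List V) : cells src tgt t p q * Θ = Θ * cells src' tgt' t' p q := by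
  induction p generalizing q with
  | nil => simp
  | cons v p ih =>
    match p, q with
    | [], [w] => rw [cells_singleton, cells_singleton, h.endProj_mul]
    | _, [] => simp
    | [], _ :: _ :: _ => simp [cells]
    | _ :: _, [_] => simp [cells]
    | x :: p, w :: y :: q =>
      rw [cells_cons (p := x :: p) (by simp) (by simp), cells_cons (p := x :: p) (by simp) (by simp),
        Matrix.mul_assoc, ih, Matrix.mul_assoc, ← Matrix.mul_assoc t, h.2, ← Matrix.mul_assoc,
        ← Matrix.mul_assoc, h.endProj_mul, Matrix.mul_assoc, Matrix.mul_assoc, Matrix.mul_assoc]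

theorem IsCellIntertwiner.conjTranspose (h : IsCellIntertwiner src tgt t src' tgt' t' Θ)
    (ht : tᴴ = t) (ht' : t'ᴴ = t') : IsCellIntertwiner src' tgt' t' src tgt t Θᴴ := by
  refine ⟨fun a b hab => ?_, ?_⟩
  · have := h.1 b a fun h0 => hab (by rw [Matrix.conjTranspose_apply, h0, star_zero])
    exact ⟨this.1.symm, this.2.symm⟩
  · have := congrArg Matrix.conjTranspose h.2
    rw [Matrix.conjTranspose_mul, Matrix.conjTranspose_mul, ht, ht'] at this
    exact this.symm

theorem IsCellIntertwiner.mul {ν : Type*} [Fintype ν] {src'' tgt'' : ν → V} {t'' : Matrix ν ν ℂ}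
    {Ξ : Matrix κ ν ℂ} (h : IsCellIntertwiner src tgt t src' tgt' t' Θ)
    (h' : IsCellIntertwiner src' tgt' t' src'' tgt'' t'' Ξ) :
    IsCellIntertwiner src tgt t src'' tgt'' t'' (Θ * Ξ) := by
  refine ⟨fun a b hab => ?_, ?_⟩
  · rw [Matrix.mul_apply] at hab
    obtain ⟨c, -, hc⟩ := Finset.exists_ne_zero_of_sum_ne_zero hab
    obtain ⟨h1, h2⟩ := h.1 a c (left_ne_zero_of_mul hc)
    obtain ⟨h3, h4⟩ := h'.1 c b (right_ne_zero_of_mul hc)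
    exact ⟨h1.trans h3, h2.trans h4⟩
  · rw [← Matrix.mul_assoc, h.2, Matrix.mul_assoc, h'.2, Matrix.mul_assoc]

theorem IsCellIntertwiner.smul (h : IsCellIntertwiner src tgt t src' tgt' t' Θ) (z : ℂ) :
    IsCellIntertwiner src tgt t src' tgt' t' (z • Θ) :=
  ⟨fun a b hab => h.1 a b fun h0 => hab (by rw [Matrix.smul_apply, h0, smul_zero]), by
    rw [Matrix.mul_smul, Matrix.smul_mul, h.2]⟩

theorem IsCellSystem.cellOp_eq_sum [DecidableEq ι] (h : IsCellSystem G μ src tgt t)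
    (h' : IsCellSystem G μ src' tgt' t') (hΘ : IsCellIntertwiner src tgt t src' tgt' t' Θ)
    {Θ' : Matrix κ ι ℂ} (hm : Θ * Θ' = 1) (a b : ι) : cellOp G src tgt t a b =
      ∑ c, ∑ d, (Θ a c * Θ' d b) • cellOp G src' tgt' t' c d := by
  refine ext_amp_ket fun p q _ _ => ?_
  have h1 : cells src tgt t p q = Θ * cells src' tgt' t' p q * Θ' := by
    rw [← hΘ.cells_mul, Matrix.mul_assoc, hm, Matrix.mul_one]
  simp only [LinearMap.sum_apply, LinearMap.smul_apply, amp_sum, amp_smul, h.amp_cellOp,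
    h'.amp_cellOp]
  rw [h1, Matrix.mul_apply, Finset.sum_comm]
  refine Finset.sum_congr rfl fun d _ => ?_
  rw [Matrix.mul_apply, Finset.sum_mul]
  exact Finset.sum_congr rfl fun c _ => by ring

theorem sum_cells_edges :
    ∑ v, ∑ w, ∑ x, ∑ y, cells src tgt t [v, x] [w, y] = t := by
  ext a b
  have h1 : ∀ v w x y, cells src tgt t [v, x] [w, y] a b =
      if tgt b = x ∧ src b = y then (if tgt a = v ∧ src a = w then t a b else 0) else 0 :=
    fun v w x y => by
      rw [cells_cons (by simp) (by simp), cells_singleton, mul_endProj_apply, endProj_mul_apply]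
  simp only [Matrix.sum_apply, h1]
  rw [Finset.sum_eq_single (tgt a), Finset.sum_eq_single (src a), Finset.sum_eq_single (tgt b),
    Finset.sum_eq_single (src b)]
  · simp
  all_goals intros; simp_all
  all_goals simp_all [eq_comm]

/-- A system can be recovered from its representation: vertex matrix elements give the projections
to labels with fixed end points, and the edge matrix elements sum up to `t`. -/
theorem IsCellSystem.intertwiner_of_rep (h : IsCellSystem G μ src tgt t)
    (h' : IsCellSystem G μ src' tgt' t') (hΘ : ∀ φ, h.rep φ * Θ = Θ * h'.rep φ) :
    IsCellIntertwiner src tgt t src' tgt' t' Θ := by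
  refine ⟨fun a b hab => ?_, ?_⟩
  · have h1 := congrFun (congrFun (hΘ (mat G μ [tgt a] [src a])) a) b
    rw [h.rep_mat, h'.rep_mat, cells_singleton, cells_singleton, endProj, endProj,
      Matrix.diagonal_mul, if_pos ⟨rfl, rfl⟩, one_mul, Matrix.mul_diagonal] at h1
    by_contra hne
    rw [if_neg (fun h2 => hne ⟨h2.2.symm, h2.1.symm⟩), mul_zero] at h1
    exact hab h1
  · rw [← sum_cells_edges (src := src) (tgt := tgt) (t := t),
      ← sum_cells_edges (src := src') (tgt := tgt') (t := t')]
    simp only [Finset.sum_mul, Finset.mul_sum, Matrix.sum_mul, Matrix.mul_sum, ← h.rep_mat,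
      ← h'.rep_mat, hΘ]

variable [Module.Finite ℂ (symAlg G μ)]

theorem IsCellSystem.rep_comm (h : IsCellSystem G μ src tgt t)
    (h' : IsCellSystem G μ src' tgt' t') (hΘ : IsCellIntertwiner src tgt t src' tgt' t' Θ)
    (φ : DualAlg G μ) : h.rep φ * Θ = Θ * h'.rep φ := by
  induction φ using dual_induction with
  | h0 => simp
  | hadd φ φ' h1 h2 => simp only [map_add, h1, h2, Matrix.mul_add, Matrix.add_mul]
  | hsmul z φ h1 => simp only [map_smul, h1, Matrix.mul_smul, Matrix.smul_mul]
  | hmat p q hp hq hpq => rw [h.rep_mat, h'.rep_mat, hΘ.cells_mul]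

end Intertwiners

/-! ### Ocneanu connections and the symmetric gauge -/

section Connections

/-- The fourth root of the weights. -/
def qrt (μ : V → ℝ) (v : V) : ℝ := √√(μ v)

theorem qrt_pos (hμ : ∀ v, 0 < μ v) (v : V) : 0 < qrt μ v :=
  Real.sqrt_pos.2 (Real.sqrt_pos.2 (hμ v))

theorem qrt_sq (v : V) : qrt μ v ^ 2 = √(μ v) := Real.sq_sqrt (Real.sqrt_nonneg _)

theorem qrt_pow_four (hμ : ∀ v, 0 < μ v) (v : V) : qrt μ v ^ 4 = μ v := by
  rw [show 4 = 2 * 2 by rfl, pow_mul, qrt_sq, Real.sq_sqrt (hμ v).le]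

theorem rt_eq_qrt (hμ : ∀ v, 0 < μ v) (v w : V) :
    rt μ v w = (qrt μ v : ℂ) ^ 2 / (qrt μ w : ℂ) ^ 2 := by
  rw [rt, Real.sqrt_div (hμ v).le, ← qrt_sq, ← qrt_sq]; push_cast; rfl

namespace OcneanuConnection

variable (c d : OcneanuConnection G μ)

/-- The ratio `(μ_{bottom} / μ_{top})^{1/4}` for a label. -/
def gauge (a : Fin c.size) : ℂ := (qrt μ (c.src a) / qrt μ (c.tgt a) : ℝ)

/-- The cells in the symmetric gauge. -/
def sym : Matrix (Fin c.size) (Fin c.size) ℂ :=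
  Matrix.of fun a b => (c.gauge a)⁻¹ * c.cell a b * c.gauge b

variable {c d}

theorem gauge_ne (hμ : ∀ v, 0 < μ v) (a : Fin c.size) : c.gauge a ≠ 0 :=
  Complex.ofReal_ne_zero.2 (div_pos (qrt_pos hμ _) (qrt_pos hμ _)).ne'

theorem conj_gauge (a : Fin c.size) : conj (c.gauge a) = c.gauge a := Complex.conj_ofReal _

theorem cell_eq (hμ : ∀ v, 0 < μ v) (a b : Fin c.size) :
    c.cell a b = c.gauge a * c.sym a b * (c.gauge b)⁻¹ := by
  have := c.gauge_ne hμ a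
  have := c.gauge_ne hμ b
  rw [sym, Matrix.of_apply]; field_simp

theorem sqrt_weight (hμ : ∀ v, 0 < μ v) (a b : Fin c.size) :
    ((√(μ (c.tgt b) * μ (c.src a) / (μ (c.tgt a) * μ (c.src b))) : ℝ) : ℂ) =
      c.gauge a ^ 2 * ((c.gauge b) ^ 2)⁻¹ := by
  rw [mul_comm (μ (c.tgt b)), mul_comm (μ (c.tgt a)), sqrt_mul_div hμ, rt_eq_qrt hμ,
    rt_eq_qrt hμ, gauge, gauge]
  push_cast
  simp only [div_pow, inv_div]
  ring

theorem conj_sym (hμ : ∀ v, 0 < μ v) (a b : Fin c.size) : conj (c.sym a b) = c.sym b a := by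
  have h1 := c.gauge_ne hμ a
  have h2 := c.gauge_ne hμ b
  rw [sym, Matrix.of_apply, Matrix.of_apply, c.reflection b a, sqrt_weight hμ, map_mul, map_mul,
    map_inv₀, conj_gauge, conj_gauge]
  field_simp

/-- Reflection makes the gauged cells Hermitian, so conjugated cells can be replaced by cells with
exchanged labels. For fixed outer vertices the gauge factors combine into the weights `rt`, and the
two unitarity conditions become `row` and `col`. -/
theorem isCellSystem (hμ : ∀ v, 0 < μ v) (c : OcneanuConnection G μ) :
    IsCellSystem G μ c.src c.tgt c.sym where
  support a b hab := c.support a b fun h0 => hab (by simp [sym, h0])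
  hermitian := c.conj_sym hμ
  row a b v hab h1 h2 := by
    have hq : ∀ v, (qrt μ v : ℂ) ≠ 0 := fun v => Complex.ofReal_ne_zero.2 (qrt_pos hμ v).ne'
    have h3 : ∀ x, (if c.src x = v then rt μ (c.tgt x) (c.tgt a) * (c.sym a x * c.sym x b) else 0) =
        (qrt μ v : ℂ) ^ 2 / (qrt μ (c.tgt a) : ℂ) ^ 2 * (c.gauge a)⁻¹ * (c.gauge b)⁻¹ *
          (if c.src x = v then c.cell a x * conj (c.cell b x) else 0) := fun x => by
      split_ifs with hx
      · subst hx
        have := hq (c.src x)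
        have := hq (c.tgt x)
        have := hq (c.tgt a)
        rw [← conj_sym hμ b x, rt_eq_qrt hμ, sym, Matrix.of_apply, Matrix.of_apply, map_mul, map_mul,
          map_inv₀, conj_gauge, conj_gauge]
        have h4 : c.gauge x = qrt μ (c.src x) / qrt μ (c.tgt x) := by rw [gauge]; push_cast; rfl
        rw [h4]
        field_simp
      · rw [mul_zero]
    simp only [h3]
    rw [← Finset.mul_sum, c.unitarity a b v hab h1 h2]
    split_ifs with h5
    · subst h5
      have := hq (c.src a)
      have := hq (c.tgt a)
      rw [rt_eq_qrt hμ, gauge]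
      push_cast
      field_simp
    · rw [mul_zero]
  col a b v hab h1 h2 := by
    have hq : ∀ v, (qrt μ v : ℂ) ≠ 0 := fun v => Complex.ofReal_ne_zero.2 (qrt_pos hμ v).ne'
    have h3 : ∀ x, (if c.tgt x = v then rt μ (c.src x) (c.src a) * (c.sym a x * c.sym x b) else 0) =
        (qrt μ v : ℂ) ^ 2 / (qrt μ (c.src a) : ℂ) ^ 2 * c.gauge a * c.gauge b *
          (if c.tgt x = v then conj (c.cell x a) * c.cell x b else 0) := fun x => by
      split_ifs with hx
      · subst hx
        have := hq (c.src x)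
        have := hq (c.tgt x)
        have := hq (c.src a)
        rw [← conj_sym hμ x a, rt_eq_qrt hμ, sym, Matrix.of_apply, Matrix.of_apply, map_mul, map_mul,
          map_inv₀, conj_gauge, conj_gauge]
        have h4 : c.gauge x = qrt μ (c.src x) / qrt μ (c.tgt x) := by rw [gauge]; push_cast; rfl
        rw [h4]
        field_simp
      · rw [mul_zero]
    simp only [h3]
    rw [← Finset.mul_sum, c.unitarity' a b v hab h1 h2]
    split_ifs with h5
    · subst h5
      have := hq (c.src a)
      have := hq (c.tgt a)
      rw [rt_eq_qrt hμ, gauge]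
      push_cast
      field_simp
    · rw [mul_zero]

theorem glue_apply (hμ : ∀ v, 0 < μ v) (p q : List V) (a b : Fin c.size) :
    c.glue q p a b = c.gauge a * cells c.src c.tgt c.sym p q a b * (c.gauge b)⁻¹ := by
  have hP : ∀ v w : V, (Matrix.diagonal fun a => if c.src a = w ∧ c.tgt a = v then (1 : ℂ) else 0) =
      endProj c.src c.tgt v w := fun v w => by
    ext a b
    by_cases h : a = b <;> simp [endProj, Matrix.diagonal_apply, h, and_comm]
  induction p generalizing q a with
  | nil => match q with
    | [] => simp [glue]
    | [_] => simp [glue]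
    | _ :: _ :: _ => simp [glue]
  | cons v p ih =>
    match p, q with
    | [], [w] =>
      rw [cells_singleton, glue, hP, endProj_apply]
      by_cases hab : a = b
      · subst hab
        have := c.gauge_ne hμ a
        split_ifs <;> field_simp
      · simp [hab]
    | _, [] => simp [glue]
    | [], w :: y :: q =>
      have hz : c.glue (y :: q) [] = 0 := by cases q <;> simp [glue]
      rw [glue, hz]
      · simp [cells]
      · simp
    | x :: p, [w] =>
      have hz : c.glue [] (x :: p) = 0 := by simp [glue]
      rw [glue, hz]
      · simp [cells]
      · simp
    | x :: p, w :: y :: q =>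
      rw [cells_cons (p := x :: p) (by simp) (by simp), glue, hP, Matrix.mul_assoc, Matrix.mul_assoc,
        endProj_mul_apply, endProj_mul_apply, Matrix.mul_apply, Matrix.mul_apply]
      · split_ifs
        · rw [Finset.mul_sum, Finset.sum_mul]
          refine Finset.sum_congr rfl fun z _ => ?_
          have := c.gauge_ne hμ z
          rw [ih, cell_eq hμ]
          field_simp
        · simp
      · simp

theorem op_eq (hμ : ∀ v, 0 < μ v) (a b : Fin c.size) :
    c.op a b = (c.gauge a * (c.gauge b)⁻¹) • cellOp G c.src c.tgt c.sym a b := by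
  refine ext_amp_ket fun p q hp hq => ?_
  have h := c.isCellSystem hμ
  rw [LinearMap.smul_apply, amp_smul, h.amp_cellOp, ket_of_isPath hq, op,
    Finsupp.linearCombination_single, one_smul, amp_sum]
  simp only [amp_smul, amp_ket]
  by_cases hl : p.length = q.length
  · let w : Fin (EPath.mk q hq).1.length → V := fun i => p[(i : ℕ)]'(by rw [hl]; exact i.2)
    refine (Finset.sum_eq_single w ?_ ?_).trans ?_
    rotate_left 2
    · have h1 : List.ofFn w = p := by
        refine List.ext_getElem (List.length_ofFn.trans hl.symm) fun i _ _ => ?_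
        simp [w]
      rw [h1, if_pos ⟨rfl, hp⟩, glue_apply hμ]
      change _ * cells _ _ _ p q a b * _ * 1 = _
      ring
    · intro w' _ hw
      rw [if_neg, mul_zero]
      rintro ⟨h1, -⟩
      apply hw
      ext i
      exact (List.getElem_ofFn (f := w') (i := i)
        (by rw [List.length_ofFn]; exact i.2)).symm.trans (by simp only [w, h1])
    · exact fun h0 => absurd (Finset.mem_univ _) h0
  · rw [cells_of_length_ne hl]
    simp only [Matrix.zero_apply, mul_zero]
    refine Finset.sum_eq_zero fun w _ => ?_
    rw [if_neg, mul_zero]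
    rintro ⟨rfl, -⟩
    exact hl List.length_ofFn

/-- The fourth root in `symOp` equals `gauge b / gauge a`, the inverse of the factor in `op_eq`. -/
theorem symOp_eq (hμ : ∀ v, 0 < μ v) (a b : Fin c.size) :
    c.symOp a b = cellOp G c.src c.tgt c.sym a b := by
  have h1 := c.gauge_ne hμ a
  have h2 := c.gauge_ne hμ b
  have hq := fun v => (qrt_pos hμ v)
  rw [symOp, op_eq hμ, smul_smul]
  have h3 : ((μ (c.tgt b) * μ (c.src a) / (μ (c.tgt a) * μ (c.src b))) ^ (-(1 / 4) : ℝ) : ℝ) =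
      (qrt μ (c.src b) / qrt μ (c.tgt b)) / (qrt μ (c.src a) / qrt μ (c.tgt a)) := by
    have h4 : μ (c.tgt b) * μ (c.src a) / (μ (c.tgt a) * μ (c.src b)) =
        ((qrt μ (c.tgt b) * qrt μ (c.src a) / (qrt μ (c.tgt a) * qrt μ (c.src b))) ^ 4) := by
      rw [div_pow, mul_pow, mul_pow]; simp only [qrt_pow_four hμ]
    have h5 : 0 < qrt μ (c.tgt b) * qrt μ (c.src a) / (qrt μ (c.tgt a) * qrt μ (c.src b)) :=
      div_pos (mul_pos (hq _) (hq _)) (mul_pos (hq _) (hq _))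
    rw [h4, ← Real.rpow_natCast, ← Real.rpow_mul h5.le]
    norm_num
    rw [Real.rpow_neg_one]
    have := (hq (c.src a)).ne'
    have := (hq (c.src b)).ne'
    have := (hq (c.tgt a)).ne'
    have := (hq (c.tgt b)).ne'
    field_simp
  have h6 : (((μ (c.tgt b) * μ (c.src a) / (μ (c.tgt a) * μ (c.src b))) ^ (-(1 / 4) : ℝ) : ℝ) : ℂ) =
      c.gauge b / c.gauge a := by
    rw [h3, gauge, gauge, ← Complex.ofReal_div]
  rw [h6, show c.gauge b / c.gauge a * (c.gauge a * (c.gauge b)⁻¹) = 1 by field_simp, one_smul]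

/-- Nonzero entries of an intertwiner connect labels with the same end points, hence with the same
gauge factor, so passing to the symmetric gauge does not change the condition. -/
theorem intertwines_iff (hμ : ∀ v, 0 < μ v) (Θ : Matrix (Fin c.size) (Fin d.size) ℂ) :
    Intertwines c d Θ ↔ IsCellIntertwiner c.src c.tgt c.sym d.src d.tgt d.sym Θ := by
  refine and_congr_right fun hE => ?_
  have hS : ∀ a b, c.gauge a * Θ a b = Θ a b * d.gauge b := fun a b => by
    by_cases h0 : Θ a b = 0
    · simp [h0]
    · obtain ⟨h1, h2⟩ := hE a b h0
      rw [gauge, gauge, h1, h2, mul_comm]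
  have hS' : ∀ a b, (c.gauge a)⁻¹ * Θ a b = Θ a b * (d.gauge b)⁻¹ := fun a b => by
    have h1 := c.gauge_ne hμ a
    have h2 := d.gauge_ne hμ b
    field_simp
    exact (hS a b).symm
  have h1 : ∀ a b, (c.sym * Θ) a b = (c.gauge a)⁻¹ * (c.cell * Θ) a b * d.gauge b := fun a b => by
    rw [Matrix.mul_apply, Matrix.mul_apply, Finset.mul_sum, Finset.sum_mul]
    refine Finset.sum_congr rfl fun x _ => ?_
    rw [sym, Matrix.of_apply, mul_assoc, hS]; ring
  have h2 : ∀ a b, (Θ * d.sym) a b = (c.gauge a)⁻¹ * (Θ * d.cell) a b * d.gauge b := fun a b => by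
    rw [Matrix.mul_apply, Matrix.mul_apply, Finset.mul_sum, Finset.sum_mul]
    refine Finset.sum_congr rfl fun x _ => ?_
    rw [sym, Matrix.of_apply, ← mul_assoc (c.gauge a)⁻¹, hS']; ring
  constructor
  · intro h
    ext a b
    rw [h1, h2, h]
  · intro h
    ext a b
    have h3 := congrFun (congrFun h a) b
    rw [h1, h2] at h3
    exact mul_left_cancel₀ (inv_ne_zero (c.gauge_ne hμ a)) (mul_right_cancel₀ (d.gauge_ne hμ b) h3)

theorem Equivalent.symm (h : Equivalent c d) : Equivalent d c := by
  obtain ⟨Θ, Θ', h1, h2, h3, h4⟩ := h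
  exact ⟨Θ', Θ, h2, h1, h4, h3⟩

theorem Equivalent.symOp_mem_span (hμ : ∀ v, 0 < μ v) (h : Equivalent c d) (a b : Fin c.size) :
    c.symOp a b ∈ Submodule.span ℂ (Set.range fun i : Fin d.size × Fin d.size =>
      d.symOp i.1 i.2) := by
  obtain ⟨Θ, Θ', h1, -, h3, -⟩ := h
  rw [symOp_eq hμ, (c.isCellSystem hμ).cellOp_eq_sum (d.isCellSystem hμ)
    ((intertwines_iff hμ Θ).1 h1) h3]
  refine Submodule.sum_mem _ fun x _ => Submodule.sum_mem _ fun y _ => Submodule.smul_mem _ _ ?_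
  rw [← symOp_eq hμ]
  exact Submodule.subset_span ⟨(x, y), rfl⟩

end OcneanuConnection

/-! ### From cell systems back to connections -/

section OfCells

variable {n : ℕ} {src tgt : Fin n → V} {t : Matrix (Fin n) (Fin n) ℂ}

/-- The connection of a system of cells in the symmetric gauge. -/
def IsCellSystem.connection (hμ : ∀ v, 0 < μ v) (h : IsCellSystem G μ src tgt t) :
    OcneanuConnection G μ where
  size := n
  src := src
  tgt := tgt
  cell := Matrix.of fun a b => (qrt μ (src a) / qrt μ (tgt a) : ℝ) * t a b *
    ((qrt μ (src b) / qrt μ (tgt b) : ℝ) : ℂ)⁻¹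
  support a b hab := h.support a b fun h0 => hab (by simp [h0])
  reflection a b := by
    have hq : ∀ v, (qrt μ v : ℂ) ≠ 0 := fun v => Complex.ofReal_ne_zero.2 (qrt_pos hμ v).ne'
    have := hq (src a)
    have := hq (src b)
    have := hq (tgt a)
    have := hq (tgt b)
    rw [mul_comm (μ (tgt b)), mul_comm (μ (tgt a)), sqrt_mul_div hμ, rt_eq_qrt hμ, rt_eq_qrt hμ,
      Matrix.of_apply, Matrix.of_apply, map_mul, map_mul, map_inv₀, Complex.conj_ofReal,
      Complex.conj_ofReal, h.hermitian]
    push_cast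
    field_simp
  unitarity a b v hab h1 h2 := by
    have hq : ∀ v, (qrt μ v : ℂ) ≠ 0 := fun v => Complex.ofReal_ne_zero.2 (qrt_pos hμ v).ne'
    have h3 : ∀ x, (if src x = v then (Matrix.of fun a b : Fin n =>
        (qrt μ (src a) / qrt μ (tgt a) : ℝ) * t a b * ((qrt μ (src b) / qrt μ (tgt b) : ℝ) : ℂ)⁻¹) a x *
        conj ((Matrix.of fun a b : Fin n => (qrt μ (src a) / qrt μ (tgt a) : ℝ) * t a b *
          ((qrt μ (src b) / qrt μ (tgt b) : ℝ) : ℂ)⁻¹) b x) else 0) =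
        (qrt μ (src a) * qrt μ (src b) / (qrt μ v : ℂ) ^ 2) *
          (if src x = v then rt μ (tgt x) (tgt a) * (t a x * t x b) else 0) := fun x => by
      split_ifs with hx
      · subst hx
        have := hq (src x)
        have := hq (tgt x)
        have := hq (tgt b)
        rw [Matrix.of_apply, Matrix.of_apply, map_mul, map_mul, map_inv₀, Complex.conj_ofReal,
          Complex.conj_ofReal, h.hermitian, rt_eq_qrt hμ, hab]
        push_cast
        field_simp
      · rw [mul_zero]
    simp only [h3]
    rw [← Finset.mul_sum, h.row a b v hab h1 h2]
    split_ifs with h5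
    · subst h5
      have := hq (src a)
      have := hq v
      rw [rt_eq_qrt hμ]
      field_simp
    · rw [mul_zero]
  unitarity' a b v hab h1 h2 := by
    have hq : ∀ v, (qrt μ v : ℂ) ≠ 0 := fun v => Complex.ofReal_ne_zero.2 (qrt_pos hμ v).ne'
    have h3 : ∀ x, (if tgt x = v then conj ((Matrix.of fun a b : Fin n =>
        (qrt μ (src a) / qrt μ (tgt a) : ℝ) * t a b * ((qrt μ (src b) / qrt μ (tgt b) : ℝ) : ℂ)⁻¹) x a) *
        (Matrix.of fun a b : Fin n => (qrt μ (src a) / qrt μ (tgt a) : ℝ) * t a b *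
          ((qrt μ (src b) / qrt μ (tgt b) : ℝ) : ℂ)⁻¹) x b else 0) =
        (qrt μ (tgt a) * qrt μ (tgt b) / (qrt μ v : ℂ) ^ 2) *
          (if tgt x = v then rt μ (src x) (src a) * (t a x * t x b) else 0) := fun x => by
      split_ifs with hx
      · subst hx
        have := hq (src x)
        have := hq (tgt x)
        have := hq (src b)
        rw [Matrix.of_apply, Matrix.of_apply, map_mul, map_mul, map_inv₀, Complex.conj_ofReal,
          Complex.conj_ofReal, h.hermitian, rt_eq_qrt hμ, hab]
        push_cast
        field_simp
      · rw [mul_zero]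
    simp only [h3]
    rw [← Finset.mul_sum, h.col a b v hab h1 h2]
    split_ifs with h5
    · subst h5
      have := hq (tgt a)
      have := hq v
      rw [rt_eq_qrt hμ]
      field_simp
    · rw [mul_zero]

theorem IsCellSystem.sym_connection (hμ : ∀ v, 0 < μ v) (h : IsCellSystem G μ src tgt t) :
    (h.connection hμ).sym = t := by
  have hs : ∀ a, (h.connection hμ).gauge a ≠ 0 := OcneanuConnection.gauge_ne hμ
  ext a b
  have h1 := hs a
  have h2 := hs b
  change ((h.connection hμ).gauge a)⁻¹ * ((h.connection hμ).gauge a * t a b *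
    ((h.connection hμ).gauge b)⁻¹) * (h.connection hμ).gauge b = _
  field_simp

theorem IsCellSystem.connection_isIrreducible (hμ : ∀ v, 0 < μ v) (h : IsCellSystem G μ src tgt t)
    (hn : 0 < n) (hI : ∀ Θ, IsCellIntertwiner src tgt t src tgt t Θ → ∃ z : ℂ, Θ = z • 1) :
    (h.connection hμ).IsIrreducible := by
  refine ⟨hn, fun Θ hΘ => ?_⟩
  rw [OcneanuConnection.intertwines_iff hμ, h.sym_connection hμ] at hΘ
  exact hI Θ hΘ

theorem IsCellSystem.connection_symOp (hμ : ∀ v, 0 < μ v) (h : IsCellSystem G μ src tgt t)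
    (a b : Fin n) : (h.connection hμ).symOp a b = cellOp G src tgt t a b := by
  refine (OcneanuConnection.symOp_eq (c := h.connection hμ) hμ a b).trans ?_
  rw [h.sym_connection hμ]; rfl

end OfCells

end Connections

end FaceModel

end

noncomputable section
namespace FaceModel
set_option linter.unusedSectionVars false
set_option linter.unusedSimpArgs false
open scoped Classical Matrix

variable {V : Type*} {G : SimpleGraph V} [Fintype V] {β : ℝ} {μ : V → ℝ}

/-! ### Left ideals of the dual as cell systems -/

section LeftIdeals

theorem glueList_pair (v x : V) (l : List V) : glueList [v, x] (x :: l) = v :: x :: l := by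
  rw [show [v, x] = [v] ++ [x] from rfl, glueList_append_cons, if_pos rfl]; rfl

/-- Commutation with `cup`, read as a relation in the dual. In the left multiplication matrices of
an adapted basis it becomes the condition `col`. -/
theorem sum_rt_mat_right {a b c : V} (hab : G.Adj a b) (hbc : G.Adj b c) (v : V) :
    ∑ w, rt μ w v • mat G μ [a, b, c] [v, w, v] =
      if a = c then rt μ b a • mat G μ [a] [v] else 0 := by
  ext S
  have h1 : cup μ 0 (ket G [v]) = ∑ w, rt μ w v • ket G [v, w, v] :=
    cup_append μ (l := []) rfl v []
  have h2 : amp (S.1 (cup μ 0 (ket G [v]))) [a, b, c] =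
      if a = c then rt μ b a * amp (S.1 (ket G [v])) [a] else 0 := by
    have h3 := cap_append μ (i := 0) (l := []) (a := a) (b := b) (c := c) (m := []) (G := G) rfl
      (by simp [hab, hbc])
    rw [List.nil_append] at h3
    rw [symAlg_cup S.2, ← ip_ket_left, ← (adjoint_cup_cap μ 0).symm, h3]
    split_ifs
    · rw [LinearMap.map_smulₛₗ, LinearMap.smul_apply, List.nil_append, ip_ket_left, conj_rt]; rfl
    · simp
  rw [h1] at h2
  simp only [map_sum, map_smul, amp_sum, amp_smul] at h2
  simp only [LinearMap.sum_apply, LinearMap.smul_apply, mat_apply, smul_eq_mul]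
  rw [h2]
  split_ifs
  · rw [LinearMap.smul_apply, mat_apply]; rfl
  · rfl

/-- Commutation with `cap`, read as a relation in the dual. In the left multiplication matrices of
an adapted basis it becomes the condition `row`. -/
theorem sum_rt_mat_left {u v w : V} (huv : G.Adj u v) (hvw : G.Adj v w) (a : V) :
    ∑ x, rt μ x a • mat G μ [a, x, a] [u, v, w] =
      if u = w then rt μ v u • mat G μ [a] [u] else 0 := by
  ext S
  have h1 : cup μ 0 (ket G [a]) = ∑ w, rt μ w a • ket G [a, w, a] :=
    cup_append μ (l := []) rfl a []
  have h2 : ip (cup μ 0 (ket G [a])) (S.1 (ket G [u, v, w])) =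
      if u = w then rt μ v u * amp (S.1 (ket G [u])) [a] else 0 := by
    have h3 := cap_append μ (i := 0) (l := []) (a := u) (b := v) (c := w) (m := []) (G := G) rfl
      (by simp [huv, hvw])
    rw [List.nil_append] at h3
    rw [adjoint_cup_cap μ 0, ← symAlg_cap S.2, ip_ket_left, h3]
    split_ifs
    · rw [map_smul, amp_smul]; rfl
    · simp
  rw [h1] at h2
  simp only [map_sum, LinearMap.map_smulₛₗ, LinearMap.sum_apply, LinearMap.smul_apply, ip_ket_left,
    conj_rt, smul_eq_mul] at h2
  simp only [LinearMap.sum_apply, LinearMap.smul_apply, mat_apply, smul_eq_mul]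
  rw [h2]
  split_ifs
  · rw [LinearMap.smul_apply, mat_apply]; rfl
  · rfl

variable [Module.Finite ℂ (symAlg G μ)]

instance finite_dualAlg : Module.Finite ℂ (DualAlg G μ) :=
  have : Module.Free ℂ (symAlg G μ) := free_symAlg
  inferInstance

variable (hW : IsWeight G β μ)

/-- An orthonormal basis of a left ideal of the dual that is adapted to the end points. -/
structure IsAdaptedBasis (K : Submodule ℂ (DualAlg G μ)) {n : ℕ} (src tgt : Fin n → V)
    (e : Fin n → DualAlg G μ) : Prop where
  ideal : ∀ φ, ∀ x ∈ K, dualMul φ x ∈ K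
  mem : ∀ a, e a ∈ K
  orthonormal : ∀ a b, dualForm hW (e a) (e b) = if a = b then 1 else 0
  expand : ∀ x ∈ K, x = ∑ a, dualForm hW (e a) x • e a
  ends : ∀ a, dualMul (mat G μ [tgt a] [src a]) (e a) = e a

/-- The elements `mat G μ [v] [w]` are self-adjoint, mutually orthogonal idempotents with sum `1`.
They split `K` into orthogonal pieces, and orthonormal bases of the pieces are put together. -/
theorem exists_adaptedBasis {K : Submodule ℂ (DualAlg G μ)}
    (hK : ∀ φ, ∀ x ∈ K, dualMul φ x ∈ K) : ∃ (n : ℕ) (src tgt : Fin n → V)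
      (e : Fin n → DualAlg G μ), IsAdaptedBasis hW K src tgt e := by
  let U : V × V → Submodule ℂ (DualAlg G μ) := fun v =>
    K ⊓ LinearMap.ker (dualMul (mat G μ [v.1] [v.2]) - LinearMap.id)
  have hU : ∀ v x, x ∈ U v ↔ x ∈ K ∧ dualMul (mat G μ [v.1] [v.2]) x = x := fun v x => by
    simp [U, sub_eq_zero]
  have hs : ∀ (v : V × V) x y, dualForm hW (dualMul (mat G μ [v.1] [v.2]) x) y =
      dualForm hW x (dualMul (mat G μ [v.1] [v.2]) y) := fun v x y => by
    rw [dualForm_mul, dualStar_mat]; rfl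
  choose d u hu ho hx using fun v => exists_orthonormal (dualForm hW) (dualForm_symm hW)
    (dualForm_pos hW) (U v)
  let f : Fin (Fintype.card ((v : V × V) × Fin (d v))) ≃ ((v : V × V) × Fin (d v)) :=
    (Fintype.equivFin _).symm
  refine ⟨_, fun a => (f a).1.2, fun a => (f a).1.1, fun a => u _ (f a).2, hK,
    fun a => ((hU _ _).1 (hu _ _)).1, fun a b => ?_, fun x hxK => ?_,
    fun a => ((hU _ _).1 (hu _ _)).2⟩
  · simp only [← f.injective.eq_iff (a := a)]
    generalize f a = i
    generalize f b = j
    obtain ⟨v, i⟩ := i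
    obtain ⟨w, j⟩ := j
    by_cases hvw : v = w
    · subst hvw
      simp [ho]
    · rw [if_neg fun h => hvw (congrArg Sigma.fst h)]
      dsimp only
      rw [← ((hU _ _).1 (hu v i)).2, ← ((hU _ _).1 (hu w j)).2, hs, ← dualMul_assoc,
        dualMul_singleton_singleton, if_neg fun h => hvw (Prod.ext h.1 h.2)]
      simp
  · rw [Equiv.sum_comp f (fun i => dualForm hW (u i.1 i.2) x • u i.1 i.2), Fintype.sum_sigma,
      Fintype.sum_prod_type]
    conv_lhs => rw [← dualOne_mul x, dualOne]
    simp only [map_sum, LinearMap.sum_apply]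
    refine Finset.sum_congr rfl fun v _ => Finset.sum_congr rfl fun w _ => ?_
    have h1 : dualMul (mat G μ [v] [w]) x ∈ U (v, w) := (hU _ _).2 ⟨hK _ _ hxK, by
      rw [← dualMul_assoc, dualMul_singleton_singleton, if_pos ⟨rfl, rfl⟩]⟩
    conv_lhs => rw [hx (v, w) _ h1]
    refine Finset.sum_congr rfl fun i _ => ?_
    rw [← hs (v, w), ((hU _ _).1 (hu (v, w) i)).2]

namespace IsAdaptedBasis

variable {hW} {K : Submodule ℂ (DualAlg G μ)} {n : ℕ} {src tgt : Fin n → V}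
  {e : Fin n → DualAlg G μ}

variable (hW e) in
/-- The matrix of left multiplication. -/
def leftMatrix : DualAlg G μ →ₗ[ℂ] Matrix (Fin n) (Fin n) ℂ where
  toFun φ := Matrix.of fun a b => dualForm hW (e a) (dualMul φ (e b))
  map_add' φ ψ := by ext; simp
  map_smul' z φ := by ext; simp

theorem leftMatrix_apply (φ : DualAlg G μ) (a b : Fin n) :
    leftMatrix hW e φ a b = dualForm hW (e a) (dualMul φ (e b)) := rfl

variable (h : IsAdaptedBasis hW K src tgt e)
include h

theorem mul_eq_sum (φ : DualAlg G μ) (b : Fin n) :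
    dualMul φ (e b) = ∑ a, leftMatrix hW e φ a b • e a :=
  h.expand _ (h.ideal φ _ (h.mem b))

theorem leftMatrix_mul (φ ψ : DualAlg G μ) :
    leftMatrix hW e (dualMul φ ψ) = leftMatrix hW e φ * leftMatrix hW e ψ := by
  ext a b
  rw [leftMatrix_apply, dualMul_assoc, h.mul_eq_sum ψ b, Matrix.mul_apply]
  simp only [map_sum, map_smul, smul_eq_mul]
  exact Finset.sum_congr rfl fun c _ => mul_comm _ _

theorem leftMatrix_star (φ : DualAlg G μ) (a b : Fin n) :
    leftMatrix hW e (dualStar φ) a b = conj (leftMatrix hW e φ b a) := by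
  rw [leftMatrix_apply, leftMatrix_apply, ← dualForm_mul, dualForm_symm]

theorem leftMatrix_singleton (v w : V) :
    leftMatrix hW e (mat G μ [v] [w]) = endProj src tgt v w := by
  ext a b
  rw [leftMatrix_apply, ← h.ends b, ← dualMul_assoc, dualMul_singleton_singleton, endProj_apply]
  by_cases h1 : v = tgt b ∧ w = src b
  · obtain ⟨rfl, rfl⟩ := h1
    rw [if_pos ⟨rfl, rfl⟩, h.ends, h.orthonormal]
    by_cases hab : a = b <;> simp [hab]
  · rw [if_neg h1, if_neg]
    · simp
    · rintro ⟨rfl, rfl, rfl⟩; exact h1 ⟨rfl, rfl⟩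

variable (hW src tgt e) in
omit h in
/-- The cells of an adapted basis. -/
def cell : Matrix (Fin n) (Fin n) ℂ :=
  Matrix.of fun a b => leftMatrix hW e (mat G μ [tgt a, tgt b] [src a, src b]) a b

omit h in
theorem mat_edge_eq (v x w y : V) : mat G μ [v, x] [w, y] = dualMul (mat G μ [v] [w])
      (dualMul (mat G μ [v, x] [w, y]) (mat G μ [x] [y])) := by
  rw [dualMul_mat (p := [v, x]) (q := [w, y]) (by simp), dualMul_mat (by simp), glueList_pair,
    glueList_pair, glueList_singleton_left, glueList_singleton_left]
  simp

omit h in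
theorem mat_cons_cons (v x w y : V) (p q : List V) : mat G μ (v :: x :: p) (w :: y :: q) =
    dualMul (mat G μ [v, x] [w, y]) (mat G μ (x :: p) (y :: q)) := by
  rw [dualMul_mat (by simp), glueList_pair, glueList_pair]

theorem leftMatrix_edge (v x w y : V) : leftMatrix hW e (mat G μ [v, x] [w, y]) =
    endProj src tgt v w * cell hW src tgt e * endProj src tgt x y := by
  have h1 := congrArg (leftMatrix hW e) (mat_edge_eq (G := G) (μ := μ) v x w y)
  rw [h.leftMatrix_mul, h.leftMatrix_mul, h.leftMatrix_singleton, h.leftMatrix_singleton] at h1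
  ext a b
  have h2 := congrFun (congrFun h1 a) b
  rw [endProj_mul_apply, mul_endProj_apply] at h2
  rw [h2, mul_endProj_apply, endProj_mul_apply]
  by_cases h3 : tgt a = v ∧ src a = w
  · obtain ⟨rfl, rfl⟩ := h3
    by_cases h4 : tgt b = x ∧ src b = y
    · obtain ⟨rfl, rfl⟩ := h4
      rw [if_pos ⟨rfl, rfl⟩, if_pos ⟨rfl, rfl⟩, if_pos ⟨rfl, rfl⟩, if_pos ⟨rfl, rfl⟩, cell,
        Matrix.of_apply]
    · rw [if_neg h4, if_neg h4, ite_self]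
  · rw [if_neg h3, if_neg h3, ite_self]

theorem leftMatrix_mat (p q : List V) :
    leftMatrix hW e (mat G μ p q) = cells src tgt (cell hW src tgt e) p q := by
  induction p generalizing q with
  | nil => rw [mat_nil_left, map_zero, cells_nil_left]
  | cons v p ih =>
    by_cases hl : (v :: p).length = q.length
    · rcases p with _ | ⟨x, p⟩
      · obtain ⟨w, rfl⟩ := List.length_eq_one_iff.1 hl.symm
        rw [cells_singleton, h.leftMatrix_singleton]
      · rcases q with _ | ⟨w, _ | ⟨y, q⟩⟩
        · simp at hl
        · simp at hl
        · rw [mat_cons_cons, h.leftMatrix_mul, ih, h.leftMatrix_edge,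
            cells_cons (p := x :: p) (by simp) (by simp),
            Matrix.mul_assoc _ (endProj src tgt x y), endProj_mul_cells, if_pos ⟨rfl, rfl⟩]
    · rw [mat_of_length_ne hl, map_zero, cells_of_length_ne hl]

theorem sum_cell_mul_cell (a b : Fin n) (v w : V) :
    ∑ c, (if tgt c = v ∧ src c = w then cell hW src tgt e a c * cell hW src tgt e c b else 0) =
      leftMatrix hW e (mat G μ [tgt a, v, tgt b] [src a, w, src b]) a b := by
  rw [h.leftMatrix_mat, cells_cons (by simp) (by simp), cells_cons (by simp) (by simp),
    cells_singleton, Matrix.mul_assoc, endProj_mul_apply, if_pos ⟨rfl, rfl⟩, ← Matrix.mul_assoc,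
    ← Matrix.mul_assoc, mul_endProj_apply, if_pos ⟨rfl, rfl⟩, Matrix.mul_apply]
  refine Finset.sum_congr rfl fun c _ => ?_
  rw [mul_endProj_apply]
  split_ifs <;> simp

/-- Left multiplication is a *-representation in which the vertex elements are the projections
`endProj`. The star of an edge element gives Hermiticity, and `sum_rt_mat_left` and
`sum_rt_mat_right` give the two unitarity conditions. -/
theorem isCellSystem : IsCellSystem G μ src tgt (cell hW src tgt e) where
  support a b hab := by
    constructor
    · by_contra hne
      apply hab
      rw [cell, Matrix.of_apply, mat_of_not_right (by simpa using hne)]; simp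
    · by_contra hne
      apply hab
      rw [cell, Matrix.of_apply, mat_of_not_left (by simpa using hne)]; simp
  hermitian a b := by
    rw [cell, Matrix.of_apply, Matrix.of_apply, ← h.leftMatrix_star, dualStar_mat]; rfl
  row a b v hab h1 h2 := by
    have h3 := congrArg (fun φ => leftMatrix hW e φ a b)
      (sum_rt_mat_left (μ := μ) h1 h2.symm (tgt a))
    simp only [map_sum, map_smul, Matrix.sum_apply, Matrix.smul_apply] at h3
    have h4 : ∀ x, leftMatrix hW e (mat G μ [tgt a, x, tgt a] [src a, v, src b]) a b =
        ∑ c, (if tgt c = x ∧ src c = v then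
          cell hW src tgt e a c * cell hW src tgt e c b else 0) := fun x => by
      rw [h.sum_cell_mul_cell, ← hab]
    simp only [h4, Finset.smul_sum] at h3
    rw [Finset.sum_comm] at h3
    have h5 : ∀ c, ∑ x, rt μ x (tgt a) • (if tgt c = x ∧ src c = v then
          cell hW src tgt e a c * cell hW src tgt e c b else 0) =
        if src c = v then rt μ (tgt c) (tgt a) *
          (cell hW src tgt e a c * cell hW src tgt e c b) else 0 := fun c => by
      rw [Finset.sum_eq_single (tgt c)]
      · by_cases hc : src c = v <;> simp [hc]
      · intro x _ hx; simp [Ne.symm hx]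
      · simp
    simp only [h5] at h3
    rw [h3]
    by_cases hs : src a = src b
    · rw [if_pos hs, map_smul, h.leftMatrix_singleton, Matrix.smul_apply, endProj_apply]
      by_cases h6 : a = b <;> simp [h6]
    · rw [if_neg hs, if_neg fun h6 => hs (congrArg src h6)]; simp
  col a b v hab h1 h2 := by
    have h3 := congrArg (fun φ => leftMatrix hW e φ a b)
      (sum_rt_mat_right (μ := μ) h1 h2.symm (src a))
    simp only [map_sum, map_smul, Matrix.sum_apply, Matrix.smul_apply] at h3
    have h4 : ∀ x, leftMatrix hW e (mat G μ [tgt a, v, tgt b] [src a, x, src a]) a b =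
        ∑ c, (if tgt c = v ∧ src c = x then
          cell hW src tgt e a c * cell hW src tgt e c b else 0) := fun x => by
      rw [h.sum_cell_mul_cell, ← hab]
    simp only [h4, Finset.smul_sum] at h3
    rw [Finset.sum_comm] at h3
    have h5 : ∀ c, ∑ x, rt μ x (src a) • (if tgt c = v ∧ src c = x then
          cell hW src tgt e a c * cell hW src tgt e c b else 0) =
        if tgt c = v then rt μ (src c) (src a) *
          (cell hW src tgt e a c * cell hW src tgt e c b) else 0 := fun c => by
      rw [Finset.sum_eq_single (src c)]
      · by_cases hc : tgt c = v <;> simp [hc]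
      · intro x _ hx; simp [Ne.symm hx]
      · simp
    simp only [h5] at h3
    rw [h3]
    by_cases hs : tgt a = tgt b
    · rw [if_pos hs, map_smul, h.leftMatrix_singleton, Matrix.smul_apply, endProj_apply]
      by_cases h6 : a = b <;> simp [h6]
    · rw [if_neg hs, if_neg fun h6 => hs (congrArg tgt h6)]; simp

theorem rep_eq (φ : DualAlg G μ) : h.isCellSystem.rep φ = leftMatrix hW e φ := by
  suffices hs : h.isCellSystem.rep = leftMatrix hW e from congrArg (fun f => f φ) hs
  exact dual_hom_ext fun p q _ _ _ => by rw [h.isCellSystem.rep_mat, h.leftMatrix_mat]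

theorem mul_sum (φ : DualAlg G μ) (y : Fin n → ℂ) :
    dualMul φ (∑ b, y b • e b) = ∑ a, (leftMatrix hW e φ *ᵥ y) a • e a := by
  simp only [map_sum, map_smul, h.mul_eq_sum φ, Matrix.mulVec, dotProduct, Finset.sum_smul,
    Finset.smul_sum, smul_smul]
  rw [Finset.sum_comm]
  exact Finset.sum_congr rfl fun a _ => Finset.sum_congr rfl fun b _ => by rw [mul_comm]

theorem form_sum (a : Fin n) (y : Fin n → ℂ) : dualForm hW (e a) (∑ b, y b • e b) = y a := by
  simp [h.orthonormal]

end IsAdaptedBasis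

/-- Among the left ideals not annihilated by left multiplication with `φ` take a minimal one. The
cells of an adapted basis then form an irreducible connection, and some matrix entry of `φ` in it is
not zero. Such an entry is the value of `φ` at one of the operators of the connection. -/
theorem exists_irreducible_apply_ne_zero (hW : IsWeight G β μ) {φ : DualAlg G μ} (hφ : φ ≠ 0) :
    ∃ c : OcneanuConnection G μ, c.IsIrreducible ∧
      ∃ a b, ∃ h : c.symOp a b ∈ symAlg G μ, φ ⟨_, h⟩ ≠ 0 := by
  let P : Set (Submodule ℂ (DualAlg G μ)) :=
    {K | (∀ ψ, ∀ x ∈ K, dualMul ψ x ∈ K) ∧ ∃ x ∈ K, dualMul φ x ≠ 0}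
  obtain ⟨K, ⟨hK, x, hx, hφx⟩, hmin⟩ := (wellFounded_lt (α := Submodule ℂ (DualAlg G μ))).has_min P
    ⟨⊤, fun _ _ _ => trivial, dualOne G μ, trivial, by rwa [mul_dualOne]⟩
  have hlt : ∀ L < K, (∀ ψ, ∀ x ∈ L, dualMul ψ x ∈ L) → ∀ x ∈ L, dualMul φ x = 0 :=
    fun L hL hI x hxL => by
      by_contra hne
      exact hmin L ⟨hI, x, hxL, hne⟩ hL
  obtain ⟨n, src, tgt, e, h⟩ := exists_adaptedBasis hW hK
  have hx' := h.expand x hx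
  obtain ⟨b, hb⟩ : ∃ b, dualMul φ (e b) ≠ 0 := by
    by_contra! hne
    rw [hx'] at hφx
    simp [hne] at hφx
  obtain ⟨a, ha⟩ : ∃ a, h.isCellSystem.rep φ a b ≠ 0 := by
    by_contra! hne
    rw [h.mul_eq_sum, ← h.rep_eq] at hb
    simp [hne] at hb
  have hI : ∀ Θ, IsCellIntertwiner src tgt (IsAdaptedBasis.cell hW src tgt e) src tgt
      (IsAdaptedBasis.cell hW src tgt e) Θ → ∃ z : ℂ, Θ = z • 1 := fun Θ hΘ => by
    have hne : Nonempty (Fin n) := ⟨a⟩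
    obtain ⟨z, hz⟩ := Module.End.exists_eigenvalue (Matrix.toLin' Θ)
    obtain ⟨y₀, hy₀⟩ := hz.exists_hasEigenvector
    -- An eigenspace of an intertwiner is stable under left multiplication, so its image `L` is a
    -- left ideal inside `K`. If `L = K` the intertwiner is scalar.
    have hΘz : Θ *ᵥ y₀ = z • y₀ := by simpa using hy₀.apply_eq_smul
    let L : Submodule ℂ (DualAlg G μ) :=
      (LinearMap.ker (Matrix.toLin' Θ - z • LinearMap.id)).map (Fintype.linearCombination ℂ e)
    have hL : ∀ x, x ∈ L ↔ ∃ y, Θ *ᵥ y = z • y ∧ ∑ b, y b • e b = x := fun x => by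
      simp [L, Submodule.mem_map, sub_eq_zero, Fintype.linearCombination_apply]
    have hLI : ∀ ψ, ∀ x ∈ L, dualMul ψ x ∈ L := fun ψ x hxL => by
      obtain ⟨y, hy, rfl⟩ := (hL x).1 hxL
      refine (hL _).2 ⟨_, ?_, (h.mul_sum ψ y).symm⟩
      rw [Matrix.mulVec_mulVec, ← h.rep_eq, ← h.isCellSystem.rep_comm h.isCellSystem hΘ,
        ← Matrix.mulVec_mulVec, hy, Matrix.mulVec_smul]
    have hLK : L ≤ K := fun x hxL => by
      obtain ⟨y, -, rfl⟩ := (hL x).1 hxL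
      exact Submodule.sum_mem _ fun b _ => Submodule.smul_mem _ _ (h.mem b)
    by_cases hLeq : L = K
    · refine ⟨z, ?_⟩
      ext a b
      obtain ⟨y, hy, hyb⟩ := (hL (e b)).1 (hLeq ▸ h.mem b)
      have hys : y = Pi.single b 1 := by
        ext c
        rw [← h.form_sum c y, hyb, h.orthonormal, Pi.single_apply]
      rw [hys] at hy
      have := congrFun hy a
      simpa [Matrix.one_apply, Pi.single_apply] using this
    · exfalso
      have hL0 := hlt L (lt_of_le_of_ne hLK hLeq) hLI
      -- The orthogonal complement of `L` in `K` is also a left ideal, and a proper one because `L`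
      -- contains the nonzero vector with coordinates `y₀`. By minimality `φ` annihilates both `L`
      -- and `M`, hence the vector `x`, a contradiction.
      let M : Submodule ℂ (DualAlg G μ) := K ⊓ ⨅ y : L, LinearMap.ker (dualForm hW y)
      have hM : ∀ x, x ∈ M ↔ x ∈ K ∧ ∀ y ∈ L, dualForm hW y x = 0 := fun x => by
        simp [M, Submodule.mem_iInf]
      have hMI : ∀ ψ, ∀ x ∈ M, dualMul ψ x ∈ M := fun ψ x hxM => by
        obtain ⟨h1, h2⟩ := (hM x).1 hxM
        refine (hM _).2 ⟨hK _ _ h1, fun y hy => ?_⟩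
        rw [← dualStar_dualStar ψ, ← dualForm_mul]
        exact h2 _ (hLI _ _ hy)
      have hMK : M ≠ K := fun hMK => by
        have h1 : ∑ b, y₀ b • e b ∈ L := (hL _).2 ⟨y₀, hΘz, rfl⟩
        have h2 := ((hM _).1 (hMK ▸ hLK h1 : _ ∈ M)).2 _ h1
        have h3 : ∑ b, y₀ b • e b = 0 := by
          by_contra hne
          have := dualForm_pos hW _ hne
          rw [h2] at this
          simp at this
        apply hy₀.2
        ext c
        rw [← h.form_sum c y₀, h3]; simp
      have hM0 := hlt M (lt_of_le_of_ne inf_le_left hMK) hMI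
      obtain ⟨y, hy, hxy⟩ := exists_decomposition (dualForm hW) (dualForm_symm hW)
        (dualForm_pos hW) L x
      have h1 := hM0 (x - y) ((hM _).2 ⟨K.sub_mem hx (hLK hy), hxy⟩)
      rw [map_sub, hL0 y hy, sub_zero] at h1
      exact hφx h1
  refine ⟨h.isCellSystem.connection hW.pos,
    h.isCellSystem.connection_isIrreducible hW.pos a.pos hI, a, b, ?_⟩
  have h1 := h.isCellSystem.connection_symOp hW.pos a b
  exact ⟨by rw [h1]; exact h.isCellSystem.cellOp_mem a b, by simp only [h1]; exact ha⟩

end LeftIdeals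

end FaceModel

end

noncomputable section
namespace FaceModel
set_option linter.unusedSectionVars false
set_option linter.unusedSimpArgs false
open scoped Classical Matrix

variable {V : Type*} {G : SimpleGraph V} [Fintype V] {β : ℝ} {μ : V → ℝ}

/-! ### Linear independence and separation by linear forms -/

section Monoids

variable {M : Type*} [AddCommMonoid M] [Module ℂ M]

theorem linearIndependent_of_sum_eq_zero {ι : Type*} [Fintype ι] {v : ι → M}
    (h : ∀ g : ι → ℂ, ∑ i, g i • v i = 0 → ∀ i, g i = 0) : LinearIndependent ℂ v := by
  let : AddCommGroup M := Module.addCommMonoidToAddCommGroup ℂ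
  exact Fintype.linearIndependent_iff.2 h

theorem exists_le_ker_of_notMem' {p : Submodule ℂ M} {x : M} (hx : x ∉ p) :
    ∃ f : M →ₗ[ℂ] ℂ, f x ≠ 0 ∧ p ≤ LinearMap.ker f := by
  let : AddCommGroup M := Module.addCommMonoidToAddCommGroup ℂ
  exact Submodule.exists_le_ker_of_notMem hx

end Monoids

/-! ### Schur's lemma and orthogonality of irreducible connections -/

namespace OcneanuConnection

variable {c d : OcneanuConnection G μ}

theorem conjTranspose_sym (hμ : ∀ v, 0 < μ v) (c : OcneanuConnection G μ) : c.symᴴ = c.sym :=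
  (c.isCellSystem hμ).conjTranspose

theorem IsIrreducible.exists_eq_smul (hμ : ∀ v, 0 < μ v) (hc : c.IsIrreducible)
    {Θ : Matrix (Fin c.size) (Fin c.size) ℂ}
    (h : IsCellIntertwiner c.src c.tgt c.sym c.src c.tgt c.sym Θ) : ∃ z : ℂ, Θ = z • 1 :=
  hc.2 Θ ((intertwines_iff hμ Θ).2 h)

open scoped ComplexOrder in
-- Schur's lemma: by irreducibility `Θ * Θᴴ` and `Θᴴ * Θ` are scalar matrices. If `Θ` is not zero,
-- the two scalars coincide and are nonzero, so `Θ` with a multiple of `Θᴴ` would be an equivalence.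
theorem intertwiner_eq_zero (hμ : ∀ v, 0 < μ v) (hc : c.IsIrreducible) (hd : d.IsIrreducible)
    (hne : ¬ Equivalent c d) {Θ : Matrix (Fin c.size) (Fin d.size) ℂ}
    (h : IsCellIntertwiner c.src c.tgt c.sym d.src d.tgt d.sym Θ) : Θ = 0 := by
  by_contra h0
  have h' := h.conjTranspose (c.conjTranspose_sym hμ) (d.conjTranspose_sym hμ)
  obtain ⟨z, hz⟩ := hc.exists_eq_smul hμ (h.mul h')
  obtain ⟨w, hw⟩ := hd.exists_eq_smul hμ (h'.mul h)
  have h1 : z • Θ = w • Θ := by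
    calc z • Θ = (Θ * Θᴴ) * Θ := by rw [hz, Matrix.smul_mul, Matrix.one_mul]
      _ = w • Θ := by rw [Matrix.mul_assoc, hw, Matrix.mul_smul, Matrix.mul_one]
  obtain rfl : z = w := smul_left_injective ℂ h0 h1
  have hz0 : z ≠ 0 := by
    rintro rfl
    rw [zero_smul, Matrix.self_mul_conjTranspose_eq_zero] at hz
    exact h0 hz
  refine hne ⟨Θ, z⁻¹ • Θᴴ, (intertwines_iff hμ _).2 h, (intertwines_iff hμ _).2 (h'.smul _), ?_, ?_⟩
  · rw [Matrix.mul_smul, hz, smul_smul, inv_mul_cancel₀ hz0, one_smul]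
  · rw [Matrix.smul_mul, hw, smul_smul, inv_mul_cancel₀ hz0, one_smul]

theorem symOp_mem (hμ : ∀ v, 0 < μ v) (c : OcneanuConnection G μ) (a b : Fin c.size) :
    c.symOp a b ∈ symAlg G μ := by
  rw [symOp_eq hμ]; exact (c.isCellSystem hμ).cellOp_mem a b

theorem rep_apply_symOp (hμ : ∀ v, 0 < μ v) (c : OcneanuConnection G μ) (φ : DualAlg G μ)
    (a b : Fin c.size) : (c.isCellSystem hμ).rep φ a b = φ ⟨_, c.symOp_mem hμ a b⟩ := by
  rw [IsCellSystem.rep_apply]; congr 2; exact (symOp_eq hμ a b).symm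

section Orthogonality

variable [Module.Finite ℂ (symAlg G μ)]

section Average

variable {ι κ : Type*} [Fintype ι] [Fintype κ] {src tgt : ι → V} {t : Matrix ι ι ℂ}
  {src' tgt' : κ → V} {t' : Matrix κ κ ℂ}

/-- The averages over an orthonormal basis of the dual are intertwiners. -/
theorem average_isCellIntertwiner (hW : IsWeight G β μ) {n : ℕ} {u : Fin n → DualAlg G μ}
    (hu : ∀ x, x = ∑ i, dualForm hW (u i) x • u i)
    (h : IsCellSystem G μ src tgt t) (h' : IsCellSystem G μ src' tgt' t') (X : Matrix ι κ ℂ) :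
    IsCellIntertwiner src tgt t src' tgt' t' (∑ i, h.rep (u i) * X * (h'.rep (u i))ᴴ) := by
  refine h.intertwiner_of_rep h' fun φ => ?_
  have h1 : ∀ i, h.rep φ * h.rep (u i) = ∑ j, dualForm hW (u j) (dualMul φ (u i)) • h.rep (u j) :=
    fun i => by
      rw [← h.rep_mul]; conv_lhs => rw [hu (dualMul φ (u i))]
      simp only [map_sum, map_smul]
  have h2 : ∀ j, (h'.rep (u j))ᴴ * h'.rep φ =
      ∑ i, dualForm hW (u j) (dualMul φ (u i)) • (h'.rep (u i))ᴴ := fun j => by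
    rw [← Matrix.conjTranspose_conjTranspose (h'.rep φ), ← h'.rep_star φ, ← Matrix.conjTranspose_mul,
      ← h'.rep_mul]
    conv_lhs => rw [hu (dualMul (dualStar φ) (u j))]
    simp only [map_sum, map_smul, Matrix.conjTranspose_sum, Matrix.conjTranspose_smul]
    refine Finset.sum_congr rfl fun i _ => ?_
    rw [← starRingEnd_apply, dualForm_symm, dualForm_mul, dualStar_dualStar]
  calc h.rep φ * ∑ i, h.rep (u i) * X * (h'.rep (u i))ᴴ
      = ∑ i, ∑ j, dualForm hW (u j) (dualMul φ (u i)) • (h.rep (u j) * X * (h'.rep (u i))ᴴ) := by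
        rw [Matrix.mul_sum]
        refine Finset.sum_congr rfl fun i _ => ?_
        rw [← Matrix.mul_assoc, ← Matrix.mul_assoc, h1, Matrix.sum_mul, Matrix.sum_mul]
        simp only [Matrix.smul_mul]
    _ = ∑ j, ∑ i, dualForm hW (u j) (dualMul φ (u i)) • (h.rep (u j) * X * (h'.rep (u i))ᴴ) :=
        Finset.sum_comm
    _ = (∑ i, h.rep (u i) * X * (h'.rep (u i))ᴴ) * h'.rep φ := by
        rw [Matrix.sum_mul]
        refine Finset.sum_congr rfl fun j _ => ?_
        rw [Matrix.mul_assoc, h2, Matrix.mul_sum]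
        simp only [Matrix.mul_smul]

theorem average_vecMulVec (A : Matrix ι ι ℂ) (B : Matrix κ κ ℂ) (x : ι → ℂ) (y : κ → ℂ) (a : ι)
    (b : κ) : (A * Matrix.vecMulVec x (star y) * Bᴴ) a b = (A *ᵥ x) a * conj ((B *ᵥ y) b) := by
  rw [Matrix.mul_vecMulVec, Matrix.vecMulVec_mul, ← Matrix.star_mulVec, Matrix.vecMulVec_apply]
  rfl

end Average

/-- A linear relation says that a sum of entries `(R x φ *ᵥ v x a) a` vanishes for every `φ`. Rank
one matrices made from these coefficient vectors are averaged over an orthonormal basis of the dual.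
The averages are intertwiners, hence zero between different connections and scalar on each one,
which isolates the coefficients one row at a time. -/
theorem linearIndependent_symOp (hW : IsWeight G β μ) {N : ℕ} {conn : Fin N → OcneanuConnection G μ}
    (hI : ∀ x, (conn x).IsIrreducible) (hne : ∀ x y, (conn x).Equivalent (conn y) → x = y) :
    LinearIndependent ℂ fun i : UnitIndex conn => (conn i.1).symOp i.2.1 i.2.2 := by
  refine linearIndependent_of_sum_eq_zero fun g hg => ?_
  obtain ⟨n, u, -, -, hu'⟩ := exists_orthonormal (dualForm hW) (dualForm_symm hW) (dualForm_pos hW) ⊤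
  have hu : ∀ x, x = ∑ i, dualForm hW (u i) x • u i := fun x => hu' x trivial
  let R : ∀ x, DualAlg G μ →ₗ[ℂ] Matrix (Fin (conn x).size) (Fin (conn x).size) ℂ :=
    fun x => ((conn x).isCellSystem hW.pos).rep
  let v : ∀ x, Fin (conn x).size → Fin (conn x).size → ℂ := fun x a b => g ⟨x, a, b⟩
  have h0 : ∀ φ, ∑ x, ∑ a, (R x φ *ᵥ v x a) a = 0 := fun φ => by
    have h1 : ∑ i : UnitIndex conn, g i • (⟨_, (conn i.1).symOp_mem hW.pos i.2.1 i.2.2⟩ :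
        symAlg G μ) = 0 := Subtype.ext (by
      rw [AddSubmonoidClass.coe_finsetSum]; exact hg)
    have h2 := congrArg φ h1
    rw [map_sum, map_zero, Fintype.sum_sigma] at h2
    rw [← h2]
    refine Finset.sum_congr rfl fun x _ => ?_
    rw [Fintype.sum_prod_type]
    refine Finset.sum_congr rfl fun a _ => ?_
    rw [Matrix.mulVec, dotProduct]
    refine Finset.sum_congr rfl fun b _ => ?_
    rw [map_smul, rep_apply_symOp hW.pos, mul_comm]; rfl
  let Θ : ∀ x y, (Fin (conn x).size → ℂ) → (Fin (conn y).size → ℂ) → Matrix _ _ ℂ := fun x y p q =>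
    ∑ i, R x (u i) * Matrix.vecMulVec p (star q) * (R y (u i))ᴴ
  have hΘ : ∀ x y p q a b, Θ x y p q a b = ∑ i, (R x (u i) *ᵥ p) a * conj ((R y (u i) *ᵥ q) b) :=
    fun x y p q a b => by
      simp only [Θ, Matrix.sum_apply, average_vecMulVec]
  have hΘI := fun x y p q => average_isCellIntertwiner hW hu ((conn x).isCellSystem hW.pos)
    ((conn y).isCellSystem hW.pos) (Matrix.vecMulVec p (star q))
  have hΘne : ∀ x y p q, x ≠ y → Θ x y p q = 0 := fun x y p q hxy =>
    intertwiner_eq_zero hW.pos (hI x) (hI y) (fun h => hxy (hne x y h)) (hΘI x y p q)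
  have hΘs : ∀ x p q, ∃ z : ℂ, Θ x x p q = z • 1 := fun x p q =>
    (hI x).exists_eq_smul hW.pos (hΘI x x p q)
  rintro ⟨y, b, b'⟩
  -- Averaging the relation against row `b` of connection `y`. Schur's lemma leaves only the term `x
  -- = y`, `a = b`, so the scalar of that average is zero.
  have h1 : ∑ x, ∑ a, Θ x y (v x a) (v y b) a b = 0 := by
    simp only [hΘ]
    calc _ = ∑ i, (∑ x, ∑ a, (R x (u i) *ᵥ v x a) a) * conj ((R y (u i) *ᵥ v y b) b) := by
          simp only [Finset.sum_mul]
          rw [Finset.sum_congr rfl fun x _ => Finset.sum_comm, Finset.sum_comm]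
      _ = 0 := by simp only [h0, zero_mul, Finset.sum_const_zero]
  rw [Finset.sum_eq_single y] at h1
  rotate_left
  · intro x _ hxy
    exact Finset.sum_eq_zero fun a _ => by rw [hΘne x y _ _ hxy]; rfl
  · simp
  rw [Finset.sum_eq_single b] at h1
  rotate_left
  · intro a _ hab
    obtain ⟨z, hz⟩ := hΘs y (v y a) (v y b)
    rw [hz, Matrix.smul_apply, Matrix.one_apply_ne hab, smul_zero]
  · simp
  obtain ⟨z, hz⟩ := hΘs y (v y b) (v y b)
  have hz0 : z = 0 := by
    rw [hz, Matrix.smul_apply, Matrix.one_apply_eq] at h1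
    simpa using h1
  rw [hz0, zero_smul] at hz
  -- The diagonal entries of the vanishing average are sums of squared absolute values. Since the `u
  -- i` span the dual, its unit then kills `v y b` too.
  have h2 : ∀ i, R y (u i) *ᵥ v y b = 0 := fun i => by
    ext a
    have h3 := hΘ y y (v y b) (v y b) a a
    rw [hz, Matrix.zero_apply] at h3
    have h4 : ∑ i, Complex.normSq ((R y (u i) *ᵥ v y b) a) = 0 := by
      have := h3.symm
      simp only [Complex.mul_conj, ← Complex.ofReal_sum] at this
      exact_mod_cast this
    rw [Finset.sum_eq_zero_iff_of_nonneg fun _ _ => Complex.normSq_nonneg _] at h4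
    exact Complex.normSq_eq_zero.1 (h4 i (Finset.mem_univ _))
  have h3 : R y (dualOne G μ) *ᵥ v y b = 0 := by
    rw [hu (dualOne G μ)]
    simp only [map_sum, map_smul, Matrix.sum_mulVec, Matrix.smul_mulVec, h2, smul_zero,
      Finset.sum_const_zero]
  have h4 : R y (dualOne G μ) = 1 := by
    ext a b
    simp only [R, IsCellSystem.rep_one, Matrix.one_apply]
    congr
  rw [h4, Matrix.one_mulVec] at h3
  exact congrFun h3 b'

end Orthogonality

end OcneanuConnection

/-! ### Complete systems of irreducible connections -/

section CompleteSystems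

variable [Module.Finite ℂ (symAlg G μ)] {N : ℕ} {conn : Fin N → OcneanuConnection G μ}

theorem card_le_finrank (hW : IsWeight G β μ) (hI : ∀ x, (conn x).IsIrreducible)
    (hne : ∀ x y, (conn x).Equivalent (conn y) → x = y) :
    N ≤ Module.finrank ℂ (Subalgebra.toSubmodule (symAlg G μ)) := by
  have h1 := OcneanuConnection.linearIndependent_symOp hW hI hne
  have h2 : LinearIndependent ℂ fun x : Fin N =>
      (⟨_, (conn x).symOp_mem hW.pos ⟨0, (hI x).1⟩ ⟨0, (hI x).1⟩⟩ :
        Subalgebra.toSubmodule (symAlg G μ)) := by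
    refine LinearIndependent.of_comp (Subalgebra.toSubmodule (symAlg G μ)).subtype ?_
    exact h1.comp (fun x : Fin N => ⟨x, ⟨0, (hI x).1⟩, ⟨0, (hI x).1⟩⟩) fun x y hxy =>
      congrArg Sigma.fst hxy
  have : Module.Finite ℂ (Subalgebra.toSubmodule (symAlg G μ)) :=
    ‹Module.Finite ℂ (symAlg G μ)›
  simpa using h2.fintype_card_le_finrank

/-- Independence of the operators bounds the number of inequivalent irreducible connections by the
dimension of `symAlg`. A system of maximal size is complete, for otherwise it could be enlarged by
one. -/
theorem exists_isCompleteSystem (hW : IsWeight G β μ) :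
    ∃ (N : ℕ) (conn : Fin N → OcneanuConnection G μ), IsCompleteSystem conn := by
  let P : ℕ → Prop := fun N => ∃ conn : Fin N → OcneanuConnection G μ,
    (∀ x, (conn x).IsIrreducible) ∧ ∀ x y, (conn x).Equivalent (conn y) → x = y
  have hb : ∀ N, P N → N ≤ Module.finrank ℂ (Subalgebra.toSubmodule (symAlg G μ)) :=
    fun N ⟨conn, h1, h2⟩ => card_le_finrank hW h1 h2
  have h0 : P 0 := ⟨fun x => x.elim0, fun x => x.elim0, fun x => x.elim0⟩
  set M := Module.finrank ℂ (Subalgebra.toSubmodule (symAlg G μ))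
  obtain ⟨conn, h1, h2⟩ := Nat.findGreatest_spec (P := P) (Nat.zero_le M) h0
  refine ⟨_, conn, h1, h2, fun c hc => ?_⟩
  by_contra! hne
  have hP : P (Nat.findGreatest P M + 1) := by
    refine ⟨Fin.snoc conn c, fun x => ?_, fun x y => ?_⟩
    · refine Fin.lastCases ?_ (fun i => ?_) x
      · rw [Fin.snoc_last]; exact hc
      · rw [Fin.snoc_castSucc]; exact h1 i
    · refine Fin.lastCases ?_ (fun i => ?_) x <;> refine Fin.lastCases ?_ (fun j => ?_) y
      · exact fun _ => rfl
      · rw [Fin.snoc_last, Fin.snoc_castSucc]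
        exact fun h => absurd h (hne j)
      · rw [Fin.snoc_last, Fin.snoc_castSucc]
        exact fun h => absurd h.symm (hne i)
      · rw [Fin.snoc_castSucc, Fin.snoc_castSucc]
        exact fun h => congrArg _ (h2 i j h)
  have := Nat.le_findGreatest (hb _ hP) hP
  omega

/-- A linear form that vanishes on the span but not on all of `symAlg` would be nonzero on an
operator of some irreducible connection, and the operators of an equivalent connection of the system
span that operator. -/
theorem IsCompleteSystem.span_symOp (hW : IsWeight G β μ) (h : IsCompleteSystem conn) :
    Submodule.span ℂ (Set.range fun i : UnitIndex conn => (conn i.1).symOp i.2.1 i.2.2) =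
      Subalgebra.toSubmodule (symAlg G μ) := by
  apply le_antisymm
  · rw [Submodule.span_le]
    rintro _ ⟨i, rfl⟩
    exact (conn i.1).symOp_mem hW.pos _ _
  · intro S hS
    by_contra hne
    obtain ⟨f, hfS, hf⟩ := exists_le_ker_of_notMem' hne
    let φ : DualAlg G μ := f ∘ₗ (symAlg G μ).val.toLinearMap
    have hφ : φ ≠ 0 := fun h0 => hfS (congrArg (fun ψ : DualAlg G μ => ψ ⟨S, hS⟩) h0)
    obtain ⟨c, hc, a, b, hm, hab⟩ := exists_irreducible_apply_ne_zero hW hφ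
    obtain ⟨x, hx⟩ := h.complete c hc
    have h1 := hx.symOp_mem_span hW.pos a b
    refine hab (hf ((Submodule.span_mono ?_) h1))
    rintro _ ⟨i, rfl⟩
    exact ⟨⟨x, i⟩, rfl⟩

/-- The adjoints are the operators of the system with top and bottom exchanged. It is irreducible
because its self-intertwiners are the complex conjugates of those of `x`; `y` is its representative.
-/
theorem IsCompleteSystem.adjoint_mem_span (hμ : ∀ v, 0 < μ v) (h : IsCompleteSystem conn)
    (x : Fin N) : ∃ y, ∀ a b, ∃ S ∈ Submodule.span ℂ (Set.range fun i : Fin (conn y).size ×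
      Fin (conn y).size => (conn y).symOp i.1 i.2), IsAdjoint ((conn x).symOp a b) S := by
  have hx := (conn x).isCellSystem hμ
  have hI : ((hx.swap).connection hμ).IsIrreducible := by
    refine hx.swap.connection_isIrreducible hμ (h.irreducible x).1 fun Θ hΘ => ?_
    have h1 : IsCellIntertwiner (conn x).src (conn x).tgt (conn x).sym (conn x).src (conn x).tgt
        (conn x).sym (Θ.map conj) := by
      refine ⟨fun a b hab => ?_, ?_⟩
      · exact (hΘ.1 a b fun h0 => hab (by simp [h0])).symm
      · have h2 := congrArg (fun M => M.map conj) hΘ.2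
        simp only [Matrix.map_mul, Matrix.map_map] at h2
        have h3 : (conn x).sym.map (conj ∘ conj) = (conn x).sym := by ext; simp
        rwa [h3] at h2
    obtain ⟨z, hz⟩ := (h.irreducible x).exists_eq_smul hμ h1
    refine ⟨conj z, ?_⟩
    ext a b
    have h4 := congrArg conj (congrFun (congrFun hz a) b)
    rw [Matrix.map_apply, Complex.conj_conj] at h4
    rw [h4, Matrix.smul_apply, Matrix.smul_apply, smul_eq_mul, map_mul, Matrix.one_apply]
    split_ifs <;> simp
  obtain ⟨y, hy⟩ := h.complete _ hI
  refine ⟨y, fun a b => ⟨_, hy.symOp_mem_span hμ a b, fun p q => ?_⟩⟩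
  rw [hx.swap.connection_symOp hμ a b, OcneanuConnection.symOp_eq hμ, single_eq_ket, single_eq_ket,
    apply_eq_amp, apply_eq_amp, hx.amp_cellOp, hx.swap.amp_cellOp, cells_map_conj, Matrix.map_apply,
    Complex.conj_conj]

end CompleteSystems

end FaceModel

end

noncomputable section
namespace FaceModel
set_option linter.unusedSectionVars false
set_option linter.unusedSimpArgs false
open scoped Classical Matrix

/-! ### Transport of weak *-Hopf structures -/

section Transport

open TensorProduct

section Tensors

variable {H K H₁ K₁ H₂ K₂ : Type*} [AddCommGroup H] [Module ℂ H] [AddCommGroup K] [Module ℂ K]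
  [AddCommGroup H₁] [Module ℂ H₁] [AddCommGroup K₁] [Module ℂ K₁]
  [AddCommGroup H₂] [Module ℂ H₂] [AddCommGroup K₂] [Module ℂ K₂]

theorem map₂_map_map {e₁ : H₁ →ₗ[ℂ] K₁} {e₂ : H₂ →ₗ[ℂ] K₂} {m₁ : H₁ →ₗ[ℂ] H₁ →ₗ[ℂ] H₁}
    {n₁ : K₁ →ₗ[ℂ] K₁ →ₗ[ℂ] K₁} {m₂ : H₂ →ₗ[ℂ] H₂ →ₗ[ℂ] H₂} {n₂ : K₂ →ₗ[ℂ] K₂ →ₗ[ℂ] K₂}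
    (h₁ : ∀ a b, n₁ (e₁ a) (e₁ b) = e₁ (m₁ a b)) (h₂ : ∀ a b, n₂ (e₂ a) (e₂ b) = e₂ (m₂ a b))
    (x y : H₁ ⊗[ℂ] H₂) : map₂ n₁ n₂ (map e₁ e₂ x) (map e₁ e₂ y) = map e₁ e₂ (map₂ m₁ m₂ x y) := by
  induction x with
  | zero => simp
  | add x x' hx hx' => simp only [map_add, LinearMap.add_apply, hx, hx']
  | tmul a b =>
    induction y with
    | zero => simp
    | add y y' hy hy' => simp only [map_add, hy, hy']
    | tmul c d => simp only [map_tmul, map₂_apply_tmul, h₁, h₂]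

theorem lift_map {e : H →ₗ[ℂ] K} {e₁ : H₁ →ₗ[ℂ] K₁} {e₂ : H₂ →ₗ[ℂ] K₂}
    {m : H →ₗ[ℂ] H →ₗ[ℂ] H} {n : K →ₗ[ℂ] K →ₗ[ℂ] K} (h : ∀ a b, n (e a) (e b) = e (m a b))
    {f : H₁ →ₗ[ℂ] H} {f' : K₁ →ₗ[ℂ] K} {g : H₂ →ₗ[ℂ] H} {g' : K₂ →ₗ[ℂ] K}
    (hf : ∀ a, f' (e₁ a) = e (f a)) (hg : ∀ a, g' (e₂ a) = e (g a)) (x : H₁ ⊗[ℂ] H₂) :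
    lift n (map f' g' (map e₁ e₂ x)) = e (lift m (map f g x)) := by
  induction x with
  | zero => simp
  | add x x' hx hx' => simp only [map_add, hx, hx']
  | tmul a b => simp only [map_tmul, lift.tmul, hf, hg, h]

theorem map_map_eq {e₁ : H →ₗ[ℂ] K} {e₂ : H₂ →ₗ[ℂ] K₂} {f : H →ₗ[ℂ] H₁} {f' : K →ₗ[ℂ] K₁}
    {E : H₁ →ₗ[ℂ] K₁} (hf : ∀ a, f' (e₁ a) = E (f a)) (x : H ⊗[ℂ] H₂) :
    map f' LinearMap.id (map e₁ e₂ x) = map E e₂ (map f LinearMap.id x) := by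
  induction x with
  | zero => simp
  | add x x' hx hx' => simp only [map_add, hx, hx']
  | tmul a b => simp only [map_tmul, hf, LinearMap.id_apply]

theorem mul'_map_map {e : H →ₗ[ℂ] K} {f g : H →ₗ[ℂ] ℂ} {f' g' : K →ₗ[ℂ] ℂ}
    (hf : ∀ a, f' (e a) = f a) (hg : ∀ a, g' (e a) = g a) (x : H ⊗[ℂ] H) :
    LinearMap.mul' ℂ ℂ (map f' g' (map e e x)) = LinearMap.mul' ℂ ℂ (map f g x) := by
  induction x with
  | zero => simp
  | add x x' hx hx' => simp only [map_add, hx, hx']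
  | tmul a b => simp only [map_tmul, hf, hg]

theorem comm_map (e : H →ₗ[ℂ] K) (x : H ⊗[ℂ] H) :
    TensorProduct.comm ℂ K K (map e e x) = map e e (TensorProduct.comm ℂ H H x) := by
  induction x with
  | zero => simp
  | add x x' hx hx' => simp only [map_add, hx, hx']
  | tmul a b => simp only [map_tmul, comm_tmul]

theorem assoc_symm_map (e : H →ₗ[ℂ] K) (a : H) (x : H ⊗[ℂ] H) :
    (TensorProduct.assoc ℂ K K K).symm (e a ⊗ₜ[ℂ] map e e x) =
      map (map e e) e ((TensorProduct.assoc ℂ H H H).symm (a ⊗ₜ[ℂ] x)) := by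
  induction x with
  | zero => simp
  | add x x' hx hx' => simp only [map_add, tmul_add, hx, hx']
  | tmul b c => simp only [map_tmul, assoc_symm_tmul]

theorem lid_map {e : H →ₗ[ℂ] K} {f : H →ₗ[ℂ] ℂ} {f' : K →ₗ[ℂ] ℂ} (hf : ∀ a, f' (e a) = f a)
    (x : H ⊗[ℂ] H) : TensorProduct.lid ℂ K (map f' LinearMap.id (map e e x)) =
      e (TensorProduct.lid ℂ H (map f LinearMap.id x)) := by
  induction x with
  | zero => simp
  | add x x' hx hx' => simp only [map_add, hx, hx']
  | tmul a b => simp only [map_tmul, hf, lid_tmul, LinearMap.id_apply, map_smul]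

theorem rid_map {e : H →ₗ[ℂ] K} {f : H →ₗ[ℂ] ℂ} {f' : K →ₗ[ℂ] ℂ} (hf : ∀ a, f' (e a) = f a)
    (x : H ⊗[ℂ] H) : TensorProduct.rid ℂ K (map LinearMap.id f' (map e e x)) =
      e (TensorProduct.rid ℂ H (map LinearMap.id f x)) := by
  induction x with
  | zero => simp
  | add x x' hx hx' => simp only [map_add, hx, hx']
  | tmul a b => simp only [map_tmul, hf, rid_tmul, LinearMap.id_apply, map_smul]

theorem map_star_map {e : H →ₗ[ℂ] K} {s : H →ₗ⋆[ℂ] H} {s' : K →ₗ⋆[ℂ] K}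
    (hs : ∀ a, s' (e a) = e (s a)) (x : H ⊗[ℂ] H) :
    map s' s' (map e e x) = map e e (map s s x) := by
  induction x with
  | zero => simp
  | add x x' hx hx' => simp only [map_add, hx, hx']
  | tmul a b => simp only [map_tmul, hs]

end Tensors

variable {H K : Type*} [AddCommGroup H] [Module ℂ H] [AddCommGroup K] [Module ℂ K]

namespace WeakStarHopf

/-- The coalgebra structure transported along a linear equivalence. -/
@[reducible] def transportCoalgebra (W : WeakStarHopf H) (e : H ≃ₗ[ℂ] K) : Coalgebra ℂ K where
  comul := map e.toLinearMap e.toLinearMap ∘ₗ W.comul ∘ₗ e.symm.toLinearMap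
  counit := W.counit ∘ₗ e.symm.toLinearMap
  coassoc := by
    ext a
    obtain ⟨a, rfl⟩ := e.surjective a
    have h := congrArg (fun f => map e.toLinearMap (map e.toLinearMap e.toLinearMap) (f a)) W.coassoc
    simp only [LinearMap.comp_apply, LinearEquiv.coe_coe, e.symm_apply_apply] at h ⊢
    generalize W.comul a = x at h ⊢
    have h1 : ∀ x : H ⊗[ℂ] H, (TensorProduct.assoc ℂ K K K) (LinearMap.rTensor K
        (map e.toLinearMap e.toLinearMap ∘ₗ W.comul ∘ₗ e.symm.toLinearMap)
          (map e.toLinearMap e.toLinearMap x)) =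
        map e.toLinearMap (map e.toLinearMap e.toLinearMap)
          ((TensorProduct.assoc ℂ H H H) (LinearMap.rTensor H W.comul x)) := fun x => by
      induction x with
      | zero => simp
      | add x x' hx hx' => simp only [map_add, hx, hx']
      | tmul a b =>
        simp only [map_tmul, LinearMap.rTensor_tmul, LinearMap.comp_apply, LinearEquiv.coe_coe,
          e.symm_apply_apply]
        generalize W.comul a = y
        induction y with
        | zero => simp
        | add y y' hy hy' => simp only [map_add, add_tmul, hy, hy']
        | tmul c d => simp
    have h2 : ∀ x : H ⊗[ℂ] H, LinearMap.lTensor K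
        (map e.toLinearMap e.toLinearMap ∘ₗ W.comul ∘ₗ e.symm.toLinearMap)
          (map e.toLinearMap e.toLinearMap x) =
        map e.toLinearMap (map e.toLinearMap e.toLinearMap) (LinearMap.lTensor H W.comul x) :=
      fun x => by
      induction x with
      | zero => simp
      | add x x' hx hx' => simp only [map_add, hx, hx']
      | tmul a b => simp
    rw [h1, h2, h]
  rTensor_counit_comp_comul := by
    ext a
    obtain ⟨a, rfl⟩ := e.surjective a
    have h := congrArg (fun f => map LinearMap.id e.toLinearMap (f a)) W.rTensor_counit_comp_comul
    simp only [LinearMap.comp_apply, LinearEquiv.coe_coe, e.symm_apply_apply] at h ⊢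
    rw [mk_apply, map_tmul] at h
    rw [mk_apply]
    refine Eq.trans ?_ h
    generalize W.comul a = x
    induction x with
    | zero => simp
    | add x x' hx hx' => simp only [map_add, hx, hx']
    | tmul a b => simp
  lTensor_counit_comp_comul := by
    ext a
    obtain ⟨a, rfl⟩ := e.surjective a
    have h := congrArg (fun f => map e.toLinearMap LinearMap.id (f a)) W.lTensor_counit_comp_comul
    simp only [LinearMap.comp_apply, LinearEquiv.coe_coe, e.symm_apply_apply] at h ⊢
    rw [LinearMap.flip_apply, mk_apply, map_tmul] at h
    rw [LinearMap.flip_apply, mk_apply]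
    refine Eq.trans ?_ h
    generalize W.comul a = x
    induction x with
    | zero => simp
    | add x x' hx hx' => simp only [map_add, hx, hx']
    | tmul a b => simp

/-- Linear operations on `K` that correspond to those of `W` define a weak *-Hopf structure. -/
@[reducible] def ofCompatible (W : WeakStarHopf H) (C : Coalgebra ℂ K) (e : H →ₗ[ℂ] K)
    (he : Function.Surjective e) (m : K →ₗ[ℂ] K →ₗ[ℂ] K) (S : K →ₗ[ℂ] K) (s : K →ₗ⋆[ℂ] K)
    (hm : ∀ a b, m (e a) (e b) = e (W.mul a b)) (hc : ∀ a, C.comul (e a) = map e e (W.comul a))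
    (hε : ∀ a, C.counit (e a) = W.counit a) (hS : ∀ a, S (e a) = e (W.antipode a))
    (hs : ∀ a, s (e a) = e (W.star a)) : WeakStarHopf K :=
  have hmm := map₂_map_map hm hm
  have hl : ∀ a b, (C.counit ∘ₗ m (e a)) (e b) = (W.counit ∘ₗ W.mul a) b := fun a b => by
    rw [LinearMap.comp_apply, hm, hε, LinearMap.comp_apply]
  have hr : ∀ a b, (C.counit ∘ₗ m.flip (e a)) (e b) = (W.counit ∘ₗ W.mul.flip a) b := fun a b => by
    rw [LinearMap.comp_apply, LinearMap.flip_apply, hm, hε, LinearMap.comp_apply,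
      LinearMap.flip_apply]
  have hid : ∀ a, (LinearMap.id : K →ₗ[ℂ] K) (e a) = e ((LinearMap.id : H →ₗ[ℂ] H) a) :=
    fun _ => rfl
  { toCoalgebra := C
    mul := m
    one := e W.one
    antipode := S
    star := s
    mul_assoc := fun a b c => by
      obtain ⟨a, rfl⟩ := he a
      obtain ⟨b, rfl⟩ := he b
      obtain ⟨c, rfl⟩ := he c
      simp only [hm, W.mul_assoc]
    one_mul := fun a => by
      obtain ⟨a, rfl⟩ := he a
      rw [hm, W.one_mul]
    mul_one := fun a => by
      obtain ⟨a, rfl⟩ := he a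
      rw [hm, W.mul_one]
    comul_mul := fun a b => by
      obtain ⟨a, rfl⟩ := he a
      obtain ⟨b, rfl⟩ := he b
      rw [hm, hc, hc, hc, hmm, W.comul_mul]
    counit_mul_mul := fun a b c => by
      obtain ⟨a, rfl⟩ := he a
      obtain ⟨b, rfl⟩ := he b
      obtain ⟨c, rfl⟩ := he c
      rw [hm, hm, hε, hc, mul'_map_map (hl a) (hr c), W.counit_mul_mul]
    counit_mul_mul' := fun a b c => by
      obtain ⟨a, rfl⟩ := he a
      obtain ⟨b, rfl⟩ := he b
      obtain ⟨c, rfl⟩ := he c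
      rw [hm, hm, hε, hc, comm_map, mul'_map_map (hl a) (hr c), W.counit_mul_mul']
    comul_comul_one := by
      rw [hc, map_map_eq hc, assoc_symm_map, ← map_tmul, map₂_map_map hmm hm, W.comul_comul_one]
    comul_comul_one' := by
      rw [hc, map_map_eq hc, assoc_symm_map, ← map_tmul, map₂_map_map hmm hm, W.comul_comul_one']
    mul_antipode := fun a => by
      obtain ⟨a, rfl⟩ := he a
      rw [hc, hc, lift_map hm hid hS, lid_map (hr a), W.mul_antipode]
    antipode_mul := fun a => by
      obtain ⟨a, rfl⟩ := he a
      rw [hc, hc, lift_map hm hS hid, rid_map (hl a), W.antipode_mul]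
    antipode_mul_antipode := fun a => by
      obtain ⟨a, rfl⟩ := he a
      rw [hc, map_map_eq hc, lift_map (f := lift W.mul ∘ₗ map W.antipode LinearMap.id) hm
        (fun x => lift_map hm hS hid x) hS, W.antipode_mul_antipode, hS]
    star_star := fun a => by
      obtain ⟨a, rfl⟩ := he a
      rw [hs, hs, W.star_star]
    star_mul := fun a b => by
      obtain ⟨a, rfl⟩ := he a
      obtain ⟨b, rfl⟩ := he b
      rw [hm, hs, W.star_mul, hs, hs, hm]
    comul_star := fun a => by
      obtain ⟨a, rfl⟩ := he a
      rw [hs, hc, hc, map_star_map hs, W.comul_star] }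

theorem transportCoalgebra_comul (W : WeakStarHopf H) (e : H ≃ₗ[ℂ] K) (a : H) :
    (W.transportCoalgebra e).comul (e a) = map e.toLinearMap e.toLinearMap (W.comul a) := by
  change map e.toLinearMap e.toLinearMap (W.comul (e.symm (e a))) = _
  rw [e.symm_apply_apply]

theorem transportCoalgebra_counit (W : WeakStarHopf H) (e : H ≃ₗ[ℂ] K) (a : H) :
    (W.transportCoalgebra e).counit (e a) = W.counit a := by
  change W.counit (e.symm (e a)) = _
  rw [e.symm_apply_apply]

/-- The weak *-Hopf structure transported along a linear equivalence. -/
def transport (W : WeakStarHopf H) (e : H ≃ₗ[ℂ] K) : WeakStarHopf K :=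
  W.ofCompatible (W.transportCoalgebra e) e.toLinearMap e.surjective
    ((W.mul.compl₁₂ e.symm.toLinearMap e.symm.toLinearMap).compr₂ e.toLinearMap)
    (e.toLinearMap ∘ₗ W.antipode ∘ₗ e.symm.toLinearMap)
    (e.toLinearMap.comp (W.star.comp e.symm.toLinearMap))
    (fun a b => by simp) (W.transportCoalgebra_comul e) (W.transportCoalgebra_counit e)
    (fun a => by simp) (fun a => by simp)

theorem isIso_transport (W : WeakStarHopf H) (e : H ≃ₗ[ℂ] K) : W.IsIso (W.transport e) e where
  map_mul a b := by simp [transport]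
  map_one := rfl
  map_comul := W.transportCoalgebra_comul e
  map_counit := W.transportCoalgebra_counit e
  map_antipode a := by simp [transport]
  map_star a := by simp [transport]

end WeakStarHopf

end Transport

end FaceModel

end

noncomputable section
namespace FaceModel
set_option linter.unusedSectionVars false
set_option linter.unusedSimpArgs false
open scoped Classical Matrix

variable {V : Type*} {G : SimpleGraph V} [Fintype V] {β : ℝ} {μ : V → ℝ}
  {N : ℕ} {conn : Fin N → OcneanuConnection G μ}

theorem isWeight_of_isPerronFrobenius [DecidableEq V] [DecidableRel G.Adj]
    (h : IsPerronFrobenius G β μ) : IsWeight G β μ where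
  pos v := lt_of_lt_of_le one_pos (h.one_le v)
  eig v := by
    have := congrFun h.eigen v
    rw [Pi.smul_apply, smul_eq_mul, Matrix.mulVec, dotProduct] at this
    rw [← this]
    refine Finset.sum_congr rfl fun w _ => ?_
    rw [SimpleGraph.adjMatrix_apply]
    split_ifs <;> simp

/-! ### The basis of symmetry operators and its dual matrix units -/

section SymmetryBasis

variable [Module.Finite ℂ (symAlg G μ)]

/-- `symAlg` is spanned by the operators of irreducible connections, and these occur in normalised
Hermitian families. -/
theorem IsCompleteSystem.toSubmodule_eq (hW : IsWeight G β μ) (h : IsCompleteSystem conn) :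
    Subalgebra.toSubmodule (symAlg G μ) = symmetrySpan G β μ := by
  refine le_antisymm ?_ (symmetrySpan_le hW.pos)
  rw [← h.span_symOp hW, Submodule.span_le]
  rintro _ ⟨i, rfl⟩
  simp only [OcneanuConnection.symOp_eq hW.pos]
  exact ((conn i.1).isCellSystem hW.pos).cellOp_mem_symmetrySpan hW.pos _ _

/-- The basis of symmetry operators given by a complete system of connections. -/
def IsCompleteSystem.basis (hW : IsWeight G β μ) (h : IsCompleteSystem conn) :
    Module.Basis (UnitIndex conn) ℂ (symAlg G μ) :=
  Module.Basis.mk (v := fun i => ⟨_, (conn i.1).symOp_mem hW.pos i.2.1 i.2.2⟩)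
    (LinearIndependent.of_comp (symAlg G μ).val.toLinearMap
      (OcneanuConnection.linearIndependent_symOp hW h.irreducible h.inequivalent))
    (by
      rintro ⟨S, hS⟩ -
      have h1 : S ∈ Submodule.span ℂ
          (Set.range fun i : UnitIndex conn => (conn i.1).symOp i.2.1 i.2.2) := by
        rw [h.span_symOp hW]; exact hS
      have h2 : (Set.range fun i : UnitIndex conn => (conn i.1).symOp i.2.1 i.2.2) =
          (symAlg G μ).val.toLinearMap '' Set.range fun i : UnitIndex conn =>
            (⟨_, (conn i.1).symOp_mem hW.pos i.2.1 i.2.2⟩ : symAlg G μ) := by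
        rw [← Set.range_comp]; rfl
      rw [h2, Submodule.span_image] at h1
      obtain ⟨T, hT, hTS⟩ := h1
      obtain rfl : T = ⟨S, hS⟩ := Subtype.ext hTS
      exact hT)

theorem IsCompleteSystem.basis_apply (hW : IsWeight G β μ) (h : IsCompleteSystem conn)
    (i : UnitIndex conn) : h.basis hW i = ⟨_, (conn i.1).symOp_mem hW.pos i.2.1 i.2.2⟩ :=
  Module.Basis.mk_apply _ _ i

theorem IsCompleteSystem.coord_basis (hW : IsWeight G β μ) (h : IsCompleteSystem conn)
    (i j : UnitIndex conn) : (h.basis hW).coord i (h.basis hW j) = if j = i then 1 else 0 := by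
  rw [Module.Basis.coord_apply, Module.Basis.repr_self, Finsupp.single_apply]

theorem IsCompleteSystem.rep_apply (hW : IsWeight G β μ) (h : IsCompleteSystem conn) (x : Fin N)
    (φ : DualAlg G μ) (a b : Fin (conn x).size) :
    ((conn x).isCellSystem hW.pos).rep φ a b = φ (h.basis hW ⟨x, a, b⟩) := by
  rw [OcneanuConnection.rep_apply_symOp hW.pos, h.basis_apply hW]

theorem IsCompleteSystem.dualMul_apply (hW : IsWeight G β μ) (h : IsCompleteSystem conn)
    (φ ψ : DualAlg G μ) (x : Fin N) (a b : Fin (conn x).size) :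
    dualMul φ ψ (h.basis hW ⟨x, a, b⟩) =
      ∑ c, φ (h.basis hW ⟨x, a, c⟩) * ψ (h.basis hW ⟨x, c, b⟩) := by
  rw [← h.rep_apply hW, IsCellSystem.rep_mul, Matrix.mul_apply]
  simp only [h.rep_apply hW]

/-- The value of a linear form at a basis element is a matrix entry of the representation of that
connection. These representations respect product and star, so the coordinate forms multiply as
matrix units. -/
theorem IsCompleteSystem.isMatrixUnits (hW : IsWeight G β μ) (h : IsCompleteSystem conn) :
    IsMatrixUnits conn (dualWeakHopf hW.pos) (h.basis hW).coord where
  mul_same x a b c d := by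
    change dualMul _ _ = _
    refine (h.basis hW).ext fun i => ?_
    obtain ⟨y, p, q⟩ := i
    rw [h.dualMul_apply hW]
    simp only [h.coord_basis hW]
    by_cases hyx : y = x
    · subst hyx
      by_cases hbc : b = c
      · subst hbc
        rw [if_pos rfl, h.coord_basis hW]
        by_cases hp : p = a <;> by_cases hq : q = d <;> simp [hp, hq]
      · rw [if_neg hbc, LinearMap.zero_apply]
        refine Finset.sum_eq_zero fun e _ => ?_
        by_cases he : e = b
        · subst he; simp [hbc]
        · simp [he]
    · have h1 : ∀ (s : Fin (conn y).size × Fin (conn y).size) u, (⟨y, s⟩ : UnitIndex conn) ≠ ⟨x, u⟩ :=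
        fun s u hs => hyx (congrArg Sigma.fst hs)
      simp only [h1, if_false, mul_zero, Finset.sum_const_zero]
      split_ifs
      · rw [h.coord_basis hW, if_neg (h1 _ _)]
      · rfl
  mul_ne x y a b c d hxy := by
    change dualMul _ _ = _
    refine (h.basis hW).ext fun i => ?_
    obtain ⟨z, p, q⟩ := i
    rw [h.dualMul_apply hW]
    simp only [h.coord_basis hW]
    refine Finset.sum_eq_zero fun e _ => ?_
    by_cases hz : z = x
    · rw [if_neg (fun hs : (⟨z, e, q⟩ : UnitIndex conn) = ⟨y, c, d⟩ =>
        hxy (hz.symm.trans (congrArg Sigma.fst hs))), mul_zero]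
    · rw [if_neg (fun hs : (⟨z, p, e⟩ : UnitIndex conn) = ⟨x, a, b⟩ => hz (congrArg Sigma.fst hs)),
        zero_mul]
  star x a b := by
    change dualStar _ = _
    refine (h.basis hW).ext fun i => ?_
    obtain ⟨y, p, q⟩ := i
    rw [← h.rep_apply hW, IsCellSystem.rep_star, Matrix.conjTranspose_apply, h.rep_apply hW,
      h.coord_basis hW, h.coord_basis hW]
    by_cases hyx : y = x
    · subst hyx
      by_cases hp : p = b <;> by_cases hq : q = a <;> simp [hp, hq]
    · rw [if_neg fun hs => hyx (congrArg Sigma.fst hs), if_neg fun hs => hyx (congrArg Sigma.fst hs),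
        star_zero]

end SymmetryBasis

/-! ### From `T` to `Oc` on essential paths -/

section EssentialPaths

variable (μ) in
/-- The weight `(μ_{first} / μ_{last})^{1/4}` of a path, or its inverse. -/
def endGauge (u v : V) : ℂ := (qrt μ u / qrt μ v : ℝ)

theorem endGauge_mul (hμ : ∀ v, 0 < μ v) (u v : V) : endGauge μ u v * endGauge μ v u = 1 := by
  have := (qrt_pos hμ u).ne'
  have := (qrt_pos hμ v).ne'
  rw [endGauge, endGauge, ← Complex.ofReal_mul]
  norm_cast
  field_simp

/-- Conjugation by two elements inverse to each other. -/
def conjEquiv {A : Type*} [Semiring A] [Algebra ℂ A] (p q : A) (hpq : p * q = 1) (hqp : q * p = 1) :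
    A ≃ₐ[ℂ] A where
  toFun x := p * x * q
  invFun x := q * x * p
  left_inv x := by
    calc q * (p * x * q) * p = (q * p) * x * (q * p) := by simp only [mul_assoc]
      _ = x := by rw [hqp, one_mul, mul_one]
  right_inv x := by
    calc p * (q * x * p) * q = (p * q) * x * (p * q) := by simp only [mul_assoc]
      _ = x := by rw [hpq, one_mul, mul_one]
  map_mul' x y := by
    calc p * (x * y) * q = p * x * 1 * y * q := by simp only [mul_assoc, one_mul]
      _ = p * x * q * (p * y * q) := by rw [← hqp]; simp only [mul_assoc]
  map_add' x y := by rw [mul_add, add_mul]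
  commutes' z := by rw [← Algebra.commutes, mul_assoc, hpq, mul_one]

/-- Conjugation by the fourth roots of the weights, followed by the restriction to essential
paths. -/
def gaugeEquiv (hW : IsWeight G β μ) : symAlg G μ ≃ₐ[ℂ] GradedEnd G β μ :=
  (conjEquiv ⟨endDiag (fun u v => endGauge μ v u), endDiag_mem _⟩ ⟨endDiag (endGauge μ), endDiag_mem _⟩
    (Subtype.ext (endDiag_mul _ _ fun u v => endGauge_mul hW.pos v u))
    (Subtype.ext (endDiag_mul _ _ fun u v => endGauge_mul hW.pos u v))).trans (restrictEquiv hW)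

/-- The factor between `op` and `symOp` depends only on the end points of the two paths, because
these are the end points of the labels whenever the matrix element is not zero. It is therefore
produced by diagonal operators on the two sides. -/
theorem gaugeEquiv_symOp (hW : IsWeight G β μ) (c : OcneanuConnection G μ) (a b : Fin c.size)
    {n : ℕ} (ξ : essential G β μ n) :
    (gaugeEquiv hW ⟨_, c.symOp_mem hW.pos a b⟩ n ξ : PathSpace G) = c.op a b ξ := by
  change (endDiag (fun u v => endGauge μ v u) * c.symOp a b * endDiag (endGauge μ) :
    Module.End ℂ (PathSpace G)) ξ.1 = _
  suffices h : endDiag (fun u v => endGauge μ v u) * c.symOp a b * endDiag (endGauge μ) = c.op a b from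
    congrArg (fun f => f ξ.1) h
  have hc := c.isCellSystem hW.pos
  refine ext_amp_ket fun p q hp hq => ?_
  rw [OcneanuConnection.symOp_eq hW.pos, OcneanuConnection.op_eq hW.pos, LinearMap.smul_apply,
    amp_smul, hc.amp_cellOp]
  by_cases h0 : cells c.src c.tgt c.sym p q a b = 0
  · obtain ⟨u, v, hu, hv⟩ := exists_ends hp.1
    obtain ⟨u', v', hu', hv'⟩ := exists_ends hq.1
    rw [Module.End.mul_apply, Module.End.mul_apply, endDiag_ket _ hu' hv', map_smul, map_smul,
      amp_smul, amp_endDiag _ _ hu hv, hc.amp_cellOp, h0]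
    simp
  · obtain ⟨-, -, -, hu, hu', hv, hv'⟩ := hc.cells_support h0
    rw [Module.End.mul_apply, Module.End.mul_apply, endDiag_ket _ hu' hv', map_smul, map_smul,
      amp_smul, amp_endDiag _ _ hu hv, hc.amp_cellOp, OcneanuConnection.gauge,
      OcneanuConnection.gauge, endGauge, endGauge]
    push_cast
    rw [inv_div]
    ring

end EssentialPaths

end FaceModel

end

/-! ### Assembly of the theorem -/

theorem mainTheorem1 {V : Type*} [Fintype V] [DecidableEq V] (G : SimpleGraph V)
    [DecidableRel G.Adj] (hG : G.IsTree) (β : ℝ) (μ : V → ℝ)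
    (hμ : IsPerronFrobenius G β μ) (hβ : β < 2) :
    -- the span `A` of the symmetry operators is a finite-dimensional algebra
    ∃ A : Subalgebra ℂ (Module.End ℂ (PathSpace G)),
      Subalgebra.toSubmodule A = symmetrySpan G β μ ∧ Module.Finite ℂ A ∧
      -- the dual carries a weak *-Hopf structure
      ∃ W : WeakStarHopf (Module.Dual ℂ A),
        -- with the projected concatenation product
        (∀ p q p' q' : EPath G, p.length = q.length → p'.length = q'.length →
          W.mul (matrixForm A (Finsupp.single p 1) (Finsupp.single q 1))
              (matrixForm A (Finsupp.single p' 1) (Finsupp.single q' 1)) =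
            matrixForm A (concat G (Finsupp.single p 1) (Finsupp.single p' 1))
              (concat G (Finsupp.single q 1) (Finsupp.single q' 1))) ∧
        -- and the coproduct dual to composition
        IsDualComul (fun a b : A => a * b) W ∧
        -- complete systems of irreducible connections exist, and for each of them
        (∃ (N : ℕ) (conn : Fin N → OcneanuConnection G μ), IsCompleteSystem conn) ∧
        ∀ (N : ℕ) (conn : Fin N → OcneanuConnection G μ), IsCompleteSystem conn →
          -- the operators `T^x_{αβ}` are symmetry operators,
          (∀ x, IsSymmetryFamily G β μ (conn x).src (conn x).tgt (conn x).symOp ∧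
            IsNormalizedFamily G μ (conn x).src (conn x).tgt (conn x).symOp) ∧
          (∀ x, ∃ y, ∀ a b, ∃ S ∈ Submodule.span ℂ (Set.range fun i : Fin (conn y).size ×
            Fin (conn y).size => (conn y).symOp i.1 i.2), IsAdjoint ((conn x).symOp a b) S) ∧
          -- they form a basis of `A`, whose dual basis consists of matrix units,
          ∃ b : Module.Basis (UnitIndex conn) ℂ A,
            (∀ i : UnitIndex conn,
              (b i : Module.End ℂ (PathSpace G)) = (conn i.1).symOp i.2.1 i.2.2) ∧
            IsMatrixUnits conn W b.coord ∧
            -- and the dual is isomorphic to the double triangle algebra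
            ∃ (B : Module.Basis (UnitIndex conn) ℂ (GradedEnd G β μ))
              (D : WeakStarHopf (Module.Dual ℂ (GradedEnd G β μ))),
              IsDoubleTriangleAlgebra conn B D ∧
              ∃ Φ : Module.Dual ℂ A ≃ₗ[ℂ] Module.Dual ℂ (GradedEnd G β μ),
                W.IsIso D Φ ∧ ∀ i, Φ (b.coord i) = B.coord i := by
  have hW := isWeight_of_isPerronFrobenius hμ
  have := hW.finite_symAlg hβ
  -- One complete system is needed already to identify `symAlg` with the span of the normalised
  -- symmetry operators.
  obtain ⟨N₀, conn₀, h₀⟩ := exists_isCompleteSystem (G := G) hW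
  refine ⟨symAlg G μ, h₀.toSubmodule_eq hW, this, dualWeakHopf hW.pos, ?_, dualComul_apply,
    ⟨N₀, conn₀, h₀⟩, fun N conn h => ⟨fun x => ?_, h.adjoint_mem_span hW.pos, h.basis hW,
      fun i => by rw [h.basis_apply hW], h.isMatrixUnits hW, ?_⟩⟩
  · intro p q p' q' hpq hpq'
    have hlen : ∀ p q : EPath G, p.length = q.length → p.1.length = q.1.length := fun p q h => by
      have h1 := List.length_pos_iff.2 p.2.1
      have h2 := List.length_pos_iff.2 q.2.1
      rw [EPath.length, EPath.length] at h
      omega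
    simp only [single_eq_ket, concat_ket]
    exact dualMul_mat (hlen p q hpq) p'.1 q'.1
  · have hs : (conn x).symOp = cellOp G (conn x).src (conn x).tgt (conn x).sym := by
      ext1 a; ext1 b; exact OcneanuConnection.symOp_eq hW.pos a b
    rw [hs]
    exact ⟨((conn x).isCellSystem hW.pos).isSymmetryFamily hW.pos,
      ((conn x).isCellSystem hW.pos).isNormalizedFamily hW.pos⟩
  · let E := gaugeEquiv (G := G) hW
    -- The weak *-Hopf structure is carried along the dual of `gaugeEquiv`. Since that map is an
    -- algebra isomorphism, the transported coproduct is again dual to composition.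
    let Φ : DualAlg G μ ≃ₗ[ℂ] Module.Dual ℂ (GradedEnd G β μ) := E.symm.toLinearEquiv.dualMap
    have hΦ : ∀ φ F, Φ φ F = φ (E.symm F) := fun _ _ => rfl
    have hiso := (dualWeakHopf (G := G) hW.pos).isIso_transport Φ
    have hΦb : ∀ i, Φ ((h.basis hW).coord i) = ((h.basis hW).map E.toLinearEquiv).coord i :=
      fun i => rfl
    have hU := h.isMatrixUnits hW
    refine ⟨(h.basis hW).map E.toLinearEquiv, (dualWeakHopf hW.pos).transport Φ,
      ⟨fun x a b n ξ => ?_, ⟨?_, ?_, ?_⟩, ?_⟩, Φ, hiso, hΦb⟩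
    · rw [Module.Basis.map_apply, h.basis_apply hW]
      exact gaugeEquiv_symOp hW (conn x) a b ξ
    · intro x a b c d
      rw [← hΦb, ← hΦb, ← hΦb, ← hiso.map_mul, hU.mul_same]
      split_ifs
      · rfl
      · rw [map_zero]
    · intro x y a b c d hxy
      rw [← hΦb, ← hΦb, ← hiso.map_mul, hU.mul_ne _ _ _ _ _ _ hxy, map_zero]
    · intro x a b
      rw [← hΦb, ← hΦb, ← hiso.map_star, hU.star]
    · intro ψ F F'
      obtain ⟨φ, rfl⟩ := Φ.surjective ψ
      rw [hiso.map_comul, hΦ]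
      change _ = φ (E.symm (F * F'))
      rw [map_mul, ← dualComul_apply]
      change _ = TensorProduct.dualDistrib ℂ _ _ ((dualWeakHopf hW.pos).comul φ) _
      generalize (dualWeakHopf hW.pos).comul φ = x
      induction x with
      | zero => simp
      | add x y hx hy => simp only [map_add, LinearMap.add_apply, hx, hy]
      | tmul φ ψ => simp only [TensorProduct.map_tmul, TensorProduct.dualDistrib_apply,
          LinearEquiv.coe_coe, hΦ]
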